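/- **Proposition 7.3.** Let $k$ be a commutative ring. For a $0$-reduced simplicial set $S$ (that is, $S_0=\{x\}$ is a one-point set), consider the following two differential graded (dg) associative unital $k$-algebras. 1. $\Omega Q_\Delta(S)$. Here $Q_\Delta(S)$ is the connected dg coalgebra over $k$ of normalized simplicial chains on $S$, with the Alexander–Whitney coproduct $\Delta(\sigma)=\sum_{p+q=n} f^p(\sigma)\otimes l^q(\sigma)$ for $\sigma\in S_n$ ($f^p$ the front $p$-face, $l^q$ the last $q$-face). For a connected dg coalgebra $(C,\partial,\Delta)$, the cobar construction $\Omega C$ is the tensor algebra $T(s\overline C)$ on the desuspension $(s\overline C)_i=\overline C_{i+1}$ of the positive degree part $\overline C=C_{>0}$, whose differential is the graded derivation $D$ with $D(sc)=-s\partial c+\sum(-1)^{\deg c'}sc'\otimes sc''$, where $\sum c'\otimes c''$ is the reduced coproduct of $c\in\overline C$ (the part of $\Delta(c)$ in $\overline C\otimes\overline C$), and $s$ is zero on $C_0$. 2. $\Gamma(S)(x,x)=Q_\Delta(\mathfrak C(S)(x,x))$. Here $\mathfrak C(S)=\operatorname{colim}_{\Delta^n\to S}\mathfrak C(\Delta^n)$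 is the rigidification of $S$, the colimit being taken in simplicial categories; $\mathfrak C(\Delta^n)$ has objects $0,\dots,n$, its mapping space from $i$ to $j$ is the nerve of the poset of subsets of $\{i,i+1,\dots,j\}$ that contain $i$ and $j$ (empty if $i>j$), and composition is given by union of subsets. The simplicial set $\mathfrak C(S)(x,x)$ is a simplicial monoid under composition, where the product $ab$ is "first $a$, then $b$", and its normalized chains over $k$ form a dg algebra by means of the Eilenberg–Zilber shuffle product. Then the dg algebras $\Omega Q_\Delta(S)$ and $\Gamma(S)(x,x)$ are naturally weakly equivalent: the functors $S\mapsto\Omega Q_\Delta(S)$ and $S\mapsto\Gamma(S)(x,x)$ from the category of $0$-reduced simplicial sets to the category of dg $k$-algebras are connected by a finite zigzag of natural transformations of dg algebra valued functors, each component of which is a quasi-isomorphism of dg algebras. -/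

import Mathlib

open CategoryTheory Opposite MonoidalCategory

local notation "⦋" n "⦌" => SimplexCategory.mk n

universe u v w u₁ u₂

namespace CobarRigid

/-! ### Shuffles -/

/-- A `(p, q)`-shuffle, written as a word (read from the inside out) with `p` letters `inl` and `q`
letters `inr`; equivalently a maximal chain in `[p] × [q]`, each letter being one step in the first
or in the second coordinate. -/
inductive Shuffle : ℕ → ℕ → Type
  | nil : Shuffle 0 0
  | inl {p q : ℕ} (w : Shuffle p q) : Shuffle (p + 1) q
  | inr {p q : ℕ} (w : Shuffle p q) : Shuffle p (q + 1)

namespace Shuffle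

/-- The number of letters. -/
def len : {p q : ℕ} → Shuffle p q → ℕ
  | _, _, nil => 0
  | _, _, inl w => w.len + 1
  | _, _, inr w => w.len + 1

/-- The sign of the shuffle: every step in the first coordinate contributes one factor `-1` for each
step in the second coordinate that precedes it. -/
def sgn : {p q : ℕ} → Shuffle p q → ℤ
  | _, _, nil => 1
  | _, q, inl w => (-1) ^ q * w.sgn
  | _, _, inr w => w.sgn

/-- The monotone map `[n + 1] → [m]` that extends `f : [n] → [m]` and sends the last element to the
last element; in terms of chains, it appends the vertex `m`. -/
def append {n m : ℕ} (f : ⦋n⦌ ⟶ ⦋m⦌) : ⦋n + 1⦌ ⟶ ⦋m⦌ :=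
  SimplexCategory.mkHom
    { toFun := Fin.lastCases (Fin.last m) fun i => f.toOrderHom i
      monotone' := by
        intro i j h
        induction j using Fin.lastCases with
        | last => simpa using Fin.le_last _
        | cast j =>
          induction i using Fin.lastCases with
          | last => exact absurd (lt_of_lt_of_le (Fin.castSucc_lt_last j) h) (lt_irrefl _)
          | cast i => simpa using f.toOrderHom.monotone (by simpa using h) }

/-- The first coordinate of the maximal chain, as a monotone map. -/
def fst : {p q : ℕ} → (w : Shuffle p q) → (⦋w.len⦌ ⟶ ⦋p⦌)
  | _, _, nil => 𝟙 _
  | p + 1, _, inl w => append (w.fst ≫ SimplexCategory.δ (Fin.last (p + 1)))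
  | _, _, inr w => append w.fst

/-- The second coordinate of the maximal chain, as a monotone map. -/
def snd : {p q : ℕ} → (w : Shuffle p q) → (⦋w.len⦌ ⟶ ⦋q⦌)
  | _, _, nil => 𝟙 _
  | _, _, inl w => append w.snd
  | _, q + 1, inr w => append (w.snd ≫ SimplexCategory.δ (Fin.last (q + 1)))

def equivZero : Shuffle 0 0 ≃ Unit where
  toFun _ := ()
  invFun _ := nil
  left_inv w := by cases w; rfl
  right_inv _ := rfl

def equivInl (p : ℕ) : Shuffle (p + 1) 0 ≃ Shuffle p 0 where
  toFun w := match w with | inl w => w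
  invFun w := inl w
  left_inv w := by cases w; rfl
  right_inv _ := rfl

def equivInr (q : ℕ) : Shuffle 0 (q + 1) ≃ Shuffle 0 q where
  toFun w := match w with | inr w => w
  invFun w := inr w
  left_inv w := by cases w; rfl
  right_inv _ := rfl

def equivSum (p q : ℕ) : Shuffle (p + 1) (q + 1) ≃ Shuffle p (q + 1) ⊕ Shuffle (p + 1) q where
  toFun w := match w with
    | inl w => Sum.inl w
    | inr w => Sum.inr w
  invFun w := match w with
    | Sum.inl w => inl w
    | Sum.inr w => inr w
  left_inv w := by cases w <;> rfl
  right_inv w := by cases w <;> rfl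

theorem finite : (p q : ℕ) → Finite (Shuffle p q)
  | 0, 0 => Finite.of_equiv _ equivZero.symm
  | p + 1, 0 => @Finite.of_equiv _ _ (finite p 0) (equivInl p).symm
  | 0, q + 1 => @Finite.of_equiv _ _ (finite 0 q) (equivInr q).symm
  | p + 1, q + 1 =>
    @Finite.of_equiv _ _ (@Finite.instSum _ _ (finite p (q + 1)) (finite (p + 1) q))
      (equivSum p q).symm

noncomputable instance (p q : ℕ) : Fintype (Shuffle p q) :=
  @Fintype.ofFinite _ (finite p q)

section sums

variable {V : Type*} [AddCommGroup V]

theorem sum_zero_zero (f : Shuffle 0 0 → V) : ∑ w, f w = f nil := by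
  rw [← equivZero.symm.sum_comp]; simp [equivZero]

theorem sum_succ_zero {p : ℕ} (f : Shuffle (p + 1) 0 → V) : ∑ w, f w = ∑ w, f (inl w) := by
  rw [← (equivInl p).symm.sum_comp]; rfl

theorem sum_zero_succ {q : ℕ} (f : Shuffle 0 (q + 1) → V) : ∑ w, f w = ∑ w, f (inr w) := by
  rw [← (equivInr q).symm.sum_comp]; rfl

theorem sum_succ_succ {p q : ℕ} (f : Shuffle (p + 1) (q + 1) → V) :
    ∑ w, f w = ∑ w, f (inl w) + ∑ w, f (inr w) := by
  rw [← (equivSum p q).symm.sum_comp, Fintype.sum_sum_type]; rfl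

end sums

theorem len_eq : {p q : ℕ} → (w : Shuffle p q) → w.len = p + q
  | _, _, nil => rfl
  | _, _, inl w => by simp only [len, len_eq w]; omega
  | _, _, inr w => by simp only [len, len_eq w]; omega

theorem hom_ext {n m : ℕ} {f g : ⦋n⦌ ⟶ ⦋m⦌} (h : ∀ i, f.toOrderHom i = g.toOrderHom i) : f = g := by
  ext i : 3
  exact h i

theorem append_last {n m : ℕ} (f : ⦋n⦌ ⟶ ⦋m⦌) :
    (append f).toOrderHom (Fin.last (n + 1)) = Fin.last m := by
  change Fin.lastCases (motive := fun _ => Fin (m + 1)) _ _ (Fin.last (n + 1)) = _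
  exact Fin.lastCases_last

theorem append_castSucc {n m : ℕ} (f : ⦋n⦌ ⟶ ⦋m⦌) (i : Fin (n + 1)) :
    (append f).toOrderHom i.castSucc = f.toOrderHom i := by
  change Fin.lastCases (motive := fun _ => Fin (m + 1)) _ _ i.castSucc = _
  exact Fin.lastCases_castSucc _

theorem comp_apply {a b c : SimplexCategory} (f : a ⟶ b) (g : b ⟶ c) (i : Fin (a.len + 1)) :
    (f ≫ g).toOrderHom i = g.toOrderHom (f.toOrderHom i) := by
  simp

theorem delta_last_apply (n : ℕ) (i : Fin (n + 1)) :
    (SimplexCategory.δ (Fin.last (n + 1))).toOrderHom i = i.castSucc := by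
  simp [SimplexCategory.δ, SimplexCategory.mkHom]

theorem delta_castSucc_last (n : ℕ) (i : Fin (n + 1)) :
    (SimplexCategory.δ i.castSucc).toOrderHom (Fin.last n) = Fin.last (n + 1) := by
  simp [SimplexCategory.δ, SimplexCategory.mkHom]

theorem delta_castSucc_castSucc (n : ℕ) (i : Fin (n + 2)) (j : Fin (n + 1)) :
    (SimplexCategory.δ i.castSucc).toOrderHom j.castSucc =
      ((SimplexCategory.δ i).toOrderHom j).castSucc := by
  simp [SimplexCategory.δ, SimplexCategory.mkHom]

theorem append_comp {a b c : ℕ} (f : ⦋a⦌ ⟶ ⦋b⦌) (g : ⦋b⦌ ⟶ ⦋c⦌)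
    (hg : g.toOrderHom (Fin.last b) = Fin.last c) : append f ≫ g = append (f ≫ g) := by
  apply hom_ext
  intro i
  induction i using Fin.lastCases with
  | last => rw [comp_apply, append_last, append_last]; exact hg
  | cast i => rw [comp_apply, append_castSucc, append_castSucc, comp_apply]

theorem delta_append {a b : ℕ} (f : ⦋a + 1⦌ ⟶ ⦋b⦌) (i : Fin (a + 2)) :
    SimplexCategory.δ i.castSucc ≫ append f = append (SimplexCategory.δ i ≫ f) := by
  apply hom_ext
  intro j
  induction j using Fin.lastCases with
  | last => rw [comp_apply, delta_castSucc_last, append_last, append_last]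
  | cast j => rw [comp_apply, delta_castSucc_castSucc, append_castSucc, append_castSucc, comp_apply]

theorem delta_last_append {a b : ℕ} (f : ⦋a⦌ ⟶ ⦋b⦌) :
    SimplexCategory.δ (Fin.last (a + 1)) ≫ append f = f := by
  apply hom_ext
  intro i
  rw [comp_apply, delta_last_apply, append_castSucc]

theorem fst_last : {p q : ℕ} → (w : Shuffle p q) →
    w.fst.toOrderHom (Fin.last w.len) = Fin.last p
  | _, _, nil => rfl
  | _, _, inl _ => append_last _
  | _, _, inr _ => append_last _

theorem snd_last : {p q : ℕ} → (w : Shuffle p q) →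
    w.snd.toOrderHom (Fin.last w.len) = Fin.last q
  | _, _, nil => rfl
  | _, _, inl _ => append_last _
  | _, _, inr _ => append_last _

/-! #### The boundary of the sum of all shuffles -/

section boundary

/-- Functions on the simplices of `Δ^p × Δ^q`. -/
abbrev Cochain (V : Type*) (p q : ℕ) := ∀ n : ℕ, (⦋n⦌ ⟶ ⦋p⦌) → (⦋n⦌ ⟶ ⦋q⦌) → V

section pull

variable {V : Type*}

def Cochain.pull {p q p' q' : ℕ} (φ : Cochain V p' q') (a : ⦋p⦌ ⟶ ⦋p'⦌) (b : ⦋q⦌ ⟶ ⦋q'⦌) :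
    Cochain V p q := fun n α β => φ n (α ≫ a) (β ≫ b)

def Cochain.app {p q : ℕ} (φ : Cochain V p q) : Cochain V p q :=
  fun n α β => φ (n + 1) (append α) (append β)

theorem app_pull {p q p' q' : ℕ} (φ : Cochain V p' q') (a : ⦋p⦌ ⟶ ⦋p'⦌) (b : ⦋q⦌ ⟶ ⦋q'⦌)
    (ha : a.toOrderHom (Fin.last p) = Fin.last p') (hb : b.toOrderHom (Fin.last q) = Fin.last q') :
    (φ.pull a b).app = φ.app.pull a b := by
  funext n α β
  simp only [Cochain.app, Cochain.pull, append_comp _ _ ha, append_comp _ _ hb]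

theorem pull_pull {p q p' q' p'' q'' : ℕ} (φ : Cochain V p'' q'') (a : ⦋p⦌ ⟶ ⦋p'⦌)
    (b : ⦋q⦌ ⟶ ⦋q'⦌) (a' : ⦋p'⦌ ⟶ ⦋p''⦌) (b' : ⦋q'⦌ ⟶ ⦋q''⦌) :
    (φ.pull a' b').pull a b = φ.pull (a ≫ a') (b ≫ b') := by
  funext n α β
  simp only [Cochain.pull, Category.assoc]

end pull

variable {V : Type*} [AddCommGroup V]

def Cochain.bd {p q : ℕ} (φ : Cochain V p q) : Cochain V p q
  | 0, _, _ => 0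
  | n + 1, α, β => ∑ i : Fin (n + 2),
      (-1 : ℤ) ^ (i : ℕ) • φ n (SimplexCategory.δ i ≫ α) (SimplexCategory.δ i ≫ β)

noncomputable def tot {p q : ℕ} (φ : Cochain V p q) : V :=
  ∑ w : Shuffle p q, w.sgn • φ w.len w.fst w.snd

theorem tot_zero_zero (φ : Cochain V 0 0) : tot φ = φ 0 (𝟙 _) (𝟙 _) := by
  rw [tot, sum_zero_zero]; simp [sgn, len, fst, snd]

theorem tot_succ_zero {p : ℕ} (φ : Cochain V (p + 1) 0) :
    tot φ = tot (φ.app.pull (SimplexCategory.δ (Fin.last (p + 1))) (𝟙 _)) := by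
  rw [tot, sum_succ_zero]; simp [tot, sgn, len, fst, snd, Cochain.app, Cochain.pull]

theorem tot_zero_succ {q : ℕ} (φ : Cochain V 0 (q + 1)) :
    tot φ = tot (φ.app.pull (𝟙 _) (SimplexCategory.δ (Fin.last (q + 1)))) := by
  rw [tot, sum_zero_succ]; simp [tot, sgn, len, fst, snd, Cochain.app, Cochain.pull]

theorem tot_succ_succ {p q : ℕ} (φ : Cochain V (p + 1) (q + 1)) :
    tot φ = (-1 : ℤ) ^ (q + 1) • tot (φ.app.pull (SimplexCategory.δ (Fin.last (p + 1))) (𝟙 _)) +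
      tot (φ.app.pull (𝟙 _) (SimplexCategory.δ (Fin.last (q + 1)))) := by
  rw [tot, sum_succ_succ]
  simp [tot, sgn, len, fst, snd, Cochain.app, Cochain.pull, Finset.smul_sum, mul_smul]

theorem tot_add {p q : ℕ} (φ ψ : Cochain V p q) :
    tot (fun n α β => φ n α β + ψ n α β) = tot φ + tot ψ := by
  simp [tot, Finset.sum_add_distrib]

theorem tot_smul {p q : ℕ} (c : ℤ) (φ : Cochain V p q) :
    tot (fun n α β => c • φ n α β) = c • tot φ := by
  simp only [tot, Finset.smul_sum]
  exact Finset.sum_congr rfl fun w _ => smul_comm _ _ _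

theorem bd_app {p q n : ℕ} (hn : n ≠ 0) (φ : Cochain V p q) (α : ⦋n⦌ ⟶ ⦋p⦌) (β : ⦋n⦌ ⟶ ⦋q⦌) :
    φ.bd (n + 1) (append α) (append β) =
      φ.app.bd n α β + (-1 : ℤ) ^ (n + 1) • φ n α β := by
  obtain ⟨n, rfl⟩ := Nat.exists_eq_succ_of_ne_zero hn
  simp only [Cochain.bd, Cochain.app]
  rw [Fin.sum_univ_castSucc]
  simp only [delta_append, delta_last_append, Fin.val_castSucc, Fin.val_last]

theorem bd_pull {p q p' q' : ℕ} (φ : Cochain V p' q') (a : ⦋p⦌ ⟶ ⦋p'⦌) (b : ⦋q⦌ ⟶ ⦋q'⦌) :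
    (φ.pull a b).bd = φ.bd.pull a b := by
  funext n α β
  cases n with
  | zero => rfl
  | succ n => simp only [Cochain.bd, Cochain.pull, Category.assoc]

/-- The boundary of an appended chain, summed over all shuffles. -/
theorem tot_bd_app {p q p' q' : ℕ} (h : p + q ≠ 0) (φ : Cochain V p' q') (a : ⦋p⦌ ⟶ ⦋p'⦌)
    (b : ⦋q⦌ ⟶ ⦋q'⦌) :
    tot (φ.bd.app.pull a b) =
      tot ((φ.app.pull a b).bd) + (-1 : ℤ) ^ (p + q + 1) • tot (φ.pull a b) := by
  rw [← tot_smul, ← tot_add]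
  refine Finset.sum_congr rfl fun w _ => ?_
  congr 1
  have hw := len_eq w
  rw [bd_pull, ← hw]
  simp only [Cochain.pull]
  exact bd_app (by omega) φ _ _

/-- The faces in the first coordinate. -/
noncomputable def facesFst : {p q : ℕ} → Cochain V p q → V
  | 0, _, _ => 0
  | p + 1, _, φ => ∑ i : Fin (p + 2), (-1 : ℤ) ^ (i : ℕ) • tot (φ.pull (SimplexCategory.δ i) (𝟙 _))

/-- The faces in the second coordinate. -/
noncomputable def facesSnd : {p q : ℕ} → Cochain V p q → V
  | _, 0, _ => 0
  | _, q + 1, φ => ∑ i : Fin (q + 2), (-1 : ℤ) ^ (i : ℕ) • tot (φ.pull (𝟙 _) (SimplexCategory.δ i))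

theorem delta_last_comp {n : ℕ} (i : Fin (n + 2)) :
    SimplexCategory.δ (Fin.last (n + 1)) ≫ SimplexCategory.δ i.castSucc =
      SimplexCategory.δ i ≫ SimplexCategory.δ (Fin.last (n + 2)) := by
  apply hom_ext
  intro j
  rw [comp_apply, comp_apply, delta_last_apply, delta_last_apply, delta_castSucc_castSucc]

theorem facesFst_succ_zero {p : ℕ} (φ : Cochain V (p + 2) 0) :
    facesFst φ = facesFst (φ.app.pull (SimplexCategory.δ (Fin.last (p + 2))) (𝟙 _)) +
      (-1 : ℤ) ^ (p + 2) • tot (φ.pull (SimplexCategory.δ (Fin.last (p + 2))) (𝟙 _)) := by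
  rw [facesFst, Fin.sum_univ_castSucc]
  congr 1
  simp only [facesFst, Fin.val_castSucc]
  refine Finset.sum_congr rfl fun i _ => ?_
  rw [tot_succ_zero, app_pull _ _ _ (delta_castSucc_last _ i) rfl, pull_pull, pull_pull,
    delta_last_comp]

theorem facesFst_succ_succ {p q : ℕ} (φ : Cochain V (p + 1) (q + 1)) :
    facesFst φ = (-1 : ℤ) ^ (q + 1) •
        facesFst (φ.app.pull (SimplexCategory.δ (Fin.last (p + 1))) (𝟙 _)) +
      ∑ i : Fin (p + 1), (-1 : ℤ) ^ (i : ℕ) • tot (φ.app.pull (SimplexCategory.δ i.castSucc)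
          (SimplexCategory.δ (Fin.last (q + 1)))) +
      (-1 : ℤ) ^ (p + 1) • tot (φ.pull (SimplexCategory.δ (Fin.last (p + 1))) (𝟙 _)) := by
  rw [facesFst, Fin.sum_univ_castSucc]
  congr 1
  cases p with
  | zero =>
    simp only [facesFst, smul_zero, zero_add]
    refine Finset.sum_congr rfl fun i _ => ?_
    rw [tot_zero_succ, app_pull _ _ _ (delta_castSucc_last _ i) rfl, pull_pull]
    simp
  | succ p =>
    simp only [facesFst, Finset.smul_sum, Fin.val_castSucc]
    rw [← Finset.sum_add_distrib]
    refine Finset.sum_congr rfl fun i _ => ?_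
    rw [tot_succ_succ, app_pull _ _ _ (delta_castSucc_last _ i) rfl, pull_pull, pull_pull, pull_pull,
      delta_last_comp, smul_add, smul_comm]
    simp

theorem facesSnd_zero_succ {q : ℕ} (φ : Cochain V 0 (q + 2)) :
    facesSnd φ = facesSnd (φ.app.pull (𝟙 _) (SimplexCategory.δ (Fin.last (q + 2)))) +
      (-1 : ℤ) ^ (q + 2) • tot (φ.pull (𝟙 _) (SimplexCategory.δ (Fin.last (q + 2)))) := by
  rw [facesSnd, Fin.sum_univ_castSucc]
  congr 1
  simp only [facesSnd, Fin.val_castSucc]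
  refine Finset.sum_congr rfl fun i _ => ?_
  rw [tot_zero_succ, app_pull _ _ _ rfl (delta_castSucc_last _ i), pull_pull, pull_pull,
    delta_last_comp]

theorem delta_zero_append (f : ⦋0⦌ ⟶ ⦋1⦌) :
    (SimplexCategory.δ 0 : ⦋0⦌ ⟶ ⦋1⦌) ≫ append f = SimplexCategory.δ 0 := by
  apply hom_ext
  intro i
  obtain rfl : i = 0 := Subsingleton.elim (α := Fin 1) _ _
  rw [comp_apply, show (SimplexCategory.δ 0 : ⦋0⦌ ⟶ ⦋1⦌).toOrderHom 0 = Fin.last 1 from rfl]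
  exact append_last f

theorem delta_one_append (f : ⦋0⦌ ⟶ ⦋1⦌) :
    (SimplexCategory.δ 1 : ⦋0⦌ ⟶ ⦋1⦌) ≫ append f = f :=
  delta_last_append f

theorem facesSnd_succ_succ {p q : ℕ} (φ : Cochain V (p + 1) (q + 1)) :
    facesSnd φ = facesSnd (φ.app.pull (𝟙 _) (SimplexCategory.δ (Fin.last (q + 1)))) +
      (-1 : ℤ) ^ q • ∑ i : Fin (q + 1), (-1 : ℤ) ^ (i : ℕ) • tot (φ.app.pull
          (SimplexCategory.δ (Fin.last (p + 1))) (SimplexCategory.δ i.castSucc)) +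
      (-1 : ℤ) ^ (q + 1) • tot (φ.pull (𝟙 _) (SimplexCategory.δ (Fin.last (q + 1)))) := by
  rw [facesSnd, Fin.sum_univ_castSucc]
  congr 1
  cases q with
  | zero =>
    simp only [facesSnd, zero_add, pow_zero, one_smul]
    refine Finset.sum_congr rfl fun i _ => ?_
    rw [tot_succ_zero, app_pull _ _ _ rfl (delta_castSucc_last _ i), pull_pull]
    simp
  | succ q =>
    simp only [facesSnd, Finset.smul_sum, Fin.val_castSucc]
    rw [← Finset.sum_add_distrib]
    refine Finset.sum_congr rfl fun i _ => ?_
    rw [tot_succ_succ, app_pull _ _ _ rfl (delta_castSucc_last _ i), pull_pull, pull_pull, pull_pull,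
      delta_last_comp, smul_add, smul_comm, add_comm]
    simp

/-- The sum of all shuffles satisfies the Leibniz formula. -/
theorem tot_bd : (p q : ℕ) → (φ : Cochain V p q) →
    tot φ.bd = facesFst φ + (-1 : ℤ) ^ p • facesSnd φ
  | 0, 0, φ => by simp [tot_zero_zero, Cochain.bd, facesFst, facesSnd]
  | 1, 0, φ => by
    simp only [tot_succ_zero, tot_zero_zero, facesFst, facesSnd, Cochain.pull, Cochain.app,
      Cochain.bd]
    refine (Finset.sum_congr rfl fun i _ => ?_).trans (by rw [smul_zero, add_zero])
    congr 2
    · fin_cases i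
      · exact delta_zero_append _
      · exact delta_one_append _
    · exact Subsingleton.elim _ _
  | 0, 1, φ => by
    simp only [tot_zero_succ, tot_zero_zero, facesFst, facesSnd, Cochain.pull, Cochain.app,
      Cochain.bd]
    rw [pow_zero, one_smul]
    refine (Finset.sum_congr rfl fun i _ => ?_).trans (zero_add _).symm
    congr 2
    · exact Subsingleton.elim _ _
    · fin_cases i
      · exact delta_zero_append _
      · exact delta_one_append _
  | p + 2, 0, φ => by
    rw [tot_succ_zero, tot_bd_app (by omega), tot_bd (p + 1) 0, facesFst_succ_zero]
    simp [facesSnd]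
  | 0, q + 2, φ => by
    rw [tot_zero_succ, tot_bd_app (by omega), tot_bd 0 (q + 1), facesSnd_zero_succ]
    simp [facesFst]
  | p + 1, q + 1, φ => by
    rw [tot_succ_succ, tot_bd_app (by omega), tot_bd_app (by omega), tot_bd p (q + 1),
      tot_bd (p + 1) q, facesFst_succ_succ, facesSnd_succ_succ]
    rw [show facesFst (φ.app.pull (𝟙 _) (SimplexCategory.δ (Fin.last (q + 1)))) =
      _ from Fin.sum_univ_castSucc _, show facesSnd (φ.app.pull (SimplexCategory.δ (Fin.last (p + 1))) (𝟙 _)) =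
      _ from Fin.sum_univ_castSucc _]
    simp only [pull_pull, Category.comp_id, Category.id_comp, Fin.val_castSucc, Fin.val_last]
    generalize facesFst (φ.app.pull (SimplexCategory.δ (Fin.last (p + 1))) (𝟙 _)) = A1
    generalize facesSnd (φ.app.pull (𝟙 _) (SimplexCategory.δ (Fin.last (q + 1)))) = A2
    generalize tot (φ.pull (𝟙 _) (SimplexCategory.δ (Fin.last (q + 1)))) = A3
    generalize tot (φ.pull (SimplexCategory.δ (Fin.last (p + 1))) (𝟙 _)) = A4
    generalize tot (φ.app.pull (SimplexCategory.δ (Fin.last (p + 1)))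
      (SimplexCategory.δ (Fin.last (q + 1)))) = A5
    generalize (∑ i : Fin (p + 1), _ : V) = A6
    generalize (∑ i : Fin (q + 1), _ : V) = A7
    rcases neg_one_pow_eq_or ℤ p with hp | hp <;> rcases neg_one_pow_eq_or ℤ q with hq | hq <;>
      simp only [pow_add, hp, hq] <;> module

end boundary

/-! #### Associativity -/

/-- Words for maximal chains in `[p] × [q] × [r]`. -/
inductive Triple : ℕ → ℕ → ℕ → Type
  | nil : Triple 0 0 0
  | one {p q r : ℕ} (t : Triple p q r) : Triple (p + 1) q r
  | two {p q r : ℕ} (t : Triple p q r) : Triple p (q + 1) r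
  | three {p q r : ℕ} (t : Triple p q r) : Triple p q (r + 1)

def toTripleR : {p m : ℕ} → Shuffle p m → {q r : ℕ} → (w' : Shuffle q r) → m = w'.len →
    Triple p q r
  | _, _, nil, _, _, nil, _ => .nil
  | _, _, inl w, _, _, w', h => .one (toTripleR w w' h)
  | _, _, inr w, _, _, inl w', h => .two (toTripleR w w' (Nat.succ.inj h))
  | _, _, inr w, _, _, inr w', h => .three (toTripleR w w' (Nat.succ.inj h))

def toTripleL : {m r : ℕ} → Shuffle m r → {p q : ℕ} → (w' : Shuffle p q) → m = w'.len →
    Triple p q r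
  | _, _, nil, _, _, nil, _ => .nil
  | _, _, inr w, _, _, w', h => .three (toTripleL w w' h)
  | _, _, inl w, _, _, inl w', h => .one (toTripleL w w' (Nat.succ.inj h))
  | _, _, inl w, _, _, inr w', h => .two (toTripleL w w' (Nat.succ.inj h))

def ofTripleR : {p q r : ℕ} → Triple p q r → (w' : Shuffle q r) × Shuffle p w'.len
  | _, _, _, .nil => ⟨nil, nil⟩
  | _, _, _, .one t => ⟨(ofTripleR t).1, inl (ofTripleR t).2⟩
  | _, _, _, .two t => ⟨inl (ofTripleR t).1, inr (ofTripleR t).2⟩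
  | _, _, _, .three t => ⟨inr (ofTripleR t).1, inr (ofTripleR t).2⟩

def ofTripleL : {p q r : ℕ} → Triple p q r → (w' : Shuffle p q) × Shuffle w'.len r
  | _, _, _, .nil => ⟨nil, nil⟩
  | _, _, _, .one t => ⟨inl (ofTripleL t).1, inl (ofTripleL t).2⟩
  | _, _, _, .two t => ⟨inr (ofTripleL t).1, inl (ofTripleL t).2⟩
  | _, _, _, .three t => ⟨(ofTripleL t).1, inr (ofTripleL t).2⟩

theorem ofR_toR {p m : ℕ} (w : Shuffle p m) : ∀ {q r : ℕ} (w' : Shuffle q r)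
    (h : m = w'.len), ofTripleR (toTripleR w w' h) = ⟨w', h ▸ w⟩ := by
  induction w with
  | nil =>
    intro q r w' h
    cases w' with
    | nil => rfl
    | inl w' => exact absurd h (Nat.succ_ne_zero _).symm
    | inr w' => exact absurd h (Nat.succ_ne_zero _).symm
  | inl w ih =>
    intro q r w' h
    subst h
    rw [toTripleR, ofTripleR, ih w' rfl]
  | inr w ih =>
    intro q r w' h
    cases w' with
    | nil => exact absurd h (Nat.succ_ne_zero _)
    | inl w' => obtain rfl := Nat.succ.inj h; rw [toTripleR, ofTripleR, ih w' rfl]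
    | inr w' => obtain rfl := Nat.succ.inj h; rw [toTripleR, ofTripleR, ih w' rfl]

theorem ofL_toL {m r : ℕ} (w : Shuffle m r) : ∀ {p q : ℕ} (w' : Shuffle p q)
    (h : m = w'.len), ofTripleL (toTripleL w w' h) = ⟨w', h ▸ w⟩ := by
  induction w with
  | nil =>
    intro p q w' h
    cases w' with
    | nil => rfl
    | inl w' => exact absurd h (Nat.succ_ne_zero _).symm
    | inr w' => exact absurd h (Nat.succ_ne_zero _).symm
  | inr w ih =>
    intro p q w' h
    subst h
    rw [toTripleL, ofTripleL, ih w' rfl]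
  | inl w ih =>
    intro p q w' h
    cases w' with
    | nil => exact absurd h (Nat.succ_ne_zero _)
    | inl w' => obtain rfl := Nat.succ.inj h; rw [toTripleL, ofTripleL, ih w' rfl]
    | inr w' => obtain rfl := Nat.succ.inj h; rw [toTripleL, ofTripleL, ih w' rfl]

theorem toR_ofR : {p q r : ℕ} → (t : Triple p q r) →
    toTripleR (ofTripleR t).2 (ofTripleR t).1 rfl = t
  | _, _, _, .nil => rfl
  | _, _, _, .one t => by simp only [ofTripleR, toTripleR, toR_ofR t]
  | _, _, _, .two t => by simp only [ofTripleR, toTripleR, toR_ofR t]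
  | _, _, _, .three t => by simp only [ofTripleR, toTripleR, toR_ofR t]

theorem toL_ofL : {p q r : ℕ} → (t : Triple p q r) →
    toTripleL (ofTripleL t).2 (ofTripleL t).1 rfl = t
  | _, _, _, .nil => rfl
  | _, _, _, .one t => by simp only [ofTripleL, toTripleL, toL_ofL t]
  | _, _, _, .two t => by simp only [ofTripleL, toTripleL, toL_ofL t]
  | _, _, _, .three t => by simp only [ofTripleL, toTripleL, toL_ofL t]

def equivTripleR (p q r : ℕ) : Triple p q r ≃ (w' : Shuffle q r) × Shuffle p w'.len where
  toFun := ofTripleR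
  invFun x := toTripleR x.2 x.1 rfl
  left_inv := toR_ofR
  right_inv x := ofR_toR x.2 x.1 rfl

def equivTripleL (p q r : ℕ) : Triple p q r ≃ (w' : Shuffle p q) × Shuffle w'.len r where
  toFun := ofTripleL
  invFun x := toTripleL x.2 x.1 rfl
  left_inv := toL_ofL
  right_inv x := ofL_toL x.2 x.1 rfl

theorem sgn_eq : {p q r : ℕ} → (t : Triple p q r) →
    (ofTripleR t).1.sgn * (ofTripleR t).2.sgn = (ofTripleL t).1.sgn * (ofTripleL t).2.sgn
  | _, _, _, .nil => rfl
  | _, q, r, .one t => by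
    have := len_eq (ofTripleR t).1
    simp only [ofTripleR, ofTripleL, sgn, this, pow_add]
    linear_combination (-1) ^ q * (-1) ^ r * sgn_eq t
  | _, _, _, .two t => by
    simp only [ofTripleR, ofTripleL, sgn]
    linear_combination (-1) ^ _ * sgn_eq t
  | _, _, _, .three t => by
    simp only [ofTripleR, ofTripleL, sgn]
    exact sgn_eq t

theorem val_eq {V : Type*} : {p q r : ℕ} → (t : Triple p q r) →
    (Φ : ∀ n : ℕ, (⦋n⦌ ⟶ ⦋p⦌) → (⦋n⦌ ⟶ ⦋q⦌) → (⦋n⦌ ⟶ ⦋r⦌) → V) →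
    Φ _ (ofTripleR t).2.fst ((ofTripleR t).2.snd ≫ (ofTripleR t).1.fst)
        ((ofTripleR t).2.snd ≫ (ofTripleR t).1.snd) =
      Φ _ ((ofTripleL t).2.fst ≫ (ofTripleL t).1.fst) ((ofTripleL t).2.fst ≫ (ofTripleL t).1.snd)
        (ofTripleL t).2.snd
  | _, _, _, .nil, Φ => rfl
  | _, _, _, .one t, Φ => by
    simp only [ofTripleR, ofTripleL, fst, snd, len]
    rw [append_comp _ _ (fst_last _), append_comp _ _ (snd_last _), append_comp _ _ (append_last _),
      append_comp _ _ (append_last _)]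
    simp only [Category.assoc, delta_last_append]
    simpa only [Category.assoc] using val_eq t fun n α β γ => Φ (n + 1)
      (append (α ≫ SimplexCategory.δ (Fin.last _))) (append β) (append γ)
  | _, _, _, .two t, Φ => by
    simp only [ofTripleR, ofTripleL, fst, snd, len]
    rw [append_comp _ _ (append_last _), append_comp _ _ (append_last _),
      append_comp _ _ (append_last _), append_comp _ _ (append_last _)]
    simp only [Category.assoc, delta_last_append]
    simpa only [Category.assoc] using val_eq t fun n α β γ => Φ (n + 1)
      (append α) (append (β ≫ SimplexCategory.δ (Fin.last _))) (append γ)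
  | _, _, _, .three t, Φ => by
    simp only [ofTripleR, ofTripleL, fst, snd, len]
    rw [append_comp _ _ (append_last _), append_comp _ _ (append_last _),
      append_comp _ _ (fst_last _), append_comp _ _ (snd_last _)]
    simp only [Category.assoc, delta_last_append]
    simpa only [Category.assoc] using val_eq t fun n α β γ => Φ (n + 1)
      (append α) (append β) (append (γ ≫ SimplexCategory.δ (Fin.last _)))

/-- Shuffling is associative. -/
theorem sum_assoc {V : Type*} [AddCommGroup V] (p q r : ℕ)
    (Φ : ∀ n : ℕ, (⦋n⦌ ⟶ ⦋p⦌) → (⦋n⦌ ⟶ ⦋q⦌) → (⦋n⦌ ⟶ ⦋r⦌) → V) :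
    ∑ w' : Shuffle q r, ∑ w : Shuffle p w'.len,
      (w'.sgn * w.sgn) • Φ w.len w.fst (w.snd ≫ w'.fst) (w.snd ≫ w'.snd) =
    ∑ w' : Shuffle p q, ∑ w : Shuffle w'.len r,
      (w'.sgn * w.sgn) • Φ w.len (w.fst ≫ w'.fst) (w.fst ≫ w'.snd) w.snd := by
  rw [Finset.sum_sigma', Finset.sum_sigma']
  refine Fintype.sum_equiv ((equivTripleR p q r).symm.trans (equivTripleL p q r)) _ _ ?_
  intro x
  obtain ⟨t, rfl⟩ := (equivTripleR p q r).surjective x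
  rw [Equiv.trans_apply, Equiv.symm_apply_apply]
  exact congrArg₂ (fun (a : ℤ) (b : V) => a • b) (sgn_eq t) (val_eq t Φ)

/-- Every step in the first coordinate is a position at which the second coordinate is constant. -/
theorem exists_step_fst : {p q : ℕ} → (w : Shuffle p q) → (i : Fin p) → ∃ t : Fin w.len,
    w.fst.toOrderHom t.castSucc = i.castSucc ∧ w.fst.toOrderHom t.succ = i.succ ∧
      w.snd.toOrderHom t.castSucc = w.snd.toOrderHom t.succ
  | p + 1, _, inl w, i => by
    induction i using Fin.lastCases with
    | last =>
      refine ⟨Fin.last _, ?_, ?_, ?_⟩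
      · exact (append_castSucc _ _).trans (by rw [comp_apply, fst_last, delta_last_apply])
      · exact append_last _
      · exact (append_castSucc _ _).trans ((snd_last w).trans (append_last _).symm)
    | cast i =>
      obtain ⟨t, h1, h2, h3⟩ := exists_step_fst w i
      refine ⟨t.castSucc, ?_, ?_, ?_⟩
      · exact (append_castSucc _ _).trans (by rw [comp_apply, h1, delta_last_apply])
      · exact (append_castSucc _ t.succ).trans (by rw [comp_apply, h2, delta_last_apply]; rfl)
      · exact (append_castSucc _ _).trans (h3.trans (append_castSucc _ t.succ).symm)
  | _, q + 1, inr w, i => by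
    obtain ⟨t, h1, h2, h3⟩ := exists_step_fst w i
    refine ⟨t.castSucc, ?_, ?_, ?_⟩
    · exact (append_castSucc _ _).trans h1
    · exact (append_castSucc _ t.succ).trans h2
    · refine (append_castSucc _ _).trans (Eq.trans ?_ (append_castSucc _ t.succ).symm)
      rw [comp_apply, comp_apply, h3]

/-- Every step in the second coordinate is a position at which the first coordinate is constant. -/
theorem exists_step_snd : {p q : ℕ} → (w : Shuffle p q) → (i : Fin q) → ∃ t : Fin w.len,
    w.snd.toOrderHom t.castSucc = i.castSucc ∧ w.snd.toOrderHom t.succ = i.succ ∧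
      w.fst.toOrderHom t.castSucc = w.fst.toOrderHom t.succ
  | _, q + 1, inr w, i => by
    induction i using Fin.lastCases with
    | last =>
      refine ⟨Fin.last _, ?_, ?_, ?_⟩
      · exact (append_castSucc _ _).trans (by rw [comp_apply, snd_last, delta_last_apply])
      · exact append_last _
      · exact (append_castSucc _ _).trans ((fst_last w).trans (append_last _).symm)
    | cast i =>
      obtain ⟨t, h1, h2, h3⟩ := exists_step_snd w i
      refine ⟨t.castSucc, ?_, ?_, ?_⟩
      · exact (append_castSucc _ _).trans (by rw [comp_apply, h1, delta_last_apply])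
      · exact (append_castSucc _ t.succ).trans (by rw [comp_apply, h2, delta_last_apply]; rfl)
      · exact (append_castSucc _ _).trans (h3.trans (append_castSucc _ t.succ).symm)
  | p + 1, _, inl w, i => by
    obtain ⟨t, h1, h2, h3⟩ := exists_step_snd w i
    refine ⟨t.castSucc, ?_, ?_, ?_⟩
    · exact (append_castSucc _ _).trans h1
    · exact (append_castSucc _ t.succ).trans h2
    · refine (append_castSucc _ _).trans (Eq.trans ?_ (append_castSucc _ t.succ).symm)
      rw [comp_apply, comp_apply, h3]

/-! #### Shuffles with a vertex -/

theorem append_delta_last (p : ℕ) :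
    append (SimplexCategory.δ (Fin.last (p + 1))) = 𝟙 ⦋p + 1⦌ := by
  apply hom_ext
  intro i
  induction i using Fin.lastCases with
  | last => rw [append_last]; rfl
  | cast i => rw [append_castSucc, delta_last_apply]; rfl

theorem sum_right_zero {V : Type*} [AddCommGroup V] (p : ℕ)
    (Φ : ∀ n : ℕ, (⦋n⦌ ⟶ ⦋p⦌) → V) :
    ∑ w : Shuffle p 0, w.sgn • Φ w.len w.fst = Φ p (𝟙 _) := by
  induction p with
  | zero => rw [sum_zero_zero]; simp [sgn, len, fst]
  | succ p ih =>
    rw [sum_succ_zero]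
    simp only [sgn, len, fst, pow_zero, one_mul]
    rw [ih fun n f => Φ (n + 1) (append (f ≫ SimplexCategory.δ (Fin.last (p + 1))))]
    rw [Category.id_comp, append_delta_last]

theorem sum_left_zero {V : Type*} [AddCommGroup V] (q : ℕ)
    (Φ : ∀ n : ℕ, (⦋n⦌ ⟶ ⦋q⦌) → V) :
    ∑ w : Shuffle 0 q, w.sgn • Φ w.len w.snd = Φ q (𝟙 _) := by
  induction q with
  | zero => rw [sum_zero_zero]; simp [sgn, len, snd]
  | succ q ih =>
    rw [sum_zero_succ]
    simp only [sgn, len, snd]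
    rw [ih fun n f => Φ (n + 1) (append (f ≫ SimplexCategory.δ (Fin.last (q + 1))))]
    rw [Category.id_comp, append_delta_last]

end Shuffle

/-! ### Differential graded algebras -/

/-- A non-negatively graded (unital, associative) differential graded algebra over `k`, with
differential of degree `-1`: the total algebra, together with its grading. -/
structure DGAlg (k : Type v) [CommRing k] where
  carrier : Type w
  [ring : Ring carrier]
  [algebra : Algebra k carrier]
  /-- The homogeneous part of degree `n`. -/
  gr : ℕ → Submodule k carrier
  [graded : GradedAlgebra gr]
  d : carrier →ₗ[k] carrier
  d_mem : ∀ (n : ℕ) (a : carrier), a ∈ gr (n + 1) → d a ∈ gr n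
  d_zero : ∀ a : carrier, a ∈ gr 0 → d a = 0
  d_d : ∀ a : carrier, d (d a) = 0
  leibniz : ∀ (n : ℕ) (a b : carrier), a ∈ gr n → d (a * b) = d a * b + (-1 : ℤ) ^ n • (a * d b)

namespace DGAlg

variable {k : Type v} [CommRing k]

attribute [instance] DGAlg.ring DGAlg.algebra DGAlg.graded

/-- A morphism of differential graded algebras: a unital algebra map of degree `0` that commutes
with the differentials. -/
@[ext]
structure Hom (A B : DGAlg.{v, w} k) where
  toAlgHom : A.carrier →ₐ[k] B.carrier
  map_gr : ∀ (n : ℕ) (a : A.carrier), a ∈ A.gr n → toAlgHom a ∈ B.gr n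
  map_d : ∀ a : A.carrier, toAlgHom (A.d a) = B.d (toAlgHom a)

instance : Category (DGAlg.{v, w} k) where
  Hom := Hom
  id A := ⟨AlgHom.id k _, fun _ _ h => h, fun _ => rfl⟩
  comp f g := ⟨g.toAlgHom.comp f.toAlgHom, fun n a h => g.map_gr n _ (f.map_gr n a h),
    fun a => (congrArg g.toAlgHom (f.map_d a)).trans (g.map_d _)⟩

/-- The underlying chain complex of a differential graded algebra. -/
noncomputable def toChainComplex (A : DGAlg.{v, w} k) : ChainComplex (ModuleCat.{w} k) ℕ :=
  ChainComplex.of (fun n => ModuleCat.of k (A.gr n))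
    (fun n => ModuleCat.ofHom (A.d.restrict (A.d_mem n)))
    (fun n => by ext a; exact A.d_d a.1)

theorem toChainComplex_d (A : DGAlg.{v, w} k) (n : ℕ) : A.toChainComplex.d (n + 1) n =
    ModuleCat.ofHom (A.d.restrict (A.d_mem n)) :=
  ChainComplex.of_d (V := ModuleCat.{w} k) (fun n => ModuleCat.of k (A.gr n))
    (fun n => ModuleCat.ofHom (A.d.restrict (A.d_mem n))) n

/-- The underlying chain map of a morphism of differential graded algebras. -/
noncomputable def toChainMap {A B : DGAlg.{v, w} k} (f : A ⟶ B) :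
    A.toChainComplex ⟶ B.toChainComplex :=
  ChainComplex.ofHom
    (fun n => ModuleCat.ofHom (f.toAlgHom.toLinearMap.restrict (f.map_gr n)))
    (fun n => by
      rw [toChainComplex_d, toChainComplex_d]
      ext a
      exact Subtype.ext (f.map_d a.1).symm)

/-- A weak equivalence of differential graded algebras is a morphism that is an isomorphism on
homology. -/
def IsWeakEquivalence {A B : DGAlg.{v, w} k} (f : A ⟶ B) : Prop :=
  QuasiIso (toChainMap f)

/-- Two functors into differential graded algebras are naturally weakly equivalent if they are
connected by a finite zigzag of natural transformations all of whose components are weak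
equivalences. -/
def NaturallyWeaklyEquivalent {C : Type*} [Category C] (F G : C ⥤ DGAlg.{v, w} k) : Prop :=
  Relation.EqvGen
    (fun F G : C ⥤ DGAlg.{v, w} k => ∃ η : F ⟶ G, ∀ X : C, IsWeakEquivalence (η.app X)) F G

end DGAlg

/-! ### Graded modules -/

/-- The linear involution that is multiplication by `(-1) ^ n` in degree `n`. -/
noncomputable def signInvolution {k : Type v} [CommRing k] {M : Type w} [AddCommGroup M]
    [Module k M] (𝒜 : ℕ → Submodule k M) [DirectSum.Decomposition 𝒜] : M →ₗ[k] M :=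
  DirectSum.toModule k ℕ M (fun n => (-1 : ℤ) ^ n • (𝒜 n).subtype) ∘ₗ
    (DirectSum.decomposeLinearEquiv 𝒜).toLinearMap

theorem signInvolution_of_mem {k : Type v} [CommRing k] {M : Type w} [AddCommGroup M]
    [Module k M] (𝒜 : ℕ → Submodule k M) [DirectSum.Decomposition 𝒜] {n : ℕ} {x : M}
    (hx : x ∈ 𝒜 n) : signInvolution 𝒜 x = (-1 : ℤ) ^ n • x := by
  simp only [signInvolution, LinearMap.comp_apply, LinearEquiv.coe_coe,
    DirectSum.decomposeLinearEquiv_apply]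
  rw [DirectSum.decompose_of_mem 𝒜 hx, ← DirectSum.lof_eq_of k, DirectSum.toModule_lof]
  rfl

/-! ### Connected differential graded coalgebras -/

open TensorProduct in
/-- A connected, counital, coassociative differential graded coalgebra over `k`, non-negatively
graded, with differential of degree `-1`. -/
structure ConnDGCoalg (k : Type v) [CommRing k] where
  carrier : Type w
  [addCommGroup : AddCommGroup carrier]
  [module : Module k carrier]
  [coalgebra : Coalgebra k carrier]
  /-- The homogeneous part of degree `n`. -/
  gr : ℕ → Submodule k carrier
  [graded : DirectSum.Decomposition gr]
  d : carrier →ₗ[k] carrier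
  d_mem : ∀ (n : ℕ) (c : carrier), c ∈ gr (n + 1) → d c ∈ gr n
  d_zero : ∀ c : carrier, c ∈ gr 0 → d c = 0
  d_d : ∀ c : carrier, d (d c) = 0
  comul_mem : ∀ (n : ℕ) (c : carrier), c ∈ gr n → Coalgebra.comul (R := k) c ∈
    ⨆ (p : ℕ) (q : ℕ) (_ : p + q = n),
      LinearMap.range (TensorProduct.map (gr p).subtype (gr q).subtype)
  comul_d : ∀ c : carrier, Coalgebra.comul (R := k) (d c) =
    TensorProduct.map d LinearMap.id (Coalgebra.comul (R := k) c) +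
      TensorProduct.map (signInvolution gr) d (Coalgebra.comul (R := k) c)
  counit_pos : ∀ (n : ℕ) (c : carrier), c ∈ gr (n + 1) → Coalgebra.counit (R := k) c = 0
  counit_d : ∀ c : carrier, Coalgebra.counit (R := k) (d c) = 0
  /-- The counit identifies the degree `0` part with `k`. -/
  connected : Function.Bijective fun c : gr 0 => Coalgebra.counit (R := k) (c : carrier)

namespace ConnDGCoalg

variable {k : Type v} [CommRing k]

attribute [instance] ConnDGCoalg.addCommGroup ConnDGCoalg.module ConnDGCoalg.coalgebra
  ConnDGCoalg.graded

/-- A morphism of connected differential graded coalgebras: a map of counital coalgebras of degree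
`0` that commutes with the differentials. -/
@[ext]
structure Hom (C D : ConnDGCoalg.{v, w} k) where
  toCoalgHom : C.carrier →ₗc[k] D.carrier
  map_gr : ∀ (n : ℕ) (c : C.carrier), c ∈ C.gr n → toCoalgHom c ∈ D.gr n
  map_d : ∀ c : C.carrier, toCoalgHom (C.d c) = D.d (toCoalgHom c)

instance : Category (ConnDGCoalg.{v, w} k) where
  Hom := Hom
  id C := ⟨CoalgHom.id k _, fun _ _ h => h, fun _ => rfl⟩
  comp f g := ⟨g.toCoalgHom.comp f.toCoalgHom, fun n a h => g.map_gr n _ (f.map_gr n a h),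
    fun a => (congrArg g.toCoalgHom (f.map_d a)).trans (g.map_d _)⟩

end ConnDGCoalg

/-! ### The cobar construction -/

namespace Cobar

variable {k : Type v} [CommRing k] (C : ConnDGCoalg.{v, w} k)

/-- The underlying algebra of the cobar construction: the tensor algebra on the positive degree part
of `C`, realized as the quotient of `C` by its degree `0` part. -/
abbrev Carrier : Type (max v w) := TensorAlgebra k (C.carrier ⧸ C.gr 0)

/-- The linear map `c ↦ s c`, extended by `0` to the degree `0` part of `C`. -/
noncomputable def s : C.carrier →ₗ[k] Carrier C :=
  TensorAlgebra.ι k ∘ₗ (C.gr 0).mkQ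

theorem s_zero (c : C.carrier) (hc : c ∈ C.gr 0) : s C c = 0 := by
  simp only [s, LinearMap.comp_apply]
  rw [show (C.gr 0).mkQ c = 0 from (Submodule.Quotient.mk_eq_zero _).2 hc, map_zero]

/-- The algebra map out of the cobar construction with prescribed values on the elements `s c`. -/
noncomputable def lift {A : Type*} [Ring A] [Algebra k A] (f : C.carrier →ₗ[k] A)
    (hf : ∀ c ∈ C.gr 0, f c = 0) : Carrier C →ₐ[k] A :=
  TensorAlgebra.lift k ((C.gr 0).liftQ f hf)

theorem lift_s {A : Type*} [Ring A] [Algebra k A] (f : C.carrier →ₗ[k] A)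
    (hf : ∀ c ∈ C.gr 0, f c = 0) (c : C.carrier) : lift C f hf (s C c) = f c := by
  simp only [lift, s, LinearMap.comp_apply, TensorAlgebra.lift_ι_apply]
  exact Submodule.liftQ_apply _ _ _

theorem algHom_ext {A : Type*} [Ring A] [Algebra k A] {f g : Carrier C →ₐ[k] A}
    (h : ∀ c, f (s C c) = g (s C c)) : f = g := by
  apply TensorAlgebra.hom_ext
  apply Submodule.linearMap_qext
  ext c
  exact h c

/-- The monomials `s c₁ ⊗ ⋯ ⊗ s cᵣ` with homogeneous factors, with their total degrees
`(deg c₁ - 1) + ⋯ + (deg cᵣ - 1)`. -/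
inductive IsMonomial : ℕ → Carrier C → Prop
  | one : IsMonomial 0 1
  | mul {p n : ℕ} {c : C.carrier} {x : Carrier C} (hc : c ∈ C.gr (p + 1)) (hx : IsMonomial n x) :
      IsMonomial (p + n) (s C c * x)

/-- The homogeneous part of degree `n` of the cobar construction. -/
noncomputable def gr (n : ℕ) : Submodule k (Carrier C) :=
  Submodule.span k {x | IsMonomial C n x}

variable {C} in
theorem IsMonomial.mem {n : ℕ} {x : Carrier C} (h : IsMonomial C n x) : x ∈ gr C n :=
  Submodule.subset_span h

variable {C} in
theorem IsMonomial.mul' {m n : ℕ} {x y : Carrier C} (hx : IsMonomial C m x)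
    (hy : IsMonomial C n y) : IsMonomial C (m + n) (x * y) := by
  induction hx with
  | one => simpa using hy
  | mul hc _ ih => rw [mul_assoc, add_assoc]; exact .mul hc ih

theorem s_mem {p : ℕ} {c : C.carrier} (hc : c ∈ C.gr (p + 1)) : s C c ∈ gr C p := by
  have := IsMonomial.mem (.mul hc .one)
  rwa [mul_one, add_zero] at this

instance : SetLike.GradedMonoid (gr C) where
  one_mem := IsMonomial.mem .one
  mul_mem m n x y hx hy := by
    have h := Submodule.mul_mem_mul hx hy
    rw [gr, gr, Submodule.span_mul_span] at h
    refine Submodule.span_mono ?_ h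
    rintro _ ⟨a, ha, b, hb, rfl⟩
    exact ha.mul' hb

/-- The map sending `s c`, for `c` homogeneous of degree `p + 1`, to its copy in degree `p`. -/
noncomputable def sGraded : C.carrier →ₗ[k] DirectSum ℕ fun n => gr C n :=
  DirectSum.toModule k ℕ _ (fun n => match n with
    | 0 => 0
    | p + 1 => DirectSum.lof k ℕ (fun n => gr C n) p ∘ₗ
        (s C ∘ₗ (C.gr (p + 1)).subtype).codRestrict (gr C p) fun c => s_mem C c.2) ∘ₗ
    (DirectSum.decomposeLinearEquiv C.gr).toLinearMap

theorem sGraded_zero (c : C.carrier) (hc : c ∈ C.gr 0) : sGraded C c = 0 := by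
  simp only [sGraded, LinearMap.comp_apply, LinearEquiv.coe_coe,
    DirectSum.decomposeLinearEquiv_apply]
  rw [DirectSum.decompose_of_mem C.gr hc, ← DirectSum.lof_eq_of k, DirectSum.toModule_lof]
  rfl

theorem sGraded_succ {p : ℕ} (c : C.carrier) (hc : c ∈ C.gr (p + 1)) :
    sGraded C c = DirectSum.of (fun n => gr C n) p ⟨s C c, s_mem C hc⟩ := by
  simp only [sGraded, LinearMap.comp_apply, LinearEquiv.coe_coe,
    DirectSum.decomposeLinearEquiv_apply]
  rw [DirectSum.decompose_of_mem C.gr hc, ← DirectSum.lof_eq_of k, DirectSum.toModule_lof]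
  rfl

variable {C} in
/-- To prove a linear identity on `C`, it suffices to prove it on homogeneous elements. -/
theorem linear_ext {V : Type*} [AddCommGroup V] [Module k V] {f g : C.carrier →ₗ[k] V}
    (h : ∀ (n : ℕ) (c : C.carrier), c ∈ C.gr n → f c = g c) : f = g := by
  ext c
  classical
  rw [← DirectSum.sum_support_decompose C.gr c, map_sum, map_sum]
  exact Finset.sum_congr rfl fun i _ => h i _ (SetLike.coe_mem _)

/-- The decomposition into homogeneous components. -/
noncomputable def components : Carrier C →ₐ[k] DirectSum ℕ fun n => gr C n :=
  lift C (A := DirectSum ℕ fun n => gr C n) (sGraded C) (sGraded_zero C)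

theorem components_s (c : C.carrier) : components C (s C c) = sGraded C c :=
  lift_s C (A := DirectSum ℕ fun n => gr C n) _ _ c

theorem components_monomial {n : ℕ} {x : Carrier C} (hx : IsMonomial C n x) :
    components C x = DirectSum.of (fun n => gr C n) n ⟨x, hx.mem⟩ := by
  induction hx with
  | one => rw [map_one]; rfl
  | mul hc hx ih =>
    rw [map_mul, components_s, sGraded_succ C _ hc, ih, DirectSum.of_mul_of]
    rfl

noncomputable instance : GradedAlgebra (gr C) :=
  GradedAlgebra.ofAlgHom (gr C) (components C)
    (by
      apply algHom_ext
      intro c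
      rw [AlgHom.comp_apply, components_s]
      refine LinearMap.congr_fun (f := (DirectSum.coeAlgHom (gr C)).toLinearMap ∘ₗ sGraded C)
        (g := s C) (linear_ext ?_) c
      intro n c hc
      cases n with
      | zero =>
        rw [LinearMap.comp_apply, sGraded_zero C c hc, s_zero C c hc, map_zero]
      | succ p =>
        rw [LinearMap.comp_apply, sGraded_succ C c hc]
        exact DirectSum.coeAlgHom_of _ _ _)
    (by
      rintro n ⟨x, hx⟩
      change components C x = _
      induction hx using Submodule.span_induction with
      | mem x hx => exact components_monomial C hx
      | zero => rw [map_zero]; exact (map_zero _).symm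
      | add x y hx hy ihx ihy =>
        rw [map_add, ihx, ihy, ← map_add]; rfl
      | smul a x hx ih =>
        rw [map_smul, ih, ← DirectSum.lof_eq_of k, ← map_smul]; rfl)

/-- The sign involution of the cobar construction, as an algebra automorphism. -/
noncomputable def sign : Carrier C →ₐ[k] Carrier C :=
  lift C (-(s C ∘ₗ signInvolution C.gr)) fun c hc => by
    simp [signInvolution_of_mem C.gr hc, s_zero C c hc]

theorem sign_s (c : C.carrier) : sign C (s C c) = -s C (signInvolution C.gr c) :=
  lift_s C _ _ c

theorem sign_of_mem {n : ℕ} {x : Carrier C} (hx : x ∈ gr C n) : sign C x = (-1 : ℤ) ^ n • x := by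
  induction hx using Submodule.span_induction with
  | mem x hx =>
    change IsMonomial C n x at hx
    induction hx with
    | one => simp
    | mul hc hx ih =>
      rw [map_mul, ih, sign_s, signInvolution_of_mem C.gr hc, pow_succ, pow_add, map_zsmul,
        mul_neg_one, neg_smul, neg_neg, smul_mul_smul_comm]
  | zero => simp
  | add x y hx hy ihx ihy => rw [map_add, ihx, ihy, smul_add]
  | smul a x hx ih => rw [map_smul, ih, smul_comm]

/-- The differential on generators: `s c ↦ - s (∂ c) + ∑ (-1) ^ (deg c') s c' ⊗ s c''`. The terms of
the coproduct of `c` with a factor of degree `0` do not contribute, so that only the reduced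
coproduct enters. -/
noncomputable def dGen : C.carrier →ₗ[k] Carrier C :=
  -(s C ∘ₗ C.d) + LinearMap.mul' k (Carrier C) ∘ₗ
    TensorProduct.map (s C ∘ₗ signInvolution C.gr) (s C) ∘ₗ Coalgebra.comul

/-- The homogeneous parts, shifted by `r`, with `0` in negative degrees. -/
noncomputable def shiftGr (r n : ℕ) : Submodule k (Carrier C) :=
  if r ≤ n then gr C (n - r) else ⊥

theorem shiftGr_congr {r n r' n' : ℕ} (h : r ≤ n ↔ r' ≤ n') (h' : n - r = n' - r') :
    shiftGr C r n = shiftGr C r' n' := by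
  unfold shiftGr; rw [h']; exact if_congr h rfl rfl

theorem s_mem_shiftGr {n : ℕ} {c : C.carrier} (hc : c ∈ C.gr n) : s C c ∈ shiftGr C 1 n := by
  cases n with
  | zero => rw [s_zero C c hc]; exact Submodule.zero_mem _
  | succ p => rw [shiftGr, if_pos (by omega)]; exact s_mem C hc

theorem mul_mem_shiftGr {a b m n : ℕ} {x y : Carrier C} (hx : x ∈ shiftGr C a m)
    (hy : y ∈ shiftGr C b n) : x * y ∈ shiftGr C (a + b) (m + n) := by
  unfold shiftGr at *
  split_ifs at hx hy with h1 h2 h2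
  · rw [if_pos (by omega), show m + n - (a + b) = (m - a) + (n - b) by omega]
    exact SetLike.mul_mem_graded hx hy
  · rw [(Submodule.mem_bot k).1 hy, mul_zero]; exact Submodule.zero_mem _
  · rw [(Submodule.mem_bot k).1 hx, zero_mul]; exact Submodule.zero_mem _
  · rw [(Submodule.mem_bot k).1 hx, zero_mul]; exact Submodule.zero_mem _

theorem dGen_mem {n : ℕ} {c : C.carrier} (hc : c ∈ C.gr n) : dGen C c ∈ shiftGr C 2 n := by
  simp only [dGen, LinearMap.add_apply, LinearMap.neg_apply, LinearMap.comp_apply]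
  refine Submodule.add_mem _ (Submodule.neg_mem _ ?_) ?_
  · cases n with
    | zero => rw [C.d_zero c hc, map_zero]; exact Submodule.zero_mem _
    | succ n =>
      rw [shiftGr_congr C (r' := 1) (n' := n) (by omega) (by omega)]
      exact s_mem_shiftGr C (C.d_mem n c hc)
  · have h := C.comul_mem n c hc
    suffices H : (⨆ (p : ℕ) (q : ℕ) (_ : p + q = n),
        LinearMap.range (TensorProduct.map (C.gr p).subtype (C.gr q).subtype)) ≤
        (shiftGr C 2 n).comap (LinearMap.mul' k (Carrier C) ∘ₗ
          TensorProduct.map (s C ∘ₗ signInvolution C.gr) (s C)) from H h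
    refine iSup_le fun p => iSup_le fun q => iSup_le fun hpq => ?_
    rintro _ ⟨t, rfl⟩
    rw [Submodule.mem_comap]
    induction t using TensorProduct.induction_on with
    | zero => rw [map_zero, map_zero]; exact Submodule.zero_mem _
    | add x y hx hy => rw [map_add, map_add]; exact Submodule.add_mem _ hx hy
    | tmul x y =>
      simp only [LinearMap.comp_apply, TensorProduct.map_tmul, LinearMap.mul'_apply,
        Submodule.subtype_apply]
      rw [← hpq, signInvolution_of_mem C.gr x.2]
      refine mul_mem_shiftGr C (s_mem_shiftGr C ?_) (s_mem_shiftGr C y.2)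
      exact zsmul_mem x.2 _

theorem dGen_zero (c : C.carrier) (hc : c ∈ C.gr 0) : dGen C c = 0 := by
  have := dGen_mem C hc
  rwa [shiftGr, if_neg (by omega), Submodule.mem_bot] at this

/-- The algebra map to upper triangular matrices that encodes the differential. -/
noncomputable def dMatrix : Carrier C →ₐ[k] Matrix (Fin 2) (Fin 2) (Carrier C) :=
  lift C
    { toFun := fun c => !![sign C (s C c), dGen C c; 0, s C c]
      map_add' := fun x y => by ext i j; fin_cases i <;> fin_cases j <;> simp
      map_smul' := fun a x => by ext i j; fin_cases i <;> fin_cases j <;> simp }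
    fun c hc => by
      ext i j; fin_cases i <;> fin_cases j <;> simp [s_zero C c hc, dGen_zero C c hc]

/-- The differential of the cobar construction: the (graded) derivation that extends `dGen`. -/
noncomputable def d : Carrier C →ₗ[k] Carrier C where
  toFun x := dMatrix C x 0 1
  map_add' x y := by simp
  map_smul' a x := by simp

theorem dMatrix_s (c : C.carrier) :
    dMatrix C (s C c) = !![sign C (s C c), dGen C c; 0, s C c] :=
  lift_s C _ _ c

/-- To prove that a subalgebra is everything, it suffices to check the elements `s c`. -/
theorem induction {P : Carrier C → Prop} (algebraMap : ∀ a : k, P (algebraMap k _ a))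
    (s : ∀ c, P (s C c)) (mul : ∀ x y, P x → P y → P (x * y))
    (add : ∀ x y, P x → P y → P (x + y)) (x : Carrier C) : P x := by
  induction x using TensorAlgebra.induction with
  | algebraMap a => exact algebraMap a
  | ι x => 
    obtain ⟨c, rfl⟩ := (C.gr 0).mkQ_surjective x
    exact s c
  | mul x y hx hy => exact mul x y hx hy
  | add x y hx hy => exact add x y hx hy

theorem dMatrix_apply (x : Carrier C) : dMatrix C x 0 0 = sign C x ∧ dMatrix C x 1 0 = 0 ∧
    dMatrix C x 1 1 = x := by
  induction x using induction with
  | algebraMap a => simp [Matrix.algebraMap_matrix_apply]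
  | s c => simp [dMatrix_s]
  | mul x y hx hy =>
    simp [Matrix.mul_apply, Fin.sum_univ_two, hx, hy]
  | add x y hx hy => simp [hx, hy]

theorem d_s (c : C.carrier) : d C (s C c) = dGen C c := by
  change dMatrix C (s C c) 0 1 = _
  rw [dMatrix_s]
  simp

theorem d_mul (x y : Carrier C) : d C (x * y) = d C x * y + sign C x * d C y := by
  change dMatrix C (x * y) 0 1 = dMatrix C x 0 1 * y + sign C x * dMatrix C y 0 1
  rw [map_mul, Matrix.mul_apply, Fin.sum_univ_two, (dMatrix_apply C x).1, (dMatrix_apply C y).2.2]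
  rw [add_comm]

theorem d_one : d C 1 = 0 := by
  change dMatrix C 1 0 1 = 0
  simp

theorem d_mem_shiftGr {n : ℕ} {x : Carrier C} (hx : x ∈ gr C n) : d C x ∈ shiftGr C 1 n := by
  induction hx using Submodule.span_induction with
  | mem x hx =>
    change IsMonomial C n x at hx
    induction hx with
    | one => rw [d_one]; exact Submodule.zero_mem _
    | mul hc hx ih =>
      rename_i p n c x
      rw [d_mul, d_s]
      refine Submodule.add_mem _ ?_ ?_
      · have := mul_mem_shiftGr C (dGen_mem C hc) (show x ∈ shiftGr C 0 n from hx.mem)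
        rwa [shiftGr_congr C (r' := 1) (n' := p + n) (by omega) (by omega)] at this
      · rw [sign_s, signInvolution_of_mem C.gr hc, map_zsmul]
        have := mul_mem_shiftGr C (show s C c ∈ shiftGr C 0 p from s_mem C hc) ih
        rw [zero_add] at this
        rw [← smul_neg, smul_mul_assoc, neg_mul]
        exact zsmul_mem (neg_mem this) _
  | zero => rw [map_zero]; exact Submodule.zero_mem _
  | add x y hx hy ihx ihy => rw [map_add]; exact Submodule.add_mem _ ihx ihy
  | smul a x hx ih => rw [map_smul]; exact Submodule.smul_mem _ _ ih

theorem sigma_sigma (c : C.carrier) : signInvolution C.gr (signInvolution C.gr c) = c := by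
  refine LinearMap.congr_fun (f := signInvolution C.gr ∘ₗ signInvolution C.gr) (g := .id)
    (linear_ext fun n c hc => ?_) c
  rw [LinearMap.comp_apply, signInvolution_of_mem C.gr hc, map_zsmul,
    signInvolution_of_mem C.gr hc, smul_smul, ← mul_pow]
  simp

theorem sigma_d (c : C.carrier) :
    signInvolution C.gr (C.d c) = -C.d (signInvolution C.gr c) := by
  refine LinearMap.congr_fun (f := signInvolution C.gr ∘ₗ C.d) (g := -(C.d ∘ₗ signInvolution C.gr))
    (linear_ext fun n c hc => ?_) c
  rw [LinearMap.neg_apply, LinearMap.comp_apply, LinearMap.comp_apply,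
    signInvolution_of_mem C.gr hc, map_zsmul]
  cases n with
  | zero => rw [C.d_zero c hc]; simp
  | succ n => rw [signInvolution_of_mem C.gr (C.d_mem n c hc), pow_succ]; simp

theorem comul_sigma (c : C.carrier) : Coalgebra.comul (R := k) (signInvolution C.gr c) =
    TensorProduct.map (signInvolution C.gr) (signInvolution C.gr) (Coalgebra.comul (R := k) c) := by
  refine LinearMap.congr_fun (f := Coalgebra.comul (R := k) ∘ₗ signInvolution C.gr)
    (g := TensorProduct.map (signInvolution C.gr) (signInvolution C.gr) ∘ₗ Coalgebra.comul (R := k))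
    (linear_ext fun n c hc => ?_) c
  rw [LinearMap.comp_apply, LinearMap.comp_apply, signInvolution_of_mem C.gr hc, map_zsmul]
  suffices H : (⨆ (p : ℕ) (q : ℕ) (_ : p + q = n),
      LinearMap.range (TensorProduct.map (C.gr p).subtype (C.gr q).subtype)) ≤
      LinearMap.eqLocus ((-1 : ℤ) ^ n • LinearMap.id)
        (TensorProduct.map (signInvolution C.gr) (signInvolution C.gr)) from H (C.comul_mem n c hc)
  refine iSup_le fun p => iSup_le fun q => iSup_le fun hpq => ?_
  rintro _ ⟨t, rfl⟩
  induction t using TensorProduct.induction_on with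
  | zero => rw [map_zero]; exact Submodule.zero_mem _
  | add x y hx hy => rw [map_add]; exact Submodule.add_mem _ hx hy
  | tmul x y =>
    rw [LinearMap.mem_eqLocus, LinearMap.smul_apply, LinearMap.id_apply, TensorProduct.map_tmul,
      TensorProduct.map_tmul, Submodule.subtype_apply, Submodule.subtype_apply,
      signInvolution_of_mem C.gr x.2, signInvolution_of_mem C.gr y.2, ← hpq, pow_add]
    simp only [← Int.cast_smul_eq_zsmul k, TensorProduct.smul_tmul_smul, Int.cast_mul]

theorem sign_sign (x : Carrier C) : sign C (sign C x) = x := by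
  induction x using induction with
  | algebraMap a => simp
  | s c => rw [sign_s, map_neg, sign_s, neg_neg, sigma_sigma]
  | mul x y hx hy => rw [map_mul, map_mul, hx, hy]
  | add x y hx hy => rw [map_add, map_add, hx, hy]

theorem d_algebraMap (a : k) : d C (algebraMap k _ a) = 0 := by
  rw [Algebra.algebraMap_eq_smul_one, map_smul, d_one, smul_zero]

theorem sign_mul' (t : TensorProduct k (Carrier C) (Carrier C)) :
    sign C (LinearMap.mul' k _ t) = LinearMap.mul' k _
      (TensorProduct.map (sign C).toLinearMap (sign C).toLinearMap t) := by
  induction t using TensorProduct.induction_on with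
  | zero => simp
  | add x y hx hy => simp only [map_add, hx, hy]
  | tmul x y => simp

theorem sign_dGen (c : C.carrier) : sign C (dGen C c) = dGen C (signInvolution C.gr c) := by
  simp only [dGen, LinearMap.add_apply, LinearMap.neg_apply, LinearMap.comp_apply, map_add, map_neg,
    sign_s, sigma_d, comul_sigma, sign_mul']
  congr 1
  · simp
  · congr 1
    generalize Coalgebra.comul (R := k) c = t
    induction t using TensorProduct.induction_on with
    | zero => simp
    | add x y hx hy => simp only [map_add, hx, hy]
    | tmul x y => simp [sign_s, TensorProduct.neg_tmul, TensorProduct.tmul_neg]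

theorem sign_d (x : Carrier C) : sign C (d C x) = - d C (sign C x) := by
  induction x using induction with
  | algebraMap a => simp [d_algebraMap]
  | s c => rw [d_s, sign_s, map_neg, d_s, neg_neg, sign_dGen]
  | mul x y hx hy =>
    rw [d_mul, map_add, map_mul, map_mul, map_mul, d_mul, hx, hy]
    simp only [neg_mul, mul_neg, neg_add]
  | add x y hx hy => rw [map_add, map_add, map_add, map_add, hx, hy, neg_add]

/-- The cubic term of the square of the differential. -/
theorem cubic (c : C.carrier) :
    LinearMap.mul' k _ (TensorProduct.map (LinearMap.mul' k (Carrier C) ∘ₗ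
      TensorProduct.map (s C) (s C ∘ₗ signInvolution C.gr) ∘ₗ Coalgebra.comul) (s C)
        (Coalgebra.comul (R := k) c)) =
    LinearMap.mul' k _ (TensorProduct.map (s C) (LinearMap.mul' k (Carrier C) ∘ₗ
      TensorProduct.map (s C ∘ₗ signInvolution C.gr) (s C) ∘ₗ Coalgebra.comul)
        (Coalgebra.comul (R := k) c)) := by
  have key : LinearMap.mul' k _ ∘ₗ TensorProduct.map (LinearMap.mul' k (Carrier C) ∘ₗ
      TensorProduct.map (s C) (s C ∘ₗ signInvolution C.gr)) (s C) =
    LinearMap.mul' k _ ∘ₗ TensorProduct.map (s C) (LinearMap.mul' k (Carrier C) ∘ₗ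
      TensorProduct.map (s C ∘ₗ signInvolution C.gr) (s C)) ∘ₗ
      (TensorProduct.assoc k C.carrier C.carrier C.carrier).toLinearMap := by
    apply TensorProduct.ext_threefold
    intro x y z
    simp [mul_assoc]
  have h := LinearMap.congr_fun key (Coalgebra.comul.rTensor C.carrier (Coalgebra.comul (R := k) c))
  simp only [LinearMap.comp_apply, LinearEquiv.coe_coe, Coalgebra.coassoc_apply] at h
  convert h using 2
  · rw [← LinearMap.comp_apply (g := LinearMap.rTensor _ _), LinearMap.map_comp_rTensor]; rfl
  · rw [← LinearMap.comp_apply (g := LinearMap.lTensor _ _), LinearMap.map_comp_lTensor]; rfl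

theorem d_dGen (c : C.carrier) : d C (dGen C c) = 0 := by
  have h1 : dGen C (C.d c) = LinearMap.mul' k _ (TensorProduct.map
      (s C ∘ₗ signInvolution C.gr ∘ₗ C.d) (s C) (Coalgebra.comul (R := k) c)) +
      LinearMap.mul' k _ (TensorProduct.map (s C) (s C ∘ₗ C.d) (Coalgebra.comul (R := k) c)) := by
    simp only [dGen, LinearMap.add_apply, LinearMap.neg_apply, LinearMap.comp_apply, C.d_d, map_zero,
      neg_zero, zero_add, C.comul_d, map_add]
    generalize Coalgebra.comul (R := k) c = t
    induction t using TensorProduct.induction_on with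
    | zero => simp
    | add x y hx hy =>
      simp only [map_add]
      rw [add_add_add_comm, hx, hy, add_add_add_comm]
    | tmul x y => simp [sigma_sigma]
  have h2 : d C (LinearMap.mul' k _ (TensorProduct.map (s C ∘ₗ signInvolution C.gr) (s C)
      (Coalgebra.comul (R := k) c))) =
      LinearMap.mul' k _ (TensorProduct.map (s C ∘ₗ signInvolution C.gr ∘ₗ C.d) (s C)
        (Coalgebra.comul (R := k) c)) +
      LinearMap.mul' k _ (TensorProduct.map (LinearMap.mul' k (Carrier C) ∘ₗ
        TensorProduct.map (s C) (s C ∘ₗ signInvolution C.gr) ∘ₗ Coalgebra.comul) (s C)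
          (Coalgebra.comul (R := k) c)) +
      LinearMap.mul' k _ (TensorProduct.map (s C) (s C ∘ₗ C.d) (Coalgebra.comul (R := k) c)) -
      LinearMap.mul' k _ (TensorProduct.map (s C) (LinearMap.mul' k (Carrier C) ∘ₗ
        TensorProduct.map (s C ∘ₗ signInvolution C.gr) (s C) ∘ₗ Coalgebra.comul)
          (Coalgebra.comul (R := k) c)) := by
    have h3 (x : C.carrier) : TensorProduct.map (s C ∘ₗ signInvolution C.gr) (s C)
        (TensorProduct.map (signInvolution C.gr) (signInvolution C.gr)
          (Coalgebra.comul (R := k) x)) =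
        TensorProduct.map (s C) (s C ∘ₗ signInvolution C.gr) (Coalgebra.comul (R := k) x) := by
      generalize Coalgebra.comul (R := k) x = t
      induction t using TensorProduct.induction_on with
      | zero => simp
      | add x y hx hy => simp only [map_add, hx, hy]
      | tmul x y => simp [sigma_sigma]
    generalize Coalgebra.comul (R := k) c = t
    induction t using TensorProduct.induction_on with
    | zero => simp
    | add x y hx hy => simp only [map_add, hx, hy]; abel
    | tmul x y =>
      simp only [TensorProduct.map_tmul, LinearMap.comp_apply, LinearMap.mul'_apply, d_mul, d_s,
        sign_s, sigma_sigma]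
      simp only [dGen, LinearMap.add_apply, LinearMap.neg_apply, LinearMap.comp_apply, comul_sigma,
        h3, sigma_d, map_neg]
      noncomm_ring
  have h4 : d C (dGen C c) = -d C (s C (C.d c)) + d C (LinearMap.mul' k _
      (TensorProduct.map (s C ∘ₗ signInvolution C.gr) (s C) (Coalgebra.comul (R := k) c))) := by
    rw [← map_neg, ← map_add]; rfl
  rw [h4, d_s, h1, h2, cubic]
  abel

theorem d_d (x : Carrier C) : d C (d C x) = 0 := by
  induction x using induction with
  | algebraMap a => rw [d_algebraMap, map_zero]
  | s c => rw [d_s, d_dGen]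
  | mul x y hx hy =>
    rw [d_mul, map_add, d_mul, d_mul, hx, hy, sign_d, sign_sign]
    simp
  | add x y hx hy => rw [map_add, map_add, hx, hy, add_zero]

end Cobar

/-- The cobar construction of a connected differential graded coalgebra. -/
noncomputable def cobarObj {k : Type v} [CommRing k] (C : ConnDGCoalg.{v, w} k) :
    DGAlg.{v, max v w} k where
  carrier := Cobar.Carrier C
  gr := Cobar.gr C
  d := Cobar.d C
  d_mem n x hx := Cobar.d_mem_shiftGr C hx
  d_zero x hx := by
    have := Cobar.d_mem_shiftGr C hx
    rwa [Cobar.shiftGr, if_neg (by omega), Submodule.mem_bot] at this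
  d_d := Cobar.d_d C
  leibniz n a b ha := by rw [Cobar.d_mul, Cobar.sign_of_mem C ha, smul_mul_assoc]

namespace Cobar

variable {k : Type v} [CommRing k] {C D : ConnDGCoalg.{v, w} k}

/-- The algebra map induced by a map of coalgebras: `s c ↦ s (f c)`. -/
noncomputable def map (f : C ⟶ D) : Carrier C →ₐ[k] Carrier D :=
  lift C (s D ∘ₗ f.toCoalgHom.toLinearMap) fun c hc => s_zero D _ (f.map_gr 0 c hc)

theorem map_s (f : C ⟶ D) (c : C.carrier) : map f (s C c) = s D (f.toCoalgHom c) :=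
  lift_s C _ _ c

theorem map_sigma (f : C ⟶ D) (c : C.carrier) :
    f.toCoalgHom (signInvolution C.gr c) = signInvolution D.gr (f.toCoalgHom c) := by
  refine LinearMap.congr_fun (f := f.toCoalgHom.toLinearMap ∘ₗ signInvolution C.gr)
    (g := signInvolution D.gr ∘ₗ f.toCoalgHom.toLinearMap) (linear_ext fun n c hc => ?_) c
  rw [LinearMap.comp_apply, LinearMap.comp_apply, signInvolution_of_mem C.gr hc, map_zsmul]
  exact (signInvolution_of_mem D.gr (f.map_gr n c hc)).symm

theorem map_sign (f : C ⟶ D) (x : Carrier C) : map f (sign C x) = sign D (map f x) := by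
  induction x using induction with
  | algebraMap a => simp
  | s c => rw [sign_s, map_neg, map_s, map_s, sign_s, map_sigma]
  | mul x y hx hy => simp only [map_mul, hx, hy]
  | add x y hx hy => simp only [map_add, hx, hy]

theorem map_dGen (f : C ⟶ D) (c : C.carrier) : map f (dGen C c) = dGen D (f.toCoalgHom c) := by
  simp only [dGen, LinearMap.add_apply, LinearMap.neg_apply, LinearMap.comp_apply, map_add, map_neg,
    map_s, f.map_d, ← CoalgHomClass.map_comp_comul_apply]
  congr 1
  generalize Coalgebra.comul (R := k) c = t
  induction t using TensorProduct.induction_on with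
  | zero => simp
  | add x y hx hy => simp only [map_add, hx, hy]
  | tmul x y => simp [map_s, map_sigma]

theorem map_d (f : C ⟶ D) (x : Carrier C) : map f (d C x) = d D (map f x) := by
  induction x using induction with
  | algebraMap a => rw [d_algebraMap, map_zero, AlgHom.commutes, d_algebraMap]
  | s c => rw [d_s, map_s, d_s, map_dGen]
  | mul x y hx hy => rw [d_mul, map_add, map_mul, map_mul, map_mul, d_mul, hx, hy, map_sign]
  | add x y hx hy => simp only [map_add, hx, hy]

theorem map_mem (f : C ⟶ D) {n : ℕ} {x : Carrier C} (hx : x ∈ gr C n) : map f x ∈ gr D n := by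
  induction hx using Submodule.span_induction with
  | mem x hx =>
    change IsMonomial C n x at hx
    induction hx with
    | one => rw [map_one]; exact IsMonomial.mem .one
    | mul hc _ ih => rw [map_mul, map_s]; exact SetLike.mul_mem_graded (s_mem D (f.map_gr _ _ hc)) ih
  | zero => rw [map_zero]; exact Submodule.zero_mem _
  | add x y hx hy ihx ihy => rw [map_add]; exact Submodule.add_mem _ ihx ihy
  | smul a x hx ih => rw [map_smul]; exact Submodule.smul_mem _ _ ih

end Cobar

/-- The cobar construction, as a functor. -/
noncomputable def cobar (k : Type v) [CommRing k] :
    ConnDGCoalg.{v, w} k ⥤ DGAlg.{v, max v w} k where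
  obj C := cobarObj C
  map f := ⟨Cobar.map f, fun _ _ h => Cobar.map_mem f h, Cobar.map_d f⟩
  map_id C := DGAlg.Hom.ext (Cobar.algHom_ext C fun c => Cobar.map_s _ c)
  map_comp {C _ _} f g := DGAlg.Hom.ext (Cobar.algHom_ext C fun c =>
    (Cobar.map_s _ c).trans (((congrArg (Cobar.map g) (Cobar.map_s f c)).trans
      (Cobar.map_s g _)).symm))

/-! ### Normalized chains of a simplicial set -/

/-- The submodule of the free module on all simplices that is spanned by the degenerate ones. -/
noncomputable def degenerateChains (k : Type v) [CommRing k] (X : SSet.{u}) :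
    Submodule k ((Σ n : ℕ, X.obj (op ⦋n⦌)) →₀ k) :=
  Submodule.span k {c | ∃ (n : ℕ) (x : X.obj (op ⦋n⦌)), x ∈ X.degenerate n ∧
    c = Finsupp.single ⟨n, x⟩ 1}

/-- The normalized chains of a simplicial set, as an ungraded module: the free module on all
simplices, modulo the degenerate ones. -/
def NChains (k : Type v) [CommRing k] (X : SSet.{u}) : Type (max u v) :=
  ((Σ n : ℕ, X.obj (op ⦋n⦌)) →₀ k) ⧸ degenerateChains k X

namespace NChains

variable (k : Type v) [CommRing k] {X Y Z : SSet.{u}}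

noncomputable instance : AddCommGroup (NChains k X) :=
  inferInstanceAs (AddCommGroup (((Σ n : ℕ, X.obj (op ⦋n⦌)) →₀ k) ⧸ degenerateChains k X))

noncomputable instance : Module k (NChains k X) :=
  inferInstanceAs (Module k (((Σ n : ℕ, X.obj (op ⦋n⦌)) →₀ k) ⧸ degenerateChains k X))

/-- The class of a simplex. -/
noncomputable def cls {n : ℕ} (x : X.obj (op ⦋n⦌)) : NChains k X :=
  (degenerateChains k X).mkQ (Finsupp.single ⟨n, x⟩ 1)

theorem cls_degenerate {n : ℕ} (x : X.obj (op ⦋n⦌)) (hx : x ∈ X.degenerate n) : cls k x = 0 :=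
  (Submodule.Quotient.mk_eq_zero _).2 (Submodule.subset_span ⟨n, x, hx, rfl⟩)

theorem cls_σ {n : ℕ} (i : Fin (n + 1)) (y : X.obj (op ⦋n⦌)) :
    cls k (X.map (SimplexCategory.σ i).op y) = 0 :=
  cls_degenerate k _ (X.σ_mem_degenerate i y)

theorem map_comp {a b c : SimplexCategory} (f : a ⟶ b) (g : b ⟶ c) (x : X.obj (op c)) :
    X.map f.op (X.map g.op x) = X.map (f ≫ g).op x := by
  rw [op_comp, Functor.map_comp_apply]

/-- A simplex that repeats a vertex for formal reasons vanishes. -/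
theorem cls_map {n : ℕ} {m : SimplexCategory} (f : ⦋n⦌ ⟶ m) (x : X.obj (op m)) (t : Fin n)
    (ht : f.toOrderHom t.castSucc = f.toOrderHom t.succ) : cls k (X.map f.op x) = 0 := by
  obtain _ | n := n
  · exact t.elim0
  · obtain ⟨g, rfl⟩ := SimplexCategory.eq_σ_comp_of_not_injective' f t ht
    rw [← map_comp, cls_σ]

variable {k}

theorem degenerateChains_le {V : Type*} [AddCommGroup V] [Module k V]
    (f : ∀ n : ℕ, X.obj (op ⦋n⦌) → V)
    (hf : ∀ (n : ℕ) (i : Fin (n + 1)) (y : X.obj (op ⦋n⦌)),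
      f (n + 1) (X.map (SimplexCategory.σ i).op y) = 0) : degenerateChains k X ≤
    LinearMap.ker (Finsupp.linearCombination k fun x : Σ n : ℕ, X.obj (op ⦋n⦌) => f x.1 x.2) := by
  refine Submodule.span_le.2 ?_
  rintro _ ⟨n, x, hx, rfl⟩
  rw [SetLike.mem_coe, LinearMap.mem_ker, Finsupp.linearCombination_single, one_smul]
  cases n with
  | zero => rw [SSet.degenerate_zero] at hx; exact hx.elim
  | succ n =>
    rw [SSet.degenerate_eq_iUnion_range_σ] at hx
    obtain ⟨i, y, rfl⟩ := Set.mem_iUnion.1 hx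
    exact hf n i y

/-- The linear map with prescribed values on simplices. -/
noncomputable def lift {V : Type*} [AddCommGroup V] [Module k V]
    (f : ∀ n : ℕ, X.obj (op ⦋n⦌) → V)
    (hf : ∀ (n : ℕ) (i : Fin (n + 1)) (y : X.obj (op ⦋n⦌)),
      f (n + 1) (X.map (SimplexCategory.σ i).op y) = 0) : NChains k X →ₗ[k] V :=
  (degenerateChains k X).liftQ (Finsupp.linearCombination k fun x => f x.1 x.2)
    (degenerateChains_le f hf)

theorem lift_cls {V : Type*} [AddCommGroup V] [Module k V]
    (f : ∀ n : ℕ, X.obj (op ⦋n⦌) → V)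
    (hf : ∀ (n : ℕ) (i : Fin (n + 1)) (y : X.obj (op ⦋n⦌)),
      f (n + 1) (X.map (SimplexCategory.σ i).op y) = 0) {n : ℕ} (x : X.obj (op ⦋n⦌)) :
    lift f hf (cls k x) = f n x :=
  (Submodule.liftQ_apply (degenerateChains k X) (Finsupp.linearCombination k
    fun x : Σ n : ℕ, X.obj (op ⦋n⦌) => f x.1 x.2) (h := degenerateChains_le f hf)
      (Finsupp.single ⟨n, x⟩ 1)).trans
    ((Finsupp.linearCombination_single _ _ _).trans (one_smul _ _))

/-- Linear maps that agree on all simplices are equal. -/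
theorem hom_ext {V : Type*} [AddCommGroup V] [Module k V] {f g : NChains k X →ₗ[k] V}
    (h : ∀ (n : ℕ) (x : X.obj (op ⦋n⦌)), f (cls k x) = g (cls k x)) : f = g := by
  refine Submodule.linearMap_qext (R := k) (degenerateChains k X)
    (Finsupp.lhom_ext' fun x => LinearMap.ext_ring (h x.1 x.2))

variable (k X)

/-- The normalized `n`-chains. -/
noncomputable def gr (n : ℕ) : Submodule k (NChains k X) :=
  Submodule.span k (Set.range fun x : X.obj (op ⦋n⦌) => cls k x)

variable {X}

theorem cls_mem {n : ℕ} (x : X.obj (op ⦋n⦌)) : cls k x ∈ gr k X n :=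
  Submodule.subset_span ⟨x, rfl⟩

variable {k} in
/-- To prove that a linear map sends `n`-chains to a submodule, it suffices to consider simplices. -/
theorem map_gr {V : Type*} [AddCommGroup V] [Module k V] (f : NChains k X →ₗ[k] V) (n : ℕ)
    (W : Submodule k V) (h : ∀ x : X.obj (op ⦋n⦌), f (cls k x) ∈ W) (c : NChains k X)
    (hc : c ∈ gr k X n) : f c ∈ W := by
  have : gr k X n ≤ W.comap f := Submodule.span_le.2 (by rintro _ ⟨x, rfl⟩; exact h x)
  exact this hc

noncomputable instance : DirectSum.Decomposition (gr k X) :=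
  DirectSum.Decomposition.ofLinearMap (gr k X)
    (lift (fun n x => DirectSum.lof k ℕ (fun n => gr k X n) n ⟨cls k x, cls_mem k x⟩)
      fun n i y => by
        rw [show (⟨cls k (X.map (SimplexCategory.σ i).op y), cls_mem k _⟩ : gr k X (n + 1)) = 0 from
          Subtype.ext (cls_σ k i y), map_zero])
    (hom_ext fun n x => by
      rw [LinearMap.comp_apply, lift_cls, DirectSum.coeLinearMap_lof]; rfl)
    (by
      refine DirectSum.linearMap_ext k fun n => LinearMap.ext fun c => ?_
      rw [LinearMap.comp_apply, LinearMap.comp_apply, DirectSum.coeLinearMap_lof]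
      obtain ⟨c, hc⟩ := c
      change _ = DirectSum.lof k ℕ (fun n => gr k X n) n ⟨c, hc⟩
      unfold gr at hc
      induction hc using Submodule.span_induction with
      | mem c hc => obtain ⟨x, rfl⟩ := hc; exact lift_cls _ _ x
      | zero => exact (map_zero _).trans (map_zero _).symm
      | add x y hx hy ihx ihy =>
        exact (map_add _ x y).trans ((congrArg₂ _ ihx ihy).trans (map_add _ _ _).symm)
      | smul a x hx ih =>
        exact (map_smul _ a x).trans ((congrArg _ ih).trans (map_smul _ _ _).symm))

/-- The boundary of a simplex. -/
noncomputable def bd : ∀ n : ℕ, X.obj (op ⦋n⦌) → NChains k X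
  | 0, _ => 0
  | n + 1, x => ∑ i : Fin (n + 2), (-1 : ℤ) ^ (i : ℕ) • cls k (X.map (SimplexCategory.δ i).op x)

theorem bd_σ (n : ℕ) (i : Fin (n + 1)) (y : X.obj (op ⦋n⦌)) :
    bd k (n + 1) (X.map (SimplexCategory.σ i).op y) = 0 := by
  rw [bd, ← Finset.sum_subset (Finset.subset_univ {i.castSucc, i.succ}),
    Finset.sum_pair (Fin.castSucc_lt_succ).ne]
  · simp only [map_comp, SimplexCategory.δ_comp_σ_self, SimplexCategory.δ_comp_σ_succ]
    simp [pow_succ]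
  · intro j _ hj
    simp only [Finset.mem_insert, Finset.mem_singleton, not_or] at hj
    obtain _ | n := n
    · obtain rfl : i = 0 := Subsingleton.elim (α := Fin 1) _ _
      fin_cases j <;> simp at hj
    rw [map_comp]
    rcases lt_or_gt_of_ne hj.1 with h | h
    · have h' : j ≤ i.castSucc := h.le
      obtain ⟨i, rfl⟩ : ∃ i', i = Fin.succ i' := 
        ⟨i.pred (by rintro rfl; simp at h), (Fin.succ_pred _ _).symm⟩
      obtain ⟨j, rfl⟩ : ∃ j', j = Fin.castSucc j' := ⟨j.castPred (by
        rintro rfl; exact absurd h (not_lt.2 (Fin.le_last _))), (Fin.castSucc_castPred _ _).symm⟩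
      rw [SimplexCategory.δ_comp_σ_of_le (by
        rw [Fin.lt_def] at h; rw [Fin.le_def]; simp at h ⊢; omega), ← map_comp, cls_σ, smul_zero]
    · have h' : i.succ < j := lt_of_le_of_ne (Fin.castSucc_lt_iff_succ_le.1 h) (Ne.symm hj.2)
      obtain ⟨j, rfl⟩ : ∃ j', j = Fin.succ j' := 
        ⟨j.pred (by rintro rfl; simp at h), (Fin.succ_pred _ _).symm⟩
      obtain ⟨i, rfl⟩ : ∃ i', i = Fin.castSucc i' := ⟨i.castPred (by
        rintro rfl; rw [Fin.succ_last] at h'; exact absurd h' (not_lt.2 (Fin.le_last _))),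
        (Fin.castSucc_castPred _ _).symm⟩
      rw [SimplexCategory.δ_comp_σ_of_gt (by
        rw [Fin.lt_def] at h' ⊢; simp at h' ⊢; omega), ← map_comp, cls_σ, smul_zero]

/-- The differential of the normalized chains. -/
noncomputable def d : NChains k X →ₗ[k] NChains k X :=
  lift (bd k) (bd_σ k)

theorem d_cls {n : ℕ} (x : X.obj (op ⦋n⦌)) : d k (cls k x) = bd k n x :=
  lift_cls _ _ x

theorem d_cls_zero (x : X.obj (op ⦋0⦌)) : d k (cls k x) = 0 :=
  d_cls k x

theorem d_cls_succ {n : ℕ} (x : X.obj (op ⦋n + 1⦌)) : d k (cls k x) =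
    ∑ i : Fin (n + 2), (-1 : ℤ) ^ (i : ℕ) • cls k (X.map (SimplexCategory.δ i).op x) :=
  d_cls k x

/-- The alternating double sum over iterated faces vanishes. -/
theorem sum_faces {V : Type*} [AddCommGroup V] (n : ℕ) (F : (⦋n⦌ ⟶ ⦋n + 2⦌) → V) :
    ∑ j : Fin (n + 3), ∑ i : Fin (n + 2), ((-1 : ℤ) ^ (j : ℕ) * (-1 : ℤ) ^ (i : ℕ)) •
      F (SimplexCategory.δ i ≫ SimplexCategory.δ j) = 0 := by
  rw [Finset.sum_comm, ← Finset.sum_product',  Finset.univ_product_univ,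
    ← Finset.sum_add_sum_compl ({ij | (ij.2 : ℕ) ≤ (ij.1 : ℕ)} : Finset _),
    ← eq_neg_iff_add_eq_zero, ← Finset.sum_neg_distrib]
  refine Finset.sum_bij (fun ij hij => (Fin.castLT ij.2
    (lt_of_le_of_lt (Finset.mem_filter.mp hij).right (Fin.is_lt ij.1)), ij.1.succ)) ?_ ?_ ?_ ?_
  · intro ij hij
    simp_rw [Finset.compl_filter, Finset.mem_filter_univ, Fin.val_succ, Fin.val_castLT] at hij ⊢
    omega
  · rintro ⟨i, j⟩ hij ⟨i', j'⟩ hij' h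
    rw [Prod.mk_inj] at h ⊢
    exact ⟨by simpa using h.2, by simpa using congrArg Fin.castSucc h.1⟩
  · rintro ⟨i', j'⟩ hij'
    simp_rw [Finset.compl_filter, Finset.mem_filter_univ, not_le] at hij'
    refine ⟨(j'.pred ?_, Fin.castSucc i'), ?_, ?_⟩
    · rintro rfl
      simp only [Fin.val_zero, not_lt_zero] at hij'
    · simpa using Nat.le_sub_one_of_lt hij'
    · simp only [Fin.castLT_castSucc, Fin.succ_pred]
  · rintro ⟨i, j⟩ hij
    simp only [Finset.mem_filter_univ] at hij
    dsimp only
    rw [← neg_smul]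
    congr 1
    · simp [pow_succ, mul_comm]
    · rw [SimplexCategory.δ_comp_δ'' (by rwa [Fin.le_def])]

theorem d_d (c : NChains k X) : d k (d k c) = 0 := by
  refine LinearMap.congr_fun (f := d k ∘ₗ d k) (g := 0) (hom_ext fun n x => ?_) c
  rw [LinearMap.comp_apply, LinearMap.zero_apply]
  match n, x with
  | 0, x => rw [d_cls_zero, map_zero]
  | 1, x => rw [d_cls_succ, map_sum]; simp [d_cls_zero]
  | n + 2, x =>
    simp only [d_cls_succ, map_sum, map_zsmul, map_comp, Finset.smul_sum, smul_smul]
    exact sum_faces n fun f => cls k (X.map f.op x)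

theorem d_mem (n : ℕ) (c : NChains k X) (hc : c ∈ gr k X (n + 1)) : d k c ∈ gr k X n :=
  map_gr (d k) _ _ (fun x => by
    rw [d_cls_succ]; exact sum_mem fun i _ => zsmul_mem (cls_mem k _) _) c hc

theorem d_zero (c : NChains k X) (hc : c ∈ gr k X 0) : d k c = 0 :=
  map_gr (d k) _ ⊥ (fun x => d_cls_zero k x) c hc

/-! ### Functoriality -/

variable {k} in
/-- The map on normalized chains induced by a map of simplicial sets. -/
noncomputable def map (f : X ⟶ Y) : NChains k X →ₗ[k] NChains k Y :=
  lift (fun n x => cls k (f.app (op ⦋n⦌) x)) fun n i y => by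
    rw [NatTrans.naturality_apply, cls_σ]

theorem map_cls (f : X ⟶ Y) {n : ℕ} (x : X.obj (op ⦋n⦌)) :
    map f (cls k x) = cls k (f.app (op ⦋n⦌) x) :=
  lift_cls _ _ x

theorem map_d (f : X ⟶ Y) (c : NChains k X) : map f (d k c) = d k (map f c) := by
  refine LinearMap.congr_fun (f := map f ∘ₗ d k) (g := d k ∘ₗ map f) (hom_ext fun n x => ?_) c
  rw [LinearMap.comp_apply, LinearMap.comp_apply, map_cls]
  cases n with
  | zero => rw [d_cls_zero, d_cls_zero, map_zero]
  | succ n => simp only [d_cls_succ, map_sum, map_zsmul, map_cls, NatTrans.naturality_apply]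

theorem map_mem (f : X ⟶ Y) (n : ℕ) (c : NChains k X) (hc : c ∈ gr k X n) :
    map f c ∈ gr k Y n :=
  map_gr (map f) _ _ (fun x => by rw [map_cls]; exact cls_mem k _) c hc

/-! ### The Alexander-Whitney coproduct -/

/-- The map `[b] → [n]` with `i ↦ a + i`. -/
def seg (n a b : ℕ) : ⦋b⦌ ⟶ ⦋n⦌ :=
  SimplexCategory.mkHom
    { toFun := fun i => ⟨min (a + i) n, by omega⟩
      monotone' := fun i j h => by
        rw [Fin.le_def] at h ⊢
        dsimp only
        omega }

theorem seg_val (n a b : ℕ) (i : Fin (b + 1)) :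
    ((seg n a b).toOrderHom i : ℕ) = min (a + i) n := rfl

theorem seg_seg (n a b c e : ℕ) (h : c + e ≤ b) : seg b c e ≫ seg n a b = seg n (a + c) e := by
  apply Shuffle.hom_ext
  intro i
  apply Fin.ext
  rw [Shuffle.comp_apply, seg_val, seg_val, seg_val]
  have : (i : ℕ) < e + 1 := i.2
  omega

theorem seg_self (n : ℕ) : seg n 0 n = 𝟙 _ := by
  apply Shuffle.hom_ext
  intro i
  apply Fin.ext
  have : (i : ℕ) < n + 1 := i.2
  rw [seg_val]
  change _ = (i : ℕ)
  omega

end NChains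

namespace NChains

variable (k : Type v) [CommRing k] {X Y Z : SSet.{u}}

/-- The Alexander-Whitney coproduct of a simplex `x` of dimension `n`: the sum over `p + q = n` of
the front `p`-face of `x` tensor the back `q`-face of `x`. -/
noncomputable def alexanderWhitney (n : ℕ) (x : X.obj (op ⦋n⦌)) :
    TensorProduct k (NChains k X) (NChains k X) :=
  ∑ pq ∈ Finset.HasAntidiagonal.antidiagonal n, TensorProduct.tmul k
    (cls k (X.map (seg n 0 pq.1).op x)) (cls k (X.map (seg n pq.1 pq.2).op x))

/-- The coproduct. -/
noncomputable def comul : NChains k X →ₗ[k] TensorProduct k (NChains k X) (NChains k X) :=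
  lift (alexanderWhitney k) fun n i y => by
    refine Finset.sum_eq_zero fun pq hpq => ?_
    rw [Finset.HasAntidiagonal.mem_antidiagonal] at hpq
    simp only [map_comp]
    have hs : (SimplexCategory.σ i).toOrderHom i.castSucc =
        (SimplexCategory.σ i).toOrderHom i.succ := by
      change Fin.predAbove _ _ = Fin.predAbove _ _
      simp
    have hi : (i : ℕ) < n + 1 := i.2
    by_cases h : (i : ℕ) < pq.1
    · rw [cls_map k (seg (n + 1) 0 pq.1 ≫ SimplexCategory.σ i) y ⟨i, h⟩, TensorProduct.zero_tmul]
      rw [Shuffle.comp_apply, Shuffle.comp_apply]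
      convert hs using 2 <;> apply Fin.ext <;> rw [seg_val] <;> simp <;> omega
    · rw [cls_map k (seg (n + 1) pq.1 pq.2 ≫ SimplexCategory.σ i) y ⟨i - pq.1, by omega⟩,
        TensorProduct.tmul_zero]
      rw [Shuffle.comp_apply, Shuffle.comp_apply]
      convert hs using 2 <;> apply Fin.ext <;> rw [seg_val] <;> simp <;> omega

theorem comul_cls {n : ℕ} (x : X.obj (op ⦋n⦌)) : comul k (cls k x) =
    ∑ pq ∈ Finset.HasAntidiagonal.antidiagonal n, TensorProduct.tmul k
      (cls k (X.map (seg n 0 pq.1).op x)) (cls k (X.map (seg n pq.1 pq.2).op x)) :=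
  lift_cls _ _ x

/-- The counit: every vertex is sent to `1`. -/
noncomputable def counit : NChains k X →ₗ[k] k :=
  lift (fun n _ => if n = 0 then 1 else 0) fun _ _ _ => rfl

theorem counit_cls {n : ℕ} (x : X.obj (op ⦋n⦌)) : counit k (cls k x) = if n = 0 then 1 else 0 :=
  lift_cls _ _ x

noncomputable instance : CoalgebraStruct k (NChains k X) where
  comul := comul k
  counit := counit k

noncomputable instance : Coalgebra k (NChains k X) where
  coassoc := hom_ext fun n x => by
    change TensorProduct.assoc k _ _ _ ((comul k).rTensor _ (comul k (cls k x))) =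
      (comul k).lTensor _ (comul k (cls k x))
    simp only [comul_cls, map_sum, LinearMap.rTensor_tmul, LinearMap.lTensor_tmul, map_comp,
      TensorProduct.sum_tmul, TensorProduct.tmul_sum, TensorProduct.assoc_tmul]
    rw [Finset.sum_sigma', Finset.sum_sigma']
    refine Finset.sum_nbij' (fun t => ⟨(t.2.1, t.2.2 + t.1.2), (t.2.2, t.1.2)⟩)
      (fun t => ⟨(t.1.1 + t.2.1, t.2.2), (t.1.1, t.2.1)⟩) ?_ ?_ ?_ ?_ ?_
    · rintro ⟨⟨p, q⟩, a, b⟩ h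
      simp only [Finset.mem_sigma, Finset.HasAntidiagonal.mem_antidiagonal, and_true] at h ⊢
      omega
    · rintro ⟨⟨p, q⟩, a, b⟩ h
      simp only [Finset.mem_sigma, Finset.HasAntidiagonal.mem_antidiagonal, and_true] at h ⊢
      omega
    · rintro ⟨⟨p, q⟩, a, b⟩ h
      simp only [Finset.mem_sigma, Finset.HasAntidiagonal.mem_antidiagonal] at h
      obtain ⟨-, rfl⟩ := h
      rfl
    · rintro ⟨⟨p, q⟩, a, b⟩ h
      simp only [Finset.mem_sigma, Finset.HasAntidiagonal.mem_antidiagonal] at h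
      obtain ⟨-, rfl⟩ := h
      rfl
    · rintro ⟨⟨p, q⟩, a, b⟩ h
      simp only [Finset.mem_sigma, Finset.HasAntidiagonal.mem_antidiagonal] at h
      obtain ⟨rfl, rfl⟩ := h
      dsimp only
      rw [seg_seg _ _ _ _ _ (by omega), seg_seg _ _ _ _ _ (by omega),
        seg_seg _ _ _ _ _ (by omega), seg_seg _ _ _ _ _ (by omega)]
      simp only [zero_add, add_zero]
  rTensor_counit_comp_comul := hom_ext fun n x => by
    change (counit k).rTensor _ (comul k (cls k x)) = TensorProduct.tmul k 1 (cls k x)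
    simp only [comul_cls, map_sum, LinearMap.rTensor_tmul, counit_cls]
    rw [Finset.sum_eq_single (0, n)]
    · rw [if_pos rfl, seg_self, op_id, X.map_id]; rfl
    · rintro ⟨p, q⟩ h hp
      rw [Finset.HasAntidiagonal.mem_antidiagonal] at h
      rw [if_neg, TensorProduct.zero_tmul]
      rintro rfl
      exact hp (by simpa using h)
    · intro h; simp at h
  lTensor_counit_comp_comul := hom_ext fun n x => by
    change (counit k).lTensor _ (comul k (cls k x)) = TensorProduct.tmul k (cls k x) 1
    simp only [comul_cls, map_sum, LinearMap.lTensor_tmul, counit_cls]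
    rw [Finset.sum_eq_single (n, 0)]
    · rw [if_pos rfl, seg_self, op_id, X.map_id]; rfl
    · rintro ⟨p, q⟩ h hp
      rw [Finset.HasAntidiagonal.mem_antidiagonal] at h
      rw [if_neg, TensorProduct.tmul_zero]
      rintro rfl
      exact hp (by simpa using h)
    · intro h; simp at h

theorem delta_val (n : ℕ) (i : Fin (n + 2)) (j : Fin (n + 1)) :
    ((SimplexCategory.δ i).toOrderHom j : ℕ) = if (j : ℕ) < i then (j : ℕ) else j + 1 := by
  change (Fin.succAbove i j : ℕ) = _
  rw [Fin.succAbove]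
  split_ifs with h1 h2 h2
  · rfl
  · exact absurd h1 h2
  · exact absurd h2 h1
  · rfl

/-- Faces of front faces and back faces. -/
theorem delta_seg_front {p q : ℕ} (i : Fin (p + 2)) (j : Fin (p + q + 2)) (h : (i : ℕ) = j) :
    SimplexCategory.δ i ≫ seg (p + q + 1) 0 (p + 1) =
      seg (p + q) 0 p ≫ SimplexCategory.δ j := by
  apply Shuffle.hom_ext
  intro t
  have ht : (t : ℕ) < p + 1 := t.2
  apply Fin.ext
  rw [Shuffle.comp_apply, Shuffle.comp_apply, seg_val, delta_val, delta_val, seg_val]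
  split_ifs <;> omega

theorem seg_back {p q : ℕ} (j : Fin (p + q + 2)) (hi : (j : ℕ) ≤ p) :
    seg (p + q + 1) (p + 1) q = seg (p + q) p q ≫ SimplexCategory.δ j := by
  apply Shuffle.hom_ext
  intro t
  have ht : (t : ℕ) < q + 1 := t.2
  apply Fin.ext
  rw [Shuffle.comp_apply, seg_val, delta_val, seg_val]
  split_ifs <;> omega

theorem seg_front {p q : ℕ} (j : Fin (p + q + 2)) (hi : p < (j : ℕ)) :
    seg (p + q + 1) 0 p = seg (p + q) 0 p ≫ SimplexCategory.δ j := by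
  apply Shuffle.hom_ext
  intro t
  have ht : (t : ℕ) < p + 1 := t.2
  apply Fin.ext
  rw [Shuffle.comp_apply, seg_val, delta_val, seg_val]
  split_ifs <;> omega

theorem delta_seg_back {p q : ℕ} (i : Fin (q + 2)) (j : Fin (p + q + 2)) (h : p + (i : ℕ) = j) :
    SimplexCategory.δ i ≫ seg (p + q + 1) p (q + 1) =
      seg (p + q) p q ≫ SimplexCategory.δ j := by
  apply Shuffle.hom_ext
  intro t
  have ht : (t : ℕ) < q + 1 := t.2
  apply Fin.ext
  rw [Shuffle.comp_apply, Shuffle.comp_apply, seg_val, delta_val, delta_val, seg_val]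
  split_ifs <;> omega

theorem delta_last_seg {p q : ℕ} : SimplexCategory.δ (Fin.last (p + 1)) ≫
    seg (p + q + 1) 0 (p + 1) = seg (p + q + 1) 0 p := by
  apply Shuffle.hom_ext
  intro t
  have ht : (t : ℕ) < p + 1 := t.2
  apply Fin.ext
  rw [Shuffle.comp_apply, seg_val, delta_val, seg_val, Fin.val_last, if_pos ht]

theorem delta_zero_seg {p q : ℕ} : SimplexCategory.δ 0 ≫
    seg (p + q + 1) p (q + 1) = seg (p + q + 1) (p + 1) q := by
  apply Shuffle.hom_ext
  intro t
  have ht : (t : ℕ) < q + 1 := t.2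
  apply Fin.ext
  rw [Shuffle.comp_apply, seg_val, delta_val, seg_val, if_neg (by simp)]
  omega

open TensorProduct in
/-- The faces that enter in the compatibility of differential and coproduct, for a fixed bidegree. -/
theorem sum_split (p q : ℕ) (x : X.obj (op ⦋p + q + 1⦌)) :
    (∑ j : Fin (p + q + 2), (-1 : ℤ) ^ (j : ℕ) • TensorProduct.tmul k
      (cls k (X.map (seg (p + q) 0 p ≫ SimplexCategory.δ j).op x))
      (cls k (X.map (seg (p + q) p q ≫ SimplexCategory.δ j).op x))) =
    TensorProduct.tmul k (d k (cls k (X.map (seg (p + q + 1) 0 (p + 1)).op x)))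
      (cls k (X.map (seg (p + q + 1) (p + 1) q).op x)) +
    (-1 : ℤ) ^ p • TensorProduct.tmul k (cls k (X.map (seg (p + q + 1) 0 p).op x))
      (d k (cls k (X.map (seg (p + q + 1) p (q + 1)).op x))) := by
  rw [← Fin.sum_congr' _ (show p + 1 + (q + 1) = p + q + 2 by omega), Fin.sum_univ_add,
    d_cls_succ, d_cls_succ, Fin.sum_univ_castSucc (n := p + 1), Fin.sum_univ_succ (n := q + 1),
    TensorProduct.add_tmul, TensorProduct.tmul_add, smul_add]
  simp only [map_comp, delta_last_seg, delta_zero_seg]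
  have h0 : ((-1 : ℤ) ^ ((Fin.last (p + 1) : Fin (p + 2)) : ℕ) •
      cls k (X.map (seg (p + q + 1) 0 p).op x)) ⊗ₜ[k] cls k (X.map (seg (p + q + 1) (p + 1) q).op x) +
      (-1 : ℤ) ^ p • (cls k (X.map (seg (p + q + 1) 0 p).op x)) ⊗ₜ[k] ((-1 : ℤ) ^ ((0 : Fin (q + 2)) : ℕ) •
        cls k (X.map (seg (p + q + 1) (p + 1) q).op x)) = 0 := by
    simp [pow_succ, TensorProduct.neg_tmul, ← TensorProduct.smul_tmul']
  have h1 : ∀ {V : Type (max u v)} [AddCommGroup V] (a b c e : V), b + c = 0 →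
      a + b + (c + e) = a + e := fun a b c e h => by rw [add_assoc, ← add_assoc b, h, zero_add]
  refine Eq.trans ?_ (h1 _ _ _ _ h0).symm
  congr 1
  · rw [TensorProduct.sum_tmul]
    refine Finset.sum_congr rfl fun i _ => ?_
    rw [delta_seg_front _ (Fin.cast (by omega) (Fin.castAdd (q + 1) i)) (by simp),
      seg_back (Fin.cast (by omega) (Fin.castAdd (q + 1) i)) (by simp; omega),
      ← TensorProduct.smul_tmul']
    rfl
  · rw [TensorProduct.tmul_sum, Finset.smul_sum]
    refine Finset.sum_congr rfl fun i _ => ?_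
    rw [delta_seg_back _ (Fin.cast (by omega) (Fin.natAdd (p + 1) i)) (by simp; omega),
      seg_front (Fin.cast (by omega) (Fin.natAdd (p + 1) i)) (by simp; omega),
      TensorProduct.tmul_smul, smul_smul, ← pow_add]
    congr 2
    simp
    omega

theorem comul_d (c : NChains k X) : comul k (d k c) =
    TensorProduct.map (d k) LinearMap.id (comul k c) +
      TensorProduct.map (signInvolution (gr k X)) (d k) (comul k c) := by
  refine LinearMap.congr_fun (f := comul k ∘ₗ d k)
    (g := TensorProduct.map (d k) LinearMap.id ∘ₗ comul k +
      TensorProduct.map (signInvolution (gr k X)) (d k) ∘ₗ comul k) (hom_ext fun n x => ?_) c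
  simp only [LinearMap.add_apply, LinearMap.comp_apply]
  cases n with
  | zero => 
    rw [d_cls_zero, map_zero, comul_cls]
    simp [d_cls_zero]
  | succ n =>
    simp only [comul_cls, d_cls_succ, map_sum, map_zsmul, TensorProduct.map_tmul, map_comp,
      signInvolution_of_mem _ (cls_mem k _), LinearMap.id_apply]
    rw [Finset.Nat.sum_antidiagonal_succ, Finset.Nat.sum_antidiagonal_succ' (n := n)]
    simp only [d_cls_zero, TensorProduct.zero_tmul, TensorProduct.tmul_zero, zero_add,
      Finset.smul_sum]
    rw [Finset.sum_comm, ← Finset.sum_add_distrib]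
    refine Finset.sum_congr rfl fun pq hpq => ?_
    obtain ⟨p, q⟩ := pq
    rw [Finset.HasAntidiagonal.mem_antidiagonal] at hpq
    obtain rfl : p + q = n := hpq
    exact (sum_split k p q x).trans (by rw [TensorProduct.smul_tmul'])

theorem counit_d (c : NChains k X) : counit k (d k c) = 0 := by
  refine LinearMap.congr_fun (f := counit k ∘ₗ d k) (g := 0) (hom_ext fun n x => ?_) c
  rw [LinearMap.comp_apply, LinearMap.zero_apply]
  match n, x with
  | 0, x => rw [d_cls_zero, map_zero]
  | 1, x => simp [d_cls_succ, counit_cls, Fin.sum_univ_two]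
  | n + 2, x => simp [d_cls_succ, counit_cls]

theorem comul_mem (n : ℕ) (c : NChains k X) (hc : c ∈ gr k X n) : comul k c ∈
    ⨆ (p : ℕ) (q : ℕ) (_ : p + q = n),
      LinearMap.range (TensorProduct.map (gr k X p).subtype (gr k X q).subtype) := by
  refine map_gr (comul k) n _ (fun x => ?_) c hc
  rw [comul_cls]
  refine Submodule.sum_mem _ fun pq hpq => ?_
  refine Submodule.mem_iSup_of_mem pq.1 (Submodule.mem_iSup_of_mem pq.2 (Submodule.mem_iSup_of_mem
    (Finset.HasAntidiagonal.mem_antidiagonal.1 hpq) ?_))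
  exact ⟨TensorProduct.tmul k ⟨_, cls_mem k _⟩ ⟨_, cls_mem k _⟩, TensorProduct.map_tmul _ _ _ _⟩

theorem counit_pos (n : ℕ) (c : NChains k X) (hc : c ∈ gr k X (n + 1)) : counit k c = 0 :=
  map_gr (counit k) _ ⊥ (fun x => by rw [counit_cls]; exact if_neg (Nat.succ_ne_zero n)) c hc

theorem connected (x : X.obj (op ⦋0⦌)) (hx : ∀ y : X.obj (op ⦋0⦌), y = x) :
    Function.Bijective fun c : gr k X 0 => counit k (c : NChains k X) := by
  have h : ∀ a : k, counit k (a • cls k x) = a := fun a => by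
    rw [map_smul, counit_cls, if_pos rfl, smul_eq_mul, mul_one]
  have h' : ∀ c ∈ gr k X 0, c = counit k c • cls k x := fun c hc => by
    refine Submodule.span_induction (p := fun c _ => c = counit k c • cls k x) ?_ ?_ ?_ ?_ hc
    · rintro _ ⟨y, rfl⟩
      rw [hx y, counit_cls, if_pos rfl, one_smul]
    · simp
    · intro a b _ _ ha hb; rw [map_add, add_smul, ← ha, ← hb]
    · intro a b _ hb; rw [map_smul, smul_assoc, ← hb]
  refine ⟨fun c c' hc => Subtype.ext ?_, fun a => ⟨⟨a • cls k x,
    Submodule.smul_mem _ _ (cls_mem k x)⟩, h a⟩⟩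
  rw [h' _ c.2, h' _ c'.2]
  exact congrArg (fun a => a • cls k x) hc

variable {k}

theorem map_counit (f : X ⟶ Y) (c : NChains k X) : counit k (map f c) = counit k c := by
  refine LinearMap.congr_fun (f := counit k ∘ₗ map f) (g := counit k) (hom_ext fun n x => ?_) c
  rw [LinearMap.comp_apply, map_cls, counit_cls, counit_cls]

theorem map_comul (f : X ⟶ Y) (c : NChains k X) :
    TensorProduct.map (map f) (map f) (comul k c) = comul k (map f c) := by
  refine LinearMap.congr_fun (f := TensorProduct.map (map f) (map f) ∘ₗ comul k)
    (g := comul k ∘ₗ map f) (hom_ext fun n x => ?_) c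
  simp only [LinearMap.comp_apply, map_cls, comul_cls, map_sum, TensorProduct.map_tmul,
    NatTrans.naturality_apply]

theorem map_id_apply (c : NChains k X) : map (𝟙 X) c = c :=
  LinearMap.congr_fun (f := map (𝟙 X)) (g := .id) (hom_ext fun n x => by rw [map_cls]; rfl) c

theorem map_comp_apply (f : X ⟶ Y) (g : Y ⟶ Z) (c : NChains k X) :
    map (f ≫ g) c = map g (map f c) :=
  LinearMap.congr_fun (f := map (f ≫ g)) (g := map g ∘ₗ map f) (hom_ext fun n x => by
    rw [LinearMap.comp_apply, map_cls, map_cls, map_cls]; rfl) c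

end NChains

/-! ### The differential graded coalgebra of a reduced simplicial set -/

/-- A `0`-reduced simplicial set: there is exactly one vertex. -/
structure ReducedSSet where
  toSSet : SSet.{u}
  vertex : toSSet.obj (op ⦋0⦌)
  eq_vertex : ∀ y : toSSet.obj (op ⦋0⦌), y = vertex

/-- Morphisms of `0`-reduced simplicial sets are maps of simplicial sets. -/
instance : Category ReducedSSet.{u} where
  Hom S T := S.toSSet ⟶ T.toSSet
  id S := 𝟙 S.toSSet
  comp f g := CategoryStruct.comp (obj := SSet.{u}) f g

/-- The normalized chains of a `0`-reduced simplicial set, as a differential graded coalgebra. -/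
noncomputable def normalizedChainsCoalg (k : Type v) [CommRing k] :
    ReducedSSet.{u} ⥤ ConnDGCoalg.{v, max u v} k where
  obj S :=
    { carrier := NChains k S.toSSet
      gr := NChains.gr k S.toSSet
      d := NChains.d k
      d_mem := NChains.d_mem k
      d_zero := NChains.d_zero k
      d_d := NChains.d_d k
      comul_mem := NChains.comul_mem k
      comul_d := NChains.comul_d k
      counit_pos := NChains.counit_pos k
      counit_d := NChains.counit_d k
      connected := NChains.connected k S.vertex S.eq_vertex }
  map {S T} f :=
    { toCoalgHom :=
        { NChains.map (X := S.toSSet) (Y := T.toSSet) f with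
          counit_comp := LinearMap.ext fun c => NChains.map_counit _ c
          map_comp_comul := LinearMap.ext fun c => NChains.map_comul _ c }
      map_gr := NChains.map_mem k _
      map_d := NChains.map_d k _ }
  map_id _ := ConnDGCoalg.Hom.ext (CoalgHom.ext fun c => NChains.map_id_apply c)
  map_comp _ _ := ConnDGCoalg.Hom.ext (CoalgHom.ext fun c => NChains.map_comp_apply _ _ c)

/-! ### The differential graded algebra of a simplicial monoid -/

/-- The underlying simplicial set of a simplicial monoid. -/
def underlying (M : SimplicialObject MonCat.{u}) : SSet.{u} := M ⋙ forget MonCat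

namespace NChains

variable (k : Type v) [CommRing k] (M : SimplicialObject MonCat.{u})

variable {M} in
/-- The class of a simplex of a simplicial monoid. -/
noncomputable def mcls {n : ℕ} (x : M.obj (op ⦋n⦌)) : NChains k (underlying M) :=
  cls k (X := underlying M) x

variable {M} in
/-- The product `a(α) b(β)` for the pairs of operators `α`, `β`. -/
noncomputable def prodCochain {p q : ℕ} (a : M.obj (op ⦋p⦌)) (b : M.obj (op ⦋q⦌)) :
    Shuffle.Cochain (NChains k (underlying M)) p q :=
  fun _ α β => mcls k ((M.map α.op).hom a * (M.map β.op).hom b)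

variable {M} in
/-- The Eilenberg-Zilber shuffle product of two simplices of a simplicial monoid: the signed sum over
all shuffles of the products of the corresponding degeneracies. -/
noncomputable def shuffleProd {p q : ℕ} (a : M.obj (op ⦋p⦌)) (b : M.obj (op ⦋q⦌)) :
    NChains k (underlying M) :=
  ∑ w : Shuffle p q, w.sgn • mcls k ((M.map w.fst.op).hom a * (M.map w.snd.op).hom b)

variable {M}

theorem mon_map_comp {a b c : SimplexCategory} (f : a ⟶ b) (g : b ⟶ c) (x : M.obj (op c)) :
    (M.map f.op).hom ((M.map g.op).hom x) = (M.map (f ≫ g).op).hom x := by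
  rw [op_comp, M.map_comp]; rfl

theorem mon_map_id {a : SimplexCategory} (x : M.obj (op a)) : (M.map (𝟙 a).op).hom x = x := by
  rw [op_id, M.map_id]; rfl

theorem mcls_degenerate {n : ℕ} {c e : SimplexCategory} (f : ⦋n⦌ ⟶ c) (g : ⦋n⦌ ⟶ e)
    (x : M.obj (op c)) (y : M.obj (op e)) (t : Fin n)
    (hf : f.toOrderHom t.castSucc = f.toOrderHom t.succ)
    (hg : g.toOrderHom t.castSucc = g.toOrderHom t.succ) :
    mcls k ((M.map f.op).hom x * (M.map g.op).hom y) = 0 := by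
  obtain _ | n := n
  · exact t.elim0
  · obtain ⟨f, rfl⟩ := SimplexCategory.eq_σ_comp_of_not_injective' f t hf
    obtain ⟨g, rfl⟩ := SimplexCategory.eq_σ_comp_of_not_injective' g t hg
    rw [← mon_map_comp, ← mon_map_comp, ← map_mul]
    exact cls_σ k t _

theorem sigma_step {n : ℕ} (i : Fin (n + 1)) : (SimplexCategory.σ i).toOrderHom i.castSucc =
    (SimplexCategory.σ i).toOrderHom i.succ := by
  change Fin.predAbove _ _ = Fin.predAbove _ _
  simp

theorem shuffleProd_σ {p q : ℕ} (a : M.obj (op ⦋p⦌)) (i : Fin (q + 1)) (b : M.obj (op ⦋q⦌)) :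
    shuffleProd k a ((M.map (SimplexCategory.σ i).op).hom b) = 0 := by
  refine Finset.sum_eq_zero fun w _ => ?_
  obtain ⟨t, h1, h2, h3⟩ := Shuffle.exists_step_snd w i
  rw [mon_map_comp, mcls_degenerate k _ _ _ _ t h3, smul_zero]
  rw [Shuffle.comp_apply, Shuffle.comp_apply, h1, h2, sigma_step]

theorem σ_shuffleProd {p q : ℕ} (i : Fin (p + 1)) (a : M.obj (op ⦋p⦌)) (b : M.obj (op ⦋q⦌)) :
    shuffleProd k ((M.map (SimplexCategory.σ i).op).hom a) b = 0 := by
  refine Finset.sum_eq_zero fun w _ => ?_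
  obtain ⟨t, h1, h2, h3⟩ := Shuffle.exists_step_fst w i
  rw [mon_map_comp, mcls_degenerate k _ _ _ _ t _ h3, smul_zero]
  rw [Shuffle.comp_apply, Shuffle.comp_apply, h1, h2, sigma_step]

/-- The product of the normalized chains of a simplicial monoid. -/
noncomputable def mulMap :
    NChains k (underlying M) →ₗ[k] NChains k (underlying M) →ₗ[k] NChains k (underlying M) :=
  lift (fun p a => lift (fun q b => shuffleProd k (M := M) (p := p) (q := q) a b)
    fun q i b => shuffleProd_σ k _ i _) fun p i a => hom_ext fun q b => by
      exact (lift_cls _ _ b).trans (σ_shuffleProd k (M := M) i a b)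

theorem mulMap_mcls {p q : ℕ} (a : M.obj (op ⦋p⦌)) (b : M.obj (op ⦋q⦌)) :
    mulMap k (mcls k a) (mcls k b) = shuffleProd k a b :=
  (LinearMap.congr_fun (lift_cls (X := underlying M) _ _ a) (mcls k b)).trans
    (lift_cls (X := underlying M) _ _ b)

theorem hom_ext' {V : Type*} [AddCommGroup V] [Module k V] {f g : NChains k (underlying M) →ₗ[k] V}
    (h : ∀ (n : ℕ) (x : M.obj (op ⦋n⦌)), f (mcls k x) = g (mcls k x)) : f = g :=
  hom_ext h

theorem mulMap_assoc (a b c : NChains k (underlying M)) :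
    mulMap k (mulMap k a b) c = mulMap k a (mulMap k b c) := by
  suffices h : (LinearMap.llcomp k _ _ _ (mulMap k)) ∘ₗ mulMap (M := M) k =
      (LinearMap.llcomp k _ _ _).flip (mulMap k) ∘ₗ (LinearMap.llcomp k _ _ _) ∘ₗ mulMap k by
    exact LinearMap.congr_fun (LinearMap.congr_fun (LinearMap.congr_fun h a) b) c
  refine hom_ext' k fun p a => hom_ext' k fun q b => hom_ext' k fun r c => ?_
  simp only [LinearMap.comp_apply, LinearMap.llcomp_apply, LinearMap.flip_apply, mulMap_mcls]
  rw [shuffleProd, shuffleProd, map_sum, map_sum, LinearMap.sum_apply]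
  simp only [map_zsmul, LinearMap.smul_apply, mulMap_mcls]
  simp only [shuffleProd, map_mul, mon_map_comp, Finset.smul_sum, smul_smul]
  rw [Shuffle.sum_assoc p q r fun n α β γ => mcls k ((M.map α.op).hom a *
    ((M.map β.op).hom b * (M.map γ.op).hom c))]
  simp only [mul_assoc]

theorem one_mulMap (a : NChains k (underlying M)) :
    mulMap k (mcls k (1 : M.obj (op ⦋0⦌))) a = a := by
  refine LinearMap.congr_fun (g := .id) (hom_ext' k fun p a => ?_) a
  rw [mulMap_mcls, shuffleProd]
  simp only [map_one, one_mul]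
  rw [Shuffle.sum_left_zero p fun n α => mcls k ((M.map α.op).hom a), mon_map_id]
  rfl

theorem mulMap_one (a : NChains k (underlying M)) :
    mulMap k a (mcls k (1 : M.obj (op ⦋0⦌))) = a := by
  refine LinearMap.congr_fun (f := (mulMap k).flip (mcls k 1)) (g := .id)
    (hom_ext' k fun p a => ?_) a
  rw [LinearMap.flip_apply, mulMap_mcls, shuffleProd]
  simp only [map_one, mul_one]
  rw [Shuffle.sum_right_zero p fun n α => mcls k ((M.map α.op).hom a), mon_map_id]
  rfl

noncomputable instance : Ring (NChains k (underlying M)) where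
  mul a b := mulMap k a b
  one := mcls k (1 : M.obj (op ⦋0⦌))
  mul_assoc := mulMap_assoc k
  one_mul := one_mulMap k
  mul_one := mulMap_one k
  left_distrib a b c := map_add (mulMap k a) b c
  right_distrib a b c := LinearMap.map_add₂ (mulMap k) a b c
  zero_mul a := LinearMap.map_zero₂ (mulMap k) a
  mul_zero a := map_zero (mulMap k a)
  neg_add_cancel := neg_add_cancel
  zsmul := fun n a => n • a
  zsmul_zero' := SubNegMonoid.zsmul_zero'
  zsmul_succ' := SubNegMonoid.zsmul_succ'
  zsmul_neg' := SubNegMonoid.zsmul_neg'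
  sub_eq_add_neg := sub_eq_add_neg

noncomputable instance : Algebra k (NChains k (underlying M)) :=
  Algebra.ofModule (fun r a b => LinearMap.map_smul₂ (mulMap k) r a b)
    (fun r a b => map_smul (mulMap k a) r b)

theorem mul_def (a b : NChains k (underlying M)) : a * b = mulMap k a b := rfl

theorem one_def : (1 : NChains k (underlying M)) = mcls k (1 : M.obj (op ⦋0⦌)) := rfl

theorem shuffleProd_mem {p q : ℕ} (a : M.obj (op ⦋p⦌)) (b : M.obj (op ⦋q⦌)) :
    shuffleProd k a b ∈ gr k (underlying M) (p + q) := by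
  refine sum_mem fun w _ => zsmul_mem ?_ _
  rw [← w.len_eq]
  exact cls_mem k _

noncomputable instance : SetLike.GradedMonoid (gr k (underlying M)) where
  one_mem := cls_mem k _
  mul_mem p q a b ha hb := by
    refine map_gr (mulMap k a) q _ (fun b => ?_) b hb
    refine map_gr ((mulMap k).flip (mcls k b)) p _ (fun a => ?_) a ha
    exact (mulMap_mcls k (M := M) a b).symm ▸ shuffleProd_mem k _ _

noncomputable instance : GradedAlgebra (gr k (underlying M)) where

theorem d_mcls {n : ℕ} (x : M.obj (op ⦋n + 1⦌)) : d k (mcls k x) = ∑ i : Fin (n + 2),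
    (-1 : ℤ) ^ (i : ℕ) • mcls k ((M.map (SimplexCategory.δ i).op).hom x) :=
  d_cls_succ k (X := underlying M) x

theorem d_shuffleProd {p q : ℕ} (a : M.obj (op ⦋p⦌)) (b : M.obj (op ⦋q⦌)) :
    d k (shuffleProd k a b) = mulMap k (d k (mcls k a)) (mcls k b) +
      (-1 : ℤ) ^ p • mulMap k (mcls k a) (d k (mcls k b)) := by
  have h := Shuffle.tot_bd p q (prodCochain k a b)
  have h1 : Shuffle.tot (prodCochain k a b).bd = d k (shuffleProd k a b) := by
    rw [shuffleProd, map_sum]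
    refine Finset.sum_congr rfl fun w _ => ?_
    rw [map_zsmul]
    congr 1
    generalize w.fst = α, w.snd = β
    revert α β
    generalize w.len = n
    intro α β
    cases n with
    | zero => exact (d_cls_zero k (X := underlying M) _).symm
    | succ n =>
      rw [d_mcls]
      simp only [map_mul, mon_map_comp]
      rfl
  have h2 : Shuffle.facesFst (prodCochain k a b) = mulMap k (d k (mcls k a)) (mcls k b) := by
    cases p with
    | zero =>
      rw [show d k (mcls k a) = 0 from d_cls_zero k (X := underlying M) a, map_zero]; rfl
    | succ p =>
      rw [d_mcls, map_sum, LinearMap.sum_apply]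
      refine Finset.sum_congr rfl fun i _ => ?_
      rw [map_zsmul, LinearMap.smul_apply, mulMap_mcls]
      congr 1
      refine Finset.sum_congr rfl fun w _ => ?_
      simp only [Shuffle.Cochain.pull, prodCochain, mon_map_comp, Category.comp_id]
  have h3 : Shuffle.facesSnd (prodCochain k a b) = mulMap k (mcls k a) (d k (mcls k b)) := by
    cases q with
    | zero =>
      rw [show d k (mcls k b) = 0 from d_cls_zero k (X := underlying M) b, map_zero]; rfl
    | succ q =>
      rw [d_mcls, map_sum]
      refine Finset.sum_congr rfl fun i _ => ?_
      rw [map_zsmul, mulMap_mcls]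
      congr 1
      refine Finset.sum_congr rfl fun w _ => ?_
      simp only [Shuffle.Cochain.pull, prodCochain, mon_map_comp, Category.comp_id]
  rw [← h1, h, h2, h3]

theorem leibniz (p : ℕ) (a b : NChains k (underlying M)) (ha : a ∈ gr k (underlying M) p) :
    d k (a * b) = d k a * b + (-1 : ℤ) ^ p • (a * d k b) := by
  simp only [mul_def]
  refine LinearMap.congr_fun (f := d k ∘ₗ mulMap k a)
    (g := mulMap k (d k a) + (-1 : ℤ) ^ p • (mulMap k a ∘ₗ d k)) (hom_ext' k fun q b => ?_) b
  rw [← sub_eq_zero]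
  refine map_gr (d k ∘ₗ (mulMap k).flip (mcls k b) - ((mulMap k).flip (mcls k b) ∘ₗ d k +
    (-1 : ℤ) ^ p • (mulMap k).flip (d k (mcls k b)))) p ⊥ (fun a => ?_) a ha
  rw [Submodule.mem_bot]
  simp only [LinearMap.sub_apply, LinearMap.add_apply, LinearMap.comp_apply, LinearMap.smul_apply,
    LinearMap.flip_apply]
  rw [sub_eq_zero]
  exact (congrArg (d k) (mulMap_mcls k (M := M) a b)).trans (d_shuffleProd k (M := M) a b)

variable {N : SimplicialObject MonCat.{u}}

variable {k} in
/-- The algebra map induced by a map of simplicial monoids. -/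
noncomputable def mmap (f : M ⟶ N) : NChains k (underlying M) →ₐ[k] NChains k (underlying N) :=
  AlgHom.ofLinearMap (map (X := underlying M) (Y := underlying N) (Functor.whiskerRight f _))
    (by
      rw [one_def, one_def]
      exact (map_cls k (X := underlying M) _ _).trans (congrArg (mcls k) (map_one (f.app _).hom)))
    (by
      intro a b
      have hf : ∀ {n : ℕ} (x : M.obj (op ⦋n⦌)), map (X := underlying M) (Y := underlying N)
          (Functor.whiskerRight f _) (mcls k x) = mcls k ((f.app _).hom x) :=
        fun x => map_cls k (X := underlying M) _ _
      have hn : ∀ {m m'} (g : m ⟶ m') (x : M.obj m), (f.app m').hom ((M.map g).hom x) =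
          (N.map g).hom ((f.app m).hom x) := fun g x => by
        have := congrArg (fun h => MonCat.Hom.hom h x) (f.naturality g)
        exact this
      simp only [mul_def]
      generalize (map (X := underlying M) (Y := underlying N) (Functor.whiskerRight f _) :
        NChains k (underlying M) →ₗ[k] NChains k (underlying N)) = F at hf ⊢
      refine LinearMap.congr_fun (f := F ∘ₗ mulMap k a) (g := mulMap k (F a) ∘ₗ F)
        (hom_ext' k fun q b => ?_) b
      refine LinearMap.congr_fun (f := F ∘ₗ (mulMap k).flip (mcls k b))
        (g := (mulMap k).flip (F (mcls k b)) ∘ₗ F) (hom_ext' k fun p a => ?_) a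
      simp only [LinearMap.comp_apply, LinearMap.flip_apply, hf, mulMap_mcls]
      simp only [shuffleProd, map_sum, map_zsmul, hf, map_mul, hn])

theorem mmap_mcls (f : M ⟶ N) {n : ℕ} (x : M.obj (op ⦋n⦌)) :
    mmap f (mcls k x) = mcls k ((f.app _).hom x) :=
  map_cls k (X := underlying M) _ _

theorem algHom_ext {A : Type*} [Ring A] [Algebra k A] {f g : NChains k (underlying M) →ₐ[k] A}
    (h : ∀ (n : ℕ) (x : M.obj (op ⦋n⦌)), f (mcls k x) = g (mcls k x)) : f = g :=
  AlgHom.toLinearMap_injective (hom_ext' k h)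

theorem mmap_id : mmap (k := k) (𝟙 M) = AlgHom.id k _ :=
  algHom_ext k fun _ x => mmap_mcls k _ x

theorem mmap_comp {P : SimplicialObject MonCat.{u}} (f : M ⟶ N) (g : N ⟶ P) :
    mmap (k := k) (f ≫ g) = (mmap g).comp (mmap f) :=
  algHom_ext k fun _ x => by
    rw [AlgHom.comp_apply, mmap_mcls, mmap_mcls, mmap_mcls]; rfl

end NChains

/-- The normalized chains of a simplicial monoid, as a differential graded algebra. -/
noncomputable def normalizedChainsAlg (k : Type v) [CommRing k] :
    SimplicialObject MonCat.{u} ⥤ DGAlg.{v, max u v} k where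
  obj M :=
    { carrier := NChains k (underlying M)
      gr := NChains.gr k (underlying M)
      d := NChains.d k
      d_mem := NChains.d_mem k
      d_zero := NChains.d_zero k
      d_d := NChains.d_d k
      leibniz := NChains.leibniz k }
  map f :=
    { toAlgHom := NChains.mmap f
      map_gr := NChains.map_mem k _
      map_d := NChains.map_d k _ }
  map_id _ := DGAlg.Hom.ext (NChains.mmap_id k)
  map_comp _ _ := DGAlg.Hom.ext (NChains.mmap_comp k _ _)

/-! ### Simplices of mapping spaces of simplicial categories -/

/-- The pair of two simplices, as a simplex of the product. -/
def pair {X Y : SSet.{u}} {m : SimplexCategoryᵒᵖ} (a : X.obj m) (b : Y.obj m) : (X ⊗ Y).obj m :=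
  Prod.mk a b

/-- The only `m`-simplex of the point. -/
def point (m : SimplexCategoryᵒᵖ) : (𝟙_ SSet.{u}).obj m :=
  PUnit.unit

section SimplicialCat

variable {C : Type u₁} [EnrichedCategory SSet.{u} C]

/-- The composite of two `m`-simplices of mapping spaces, in diagrammatic order: first `a`,
then `b`. -/
def scomp {x y z : C} {m : SimplexCategoryᵒᵖ} (a : (x ⟶[SSet.{u}] y).obj m)
    (b : (y ⟶[SSet.{u}] z).obj m) : (x ⟶[SSet.{u}] z).obj m :=
  (eComp SSet.{u} x y z).app m (pair a b)

/-- The `m`-simplex of a mapping space given by the identity. -/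
def sid (x : C) (m : SimplexCategoryᵒᵖ) : (x ⟶[SSet.{u}] x).obj m :=
  (eId SSet.{u} x).app m (point m)

theorem sid_scomp {x y : C} {m : SimplexCategoryᵒᵖ} (a : (x ⟶[SSet.{u}] y).obj m) :
    scomp (sid x m) a = a :=
  congrArg (fun f : (x ⟶[SSet.{u}] y) ⟶ (x ⟶[SSet.{u}] y) => f.app m a)
    (e_id_comp SSet.{u} x y)

theorem scomp_sid {x y : C} {m : SimplexCategoryᵒᵖ} (a : (x ⟶[SSet.{u}] y).obj m) :
    scomp a (sid y m) = a :=
  congrArg (fun f : (x ⟶[SSet.{u}] y) ⟶ (x ⟶[SSet.{u}] y) => f.app m a)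
    (e_comp_id SSet.{u} x y)

theorem scomp_assoc {x y z t : C} {m : SimplexCategoryᵒᵖ} (a : (x ⟶[SSet.{u}] y).obj m)
    (b : (y ⟶[SSet.{u}] z).obj m) (c : (z ⟶[SSet.{u}] t).obj m) :
    scomp (scomp a b) c = scomp a (scomp b c) :=
  congrArg (fun f : _ ⟶ (x ⟶[SSet.{u}] t) => f.app m (pair a (pair b c)))
    (e_assoc SSet.{u} x y z t)

theorem map_scomp {x y z : C} {m m' : SimplexCategoryᵒᵖ} (f : m ⟶ m')
    (a : (x ⟶[SSet.{u}] y).obj m) (b : (y ⟶[SSet.{u}] z).obj m) :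
    (x ⟶[SSet.{u}] z).map f (scomp a b) =
      scomp ((x ⟶[SSet.{u}] y).map f a) ((y ⟶[SSet.{u}] z).map f b) :=
  (congrArg (fun h => h (pair a b)) ((eComp SSet.{u} x y z).naturality f)).symm

theorem map_sid (x : C) {m m' : SimplexCategoryᵒᵖ} (f : m ⟶ m') :
    (x ⟶[SSet.{u}] x).map f (sid x m) = sid x m' :=
  (NatTrans.naturality_apply (eId SSet.{u} x) f (point m)).symm

variable {D : Type u₂} [EnrichedCategory SSet.{u} D]

theorem functor_scomp (F : EnrichedFunctor SSet.{u} C D) {x y z : C} {m : SimplexCategoryᵒᵖ}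
    (a : (x ⟶[SSet.{u}] y).obj m) (b : (y ⟶[SSet.{u}] z).obj m) :
    (F.map x z).app m (scomp a b) = scomp ((F.map x y).app m a) ((F.map y z).app m b) :=
  congrArg (fun f : _ ⟶ (F.obj x ⟶[SSet.{u}] F.obj z) => f.app m (pair a b))
    (F.map_comp x y z)

theorem functor_sid (F : EnrichedFunctor SSet.{u} C D) (x : C) (m : SimplexCategoryᵒᵖ) :
    (F.map x x).app m (sid x m) = sid (F.obj x) m :=
  congrArg (fun f : _ ⟶ (F.obj x ⟶[SSet.{u}] F.obj x) => f.app m (point m))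
    (F.map_id x)

end SimplicialCat

/-! ### The simplicial monoid of endomorphisms -/

/-- The `m`-simplices of the mapping space from `x` to itself. -/
def EndAt (C : Type u₁) [EnrichedCategory SSet.{u} C] (x : C) (m : SimplexCategoryᵒᵖ) : Type u :=
  (x ⟶[SSet.{u}] x).obj m

/-- Multiplication is composition, in diagrammatic order. -/
instance (C : Type u₁) [EnrichedCategory SSet.{u} C] (x : C) (m : SimplexCategoryᵒᵖ) :
    Monoid (EndAt C x m) where
  mul a b := scomp a b
  one := sid x m
  mul_assoc a b c := scomp_assoc a b c
  one_mul a := sid_scomp a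
  mul_one a := scomp_sid a

/-- The simplicial monoid of endomorphisms of an object of a simplicial category: its underlying
simplicial set is the mapping space from `x` to itself. -/
def endMonoid (C : Type u₁) [EnrichedCategory SSet.{u} C] (x : C) :
    SimplicialObject MonCat.{u} where
  obj m := MonCat.of (EndAt C x m)
  map f := MonCat.ofHom
    { toFun := fun a => (x ⟶[SSet.{u}] x).map f a
      map_one' := map_sid x f
      map_mul' := fun a b => map_scomp f a b }
  map_id m := MonCat.hom_ext (MonoidHom.ext fun a =>
    congrArg (fun h => h a) ((x ⟶[SSet.{u}] x).map_id m))
  map_comp f g := MonCat.hom_ext (MonoidHom.ext fun a =>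
    congrArg (fun h => h a) ((x ⟶[SSet.{u}] x).map_comp f g))


/-- The map of simplicial monoids induced by a simplicial functor. -/
def endMonoidMap {C : Type u₁} [EnrichedCategory SSet.{u} C] {D : Type u₂}
    [EnrichedCategory SSet.{u} D] (F : EnrichedFunctor SSet.{u} C D) {x : C} {y : D}
    (h : F.obj x = y) : endMonoid C x ⟶ endMonoid D y where
  app m := MonCat.ofHom
    { toFun := fun a => (h ▸ (F.map x x).app m a : (y ⟶[SSet.{u}] y).obj m)
      map_one' := by subst h; exact functor_sid F x m
      map_mul' := fun a b => by subst h; exact functor_scomp F a b }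
  naturality m m' f := by
    subst h
    exact MonCat.hom_ext (MonoidHom.ext fun a =>
      congrArg (fun h => h a) ((F.map x x).naturality f))

/-! ### Rigidification -/

namespace Rigid

/-- The simplicial category with object set `[n]` whose mapping space from `i` to `j` is the nerve
of the poset of subsets of `{i, …, j}` that contain `i` and `j`, composition being the union. -/
abbrev Simplex (n : ℕ) : Type := SimplicialThickening (Fin (n + 1))

/-- The mapping space from `i` to `j` in the simplicial category of the `n`-simplex. -/
abbrev Cube {n : ℕ} (i j : Fin (n + 1)) : SSet.{0} :=
  SimplicialThickening.mk i ⟶[SSet.{0}] SimplicialThickening.mk j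

/-- The map of mapping spaces induced by a monotone map of vertices. -/
abbrev Cube.map {n n' : ℕ} (α : ⦋n⦌ ⟶ ⦋n'⦌) (i j : Fin (n + 1)) :
    Cube i j ⟶ Cube (α.toOrderHom i) (α.toOrderHom j) :=
  (SimplicialThickening.functor α.toOrderHom).map (.mk i) (.mk j)

variable (S : SSet.{u})

/-- The `i`-th vertex of an `n`-simplex. -/
def vertex {S : SSet.{u}} {n : ℕ} (σ : S.obj (op ⦋n⦌)) (i : Fin (n + 1)) : S.obj (op ⦋0⦌) :=
  S.map (SimplexCategory.const ⦋0⦌ ⦋n⦌ i).op σ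

/-- The generating `m`-simplices of the mapping space from `x` to `y`: an `m`-simplex of the mapping
space from `i` to `j` in the simplicial category of the `n`-simplex, for an `n`-simplex `σ` of `S`
whose `i`-th vertex is `x` and whose `j`-th vertex is `y`. -/
@[ext]
structure Gen (m : SimplexCategoryᵒᵖ) (x y : S.obj (op ⦋0⦌)) : Type u where
  n : ℕ
  σ : S.obj (op ⦋n⦌)
  i : Fin (n + 1)
  j : Fin (n + 1)
  c : (Cube i j).obj m
  src : vertex σ i = x
  tgt : vertex σ j = y

/-- Composable words in the generators. -/
inductive Word (m : SimplexCategoryᵒᵖ) : S.obj (op ⦋0⦌) → S.obj (op ⦋0⦌) → Type u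
  | nil (x : S.obj (op ⦋0⦌)) : Word m x x
  | cons {x y z : S.obj (op ⦋0⦌)} (g : Gen S m x y) (w : Word m y z) : Word m x z

variable {S}

/-- The relations of the colimit: the identities and the composites are those of the simplicial
categories of the simplices, and the generators are compatible with the simplicial operators. -/
inductive Rel {m : SimplexCategoryᵒᵖ} : {x y : S.obj (op ⦋0⦌)} → Word S m x y → Word S m x y → Prop
  | id {x y : S.obj (op ⦋0⦌)} {n : ℕ} (σ : S.obj (op ⦋n⦌)) (i : Fin (n + 1))
      (hi : vertex σ i = x) (w : Word S m x y) :
      Rel (.cons ⟨n, σ, i, i, sid (SimplicialThickening.mk i) m, hi, hi⟩ w) w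
  | comp {x y z t : S.obj (op ⦋0⦌)} {n : ℕ} (σ : S.obj (op ⦋n⦌)) (i j l : Fin (n + 1))
      (c : (Cube i j).obj m) (c' : (Cube j l).obj m) (hi : vertex σ i = x) (hj : vertex σ j = y)
      (hl : vertex σ l = z) (w : Word S m z t) :
      Rel (.cons ⟨n, σ, i, j, c, hi, hj⟩ (.cons ⟨n, σ, j, l, c', hj, hl⟩ w))
        (.cons ⟨n, σ, i, l, scomp c c', hi, hl⟩ w)
  | operator {x y z : S.obj (op ⦋0⦌)} {n n' : ℕ} (α : ⦋n'⦌ ⟶ ⦋n⦌) (σ : S.obj (op ⦋n⦌))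
      (i j : Fin (n' + 1)) (c : (Cube i j).obj m)
      (hi : vertex (S.map α.op σ) i = x) (hj : vertex (S.map α.op σ) j = y)
      (hi' : vertex σ (α.toOrderHom i) = x) (hj' : vertex σ (α.toOrderHom j) = y)
      (w : Word S m y z) :
      Rel (.cons ⟨n', S.map α.op σ, i, j, c, hi, hj⟩ w)
        (.cons ⟨n, σ, α.toOrderHom i, α.toOrderHom j, (Cube.map α i j).app m c, hi', hj'⟩ w)
  | cons {x y z : S.obj (op ⦋0⦌)} (g : Gen S m x y) {w w' : Word S m y z} (h : Rel w w') :
      Rel (.cons g w) (.cons g w')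

/-- The action of the simplicial operators on generators. -/
def Gen.map {m m' : SimplexCategoryᵒᵖ} (f : m ⟶ m') {x y : S.obj (op ⦋0⦌)} (g : Gen S m x y) :
    Gen S m' x y :=
  ⟨g.n, g.σ, g.i, g.j, (Cube g.i g.j).map f g.c, g.src, g.tgt⟩

/-- The action of the simplicial operators on words. -/
def Word.map {m m' : SimplexCategoryᵒᵖ} (f : m ⟶ m') :
    {x y : S.obj (op ⦋0⦌)} → Word S m x y → Word S m' x y
  | _, _, .nil x => .nil x
  | _, _, .cons g w => .cons (g.map f) (w.map f)

/-- The composite of words. -/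
def Word.append {m : SimplexCategoryᵒᵖ} :
    {x y z : S.obj (op ⦋0⦌)} → Word S m x y → Word S m y z → Word S m x z
  | _, _, _, .nil _, w' => w'
  | _, _, _, .cons g w, w' => .cons g (w.append w')

theorem Rel.map {m m' : SimplexCategoryᵒᵖ} (f : m ⟶ m') {x y : S.obj (op ⦋0⦌)} {w w' : Word S m x y}
    (h : Rel w w') : Rel (w.map f) (w'.map f) := by
  induction h with
  | id σ i hi w =>
    have := Rel.id (m := m') σ i hi (w.map f)
    rwa [← map_sid _ f] at this
  | comp σ i j l c c' hi hj hl w =>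
    have := Rel.comp σ i j l ((Cube i j).map f c) ((Cube j l).map f c') hi hj hl (w.map f)
    rwa [← map_scomp] at this
  | operator α σ i j c hi hj hi' hj' w =>
    have := Rel.operator α σ i j ((Cube i j).map f c) hi hj hi' hj' (w.map f)
    rwa [show (Cube.map α i j).app m' ((Cube i j).map f c) = _ from
      NatTrans.naturality_apply (Cube.map α i j) f c] at this
  | cons g _ ih => exact .cons _ ih

theorem Rel.append_left {m : SimplexCategoryᵒᵖ} {x y z : S.obj (op ⦋0⦌)} {w w' : Word S m x y}
    (h : Rel w w') (v : Word S m y z) : Rel (w.append v) (w'.append v) := by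
  induction h with
  | id σ i hi w => exact .id σ i hi _
  | comp σ i j l c c' hi hj hl w => exact .comp σ i j l c c' hi hj hl _
  | operator α σ i j c hi hj hi' hj' w => exact .operator α σ i j c hi hj hi' hj' _
  | cons g _ ih => exact .cons g (ih v)

theorem Rel.append_right {m : SimplexCategoryᵒᵖ} {x y z : S.obj (op ⦋0⦌)} (w : Word S m x y)
    {v v' : Word S m y z} (h : Rel v v') : Rel (w.append v) (w.append v') := by
  induction w with
  | nil _ => exact h
  | cons g _ ih => exact .cons g (ih h)

theorem Word.append_nil {m : SimplexCategoryᵒᵖ} {x y : S.obj (op ⦋0⦌)} (w : Word S m x y) :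
    w.append (.nil y) = w := by
  induction w with
  | nil _ => rfl
  | cons g _ ih => rw [Word.append, ih]

theorem Word.append_assoc {m : SimplexCategoryᵒᵖ} {x y z t : S.obj (op ⦋0⦌)} (w : Word S m x y)
    (w' : Word S m y z) (w'' : Word S m z t) :
    (w.append w').append w'' = w.append (w'.append w'') := by
  induction w with
  | nil _ => rfl
  | cons g _ ih => rw [Word.append, Word.append, Word.append, ih]

theorem Word.map_append {m m' : SimplexCategoryᵒᵖ} (f : m ⟶ m') {x y z : S.obj (op ⦋0⦌)}
    (w : Word S m x y) (w' : Word S m y z) :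
    (w.append w').map f = (w.map f).append (w'.map f) := by
  induction w with
  | nil _ => rfl
  | cons g _ ih => rw [Word.append, Word.map, Word.map, Word.append, ih]

theorem Word.map_id {m : SimplexCategoryᵒᵖ} {x y : S.obj (op ⦋0⦌)} (w : Word S m x y) :
    w.map (𝟙 m) = w := by
  induction w with
  | nil _ => rfl
  | cons g _ ih =>
    rw [Word.map, ih, Gen.map]
    congr 1

theorem Word.map_comp {m m' m'' : SimplexCategoryᵒᵖ} (f : m ⟶ m') (f' : m' ⟶ m'')
    {x y : S.obj (op ⦋0⦌)} (w : Word S m x y) : w.map (f ≫ f') = (w.map f).map f' := by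
  induction w with
  | nil _ => rfl
  | cons g _ ih =>
    rw [Word.map, Word.map, Word.map, ih]
    congr 1
/-- The mapping spaces of the rigidification of `S`: words modulo the equivalence relation generated
by the relations. -/
def mapping (x y : S.obj (op ⦋0⦌)) : SSet.{u} where
  obj m := Quot (Rel (S := S) (m := m) (x := x) (y := y))
  map f := ↾(Quot.map (Word.map f) fun _ _ h => h.map f)
  map_id m := by
    ext ⟨w⟩
    exact congrArg (Quot.mk _) w.map_id
  map_comp f g := by
    ext ⟨w⟩
    exact congrArg (Quot.mk _) (w.map_comp f g)

/-- Composition in the rigidification of `S`: concatenation of words. -/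
def mcomp {m : SimplexCategoryᵒᵖ} {x y z : S.obj (op ⦋0⦌)} (a : (mapping x y).obj m)
    (b : (mapping y z).obj m) : (mapping x z).obj m :=
  Quot.map₂ Word.append (fun w _ _ h => h.append_right w) (fun _ _ v h => h.append_left v) a b

end Rigid

/-- The rigidification of `S`, the simplicial category `colim 𝔠(Δⁿ)` over the simplices of `S`, by
generators and relations. Its objects are the vertices of `S`. -/
structure Rigid (S : SSet.{u}) where
  as : S.obj (op ⦋0⦌)

namespace Rigid

instance (S : SSet.{u}) : EnrichedCategory SSet.{u} (Rigid S) where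
  Hom x y := mapping x.as y.as
  id x :=
    { app := fun m => ↾fun _ => Quot.mk _ (.nil x.as)
      naturality := fun _ _ _ => rfl }
  comp x y z :=
    { app := fun m => ↾fun ab : _ × _ => mcomp ab.1 ab.2
      naturality := fun m m' f => by
        ext ⟨⟨a⟩, ⟨b⟩⟩
        exact congrArg (Quot.mk _) (Word.map_append f a b).symm }
  id_comp x y := by
    ext m ⟨a⟩
    rfl
  comp_id x y := by
    ext m ⟨a⟩
    exact congrArg (Quot.mk _) a.append_nil
  assoc x y z t := by
    ext m ⟨⟨a⟩, ⟨b⟩, ⟨c⟩⟩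
    exact congrArg (Quot.mk _) (a.append_assoc b c)

end Rigid

namespace Rigid

variable {S T U : SSet.{u}}

theorem vertex_app (F : S ⟶ T) {n : ℕ} (σ : S.obj (op ⦋n⦌)) (i : Fin (n + 1)) :
    vertex (F.app _ σ) i = F.app _ (vertex σ i) :=
  (NatTrans.naturality_apply F (SimplexCategory.const ⦋0⦌ ⦋n⦌ i).op σ).symm

/-- The effect of a map of simplicial sets on generators. -/
def Gen.push (F : S ⟶ T) {m : SimplexCategoryᵒᵖ} {x y : S.obj (op ⦋0⦌)} (g : Gen S m x y) :
    Gen T m (F.app _ x) (F.app _ y) :=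
  ⟨g.n, F.app _ g.σ, g.i, g.j, g.c, (vertex_app F _ _).trans (congrArg _ g.src),
    (vertex_app F _ _).trans (congrArg _ g.tgt)⟩

/-- The effect of a map of simplicial sets on words. -/
def Word.push (F : S ⟶ T) {m : SimplexCategoryᵒᵖ} :
    {x y : S.obj (op ⦋0⦌)} → Word S m x y → Word T m (F.app _ x) (F.app _ y)
  | _, _, .nil x => .nil _
  | _, _, .cons g w => .cons (g.push F) (w.push F)

theorem Gen.ext_σ {m : SimplexCategoryᵒᵖ} {x y : S.obj (op ⦋0⦌)} {n : ℕ} {σ σ' : S.obj (op ⦋n⦌)}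
    (h : σ = σ') {i j : Fin (n + 1)} (c : (Cube i j).obj m) (hi : vertex σ i = x)
    (hj : vertex σ j = y) (hi' : vertex σ' i = x) (hj' : vertex σ' j = y) :
    (⟨n, σ, i, j, c, hi, hj⟩ : Gen S m x y) = ⟨n, σ', i, j, c, hi', hj'⟩ := by
  subst h; rfl

theorem Rel.push (F : S ⟶ T) {m : SimplexCategoryᵒᵖ} {x y : S.obj (op ⦋0⦌)} {w w' : Word S m x y}
    (h : Rel w w') : Rel (w.push F) (w'.push F) := by
  induction h with
  | id σ i hi w => exact .id (F.app _ σ) i _ _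
  | comp σ i j l c c' hi hj hl w =>
    exact .comp (F.app _ σ) i j l c c' _ ((vertex_app F _ _).trans (congrArg _ hj)) _ _
  | operator α σ i j c hi hj hi' hj' w =>
    have hn := NatTrans.naturality_apply F α.op σ
    have h1 := (vertex_app F (S.map α.op σ) i).trans (congrArg _ hi)
    have h2 := (vertex_app F (S.map α.op σ) j).trans (congrArg _ hj)
    have := Rel.operator α (F.app _ σ) i j c (hn ▸ h1) (hn ▸ h2)
      ((vertex_app F _ _).trans (congrArg _ hi')) ((vertex_app F _ _).trans (congrArg _ hj'))
      (w.push F)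
    rwa [Gen.ext_σ hn.symm c (hn ▸ h1) (hn ▸ h2) h1 h2] at this
  | cons g _ ih => exact .cons _ ih

theorem Word.push_map (F : S ⟶ T) {m m' : SimplexCategoryᵒᵖ} (f : m ⟶ m') {x y : S.obj (op ⦋0⦌)}
    (w : Word S m x y) : (w.map f).push F = (w.push F).map f := by
  induction w with
  | nil _ => rfl
  | cons g _ ih => rw [Word.push, Word.map, Word.map, Word.push, ih]; rfl

theorem Word.push_append (F : S ⟶ T) {m : SimplexCategoryᵒᵖ} {x y z : S.obj (op ⦋0⦌)}
    (w : Word S m x y) (w' : Word S m y z) :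
    (w.append w').push F = (w.push F).append (w'.push F) := by
  induction w with
  | nil _ => rfl
  | cons g _ ih => rw [Word.push, Word.append, Word.append, Word.push, ih]

/-- The simplicial functor between rigidifications induced by a map of simplicial sets. -/
def functor (F : S ⟶ T) : EnrichedFunctor SSet.{u} (Rigid S) (Rigid T) where
  obj x := ⟨F.app _ x.as⟩
  map x y :=
    { app := fun m => ↾(Quot.map (Word.push F) fun _ _ h => h.push F)
      naturality := fun m m' f => by
        ext ⟨w⟩
        exact congrArg (Quot.mk _) (w.push_map F f) }
  map_id x := rfl
  map_comp x y z := by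
    ext m ⟨⟨a⟩, ⟨b⟩⟩
    exact congrArg (Quot.mk _) (a.push_append F b)

theorem Word.push_id {m : SimplexCategoryᵒᵖ} {x y : S.obj (op ⦋0⦌)} (w : Word S m x y) :
    w.push (𝟙 S) = w := by
  induction w with
  | nil _ => rfl
  | cons g _ ih => rw [Word.push, ih]; rfl

theorem Word.push_comp (F : S ⟶ T) (G : T ⟶ U) {m : SimplexCategoryᵒᵖ} {x y : S.obj (op ⦋0⦌)}
    (w : Word S m x y) : w.push (F ≫ G) = (w.push F).push G := by
  induction w with
  | nil _ => rfl
  | cons g _ ih => rw [Word.push, Word.push, Word.push, ih]; rfl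

theorem functor_id (S : SSet.{u}) : functor (𝟙 S) = EnrichedFunctor.id SSet.{u} (Rigid S) := by
  refine EnrichedFunctor.ext _ (fun _ => rfl) fun x y => ?_
  ext m ⟨w⟩
  exact congrArg (Quot.mk _) w.push_id

theorem functor_comp (F : S ⟶ T) (G : T ⟶ U) :
    functor (F ≫ G) = (functor F).comp SSet.{u} (functor G) := by
  refine EnrichedFunctor.ext _ (fun _ => rfl) fun x y => ?_
  ext m ⟨w⟩
  exact congrArg (Quot.mk _) (w.push_comp F G)

end Rigid

theorem endMonoidMap_id {C : Type u₁} [EnrichedCategory SSet.{u} C] (x : C)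
    (F : EnrichedFunctor SSet.{u} C C) (hF : F = EnrichedFunctor.id SSet.{u} C) (h : F.obj x = x) :
    endMonoidMap F h = 𝟙 (endMonoid C x) := by
  subst hF; rfl

theorem endMonoidMap_comp {C D E : Type u₁} [EnrichedCategory SSet.{u} C]
    [EnrichedCategory SSet.{u} D] [EnrichedCategory SSet.{u} E] {x : C} {y : D} {z : E}
    (F : EnrichedFunctor SSet.{u} C D) (G : EnrichedFunctor SSet.{u} D E)
    (K : EnrichedFunctor SSet.{u} C E) (hK : K = F.comp SSet.{u} G) (hF : F.obj x = y)
    (hG : G.obj y = z) (h : K.obj x = z) :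
    endMonoidMap K h = endMonoidMap F hF ≫ endMonoidMap G hG := by
  subst hK hF hG; rfl

/-! ### The universal property of the rigidification -/

namespace Rigid

variable {S : SSet.{0}}

theorem vertex_operator {n n' : ℕ} (α : ⦋n'⦌ ⟶ ⦋n⦌) (σ : S.obj (op ⦋n⦌)) (i : Fin (n' + 1)) :
    vertex (S.map α.op σ) i = vertex σ (α.toOrderHom i) := by
  rw [vertex, vertex, ← Functor.map_comp_apply, ← op_comp, SimplexCategory.const_comp]

/-- The coprojection of the simplicial category of a simplex into the rigidification. -/
def ι {n : ℕ} (σ : S.obj (op ⦋n⦌)) : EnrichedFunctor SSet.{0} (Simplex n) (Rigid S) where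
  obj i := ⟨vertex σ i.as⟩
  map i j :=
    { app := fun m => ↾fun c => Quot.mk _ (.cons ⟨n, σ, i.as, j.as, c, rfl, rfl⟩ (.nil _))
      naturality := fun m m' f => by ext c; rfl }
  map_id i := by
    ext m c
    exact Quot.sound (.id σ i.as rfl _)
  map_comp i j l := by
    ext m ⟨c, c'⟩
    exact (Quot.sound (.comp σ i.as j.as l.as c c' rfl rfl rfl _)).symm

section cast

variable {D : Type u₁} [EnrichedCategory SSet.{0} D]

/-- Transport of simplices of mapping spaces. -/
def castHom {a b a' b' : D} (ha : a = a') (hb : b = b') {m : SimplexCategoryᵒᵖ}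
    (c : (a ⟶[SSet.{0}] b).obj m) : (a' ⟶[SSet.{0}] b').obj m :=
  ha ▸ hb ▸ c

theorem castHom_scomp {a b e a' b' e' : D} (ha : a = a') (hb : b = b') (he : e = e')
    {m : SimplexCategoryᵒᵖ} (c : (a ⟶[SSet.{0}] b).obj m) (c' : (b ⟶[SSet.{0}] e).obj m) :
    castHom ha he (scomp c c') = scomp (castHom ha hb c) (castHom hb he c') := by
  subst ha hb he; rfl

theorem castHom_sid {a a' : D} (ha : a = a') (m : SimplexCategoryᵒᵖ) :
    castHom ha ha (sid a m) = sid a' m := by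
  subst ha; rfl

theorem castHom_map {a b a' b' : D} (ha : a = a') (hb : b = b') {m m' : SimplexCategoryᵒᵖ}
    (f : m ⟶ m') (c : (a ⟶[SSet.{0}] b).obj m) :
    castHom ha hb ((a ⟶[SSet.{0}] b).map f c) = (a' ⟶[SSet.{0}] b').map f (castHom ha hb c) := by
  subst ha hb; rfl

theorem castHom_functor {C : Type u₂} [EnrichedCategory SSet.{0} C]
    {F F' : EnrichedFunctor SSet.{0} C D} (h : F = F') {x y : C} {a b : D} (ha : F.obj x = a)
    (hb : F.obj y = b) (ha' : F'.obj x = a) (hb' : F'.obj y = b) {m : SimplexCategoryᵒᵖ}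
    (c : (x ⟶[SSet.{0}] y).obj m) :
    castHom ha hb ((F.map x y).app m c) = castHom ha' hb' ((F'.map x y).app m c) := by
  subst h; rfl

theorem castHom_castHom {a b a' b' a'' b'' : D} (ha : a = a') (hb : b = b') (ha' : a' = a'')
    (hb' : b' = b'') {m : SimplexCategoryᵒᵖ} (c : (a ⟶[SSet.{0}] b).obj m) :
    castHom ha' hb' (castHom ha hb c) = castHom (ha.trans ha') (hb.trans hb') c := by
  subst ha hb ha' hb'; rfl

theorem functor_ext {C : Type u₂} [EnrichedCategory SSet.{0} C]
    {F F' : EnrichedFunctor SSet.{0} C D} (h : ∀ x, F.obj x = F'.obj x)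
    (h' : ∀ (x y : C) (m : SimplexCategoryᵒᵖ) (c : (x ⟶[SSet.{0}] y).obj m),
      castHom (h x) (h y) ((F.map x y).app m c) = (F'.map x y).app m c) : F = F' := by
  obtain ⟨o, mp, hi, hc⟩ := F
  obtain ⟨o', mp', hi', hc'⟩ := F'
  obtain rfl : o = o' := funext h
  congr
  funext x y
  ext m c
  exact h' x y m c

end cast

variable {D : Type u₁} [EnrichedCategory SSet.{0} D]

theorem obj_eq
  (G : ∀ {n : ℕ}, S.obj (op ⦋n⦌) → EnrichedFunctor SSet.{0} (Simplex n) D)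
  (hG : ∀ {n n' : ℕ} (α : ⦋n'⦌ ⟶ ⦋n⦌) (σ : S.obj (op ⦋n⦌)),
    (SimplicialThickening.functor α.toOrderHom).comp SSet.{0} (G σ) = G (S.map α.op σ))
    {n : ℕ} (σ : S.obj (op ⦋n⦌)) (i : Fin (n + 1)) {x : S.obj (op ⦋0⦌)}
    (h : vertex σ i = x) : (G σ).obj ⟨i⟩ = (G x).obj ⟨0⟩ := by
  subst h
  exact congrArg (fun F => F.obj ⟨(0 : Fin 1)⟩) (hG (SimplexCategory.const ⦋0⦌ ⦋n⦌ i) σ)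

section eval

variable (G : ∀ {n : ℕ}, S.obj (op ⦋n⦌) → EnrichedFunctor SSet.{0} (Simplex n) D)
  (hG : ∀ {n n' : ℕ} (α : ⦋n'⦌ ⟶ ⦋n⦌) (σ : S.obj (op ⦋n⦌)),
    (SimplicialThickening.functor α.toOrderHom).comp SSet.{0} (G σ) = G (S.map α.op σ))

/-- The value of a compatible family of simplicial functors on a generator. -/
def evalGen {m : SimplexCategoryᵒᵖ} {x y : S.obj (op ⦋0⦌)} (g : Gen S m x y) :
    ((G x).obj ⟨0⟩ ⟶[SSet.{0}] (G y).obj ⟨0⟩).obj m :=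
  castHom (obj_eq G hG g.σ g.i g.src) (obj_eq G hG g.σ g.j g.tgt) (((G g.σ).map _ _).app m g.c)

/-- The value of a compatible family of simplicial functors on a word. -/
def evalWord {m : SimplexCategoryᵒᵖ} : {x y : S.obj (op ⦋0⦌)} → Word S m x y →
    ((G x).obj ⟨0⟩ ⟶[SSet.{0}] (G y).obj ⟨0⟩).obj m
  | _, _, .nil x => sid _ m
  | _, _, .cons g w => scomp (evalGen G hG g) (evalWord w)

theorem evalWord_rel {m : SimplexCategoryᵒᵖ} {x y : S.obj (op ⦋0⦌)} {w w' : Word S m x y}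
    (h : Rel w w') : evalWord G hG w = evalWord G hG w' := by
  induction h with
  | id σ i hi w =>
    rw [evalWord, evalGen]
    rw [functor_sid, castHom_sid, sid_scomp]
  | comp σ i j l c c' hi hj hl w =>
    simp only [evalWord, evalGen]
    rw [functor_scomp, castHom_scomp _ (obj_eq G hG σ j hj), scomp_assoc]
  | operator α σ i j c hi hj hi' hj' w =>
    simp only [evalWord, evalGen]
    congr 1
    exact castHom_functor (hG α σ).symm (x := ⟨i⟩) (y := ⟨j⟩) _ _ _ _ c
  | cons g _ ih => rw [evalWord, evalWord, ih]

theorem evalWord_map {m m' : SimplexCategoryᵒᵖ} (f : m ⟶ m') {x y : S.obj (op ⦋0⦌)}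
    (w : Word S m x y) : evalWord G hG (w.map f) =
      ((G x).obj ⟨0⟩ ⟶[SSet.{0}] (G y).obj ⟨0⟩).map f (evalWord G hG w) := by
  induction w with
  | nil _ => exact (map_sid _ f).symm
  | cons g w ih =>
    rw [Word.map, evalWord, evalWord, ih, map_scomp]
    congr 1
    rw [evalGen, evalGen, ← castHom_map]
    congr 1
    exact NatTrans.naturality_apply ((G g.σ).map _ _) f g.c

theorem evalWord_append {m : SimplexCategoryᵒᵖ} {x y z : S.obj (op ⦋0⦌)} (w : Word S m x y)
    (w' : Word S m y z) : evalWord G hG (w.append w') =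
      scomp (evalWord G hG w) (evalWord G hG w') := by
  induction w with
  | nil _ => exact (sid_scomp _).symm
  | cons g w ih => rw [Word.append, evalWord, evalWord, ih, scomp_assoc]

/-- The simplicial functor determined by a compatible family of simplicial functors. -/
def desc : EnrichedFunctor SSet.{0} (Rigid S) D where
  obj x := (G x.as).obj ⟨0⟩
  map x y :=
    { app := fun m => ↾(Quot.lift (evalWord G hG) fun _ _ h => evalWord_rel G hG h)
      naturality := fun m m' f => by
        ext ⟨w⟩
        exact evalWord_map G hG f w }
  map_id x := rfl
  map_comp x y z := by
    ext m ⟨⟨a⟩, ⟨b⟩⟩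
    exact evalWord_append G hG a b

end eval

/-- The coprojections are compatible with the simplicial operators. -/
theorem ι_operator {n n' : ℕ} (α : ⦋n'⦌ ⟶ ⦋n⦌) (σ : S.obj (op ⦋n⦌)) :
    (SimplicialThickening.functor α.toOrderHom).comp SSet.{0} (ι σ) = ι (S.map α.op σ) := by
  refine (functor_ext (fun i => congrArg Rigid.mk (vertex_operator α σ i.as)) ?_).symm
  intro i j m c
  have key : ∀ {a b a' b' : S.obj (op ⦋0⦌)} (ha : a = a') (hb : b = b') {n : ℕ}
      (τ : S.obj (op ⦋n⦌)) (i j : Fin (n + 1)) (c : (Cube i j).obj m) (hi : vertex τ i = a)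
      (hj : vertex τ j = b), castHom (D := Rigid S) (congrArg Rigid.mk ha) (congrArg Rigid.mk hb)
        (Quot.mk _ (.cons ⟨n, τ, i, j, c, hi, hj⟩ (.nil _)) : (mapping a b).obj m) =
        (Quot.mk _ (.cons ⟨n, τ, i, j, c, hi.trans ha, hj.trans hb⟩ (.nil _)) :
          (mapping a' b').obj m) := by
    intro a b a' b' ha hb n τ i j c hi hj
    subst ha hb; rfl
  refine (key (vertex_operator α σ i.as) (vertex_operator α σ j.as) (S.map α.op σ) i.as j.as c
    rfl rfl).trans ?_
  exact Quot.sound (.operator α σ i.as j.as c _ _ rfl rfl _)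

/-- The rigidification, with the coprojections `ι σ`, is the colimit of the simplicial categories of
the simplices of `S`. (Both sides live in the same universe here only because the simplicial category
of a simplex is enriched in simplicial sets in universe `0`.) -/
theorem existsUnique_desc
  (G : ∀ {n : ℕ}, S.obj (op ⦋n⦌) → EnrichedFunctor SSet.{0} (Simplex n) D)
  (hG : ∀ {n n' : ℕ} (α : ⦋n'⦌ ⟶ ⦋n⦌) (σ : S.obj (op ⦋n⦌)),
    (SimplicialThickening.functor α.toOrderHom).comp SSet.{0} (G σ) = G (S.map α.op σ)) :
    ∃! F : EnrichedFunctor SSet.{0} (Rigid S) D,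
    ∀ {n : ℕ} (σ : S.obj (op ⦋n⦌)), (ι σ).comp SSet.{0} F = G σ := by
  refine ⟨desc G hG, ?_, ?_⟩
  · intro n σ
    refine functor_ext (fun i => (obj_eq G hG σ i.as rfl).symm) ?_
    intro i j m c
    have h1 : ((((ι σ).comp SSet.{0} (desc G hG)).map i j).app m c) =
        castHom (obj_eq G hG σ i.as rfl) (obj_eq G hG σ j.as rfl) (((G σ).map i j).app m c) :=
      scomp_sid _
    exact (congrArg (castHom _ _) h1).trans (castHom_castHom _ _ _ _ _)
  · intro F hF
    have hobj : ∀ x, F.obj x = (G x.as).obj ⟨0⟩ := fun x => by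
      have := congrArg (fun F => F.obj ⟨(0 : Fin 1)⟩) (hF x.as)
      refine Eq.trans ?_ this
      change F.obj x = F.obj ⟨vertex x.as 0⟩
      congr 1
      obtain ⟨x⟩ := x
      congr 1
      rw [vertex, show SimplexCategory.const ⦋0⦌ ⦋0⦌ 0 = 𝟙 _ from Subsingleton.elim _ _, op_id,
        S.map_id]
      rfl
    refine functor_ext hobj ?_
    rintro ⟨x⟩ ⟨y⟩ m ⟨w⟩
    suffices H : ∀ {x y : S.obj (op ⦋0⦌)} (w : Word S m x y),
        castHom (hobj ⟨x⟩) (hobj ⟨y⟩) ((F.map (⟨x⟩ : Rigid S) ⟨y⟩).app m (Quot.mk _ w)) =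
          ((desc G hG).map ⟨x⟩ ⟨y⟩).app m (Quot.mk _ w) from H w
    intro x y w
    induction w with
    | nil x =>
      exact (congrArg (castHom _ _) (functor_sid F (⟨x⟩ : Rigid S) m)).trans (castHom_sid _ _)
    | @cons x y z g w ih =>
      have h1 : (Quot.mk _ (.cons g w) : ((⟨x⟩ : Rigid S) ⟶[SSet.{0}] (⟨z⟩ : Rigid S)).obj m) =
          scomp (x := (⟨x⟩ : Rigid S)) (y := (⟨y⟩ : Rigid S)) (z := (⟨z⟩ : Rigid S))
            (Quot.mk _ (.cons g (.nil _)) : (mapping x y).obj m)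
            (Quot.mk _ w : (mapping y z).obj m) := rfl
      rw [h1]
      refine (congrArg (castHom _ _) (functor_scomp F _ _)).trans ?_
      rw [castHom_scomp _ (hobj ⟨y⟩), ih]
      refine Eq.trans ?_ (functor_scomp (desc G hG) (x := (⟨x⟩ : Rigid S)) (y := (⟨y⟩ : Rigid S))
        (z := (⟨z⟩ : Rigid S)) _ _).symm
      congr 1
      obtain ⟨n, σ, i, j, c, rfl, rfl⟩ := g
      refine (castHom_functor (hF σ) (x := ⟨i⟩) (y := ⟨j⟩) _ _ (obj_eq G hG σ i rfl)
        (obj_eq G hG σ j rfl) c).trans ?_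
      exact (scomp_sid _).symm

end Rigid

/-! ### The two functors -/

/-- The simplicial monoid `𝔠(S)(x, x)` of a `0`-reduced simplicial set `S` with vertex `x`. -/
def loopMonoid : ReducedSSet.{u} ⥤ SimplicialObject MonCat.{u} where
  obj S := endMonoid (Rigid S.toSSet) ⟨S.vertex⟩
  map {S T} f := endMonoidMap (Rigid.functor (S := S.toSSet) (T := T.toSSet) f)
    (congrArg Rigid.mk (T.eq_vertex _))
  map_id S := endMonoidMap_id _ _ (Rigid.functor_id S.toSSet) _
  map_comp {S T U} f g := endMonoidMap_comp _ _ _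
    (Rigid.functor_comp (S := S.toSSet) (T := T.toSSet) (U := U.toSSet) f g) _ _ _

/-- The differential graded algebra `Γ(S)(x, x)` of normalized chains on the simplicial monoid
`𝔠(S)(x, x)`, for a `0`-reduced simplicial set `S` with vertex `x`. -/
noncomputable def loopChains (k : Type v) [CommRing k] :
    ReducedSSet.{u} ⥤ DGAlg.{v, max u v} k :=
  loopMonoid ⋙ normalizedChainsAlg k

end CobarRigid

/-! A single natural map from the cobar construction to the chains on the loop monoid is a
quasi-isomorphism, so the zigzag has length one.

The map. In `𝔠(Δⁿ⁺¹)` the mapping space from the first to the last vertex is a cube with one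
direction for each of the `n` interior vertices. Its fundamental chain is the shuffle product of the
edges `∅ ⊆ {b}`, `b = 1, …, n`; pushed forward along an `(n + 1)`-simplex `σ` it becomes the
`n`-chain `cube k σ`. The Leibniz rule gives the boundary (`d_cube`): where the vertex `b` always
lies on the path, one finds the product of the cubes of a front face and a back face; where `b` is
absent, one finds the cube of the inner face opposite to `b`. This is the cobar differential except
for the two outer faces. They are produced by subtracting the unit from the cubes of edges, a
correction that also makes degenerate edges go to zero. With signs, this is the twisting cochain
`twist` (`d_twist_eq`).

Normal forms. To every vertex of a flag one attaches the index at which it enters: label `0` means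
that the path can be cut there (a joint), and a label beyond the last index means that the vertex is
absent. Cutting at joints, dropping absent vertices and passing to nondegenerate simplices writes
every simplex of the loop monoid uniquely as a sequence of nondegenerate cells with positive finite
labels on their interior vertices (`exists_realize`, `nf_realize`). An `m`-simplex is nondegenerate
exactly if all labels `1, …, m` occur.

Filtration. Chains are filtered by the number `p` of interior vertices. Inner faces merge two
neighbouring labels, outer faces lower `p`. Hence the associated graded complex is a sum, over the
sequences of cells with `p` interior vertices, of copies of the complex of ordered partitions of a
`p`-element set. A contracting homotopy that moves the first element shows that this complex is
exact below its top degree `p` (`OrdPart.exists_bd`), and that a cycle of degree `p` is determined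
by its coefficient at the partition `{1}, …, {p}` (`OrdPart.eq_zero_of_bd`).

Conclusion. Call an `n`-chain diagonal if it has at most `n` interior vertices and its boundary at
most `n - 1`. By exactness the diagonal chains compute the homology, and a diagonal chain is
determined by its coefficients at the simplices with label list `1, …, n` (`eq_zero_of_ev`). Reading
off these coefficients is an algebra map `ev` to the free algebra on the cells, because two label
lists combine to `1, …, p + q` under only one shuffle. Since `ev` sends `cube k x` to `x` for a cell
`x`, its composite with the map from the cobar construction is invertible, with inverse `ofWords`.
So the cobar construction maps bijectively onto the diagonal chains. -/

namespace CobarRigid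

/-! ### The complex of ordered set partitions -/

namespace OrdPart

/-- The monotone surjection of labels that identifies `l` and `l + 1`. -/
def merge (l a : ℕ) : ℕ := if a ≤ l then a else a - 1

/-- The monotone injection of labels that omits `j + 1`. -/
def up (j a : ℕ) : ℕ := if a ≤ j then a else a + 1

/-- Adds a new first element that forms a block of its own, after the block `j`. -/
def ins (j : ℕ) (G : List ℕ) : List ℕ := (j + 1) :: G.map (up j)

/-- After a singleton block has been inserted behind block `j`, two neighbouring blocks merge in one
of four ways: both lie before the new block, the new block is absorbed by its predecessor or by its
successor, or both lie behind it. In the outer two cases the result is again an insertion, into a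
face of the old list; the middle two are the terms that telescope in alternating sums. -/
theorem merge_ins_lt {l j : ℕ} (h : l < j) (G : List ℕ) :
    (ins j G).map (merge l) = ins (j - 1) (G.map (merge l)) := by
  simp only [ins, List.map_cons, List.map_map, List.cons.injEq, List.map_inj_left,
    Function.comp_apply, merge, up]
  refine ⟨by split_ifs <;> omega, fun a _ => by split_ifs <;> omega⟩

theorem merge_ins_self (j : ℕ) (G : List ℕ) : (ins j G).map (merge j) = j :: G := by
  simp only [ins, List.map_cons, List.map_map]
  congr 1
  · simp [merge]
  · exact List.map_id'' (fun a => by simp only [Function.comp_apply, merge, up]; split_ifs <;> omega) G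

theorem merge_ins_succ (j : ℕ) (G : List ℕ) : (ins j G).map (merge (j + 1)) = (j + 1) :: G := by
  simp only [ins, List.map_cons, List.map_map]
  congr 1
  · simp [merge]
  · exact List.map_id'' (fun a => by simp only [Function.comp_apply, merge, up]; split_ifs <;> omega) G

theorem merge_ins_gt {l j : ℕ} (h : j < l) (G : List ℕ) :
    (ins j G).map (merge (l + 1)) = ins j (G.map (merge l)) := by
  simp only [ins, List.map_cons, List.map_map, List.cons.injEq, List.map_inj_left,
    Function.comp_apply, merge, up]
  refine ⟨by split_ifs <;> omega, fun a _ => by split_ifs <;> omega⟩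

/-! ### The boundary of an alternating sum of insertions. -/

section sums

variable {W : Type*} [AddCommGroup W]

/-- The boundary of a sequence of `m` blocks. -/
def bdry (m : ℕ) (e : List ℕ → W) (L : List ℕ) : W :=
  ∑ l ∈ Finset.range (m - 1), (-1 : ℤ) ^ (l + 1) • e (L.map (merge (l + 1)))

/-- The alternating sum of the insertions of a new element after the block `i` or later. -/
def insSum (m i : ℕ) (e : List ℕ → W) (G : List ℕ) : W :=
  ∑ j ∈ Finset.range (m + 1), if i ≤ j then (-1 : ℤ) ^ j • e (ins j G) else 0

/-- Operators on the free module on lists are written against a test function `e`, so that they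
compose in reversed order: `insSum m i (bdry (m + 1) e) G` is `e` applied to the boundary of the
insertion sum. Here the inner faces of one insertion are sorted by the four cases of `merge`. The
exponent `j - 1 + (l + 1)` is chosen to match the insertion behind block `j - 1` that it multiplies,
so that both remaining families acquire the same overall minus sign. -/
theorem bdry_ins (m j : ℕ) (hj : j ≤ m) (e : List ℕ → W) (G : List ℕ) :
    (-1 : ℤ) ^ j • bdry (m + 1) e (ins j G) =
      ((if 1 ≤ j then e (j :: G) else 0) - if j < m then e ((j + 1) :: G) else 0) -
      (∑ l ∈ Finset.range (m - 1), (if l + 1 < j then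
          (-1 : ℤ) ^ (j - 1 + (l + 1)) • e (ins (j - 1) (G.map (merge (l + 1)))) else 0) +
      ∑ l ∈ Finset.range (m - 1), if j < l + 1 then
          (-1 : ℤ) ^ (j + (l + 1)) • e (ins j (G.map (merge (l + 1)))) else 0) := by
  simp only [bdry, Nat.add_sub_cancel, Finset.smul_sum, smul_smul, ← pow_add]
  rcases m with _ | m
  · obtain rfl : j = 0 := by omega
    simp
  have key : ∀ l ∈ Finset.range (m + 1), (-1 : ℤ) ^ (j + (l + 1)) • e ((ins j G).map (merge (l + 1))) =
      ((if l + 1 = j then e (j :: G) else 0) - (if l = j then e ((j + 1) :: G) else 0)) -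
      ((if l + 1 < j then
          (-1 : ℤ) ^ (j - 1 + (l + 1)) • e (ins (j - 1) (G.map (merge (l + 1)))) else 0) +
        if j < l then (-1 : ℤ) ^ (j + l) • e (ins j (G.map (merge l))) else 0) := by
    intro l _
    rcases lt_trichotomy (l + 1) j with h | h | h
    · rw [merge_ins_lt h, if_neg (by omega), if_neg (by omega), if_pos h, if_neg (by omega)]
      obtain ⟨j, rfl⟩ : ∃ j', j = j' + 1 := ⟨j - 1, by omega⟩
      simp only [Nat.add_sub_cancel]
      rw [show j + 1 + (l + 1) = (j + (l + 1)) + 1 by omega, pow_succ]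
      simp
    · subst h
      rw [merge_ins_self, if_pos rfl, if_neg (by omega), if_neg (by omega), if_neg (by omega)]
      simp [← two_mul]
    · rcases Nat.eq_or_lt_of_le (Nat.le_of_lt_succ h) with h | h
      · subst h
        rw [merge_ins_succ, if_neg (by omega), if_pos rfl, if_neg (by omega), if_neg (by omega)]
        rw [← add_assoc, pow_succ, ← two_mul]
        simp
      · rw [merge_ins_gt h, if_neg (by omega), if_neg (by omega), if_neg (by omega), if_pos h]
        rw [← add_assoc, pow_succ]
        simp
  rw [Finset.sum_congr rfl key, Finset.sum_sub_distrib, Finset.sum_sub_distrib,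
    Finset.sum_add_distrib]
  congr 1
  · congr 1
    · split_ifs with h
      · rw [Finset.sum_eq_single_of_mem (j - 1) (by simp; omega) (fun l _ hl => if_neg (by omega)),
          if_pos (by omega)]
      · exact Finset.sum_eq_zero fun l _ => if_neg (by omega)
    · simp
  · simp only [Nat.add_sub_cancel]
    congr 1
    · rw [Finset.sum_range_succ, if_neg (by omega), add_zero]
    · rw [Finset.sum_range_succ', if_neg (by omega), add_zero]

/-- Insertions behind blocks `j` and `j + 1` have a common face, in which the new element joins
block `j + 1`. With alternating signs these faces cancel in pairs, and only the lower end survives: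
the new element joins block `i`. For `i = 0` there is no such block. The other faces reassemble into
the insertion sums of the faces of `G`. -/
theorem bdry_insSum (m i : ℕ) (hi : i ≤ m) (e : List ℕ → W) (G : List ℕ) :
    insSum m i (bdry (m + 1) e) G = (if 1 ≤ i then e (i :: G) else 0) -
      ∑ l ∈ Finset.range (m - 1), (-1 : ℤ) ^ (l + 1) •
        insSum (m - 1) (merge (l + 1) i) e (G.map (merge (l + 1))) := by
  rcases m with _ | m
  · obtain rfl : i = 0 := by omega
    simp [insSum, bdry]
  have h1 : insSum (m + 1) i (bdry (m + 1 + 1) e) G = ∑ j ∈ Finset.range (m + 1 + 1),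
      ((if i ≤ j then ((if 1 ≤ j then e (j :: G) else 0) -
        if j < m + 1 then e ((j + 1) :: G) else 0) else 0) -
      (∑ l ∈ Finset.range m, (if i ≤ j ∧ l + 1 < j then
          (-1 : ℤ) ^ (j - 1 + (l + 1)) • e (ins (j - 1) (G.map (merge (l + 1)))) else 0) +
      ∑ l ∈ Finset.range m, if i ≤ j ∧ j < l + 1 then
          (-1 : ℤ) ^ (j + (l + 1)) • e (ins j (G.map (merge (l + 1)))) else 0)) := by
    refine Finset.sum_congr rfl fun j hj => ?_
    rw [Finset.mem_range] at hj
    by_cases h : i ≤ j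
    · simp only [h, if_true, true_and]
      rw [bdry_ins _ _ (by omega)]
      rfl
    · simp [h]
  rw [h1, Finset.sum_sub_distrib]
  congr 1
  · -- the telescoping part
    clear h1
    have : ∀ n, i ≤ n → n ≤ m + 1 → ∑ j ∈ Finset.range (n + 1),
        (if i ≤ j then ((if 1 ≤ j then e (j :: G) else 0) -
          if j < m + 1 then e ((j + 1) :: G) else 0) else 0) =
        (if 1 ≤ i then e (i :: G) else 0) - if n < m + 1 then e ((n + 1) :: G) else 0 := by
      intro n hn
      induction n, hn using Nat.le_induction with
      | base =>
        intro h
        rw [Finset.sum_range_succ, if_pos le_rfl, Finset.sum_eq_zero, zero_add]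
        intro j hj
        rw [Finset.mem_range] at hj
        exact if_neg (by omega)
      | succ n hn ih =>
        intro h
        rw [Finset.sum_range_succ, ih (by omega), if_pos (show n < m + 1 by omega),
          if_pos (show i ≤ n + 1 by omega), if_pos (show 1 ≤ n + 1 by omega)]
        abel
    rw [this (m + 1) hi le_rfl]
    simp
  · rw [Finset.sum_add_distrib, Finset.sum_comm,
      Finset.sum_comm (s := Finset.range (m + 1 + 1)) (t := Finset.range m), ← Finset.sum_add_distrib]
    refine Finset.sum_congr rfl fun l hl => ?_
    rw [Finset.mem_range] at hl
    -- The first family inserts behind block `j - 1`, so its index is shifted by one. Afterwards the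
    -- two families live on `l < j` and on `j ≤ l`, and together they meet each admissible insertion
    -- position of the merged list once.
    rw [Finset.sum_range_succ', if_neg (by omega), add_zero, Finset.sum_range_succ (n := m + 1),
      if_neg (by omega), add_zero, ← Finset.sum_add_distrib, insSum, Finset.smul_sum]
    refine Finset.sum_congr (by simp) fun j hj => ?_
    have hm : merge (l + 1) i = if i ≤ l + 1 then i else i - 1 := rfl
    simp only [Nat.add_sub_cancel, add_lt_add_iff_right]
    rw [smul_ite, smul_zero, smul_smul, ← pow_add, add_comm (l + 1) j]
    by_cases h1 : i ≤ j + 1 ∧ l < j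
    · rw [if_pos h1, if_neg (by omega), if_pos (by rw [hm]; split_ifs <;> omega), add_zero]
    · rw [if_neg h1, zero_add]
      by_cases h2 : i ≤ j ∧ j < l + 1
      · rw [if_pos h2, if_pos (by rw [hm]; split_ifs <;> omega)]
      · rw [if_neg h2, if_neg (by rw [hm]; split_ifs <;> omega)]

end sums

/-! ### Label lists of ordered set partitions. -/

/-- The lists of labels whose underlying set is `{1, …, m}`. -/
def Good (m : ℕ) (L : List ℕ) : Prop := ∀ a, a ∈ L ↔ 1 ≤ a ∧ a ≤ m

theorem Good.le_length {m : ℕ} {L : List ℕ} (h : Good m L) : m ≤ L.length := by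
  have : Finset.Icc 1 m ⊆ L.toFinset := fun a ha => by
    rw [List.mem_toFinset]; exact (h a).2 (Finset.mem_Icc.1 ha)
  simpa using (Finset.card_le_card this).trans L.toFinset_card_le

theorem Good.merge {m l : ℕ} {L : List ℕ} (h : Good m L) (h1 : 1 ≤ l) (hl : l < m) :
    Good (m - 1) (L.map (merge l)) := by
  intro a
  rw [List.mem_map]
  constructor
  · rintro ⟨b, hb, rfl⟩
    rw [h] at hb
    unfold OrdPart.merge
    split_ifs <;> omega
  · intro ha
    refine ⟨if a ≤ l then a else a + 1, ?_, ?_⟩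
    · rw [h]; split_ifs <;> omega
    · unfold OrdPart.merge; split_ifs <;> omega

theorem Good.ins {m j : ℕ} {G : List ℕ} (h : Good m G) (hj : j ≤ m) : Good (m + 1) (ins j G) := by
  intro a
  rw [OrdPart.ins, List.mem_cons, List.mem_map]
  constructor
  · rintro (rfl | ⟨b, hb, rfl⟩)
    · omega
    · rw [h] at hb
      unfold up
      split_ifs <;> omega
  · intro ha
    rcases lt_trichotomy a (j + 1) with h' | h' | h'
    · exact Or.inr ⟨a, (h a).2 (by omega), by unfold up; split_ifs <;> omega⟩
    · exact Or.inl h'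
    · exact Or.inr ⟨a - 1, (h _).2 (by omega), by unfold up; split_ifs <;> omega⟩

theorem Good.tail {m a : ℕ} {G : List ℕ} (h : Good m (a :: G)) (ha : a ∈ G) : Good m G := by
  intro b
  rw [← h, List.mem_cons]
  constructor
  · exact Or.inr
  · rintro (rfl | hb)
    · exact ha
    · exact hb

theorem Good.pred {m : ℕ} {G : List ℕ} (h : Good m (1 :: G)) (h1 : 1 ∉ G) :
    Good (m - 1) (G.map Nat.pred) := by
  intro b
  rw [List.mem_map]
  constructor
  · rintro ⟨c, hc, rfl⟩
    have h2 := (h c).1 (List.mem_cons_of_mem _ hc)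
    have : c ≠ 1 := by rintro rfl; exact h1 hc
    rw [Nat.pred_eq_sub_one]
    omega
  · intro hb
    refine ⟨b + 1, ?_, rfl⟩
    have := (h (b + 1)).2 (by omega)
    rw [List.mem_cons] at this
    exact this.resolve_left (by omega)

/-! ### The homotopy that isolates the first element. -/

section homotopy

variable {W : Type*} [AddCommGroup W]

/-- The contracting homotopy, moving the first element to the later positions. -/
def htpy (m : ℕ) (e : List ℕ → W) : List ℕ → W
  | [] => 0
  | a :: G => if a ∈ G then insSum m a e G else 0

/-- The removal of the first element, if it forms the first block. -/
def behead (e : List ℕ → W) : List ℕ → W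
  | [] => 0
  | a :: G => if a = 1 ∧ 1 ∉ G then e (G.map Nat.pred) else 0

theorem insSum_of_lt {m i : ℕ} (h : m < i) (e : List ℕ → W) (G : List ℕ) : insSum m i e G = 0 :=
  Finset.sum_eq_zero fun j hj => if_neg (by rw [Finset.mem_range] at hj; omega)

theorem insSum_succ {m i : ℕ} (h : i ≤ m) (e : List ℕ → W) (G : List ℕ) :
    insSum m i e G = (-1 : ℤ) ^ i • e (ins i G) + insSum m (i + 1) e G := by
  rw [insSum, insSum, ← Finset.sum_erase_add _ _ (show i ∈ Finset.range (m + 1) by simp; omega),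
    ← Finset.sum_erase_add (a := i) _ (fun j => if i + 1 ≤ j then _ else _) (by simp; omega),
    if_pos le_rfl, if_neg (by omega), add_zero, add_comm]
  congr 1
  refine Finset.sum_congr rfl fun j hj => ?_
  rw [Finset.mem_erase] at hj
  exact if_congr (by omega) rfl rfl

/-- If the first element shares its block, `bdry_insSum` yields the list itself, and its remaining
sum cancels the homotopy of the boundary, since the first element keeps its companion under every
merge. If the first element is alone, the homotopy vanishes on the list, and only the merges of its
block with the successor and with the predecessor contribute. They give insertion sums starting at
`a` and at `a - 1` with opposite signs, whose difference is the one insertion that restores the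
list. For `a = 1` there is no predecessor; the missing full insertion sum is the term with `behead`.
-/
theorem htpy_bdry {m : ℕ} (e : List ℕ → W) {a : ℕ} {G : List ℕ} (h : Good m (a :: G)) :
    htpy m (bdry (m + 1) e) (a :: G) + bdry m (htpy (m - 1) e) (a :: G) =
      e (a :: G) - behead (insSum (m - 1) 0 e) (a :: G) := by
  have ham := (h a).1 List.mem_cons_self
  by_cases ha : a ∈ G
  · rw [htpy, if_pos ha, bdry_insSum m a ham.2, if_pos ham.1, behead, if_neg (by
      rintro ⟨rfl, h'⟩; exact h' ha), bdry]
    simp only [List.map_cons, htpy, if_pos (List.mem_map_of_mem ha)]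
    abel
  · rw [htpy, if_neg ha, zero_add, bdry]
    -- No other element has label `a`, so closing the gap at `a` from above or from below is the
    -- same on `G`.
    have hG : G.map (merge a) = G.map (merge (a - 1)) := by
      refine List.map_congr_left fun b hb => ?_
      have : b ≠ a := by rintro rfl; exact ha hb
      unfold merge; split_ifs <;> omega
    have hins : ins (a - 1) (G.map (merge a)) = a :: G := by
      rw [ins, List.map_map, Nat.sub_add_cancel ham.1]
      congr 1
      conv_rhs => rw [← List.map_id G]
      refine List.map_congr_left fun b hb => ?_
      have : b ≠ a := by rintro rfl; exact ha hb
      simp only [Function.comp_apply, merge, up, id]; split_ifs <;> omega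
    -- Every merge that does not involve block `a` leaves the first element alone, and the homotopy
    -- kills it.
    have key : ∀ l ∈ Finset.range (m - 1), (-1 : ℤ) ^ (l + 1) •
        htpy (m - 1) e ((a :: G).map (merge (l + 1))) =
        (if l = a - 1 then (-1 : ℤ) ^ a • insSum (m - 1) a e (G.map (merge a)) else 0) +
        (if l + 2 = a then (-1 : ℤ) ^ (a - 1) • insSum (m - 1) (a - 1) e (G.map (merge a)) else 0) := by
      intro l hl
      rw [Finset.mem_range] at hl
      rw [List.map_cons, htpy]
      by_cases h1 : l = a - 1
      · obtain rfl : a = l + 1 := by omega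
        have : merge (l + 1) (l + 1) ∈ G.map (merge (l + 1)) := by
          refine List.mem_map.2 ⟨l + 2, ?_, by unfold merge; split_ifs <;> omega⟩
          have := (h (l + 2)).2 (by omega)
          rw [List.mem_cons] at this
          exact this.resolve_left (by omega)
        rw [if_pos h1, if_neg (Nat.succ_ne_self _), if_pos this,
          show merge (l + 1) (l + 1) = l + 1 from if_pos le_rfl]
        exact (add_zero _).symm
      · by_cases h2 : l + 2 = a
        · have h3 : merge (l + 1) a = a - 1 := by unfold merge; split_ifs <;> omega
          have h4 : l + 1 = a - 1 := by omega
          have : merge (l + 1) a ∈ G.map (merge (l + 1)) := by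
            refine List.mem_map.2 ⟨l + 1, ?_, by unfold merge; split_ifs <;> omega⟩
            have := (h (l + 1)).2 (by omega)
            rw [List.mem_cons] at this
            exact this.resolve_left (by omega)
          rw [if_neg h1, if_pos h2, zero_add, if_pos this, h3, h4, hG]
        · rw [if_neg h1, if_neg h2, add_zero, if_neg, smul_zero]
          rw [List.mem_map]
          rintro ⟨b, hb, hb'⟩
          have : b ≠ a := by rintro rfl; exact ha hb
          unfold merge at hb'
          split_ifs at hb' <;> omega
    rw [Finset.sum_congr rfl key, Finset.sum_add_distrib, Finset.sum_ite_eq' ]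
    have hs := insSum_succ (m := m - 1) (i := a - 1) (by omega) e (G.map (merge a))
    rw [hins, Nat.sub_add_cancel ham.1] at hs
    -- For `a = m` there is no successor block, but then the insertion sum is empty as well, so the
    -- condition can be dropped.
    have h1 : (if a - 1 ∈ Finset.range (m - 1) then
        (-1 : ℤ) ^ a • insSum (m - 1) a e (G.map (merge a)) else 0) =
        (-1 : ℤ) ^ a • insSum (m - 1) a e (G.map (merge a)) := by
      split_ifs with hm
      · rfl
      · rw [insSum_of_lt (by rw [Finset.mem_range] at hm; omega), smul_zero]
    rw [h1, behead]
    by_cases ha1 : a = 1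
    · subst ha1
      have hp : G.map Nat.pred = G.map (merge 1) := List.map_congr_left fun b hb => by
        have : b ≠ 1 := by rintro rfl; exact ha hb
        unfold merge; rw [Nat.pred_eq_sub_one]; split_ifs <;> omega
      rw [if_pos ⟨rfl, ha⟩, Finset.sum_eq_zero (fun l _ => if_neg (by omega)), add_zero, hp]
      rw [Nat.sub_self] at hs
      rw [hs]
      simp
    · rw [if_neg (fun h => ha1 h.1), Finset.sum_eq_single_of_mem (a - 2) (by simp; omega)
        (fun l _ hl => if_neg (by omega)), if_pos (by omega), hs]
      obtain ⟨a, rfl⟩ : ∃ b, a = b + 1 := ⟨a - 1, by omega⟩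
      rw [Nat.add_sub_cancel, smul_add, smul_smul, ← mul_pow, pow_succ]
      simp

/-- Removing the first block lowers all labels by one, which shifts the sign of every merge. The
merge of the first two blocks has no counterpart, but it gives the first element a companion and is
killed. If the first element does not form the first block, some later element has label `1`; this
persists under merging, so both sides vanish. -/
theorem behead_bdry {m : ℕ} (e : List ℕ → W) {L : List ℕ} (h : Good m L) :
    bdry m (behead e) L = -behead (bdry (m - 1) e) L := by
  rcases L with _ | ⟨a, G⟩
  · simp [bdry, behead]
  by_cases ha : a = 1 ∧ 1 ∉ G
  · obtain ⟨rfl, ha⟩ := ha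
    rw [behead, if_pos ⟨rfl, ha⟩, bdry, bdry]
    rcases hm : m - 1 with _ | m'
    · simp
    · rw [Finset.sum_range_succ', ← Finset.sum_neg_distrib, Nat.add_sub_cancel]
      have h2 : 2 ∈ G := by
        have := (h 2).2 (by omega)
        rw [List.mem_cons] at this
        exact this.resolve_left (by omega)
      have h0 : behead e ((1 :: G).map (merge (0 + 1))) = 0 := by
        rw [List.map_cons, behead, if_neg]
        rintro ⟨-, h⟩
        exact h (List.mem_map.2 ⟨2, h2, rfl⟩)
      rw [h0, smul_zero, add_zero]
      refine Finset.sum_congr rfl fun l hl => ?_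
      rw [List.map_cons, behead, if_pos]
      · rw [pow_succ, List.map_map, List.map_map]
        simp only [mul_neg, mul_one, neg_smul]
        congr 3
        refine List.map_congr_left fun b hb => ?_
        have := (h b).1 (List.mem_cons_of_mem _ hb)
        have : b ≠ 1 := by rintro rfl; exact ha hb
        simp only [Function.comp_apply, merge, Nat.pred_eq_sub_one]
        split_ifs <;> omega
      · refine ⟨by unfold merge; split_ifs <;> omega, ?_⟩
        rw [List.mem_map]
        rintro ⟨b, hb, hb'⟩
        have := (h b).1 (List.mem_cons_of_mem _ hb)
        have : b ≠ 1 := by rintro rfl; exact ha hb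
        unfold merge at hb'
        split_ifs at hb' <;> omega
  · rw [behead, if_neg ha, neg_zero, bdry]
    refine Finset.sum_eq_zero fun l hl => ?_
    rw [List.map_cons, behead, if_neg, smul_zero]
    rintro ⟨h1, h2⟩
    rw [Finset.mem_range] at hl
    have ham := (h a).1 List.mem_cons_self
    have h3 : 1 ∈ G := by
      by_contra h3
      have := (h 1).2 (by omega)
      rw [List.mem_cons] at this
      exact ha ⟨(this.resolve_right h3).symm, h3⟩
    exact h2 (List.mem_map.2 ⟨1, h3, by unfold merge; split_ifs <;> omega⟩)

theorem insSum_zero_bdry (m : ℕ) (e : List ℕ → W) (G : List ℕ) :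
    insSum m 0 (bdry (m + 1) e) G = -bdry m (insSum (m - 1) 0 e) G := by
  rw [bdry_insSum m 0 (Nat.zero_le _), if_neg (by omega), zero_sub]
  rfl

variable {W' : Type*} [AddCommGroup W'] (T : W →+ W')

/-- All these operators are universal integral combinations of values of `e`, so they commute with
additive maps. This turns identities for arbitrary test functions into identities of endomorphisms
of the free module on lists. -/
theorem map_bdry (m : ℕ) (e : List ℕ → W) (L : List ℕ) :
    T (bdry m e L) = bdry m (fun L => T (e L)) L := by
  simp [bdry]

theorem map_insSum (m i : ℕ) (e : List ℕ → W) (L : List ℕ) :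
    T (insSum m i e L) = insSum m i (fun L => T (e L)) L := by
  simp [insSum, apply_ite T]

theorem map_htpy (m : ℕ) (e : List ℕ → W) (L : List ℕ) :
    T (htpy m e L) = htpy m (fun L => T (e L)) L := by
  cases L <;> simp [htpy, apply_ite T, map_insSum]

theorem map_behead (e : List ℕ → W) (L : List ℕ) :
    T (behead e L) = behead (fun L => T (e L)) L := by
  cases L <;> simp [behead, apply_ite T]

end homotopy

/-! ### Exactness below the top degree, and detection of cycles in the top degree. -/

section complex

variable {V : Type*} [AddCommGroup V]

/-- The endomorphism of the free module on lists with prescribed values. -/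
noncomputable def ext (h : List ℕ → V →+ (List ℕ →₀ V)) : (List ℕ →₀ V) →+ (List ℕ →₀ V) :=
  Finsupp.liftAddHom h

theorem ext_single (h : List ℕ → V →+ (List ℕ →₀ V)) (L : List ℕ) (v : V) :
    ext h (Finsupp.single L v) = h L v :=
  Finsupp.liftAddHom_apply_single _ _ _

variable (V) in
/-- The differential of the complex of ordered set partitions. -/
noncomputable def bd (m : ℕ) : (List ℕ →₀ V) →+ (List ℕ →₀ V) :=
  ext (bdry m Finsupp.singleAddHom)

theorem bd_single (m : ℕ) (L : List ℕ) (v : V) :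
    bd V m (Finsupp.single L v) = bdry m (fun L => Finsupp.single L v) L :=
  (ext_single _ _ _).trans (map_bdry (AddMonoidHom.eval v : (V →+ (List ℕ →₀ V)) →+ (List ℕ →₀ V))
    m Finsupp.singleAddHom L)

variable (V) in
noncomputable def htpyHom (m : ℕ) : (List ℕ →₀ V) →+ (List ℕ →₀ V) :=
  ext (htpy m Finsupp.singleAddHom)

theorem htpyHom_single (m : ℕ) (L : List ℕ) (v : V) :
    htpyHom V m (Finsupp.single L v) = htpy m (fun L => Finsupp.single L v) L :=
  (ext_single _ _ _).trans (map_htpy (AddMonoidHom.eval v : (V →+ (List ℕ →₀ V)) →+ (List ℕ →₀ V))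
    m Finsupp.singleAddHom L)

variable (V) in
noncomputable def beheadHom : (List ℕ →₀ V) →+ (List ℕ →₀ V) :=
  ext (behead Finsupp.singleAddHom)

theorem beheadHom_single (L : List ℕ) (v : V) :
    beheadHom V (Finsupp.single L v) = behead (fun L => Finsupp.single L v) L :=
  (ext_single _ _ _).trans (map_behead (AddMonoidHom.eval v : (V →+ (List ℕ →₀ V)) →+ (List ℕ →₀ V))
    Finsupp.singleAddHom L)

variable (V) in
noncomputable def insHom (m : ℕ) : (List ℕ →₀ V) →+ (List ℕ →₀ V) :=
  ext (insSum m 0 Finsupp.singleAddHom)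

theorem insHom_single (m : ℕ) (L : List ℕ) (v : V) :
    insHom V m (Finsupp.single L v) = insSum m 0 (fun L => Finsupp.single L v) L :=
  (ext_single _ _ _).trans (map_insSum (AddMonoidHom.eval v : (V →+ (List ℕ →₀ V)) →+ (List ℕ →₀ V))
    m 0 Finsupp.singleAddHom L)

variable (V) in
/-- The chains on ordered partitions of a set of `p` elements into `m` blocks. -/
def chains (m p : ℕ) : AddSubgroup (List ℕ →₀ V) where
  carrier := {u | ∀ L, ¬ (Good m L ∧ L.length = p) → u L = 0}
  zero_mem' := fun _ _ => rfl
  add_mem' := fun {a b} ha hb L hL => by rw [Finsupp.add_apply, ha L hL, hb L hL, add_zero]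
  neg_mem' := fun {a} ha L hL => by rw [Finsupp.neg_apply, ha L hL, neg_zero]

theorem single_mem_chains {m p : ℕ} {L : List ℕ} (hL : Good m L) (hp : L.length = p) (v : V) :
    Finsupp.single L v ∈ chains V m p := by
  classical
  intro L' hL'
  rw [Finsupp.single_apply, if_neg]
  rintro rfl
  exact hL' ⟨hL, hp⟩

@[elab_as_elim]
theorem chains_induction {m p : ℕ} {P : (List ℕ →₀ V) → Prop} {u : List ℕ →₀ V}
    (hu : u ∈ chains V m p) (h0 : P 0) (hadd : ∀ x y, P x → P y → P (x + y))
    (hs : ∀ L v, Good m L → L.length = p → P (Finsupp.single L v)) : P u := by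
  rw [← Finsupp.sum_single u]
  refine Finset.sum_induction _ P hadd h0 fun L hL => ?_
  by_cases h : Good m L ∧ L.length = p
  · exact hs L _ h.1 h.2
  · exact absurd (hu L h) (Finsupp.mem_support_iff.1 hL)

theorem insSum_mem {m p i : ℕ} {L : List ℕ} (hL : Good m L) (hp : L.length = p) (v : V) :
    insSum m i (fun L => Finsupp.single L v) L ∈ chains V (m + 1) (p + 1) := by
  refine sum_mem fun j hj => ?_
  rw [Finset.mem_range] at hj
  split_ifs
  · exact zsmul_mem (single_mem_chains (hL.ins (by omega)) (by simp [ins, hp]) v) _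
  · exact zero_mem _

theorem htpyHom_mem {m p : ℕ} {u : List ℕ →₀ V} (hu : u ∈ chains V m p) :
    htpyHom V m u ∈ chains V (m + 1) p := by
  refine chains_induction hu (by rw [map_zero]; exact zero_mem _)
    (fun x y hx hy => by rw [map_add]; exact add_mem hx hy) fun L v hL hp => ?_
  rw [htpyHom_single]
  rcases L with _ | ⟨a, G⟩
  · exact zero_mem _
  · rw [htpy]
    split_ifs with h
    · obtain rfl : G.length + 1 = p := hp
      exact insSum_mem (hL.tail h) rfl v
    · exact zero_mem _

theorem insHom_mem {m p : ℕ} {u : List ℕ →₀ V} (hu : u ∈ chains V m p) :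
    insHom V m u ∈ chains V (m + 1) (p + 1) := by
  refine chains_induction hu (by rw [map_zero]; exact zero_mem _)
    (fun x y hx hy => by rw [map_add]; exact add_mem hx hy) fun L v hL hp => ?_
  rw [insHom_single]
  exact insSum_mem hL hp v

theorem beheadHom_mem {m p : ℕ} {u : List ℕ →₀ V} (hu : u ∈ chains V m (p + 1)) :
    beheadHom V u ∈ chains V (m - 1) p := by
  refine chains_induction hu (by rw [map_zero]; exact zero_mem _)
    (fun x y hx hy => by rw [map_add]; exact add_mem hx hy) fun L v hL hp => ?_
  rw [beheadHom_single]
  rcases L with _ | ⟨a, G⟩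
  · exact zero_mem _
  · rw [behead]
    split_ifs with h
    · obtain ⟨rfl, h⟩ := h
      refine single_mem_chains (hL.pred h) (by simpa using hp) v
    · exact zero_mem _

/-- This makes the complex for `p + 1` elements homotopy equivalent to the one for `p` elements with
one block less, through `beheadHom` and `insHom`; the exactness statements follow by induction on
`p`. -/
theorem homotopy {m p : ℕ} {u : List ℕ →₀ V} (hu : u ∈ chains V m (p + 1)) :
    bd V (m + 1) (htpyHom V m u) + htpyHom V (m - 1) (bd V m u) =
      u - insHom V (m - 1) (beheadHom V u) := by
  refine chains_induction hu (by simp) (fun x y hx hy => ?_) fun L v hL hp => ?_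
  · simp only [map_add]
    rw [add_add_add_comm, hx, hy]
    abel
  · rcases L with _ | ⟨a, G⟩
    · simp at hp
    · rw [htpyHom_single, bd_single, beheadHom_single, map_htpy, map_bdry, map_behead]
      simp only [bd_single, htpyHom_single, insHom_single]
      exact htpy_bdry _ hL

theorem bd_behead {m p : ℕ} {u : List ℕ →₀ V} (hu : u ∈ chains V m p) :
    beheadHom V (bd V m u) = -bd V (m - 1) (beheadHom V u) := by
  refine chains_induction hu (by simp) (fun x y hx hy => ?_) fun L v hL hp => ?_
  · simp only [map_add, hx, hy, neg_add]
  · rw [bd_single, beheadHom_single, map_bdry, map_behead]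
    simp only [bd_single, beheadHom_single]
    exact behead_bdry _ hL

theorem bd_insHom (m : ℕ) (u : List ℕ →₀ V) :
    bd V (m + 1) (insHom V m u) = -insHom V (m - 1) (bd V m u) := by
  induction u using Finsupp.induction_linear with
  | zero => simp
  | add x y hx hy => simp only [map_add, hx, hy, neg_add]
  | single L v =>
    rw [bd_single, insHom_single, map_bdry, map_insSum]
    simp only [bd_single, insHom_single]
    exact insSum_zero_bdry m _ L

theorem chains_eq_zero {m p : ℕ} (h : p < m) {u : List ℕ →₀ V} (hu : u ∈ chains V m p) : u = 0 :=
  chains_induction hu rfl (fun x y hx hy => by rw [hx, hy, add_zero]) fun L v hL hp => by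
    have := hL.le_length
    omega

theorem chains_zero_succ {p : ℕ} {u : List ℕ →₀ V} (hu : u ∈ chains V 0 (p + 1)) : u = 0 :=
  chains_induction hu rfl (fun x y hx hy => by rw [hx, hy, add_zero]) fun L v hL hp => by
    rcases L with _ | ⟨a, G⟩
    · simp at hp
    · have := (hL a).1 List.mem_cons_self
      omega

/-- The complex of ordered set partitions is exact except in the top degree. -/
theorem exists_bd {p : ℕ} : ∀ {m : ℕ} {u : List ℕ →₀ V}, u ∈ chains V m p → m < p → bd V m u = 0 →
    ∃ y ∈ chains V (m + 1) p, bd V (m + 1) y = u := by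
  induction p with
  | zero => intro m u _ h; omega
  | succ p ih =>
    intro m u hu hm hd
    rcases m with _ | m
    · exact ⟨0, zero_mem _, by rw [map_zero, chains_zero_succ hu]⟩
    · have h1 := homotopy hu
      rw [hd, map_zero, add_zero, Nat.add_sub_cancel] at h1
      have h2 := bd_behead hu
      rw [hd, map_zero, eq_comm, neg_eq_zero] at h2
      obtain ⟨y, hy, hy'⟩ := ih (beheadHom_mem hu) (by omega) h2
      rw [Nat.add_sub_cancel] at hy hy'
      -- The homotopy exhibits the cycle as a boundary up to the insertion of its beheading. The
      -- beheading is a cycle on fewer elements, hence the boundary of `y`; the minus sign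
      -- compensates that `insHom` anticommutes with the differential.
      refine ⟨htpyHom V (m + 1) u - insHom V (m + 1) y,
        sub_mem (htpyHom_mem hu) (insHom_mem hy), ?_⟩
      rw [map_sub, h1, bd_insHom, Nat.add_sub_cancel, hy']
      abel

/-- A cycle in the top degree is determined by its coefficient at one maximal partition. -/
theorem eq_zero_of_bd {p : ℕ} : ∀ {u : List ℕ →₀ V}, u ∈ chains V p p → bd V p u = 0 →
    u (List.range' 1 p) = 0 → u = 0 := by
  induction p with
  | zero =>
    intro u hu _ h
    ext L
    by_cases hL : Good 0 L ∧ L.length = 0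
    · obtain rfl := List.length_eq_zero_iff.1 hL.2; exact h
    · exact hu L hL
  | succ p ih =>
    intro u hu hd h
    have h1 := homotopy hu
    -- In top degree the homotopy would need more blocks than there are elements, so it vanishes and
    -- the cycle is the insertion of its beheading.
    rw [hd, map_zero, add_zero, chains_eq_zero (by omega) (htpyHom_mem hu), map_zero,
      Nat.add_sub_cancel] at h1
    have h2 := bd_behead hu
    rw [hd, map_zero, eq_comm, neg_eq_zero, Nat.add_sub_cancel] at h2
    -- The list `1, …, p + 1` is the only one whose beheading is `1, …, p`.
    have h3 : (beheadHom V u) (List.range' 1 p) = u (List.range' 1 (p + 1)) := by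
      clear h1 h2 hd h
      refine chains_induction hu (by simp) (fun x y hx hy => ?_) fun L v hL hp => ?_
      · rw [map_add, Finsupp.add_apply, Finsupp.add_apply, hx, hy]
      · classical
        rcases L with _ | ⟨a, G⟩
        · simp at hp
        rw [beheadHom_single, behead, List.range'_succ]
        by_cases ha : a = 1 ∧ 1 ∉ G
        · rw [if_pos ha, Finsupp.single_apply, Finsupp.single_apply]
          refine if_congr ?_ rfl rfl
          obtain ⟨rfl, ha⟩ := ha
          rw [List.cons.injEq, ← List.map_add_range' (a := 1)]
          constructor
          · intro h
            refine ⟨rfl, ?_⟩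
            rw [← h, List.map_map]
            conv_lhs => rw [← List.map_id G]
            refine List.map_congr_left fun b hb => ?_
            have := (hL b).1 (List.mem_cons_of_mem _ hb)
            simp only [id, Function.comp_apply, Nat.pred_eq_sub_one]
            omega
          · rintro ⟨-, rfl⟩
            rw [List.map_map]
            refine List.map_id'' (fun b => ?_) _
            simp
        · rw [if_neg ha, Finsupp.single_apply, if_neg]
          · rfl
          · intro h
            rw [List.cons.injEq] at h
            refine ha ⟨h.1, ?_⟩
            rw [h.2]
            simp
    have h4 := ih (u := beheadHom V u) (beheadHom_mem hu) h2 (h3.trans h)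
    rw [h4, map_zero, sub_zero] at h1
    exact h1.symm

end complex

end OrdPart

/-! ### Flags -/

namespace Rigid

section flags

variable {n : ℕ} {i j l : Fin (n + 1)} {m m' : SimplexCategoryᵒᵖ}

/-- The `t`-th subset of the chain given by a simplex of a mapping space of `𝔠(Δⁿ)`. -/
def flagSet (c : (Cube i j).obj m) (t : Fin (m.unop.len + 1)) : Set (Fin (n + 1)) :=
  (CategoryTheory.Functor.obj
    (show ComposableArrows (SimplicialThickening.Path i j) m.unop.len from c) t).I

theorem flagSet_mono (c : (Cube i j).obj m) : Monotone (flagSet c) := fun s t h => by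
  have f := CategoryTheory.Functor.map
    (show ComposableArrows (SimplicialThickening.Path i j) m.unop.len from c) (homOfLE h)
  exact f.1.1.1

theorem left_mem_flagSet (c : (Cube i j).obj m) (t : Fin (m.unop.len + 1)) : i ∈ flagSet c t :=
  SimplicialThickening.Path.left _

theorem right_mem_flagSet (c : (Cube i j).obj m) (t : Fin (m.unop.len + 1)) : j ∈ flagSet c t :=
  SimplicialThickening.Path.right _

theorem le_of_mem_flagSet {c : (Cube i j).obj m} {t : Fin (m.unop.len + 1)} {v : Fin (n + 1)}
    (h : v ∈ flagSet c t) : i ≤ v ∧ v ≤ j :=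
  ⟨SimplicialThickening.Path.left_le _ v h, SimplicialThickening.Path.le_right _ v h⟩

theorem flag_le (c : (Cube i j).obj m) : i ≤ j :=
  (le_of_mem_flagSet (right_mem_flagSet c 0)).1

/-- The paths form a poset, so a simplex of the nerve is determined by its vertices. -/
theorem flagSet_ext {c c' : (Cube i j).obj m} (h : ∀ t, flagSet c t = flagSet c' t) : c = c' := by
  refine CategoryTheory.Functor.ext (fun t => SimplicialThickening.Path.ext (h t)) ?_
  intro s t f
  have : Subsingleton ((CategoryTheory.Functor.obj
      (show ComposableArrows (SimplicialThickening.Path i j) m.unop.len from c) s) ⟶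
      (CategoryTheory.Functor.obj
        (show ComposableArrows (SimplicialThickening.Path i j) m.unop.len from c) t)) :=
    ⟨fun a b => by
      obtain ⟨⟨⟨a⟩⟩⟩ := a
      obtain ⟨⟨⟨b⟩⟩⟩ := b
      rfl⟩
  exact this.elim _ _

theorem flagSet_scomp (c : (Cube i j).obj m) (c' : (Cube j l).obj m) (t : Fin (m.unop.len + 1)) :
    flagSet (scomp c c' : (Cube i l).obj m) t = flagSet c t ∪ flagSet c' t := rfl

theorem flagSet_cubeMap {n' : ℕ} (α : ⦋n⦌ ⟶ ⦋n'⦌) (c : (Cube i j).obj m)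
    (t : Fin (m.unop.len + 1)) :
    flagSet ((Cube.map α i j).app m c) t = α.toOrderHom '' flagSet c t := rfl

/-- The flag with prescribed interior elements. -/
def flag (m : SimplexCategoryᵒᵖ) (hij : i ≤ j) (T : Fin (m.unop.len + 1) → Set (Fin (n + 1)))
    (hT : Monotone T) : (Cube i j).obj m :=
  show ComposableArrows (SimplicialThickening.Path i j) m.unop.len from
  { obj := fun t => ⟨{v | v = i ∨ v = j ∨ (i ≤ v ∧ v ≤ j ∧ v ∈ T t)}, Or.inl rfl, Or.inr (Or.inl rfl),
      by rintro k (rfl | rfl | h); exacts [le_rfl, hij, h.1],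
      by rintro k (rfl | rfl | h); exacts [hij, le_rfl, h.2.1]⟩
    map := fun {s t} f => ⟨⟨⟨by
      rintro k (rfl | rfl | h)
      exacts [Or.inl rfl, Or.inr (Or.inl rfl), Or.inr (Or.inr ⟨h.1, h.2.1, hT (leOfHom f) h.2.2⟩)]⟩⟩⟩ }

theorem mem_flagSet_flag {hij : i ≤ j} {T : Fin (m.unop.len + 1) → Set (Fin (n + 1))}
    {hT : Monotone T} {t : Fin (m.unop.len + 1)} {v : Fin (n + 1)} :
    v ∈ flagSet (flag m hij T hT) t ↔ v = i ∨ v = j ∨ (i ≤ v ∧ v ≤ j ∧ v ∈ T t) := Iff.rfl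

open Classical in
/-- The label of a vertex: the first index of a subset of the chain that contains the vertex. -/
noncomputable def label (c : (Cube i j).obj m) (v : Fin (n + 1)) : ℕ :=
  (Finset.univ.filter fun t => v ∉ flagSet c t).card

/-- The sets of a flag increase, so the indices whose set misses `v` form an initial segment, and
their number is the first index at which `v` is present. A vertex that never occurs has label
`m.unop.len + 1`, one more than the largest index. -/
theorem label_le_iff (c : (Cube i j).obj m) (v : Fin (n + 1)) (t : Fin (m.unop.len + 1)) :
    label c v ≤ t ↔ v ∈ flagSet c t := by
  classical
  constructor
  · intro h
    by_contra hv
    have : Finset.Iic t ⊆ Finset.univ.filter fun t => v ∉ flagSet c t := fun s hs => by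
      rw [Finset.mem_filter]
      exact ⟨Finset.mem_univ _, fun h => hv (flagSet_mono c (Finset.mem_Iic.1 hs) h)⟩
    have := Finset.card_le_card this
    rw [Fin.card_Iic] at this
    exact absurd (this.trans h) (by omega)
  · intro hv
    have : (Finset.univ.filter fun t => v ∉ flagSet c t) ⊆ Finset.Iio t := fun s hs => by
      rw [Finset.mem_filter] at hs
      rw [Finset.mem_Iio]
      by_contra h
      exact hs.2 (flagSet_mono c (not_lt.1 h) hv)
    have := Finset.card_le_card this
    rwa [Fin.card_Iio] at this

theorem label_le_iff_of_le (c : (Cube i j).obj m) (v : Fin (n + 1)) {t : ℕ}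
    (ht : t ≤ m.unop.len) : label c v ≤ t ↔ v ∈ flagSet c ⟨t, Nat.lt_succ_of_le ht⟩ :=
  label_le_iff c v ⟨t, Nat.lt_succ_of_le ht⟩

theorem label_eq_zero (c : (Cube i j).obj m) (v : Fin (n + 1)) :
    label c v = 0 ↔ v ∈ flagSet c 0 := by
  rw [← label_le_iff]
  simp

theorem label_left (c : (Cube i j).obj m) : label c i = 0 :=
  (label_eq_zero c i).2 (left_mem_flagSet c 0)

theorem label_right (c : (Cube i j).obj m) : label c j = 0 :=
  (label_eq_zero c j).2 (right_mem_flagSet c 0)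

end flags

/-! ### Normal forms -/

section normalForm

variable (S : SSet.{u})

/-- The nondegenerate simplices of positive dimension. -/
structure Cell where
  n : ℕ
  x : S.obj (op ⦋n + 1⦌)
  nd : x ∈ S.nonDegenerate (n + 1)

/-- A sequence of nondegenerate simplices of positive dimension, together with a sequence of labels of
interior vertices. -/
abbrev Necklace := FreeMonoid (Cell S) × FreeMonoid ℕ

variable {S}

/-- The least label in the fiber over a vertex. -/
noncomputable def fiberMin {r k : ℕ} (f : Fin (r + 1) → ℕ) (g : ⦋r⦌ ⟶ ⦋k⦌) (u : Fin (k + 1)) : ℕ :=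
  sInf (f '' {v | g.toOrderHom v = u})

/-- Flags are pushed forward by taking images, so a vertex of a quotient enters as soon as one of
its preimages does; this is why labels descend by minima. The fiber has to be nonempty, since the
infimum of the empty set is `0`, the label of a joint. -/
theorem fiberMin_le_iff {r k : ℕ} {f : Fin (r + 1) → ℕ} {g : ⦋r⦌ ⟶ ⦋k⦌} {u : Fin (k + 1)}
    (h : ∃ v, g.toOrderHom v = u) (t : ℕ) :
    fiberMin f g u ≤ t ↔ ∃ v, g.toOrderHom v = u ∧ f v ≤ t := by
  constructor
  · intro ht
    obtain ⟨v, hv, hv'⟩ := Nat.sInf_mem (s := f '' {v | g.toOrderHom v = u})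
      (by obtain ⟨v, hv⟩ := h; exact ⟨f v, v, hv, rfl⟩)
    exact ⟨v, hv, hv' ▸ ht⟩
  · rintro ⟨v, hv, ht⟩
    exact (Nat.sInf_le (s := f '' {v | g.toOrderHom v = u}) ⟨v, hv, rfl⟩).trans ht

theorem surjective_of_epi {r k : ℕ} (g : ⦋r⦌ ⟶ ⦋k⦌) [Epi g] : Function.Surjective g.toOrderHom :=
  SimplexCategory.epi_iff_surjective.1 inferInstance

theorem fiberMin_comp {q r k : ℕ} (f : Fin (q + 1) → ℕ) (α : ⦋q⦌ ⟶ ⦋r⦌) [Epi α] (g : ⦋r⦌ ⟶ ⦋k⦌)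
    [Epi g] : fiberMin f (α ≫ g) = fiberMin (fiberMin f α) g := by
  funext u
  refine eq_of_forall_ge_iff fun t => ?_
  rw [fiberMin_le_iff (surjective_of_epi (α ≫ g) u), fiberMin_le_iff (surjective_of_epi g u)]
  constructor
  · rintro ⟨v, hv, ht⟩
    exact ⟨α.toOrderHom v, (Shuffle.comp_apply α g v).symm.trans hv,
      (fiberMin_le_iff (f := f) (g := α) (u := α.toOrderHom v) ⟨v, rfl⟩ t).2 ⟨v, rfl, ht⟩⟩
  · rintro ⟨v, hv, ht⟩
    obtain ⟨w, rfl, hw⟩ := (fiberMin_le_iff (surjective_of_epi α v) t).1 ht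
    exact ⟨w, (Shuffle.comp_apply α g w).trans hv, hw⟩

theorem fiberMin_id {k : ℕ} (f : Fin (k + 1) → ℕ) : fiberMin f (𝟙 ⦋k⦌) = f := by
  funext u
  refine eq_of_forall_ge_iff fun t => ?_
  refine (fiberMin_le_iff (g := 𝟙 ⦋k⦌) (u := u) ⟨u, rfl⟩ t).trans ?_
  constructor
  · rintro ⟨v, rfl, h⟩
    exact h
  · exact fun h => ⟨u, rfl, h⟩

/-- The necklace of a labelled nondegenerate simplex. -/
def bead : (k : ℕ) → (x : S.obj (op ⦋k⦌)) → x ∈ S.nonDegenerate k → (Fin (k + 1) → ℕ) → Necklace S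
  | 0, _, _, _ => 1
  | k + 1, x, hx, f => (FreeMonoid.of ⟨k, x, hx⟩,
      FreeMonoid.ofList (List.ofFn fun i : Fin k => f i.succ.castSucc))

/-- The necklace of a labelled simplex: one passes to the nondegenerate simplex of which it is a
degeneracy. -/
noncomputable def reduce {r : ℕ} (τ : S.obj (op ⦋r⦌)) (f : Fin (r + 1) → ℕ) : Necklace S :=
  let h := S.exists_nonDegenerate τ
  bead h.choose h.choose_spec.choose_spec.choose_spec.choose.1
    h.choose_spec.choose_spec.choose_spec.choose.2 (fiberMin f h.choose_spec.choose)

/-- The nondegenerate simplex, its dimension and the degeneracy operator are unique by the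
Eilenberg–Zilber lemma, so the choices made in `reduce` are immaterial. -/
theorem reduce_eq {r k : ℕ} {τ : S.obj (op ⦋r⦌)} (f : Fin (r + 1) → ℕ) (g : ⦋r⦌ ⟶ ⦋k⦌) [Epi g]
    (x : S.obj (op ⦋k⦌)) (hx : x ∈ S.nonDegenerate k) (h : τ = S.map g.op x) :
    reduce τ f = bead k x hx (fiberMin f g) := by
  have H := S.exists_nonDegenerate τ
  change bead H.choose H.choose_spec.choose_spec.choose_spec.choose.1
    H.choose_spec.choose_spec.choose_spec.choose.2 (fiberMin f H.choose_spec.choose) = _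
  have hepi := H.choose_spec.choose_spec.choose
  have heq := H.choose_spec.choose_spec.choose_spec.choose_spec
  generalize H.choose_spec.choose_spec.choose_spec.choose = y at *
  generalize H.choose_spec.choose = g' at *
  generalize H.choose = k' at *
  obtain rfl : k' = k := S.unique_nonDegenerate_dim τ g' y heq g ⟨x, hx⟩ h
  obtain rfl : y = ⟨x, hx⟩ := S.unique_nonDegenerate_simplex τ g' y heq g ⟨x, hx⟩ h
  obtain rfl : g' = g := S.unique_nonDegenerate_map τ g' _ heq g ⟨x, hx⟩ h
  rfl

theorem reduce_map {r' r : ℕ} (α : ⦋r'⦌ ⟶ ⦋r⦌) [Epi α] (τ : S.obj (op ⦋r⦌))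
    (f : Fin (r' + 1) → ℕ) : reduce (S.map α.op τ) f = reduce τ (fiberMin f α) := by
  obtain ⟨k, g, hg, x, hx⟩ := S.exists_nonDegenerate τ
  rw [reduce_eq _ g x.1 x.2 hx, reduce_eq (k := k) f (α ≫ g) x.1 x.2
    (by rw [hx, NChains.map_comp]), fiberMin_comp]

theorem reduce_zero (τ : S.obj (op ⦋0⦌)) (f : Fin 1 → ℕ) : reduce τ f = 1 :=
  reduce_eq f (𝟙 _) τ (by simp) (by rw [op_id, S.map_id]; rfl)

theorem reduce_of_nonDegenerate {k : ℕ} (x : S.obj (op ⦋k⦌)) (hx : x ∈ S.nonDegenerate k)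
    (f : Fin (k + 1) → ℕ) : reduce x f = bead k x hx f := by
  rw [reduce_eq f (𝟙 _) x hx (by rw [op_id, S.map_id]; rfl), fiberMin_id]

/-- The inclusion of a nonempty set of vertices. -/
def incl {n : ℕ} (A : Finset (Fin (n + 1))) (hA : A.Nonempty) : ⦋A.card - 1⦌ ⟶ ⦋n⦌ :=
  SimplexCategory.mkHom (A.orderEmbOfFin (k := A.card - 1 + 1)
    (Nat.sub_add_cancel hA.card_pos).symm).toOrderHom

theorem mem_iff_incl {n : ℕ} {A : Finset (Fin (n + 1))} {hA : A.Nonempty} {u : Fin (n + 1)} :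
    u ∈ A ↔ ∃ v, (incl A hA).toOrderHom v = u := by
  have := congrArg (u ∈ ·) (A.range_orderEmbOfFin (Nat.sub_add_cancel hA.card_pos).symm)
  exact (iff_of_eq this).symm

/-- The necklace of the face of a labelled simplex that is spanned by a set of vertices. -/
noncomputable def piece {n : ℕ} (σ : S.obj (op ⦋n⦌)) (A : Finset (Fin (n + 1)))
    (lab : Fin (n + 1) → ℕ) : Necklace S :=
  open Classical in
  if h : A.Nonempty then reduce (S.map (incl A h).op σ) fun v => lab ((incl A h).toOrderHom v) else 1

/-- A parametrization of the vertex set `A` by `β` factors as a surjection followed by the inclusion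
of the face spanned by `A`. The surjection is invisible to `reduce`, provided that labels are
replaced by their minima over fibers. -/
theorem piece_eq {n r : ℕ} (σ : S.obj (op ⦋n⦌)) {A : Finset (Fin (n + 1))} {lab : Fin (n + 1) → ℕ}
    (β : ⦋r⦌ ⟶ ⦋n⦌) (f : Fin (r + 1) → ℕ) (hA : ∀ u, u ∈ A ↔ ∃ v, β.toOrderHom v = u)
    (hf : ∀ u ∈ A, ∀ t, lab u ≤ t ↔ ∃ v, β.toOrderHom v = u ∧ f v ≤ t) :
    piece σ A lab = reduce (S.map β.op σ) f := by
  have hne : A.Nonempty := ⟨β.toOrderHom 0, (hA _).2 ⟨0, rfl⟩⟩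
  rw [piece, dif_pos hne]
  let e := A.orderIsoOfFin (k := A.card - 1 + 1) (Nat.sub_add_cancel hne.card_pos).symm
  let b : ⦋r⦌ ⟶ ⦋A.card - 1⦌ := SimplexCategory.mkHom
    { toFun := fun v => e.symm ⟨β.toOrderHom v, (hA _).2 ⟨v, rfl⟩⟩
      monotone' := fun v w h => e.symm.monotone (β.toOrderHom.monotone h) }
  have hb : ∀ v, (incl A hne).toOrderHom (b.toOrderHom v) = β.toOrderHom v := fun v => by
    have : e (e.symm ⟨β.toOrderHom v, (hA _).2 ⟨v, rfl⟩⟩) = ⟨β.toOrderHom v, _⟩ :=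
      e.apply_symm_apply _
    exact (A.coe_orderIsoOfFin_apply _ _).symm.trans (congrArg Subtype.val this)
  have hinj : Function.Injective (incl A hne).toOrderHom :=
    (A.orderEmbOfFin (k := A.card - 1 + 1) (Nat.sub_add_cancel hne.card_pos).symm).injective
  have hsurj : Function.Surjective b.toOrderHom := fun w => by
    obtain ⟨v, hv⟩ := (hA _).1 (mem_iff_incl (hA := hne).2 ⟨w, rfl⟩)
    exact ⟨v, hinj ((hb v).trans hv)⟩
  have : Epi b := SimplexCategory.epi_iff_surjective.2 hsurj
  have hβ : β = b ≫ incl A hne := Shuffle.hom_ext fun v => by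
    rw [Shuffle.comp_apply, hb]
  have hmap : S.map β.op σ = S.map b.op (S.map (incl A hne).op σ) := by
    rw [NChains.map_comp, ← hβ]
  rw [hmap, reduce_map b]
  congr 1
  funext w
  refine eq_of_forall_ge_iff fun t => ?_
  rw [hf _ (mem_iff_incl.2 ⟨w, rfl⟩), fiberMin_le_iff (hsurj w)]
  refine exists_congr fun v => and_congr_left fun _ => ?_
  rw [← hb]
  exact hinj.eq_iff

theorem piece_map {n' n : ℕ} (α : ⦋n'⦌ ⟶ ⦋n⦌) (σ : S.obj (op ⦋n⦌)) {A : Finset (Fin (n' + 1))}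
    (hA : A.Nonempty) {A' : Finset (Fin (n + 1))} {lab : Fin (n' + 1) → ℕ} {lab' : Fin (n + 1) → ℕ}
    (hA' : ∀ u, u ∈ A' ↔ ∃ v ∈ A, α.toOrderHom v = u)
    (hlab : ∀ u ∈ A', ∀ t, lab' u ≤ t ↔ ∃ v ∈ A, α.toOrderHom v = u ∧ lab v ≤ t) :
    piece (S.map α.op σ) A lab = piece σ A' lab' := by
  rw [piece, dif_pos hA, NChains.map_comp]
  refine (piece_eq σ _ _ (fun u => ?_) fun u hu t => ?_).symm
  · rw [hA']
    constructor
    · rintro ⟨v, hv, rfl⟩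
      obtain ⟨w, rfl⟩ := (mem_iff_incl (hA := hA)).1 hv
      exact ⟨w, Shuffle.comp_apply _ _ _⟩
    · rintro ⟨w, rfl⟩
      exact ⟨_, mem_iff_incl.2 ⟨w, rfl⟩, (Shuffle.comp_apply _ _ _).symm⟩
  · rw [hlab u hu]
    constructor
    · rintro ⟨v, hv, rfl, ht⟩
      obtain ⟨w, rfl⟩ := (mem_iff_incl (hA := hA)).1 hv
      exact ⟨w, Shuffle.comp_apply _ _ _, ht⟩
    · rintro ⟨w, rfl, ht⟩
      exact ⟨_, mem_iff_incl.2 ⟨w, rfl⟩, (Shuffle.comp_apply _ _ _).symm, ht⟩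

theorem piece_congr {n : ℕ} (σ : S.obj (op ⦋n⦌)) {A A' : Finset (Fin (n + 1))}
    {lab lab' : Fin (n + 1) → ℕ} (hA : A = A') (h : ∀ v ∈ A, lab v = lab' v) :
    piece σ A lab = piece σ A' lab' := by
  subst hA
  unfold piece
  split_ifs with hA
  · congr 1
    funext v
    exact h _ (mem_iff_incl.2 ⟨v, rfl⟩)
  · rfl

theorem piece_singleton {n : ℕ} (σ : S.obj (op ⦋n⦌)) (u : Fin (n + 1)) (lab : Fin (n + 1) → ℕ) :
    piece σ {u} lab = 1 := by
  rw [piece_eq σ (SimplexCategory.const ⦋0⦌ ⦋n⦌ u) (fun _ => lab u), reduce_zero]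
  · intro v
    rw [Finset.mem_singleton]
    exact ⟨fun h => ⟨0, h.symm⟩, fun ⟨_, h⟩ => h.symm⟩
  · intro v hv t
    rw [Finset.mem_singleton] at hv
    subst hv
    exact ⟨fun h => ⟨0, rfl, h⟩, fun ⟨_, _, h⟩ => h⟩

/-! ### Cutting a labelled simplex at the vertices with label zero. -/

/-- The vertices with finite label from `a` up to the next vertex with label `0`. -/
def chunk {n : ℕ} (lab : Fin (n + 1) → ℕ) (m : ℕ) (a : Fin (n + 1)) : Finset (Fin (n + 1)) :=
  Finset.univ.filter fun v => a ≤ v ∧ lab v ≤ m ∧ ∀ u, a < u → u < v → lab u ≠ 0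

/-- The necklace between a vertex with label `0` and the next one. -/
noncomputable def chunkPiece {n : ℕ} (σ : S.obj (op ⦋n⦌)) (lab : Fin (n + 1) → ℕ) (m a : ℕ) :
    Necklace S :=
  open Classical in
  if h : ∃ ha : a < n + 1, lab ⟨a, ha⟩ = 0 then piece σ (chunk lab m ⟨a, h.1⟩) lab else 1

/-- The necklace of a labelled simplex between two vertices with label `0`. -/
noncomputable def necklace {n : ℕ} (σ : S.obj (op ⦋n⦌)) (lab : Fin (n + 1) → ℕ) (m : ℕ)
    (i j : Fin (n + 1)) : Necklace S :=
  ((List.range' i (j - i)).map (chunkPiece σ lab m)).prod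

theorem necklace_self {n : ℕ} (σ : S.obj (op ⦋n⦌)) (lab : Fin (n + 1) → ℕ) (m : ℕ)
    (i : Fin (n + 1)) : necklace σ lab m i i = 1 := by
  simp [necklace]

theorem necklace_mul {n : ℕ} (σ : S.obj (op ⦋n⦌)) (lab : Fin (n + 1) → ℕ) (m : ℕ)
    {i j l : Fin (n + 1)} (hij : i ≤ j) (hjl : j ≤ l) :
    necklace σ lab m i j * necklace σ lab m j l = necklace σ lab m i l := by
  rw [Fin.le_def] at hij hjl
  rw [necklace, necklace, necklace, ← List.prod_append, ← List.map_append,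
    show (l : ℕ) - i = (j - i) + (l - j) by omega, ← List.range'_append, one_mul,
    show (i : ℕ) + (j - i) = j by omega]

/-- The vertices with finite label between two vertices. -/
def between {n : ℕ} (lab : Fin (n + 1) → ℕ) (m : ℕ) (i j : Fin (n + 1)) : Finset (Fin (n + 1)) :=
  Finset.univ.filter fun v => i ≤ v ∧ v ≤ j ∧ lab v ≤ m

theorem mem_between {n : ℕ} {lab : Fin (n + 1) → ℕ} {m : ℕ} {i j v : Fin (n + 1)} :
    v ∈ between lab m i j ↔ i ≤ v ∧ v ≤ j ∧ lab v ≤ m := by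
  simp [between]

/-- The product runs over all positions from `i` to `j - 1`, but a position whose label is not `0`
contributes the unit, so only the factor at `i` is left. -/
theorem necklace_consecutive {n : ℕ} (σ : S.obj (op ⦋n⦌)) {lab : Fin (n + 1) → ℕ} (m : ℕ)
    {i j : Fin (n + 1)} (hij : i < j) (hi : lab i = 0) (hj : lab j = 0)
    (h : ∀ u, i < u → u < j → lab u ≠ 0) :
    necklace σ lab m i j = piece σ (between lab m i j) lab := by
  rw [Fin.lt_def] at hij
  obtain ⟨d, hd⟩ : ∃ d, (j : ℕ) - i = d + 1 := ⟨j - i - 1, by omega⟩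
  rw [necklace, hd, List.range'_succ, List.map_cons, List.prod_cons, List.prod_eq_one, mul_one,
    chunkPiece, dif_pos ⟨i.2, hi⟩]
  · congr 1
    ext v
    rw [mem_between, chunk, Finset.mem_filter]
    constructor
    · rintro ⟨-, h1, h2, h3⟩
      exact ⟨h1, not_lt.1 fun h4 => h3 j hij h4 hj, h2⟩
    · rintro ⟨h1, h2, h3⟩
      exact ⟨Finset.mem_univ _, h1, h3, fun u hu hu' => h u hu (hu'.trans_le h2)⟩
  · intro y hy
    rw [List.mem_map] at hy
    obtain ⟨a, ha, rfl⟩ := hy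
    rw [List.mem_range'_1] at ha
    rw [chunkPiece, dif_neg]
    rintro ⟨ha', h0⟩
    exact h ⟨a, ha'⟩ (by rw [Fin.lt_def]; dsimp only; omega) (by rw [Fin.lt_def]; dsimp only; omega) h0

/-- Induction along the vertices with label `0`. -/
theorem zero_induction {n : ℕ} {lab : Fin (n + 1) → ℕ} {P : Fin (n + 1) → Fin (n + 1) → Prop}
    (refl : ∀ i, lab i = 0 → P i i)
    (consecutive : ∀ i j, i < j → lab i = 0 → lab j = 0 →
      (∀ u, i < u → u < j → lab u ≠ 0) → P i j)
    (trans : ∀ i j l, i < j → j < l → lab i = 0 → lab j = 0 → lab l = 0 → P i j → P j l → P i l)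
    (i j : Fin (n + 1)) (hij : i ≤ j) (hi : lab i = 0) (hj : lab j = 0) : P i j := by
  obtain ⟨d, hd⟩ : ∃ d : ℕ, (j : ℕ) - i = d := ⟨_, rfl⟩
  induction d using Nat.strong_induction_on generalizing i j with
  | _ d ih =>
    rcases hij.eq_or_lt with rfl | hij'
    · exact refl i hi
    · by_cases h : ∃ u, i < u ∧ u < j ∧ lab u = 0
      · obtain ⟨u, h1, h2, h3⟩ := h
        have h1' := h1
        have h2' := h2
        rw [Fin.lt_def] at h1' h2'
        exact trans i u j h1 h2 hi h3 hj (ih _ (by omega) i u h1.le hi h3 rfl)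
          (ih _ (by omega) u j h2.le h3 hj rfl)
      · push Not at h
        exact consecutive i j hij' hi hj h

theorem necklace_congr {n : ℕ} (σ : S.obj (op ⦋n⦌)) {lab lab' : Fin (n + 1) → ℕ} (m : ℕ)
    {i j : Fin (n + 1)} (hij : i ≤ j) (hi : lab i = 0) (hj : lab j = 0)
    (h : ∀ v, i ≤ v → v ≤ j → lab v = lab' v) :
    necklace σ lab m i j = necklace σ lab' m i j := by
  refine zero_induction (lab := lab) (P := fun i j => (∀ v, i ≤ v → v ≤ j → lab v = lab' v) →
    necklace σ lab m i j = necklace σ lab' m i j) ?_ ?_ ?_ i j hij hi hj h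
  · intro i _ _
    rw [necklace_self, necklace_self]
  · intro i j hij hi hj h hl
    rw [necklace_consecutive σ m hij hi hj h, necklace_consecutive σ m hij
      (by rw [← hl i le_rfl hij.le, hi]) (by rw [← hl j hij.le le_rfl, hj])
      (fun u h1 h2 => by rw [← hl u h1.le h2.le]; exact h u h1 h2)]
    refine piece_congr σ ?_ fun v hv => ?_
    · ext v
      rw [mem_between, mem_between]
      constructor <;> rintro ⟨h1, h2, h3⟩ <;> refine ⟨h1, h2, ?_⟩
      · rwa [← hl v h1 h2]
      · rwa [hl v h1 h2]
    · rw [mem_between] at hv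
      exact hl v hv.1 hv.2.1
  · intro i j l hij hjl _ _ _ h1 h2 h
    rw [← necklace_mul σ lab m hij.le hjl.le, ← necklace_mul σ lab' m hij.le hjl.le,
      h1 fun v hv hv' => h v hv (hv'.trans hjl.le), h2 fun v hv hv' => h v (hij.le.trans hv) hv']

/-- Between two consecutive joints, the vertices that occur in the image are the images of the
vertices that occur in the source, and their labels are fiber minima, so `piece_map` applies. The
condition on labels is asked only for `t ≤ m`: a vertex outside the image of `α` is absent, which is
expressed by some label above `m` and not by an infinite one. -/
theorem necklace_map {n' n : ℕ} (α : ⦋n'⦌ ⟶ ⦋n⦌) (σ : S.obj (op ⦋n⦌)) {lab : Fin (n' + 1) → ℕ}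
    {lab' : Fin (n + 1) → ℕ} {m : ℕ}
    (hlab : ∀ u t, t ≤ m → (lab' u ≤ t ↔ ∃ v, α.toOrderHom v = u ∧ lab v ≤ t))
    {i j : Fin (n' + 1)} (hij : i ≤ j) (hi : lab i = 0) (hj : lab j = 0) :
    necklace (S.map α.op σ) lab m i j = necklace σ lab' m (α.toOrderHom i) (α.toOrderHom j) := by
  have hz : ∀ i, lab i = 0 → lab' (α.toOrderHom i) = 0 := fun i hi => Nat.le_zero.1
    ((hlab _ 0 (Nat.zero_le m)).2 ⟨i, rfl, hi.le⟩)
  refine zero_induction (lab := lab) (P := fun i j => necklace (S.map α.op σ) lab m i j =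
    necklace σ lab' m (α.toOrderHom i) (α.toOrderHom j)) ?_ ?_ ?_ i j hij hi hj
  · intro i _
    rw [necklace_self, necklace_self]
  · intro i j hij hi hj h
    have him : i ∈ between lab m i j := mem_between.2 ⟨le_rfl, hij.le, hi.le.trans (Nat.zero_le m)⟩
    have hjm : j ∈ between lab m i j := mem_between.2 ⟨hij.le, le_rfl, hj.le.trans (Nat.zero_le m)⟩
    rw [necklace_consecutive _ m hij hi hj h]
    -- The operator may identify the two joints. Then everything between them collapses to a vertex,
    -- whose necklace is the unit.
    rcases (α.toOrderHom.monotone hij.le).eq_or_lt with he | hlt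
    · rw [← he, necklace_self, ← piece_singleton σ (α.toOrderHom i) lab']
      refine piece_map α σ ⟨i, him⟩ (fun u => ?_) fun u hu t => ?_
      · rw [Finset.mem_singleton]
        constructor
        · rintro rfl
          exact ⟨i, him, rfl⟩
        · rintro ⟨v, hv, rfl⟩
          rw [mem_between] at hv
          exact le_antisymm ((α.toOrderHom.monotone hv.2.1).trans he.ge) (α.toOrderHom.monotone hv.1)
      · rw [Finset.mem_singleton] at hu
        subst hu
        rw [hz i hi]
        exact ⟨fun ht => ⟨i, him, rfl, hi.le.trans ht⟩, fun _ => Nat.zero_le t⟩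
    -- By monotonicity, a vertex strictly between the images of the joints has its preimages between
    -- the joints; the two end vertices are reached by the joints themselves.
    · have hpre : ∀ u t, t ≤ m → α.toOrderHom i ≤ u → u ≤ α.toOrderHom j → lab' u ≤ t →
          ∃ v ∈ between lab m i j, α.toOrderHom v = u ∧ lab v ≤ t := by
        intro u t ht h1 h2 hu
        rcases h1.eq_or_lt with rfl | h1
        · exact ⟨i, him, rfl, hi.le.trans (Nat.zero_le t)⟩
        rcases h2.eq_or_lt with rfl | h2
        · exact ⟨j, hjm, rfl, hj.le.trans (Nat.zero_le t)⟩
        obtain ⟨v, rfl, hv⟩ := (hlab u t ht).1 hu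
        refine ⟨v, mem_between.2 ⟨?_, ?_, hv.trans ht⟩, rfl, hv⟩
        · exact not_lt.1 fun h => absurd (α.toOrderHom.monotone h.le) (not_le.2 h1)
        · exact not_lt.1 fun h => absurd (α.toOrderHom.monotone h.le) (not_le.2 h2)
      rw [necklace_consecutive σ m hlt (hz i hi) (hz j hj)]
      · refine piece_map α σ ⟨i, him⟩ (fun u => ?_) fun u hu t => ?_
        · rw [mem_between]
          constructor
          · rintro ⟨h1, h2, h3⟩
            obtain ⟨v, hv, hv', -⟩ := hpre u m le_rfl h1 h2 h3
            exact ⟨v, hv, hv'⟩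
          · rintro ⟨v, hv, rfl⟩
            rw [mem_between] at hv
            exact ⟨α.toOrderHom.monotone hv.1, α.toOrderHom.monotone hv.2.1,
              (hlab _ m le_rfl).2 ⟨v, rfl, hv.2.2⟩⟩
        · rw [mem_between] at hu
          rcases le_or_gt t m with ht | ht
          · exact ⟨hpre u t ht hu.1 hu.2.1, fun ⟨v, _, hv, hv'⟩ => (hlab u t ht).2 ⟨v, hv, hv'⟩⟩
          -- Above `m` both sides are true, since `u` already has a preimage whose label is at most
          -- `m`.
          · refine ⟨fun _ => ?_, fun _ => hu.2.2.trans ht.le⟩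
            obtain ⟨v, hv, hv', hv''⟩ := hpre u m le_rfl hu.1 hu.2.1 hu.2.2
            exact ⟨v, hv, hv', hv''.trans ht.le⟩
      · intro u h1 h2 h0
        obtain ⟨v, hv, rfl, hv'⟩ := hpre u 0 (Nat.zero_le m) h1.le h2.le h0.le
        rw [mem_between] at hv
        refine h v (lt_of_le_of_ne hv.1 ?_) (lt_of_le_of_ne hv.2.1 ?_) (Nat.le_zero.1 hv')
        · rintro rfl; exact h1.ne rfl
        · rintro rfl; exact h2.ne rfl
  · intro i j l hij hjl _ _ _ h1 h2
    rw [← necklace_mul _ lab m hij.le hjl.le, h1, h2, necklace_mul σ lab' m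
      (α.toOrderHom.monotone hij.le) (α.toOrderHom.monotone hjl.le)]

theorem length_bead : (k : ℕ) → (x : S.obj (op ⦋k⦌)) → (hx : x ∈ S.nonDegenerate k) →
    (f : Fin (k + 1) → ℕ) → (bead k x hx f).2.length = k - 1
  | 0, _, _, _ => rfl
  | _ + 1, _, _, _ => List.length_ofFn

theorem length_reduce_le {r : ℕ} (τ : S.obj (op ⦋r⦌)) (f : Fin (r + 1) → ℕ) :
    (reduce τ f).2.length ≤ r - 1 := by
  obtain ⟨k, g, hg, x, hx⟩ := S.exists_nonDegenerate τ
  rw [reduce_eq f g x.1 x.2 hx, length_bead]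
  have := SimplexCategory.len_le_of_epi g
  change k ≤ r at this
  omega

/-- Joints and absent vertices leave no label, and passing to nondegenerate simplices can only lose
further vertices, whence an inequality. It serves to show that outer faces have fewer interior
vertices. -/
theorem length_necklace_le {n : ℕ} (σ : S.obj (op ⦋n⦌)) {lab : Fin (n + 1) → ℕ} (m : ℕ)
    {i j : Fin (n + 1)} (hij : i ≤ j) (hi : lab i = 0) (hj : lab j = 0) :
    (necklace σ lab m i j).2.length ≤
      (Finset.univ.filter fun v => i < v ∧ v < j ∧ lab v ≠ 0 ∧ lab v ≤ m).card := by
  refine zero_induction (lab := lab) (P := fun i j => (necklace σ lab m i j).2.length ≤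
      (Finset.univ.filter fun v => i < v ∧ v < j ∧ lab v ≠ 0 ∧ lab v ≤ m).card) ?_ ?_ ?_ i j hij hi hj
  · intro i _
    rw [necklace_self]
    exact Nat.zero_le _
  · intro i j hij hi hj h
    rw [necklace_consecutive σ m hij hi hj h]
    unfold piece
    split_ifs with hA
    · refine (length_reduce_le _ _).trans ?_
      -- The face spanned by a set of `r` vertices leaves at most `r - 2` labels, which accounts for
      -- the two joints `i` and `j`.
      have : between lab m i j ⊆ insert i (insert j
          (Finset.univ.filter fun v => i < v ∧ v < j ∧ lab v ≠ 0 ∧ lab v ≤ m)) := fun v hv => by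
        rw [mem_between] at hv
        rw [Finset.mem_insert, Finset.mem_insert, Finset.mem_filter]
        rcases hv.1.eq_or_lt with rfl | h1
        · exact Or.inl rfl
        rcases hv.2.1.eq_or_lt with rfl | h2
        · exact Or.inr (Or.inl rfl)
        exact Or.inr (Or.inr ⟨Finset.mem_univ _, h1, h2, h v h1 h2, hv.2.2⟩)
      have := (Finset.card_le_card this).trans (Finset.card_insert_le _ _)
      have := Finset.card_insert_le j
        (Finset.univ.filter fun v => i < v ∧ v < j ∧ lab v ≠ 0 ∧ lab v ≤ m)
      omega
    · exact Nat.zero_le _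
  · intro i j l hij hjl _ _ _ h1 h2
    rw [← necklace_mul _ lab m hij.le hjl.le, Prod.snd_mul, FreeMonoid.length_mul]
    refine (add_le_add h1 h2).trans ?_
    rw [← Finset.card_union_of_disjoint]
    · refine Finset.card_le_card fun v hv => ?_
      rw [Finset.mem_union, Finset.mem_filter, Finset.mem_filter] at hv
      rw [Finset.mem_filter]
      rcases hv with hv | hv
      exacts [⟨hv.1, hv.2.1, hv.2.2.1.trans hjl, hv.2.2.2⟩, ⟨hv.1, hij.trans hv.2.1, hv.2.2⟩]
    · rw [Finset.disjoint_filter]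
      exact fun v _ h1 h2 => absurd h1.2.1 h2.1.not_gt

/-! ### Invariance of the necklace under the relations of the rigidification. -/

/-- The necklace of a generator. -/
noncomputable def Gen.necklace {m : SimplexCategoryᵒᵖ} {x y : S.obj (op ⦋0⦌)} (g : Gen S m x y) :
    Necklace S :=
  Rigid.necklace g.σ (label g.c) m.unop.len g.i g.j

/-- The necklace of a word. -/
noncomputable def Word.necklace {m : SimplexCategoryᵒᵖ} :
    {x y : S.obj (op ⦋0⦌)} → Word S m x y → Necklace S
  | _, _, .nil _ => 1
  | _, _, .cons g w => g.necklace * w.necklace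

/-- In a composite the middle vertex is a joint, so the necklace splits there; to the left of it the
labels of the composite are those of the first factor, to the right those of the second, because the
two flags meet only in the joint. Compatibility with operators is `necklace_map`, as flags are
pushed forward by images. -/
theorem Rel.necklace_eq {m : SimplexCategoryᵒᵖ} {x y : S.obj (op ⦋0⦌)} {w w' : Word S m x y}
    (h : Rel w w') : w.necklace = w'.necklace := by
  induction h with
  | id σ i hi w => 
    rw [Word.necklace, Gen.necklace, necklace_self, one_mul]
  | comp σ i j l c c' hi hj hl w =>
    simp only [Word.necklace, Gen.necklace]
    have hij := flag_le c
    have hjl := flag_le c'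
    rw [← mul_assoc, ← necklace_mul σ (label (scomp c c' : (Cube i l).obj m)) _ hij hjl]
    congr 2
    · refine necklace_congr σ _ hij (label_left _) (label_right _) fun v h1 h2 => ?_
      unfold label
      congr 2
      funext t
      rw [flagSet_scomp]
      refine propext (not_congr ⟨Or.inl, ?_⟩)
      rintro (h | h)
      · exact h
      · obtain rfl := le_antisymm h2 (le_of_mem_flagSet h).1
        exact right_mem_flagSet c t
    · refine necklace_congr σ _ hjl (label_left _) (label_right _) fun v h1 h2 => ?_
      unfold label
      congr 2
      funext t
      rw [flagSet_scomp]
      refine propext (not_congr ⟨Or.inr, ?_⟩)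
      rintro (h | h)
      · obtain rfl := le_antisymm (le_of_mem_flagSet h).2 h1
        exact left_mem_flagSet c' t
      · exact h
  | operator α σ i j c hi hj hi' hj' w =>
    simp only [Word.necklace, Gen.necklace]
    congr 1
    refine necklace_map α σ (fun u t ht => ?_) (flag_le c) (label_left c) (label_right c)
    rw [label_le_iff_of_le _ _ ht, flagSet_cubeMap]
    refine exists_congr fun v => ?_
    rw [label_le_iff_of_le _ _ ht, and_comm]
  | cons g _ ih => rw [Word.necklace, Word.necklace, ih]

theorem Word.necklace_append {m : SimplexCategoryᵒᵖ} {x y z : S.obj (op ⦋0⦌)} (w : Word S m x y)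
    (w' : Word S m y z) : (w.append w').necklace = w.necklace * w'.necklace := by
  induction w with
  | nil _ => exact (one_mul _).symm
  | cons g w ih => rw [Word.append, Word.necklace, Word.necklace, ih, mul_assoc]

/-- The normal form of a simplex of a mapping space of the rigidification. -/
noncomputable def normalForm {m : SimplexCategoryᵒᵖ} {x y : S.obj (op ⦋0⦌)}
    (a : (mapping x y).obj m) : Necklace S :=
  Quot.lift Word.necklace (fun _ _ h => h.necklace_eq) a

theorem normalForm_mcomp {m : SimplexCategoryᵒᵖ} {x y z : S.obj (op ⦋0⦌)} (a : (mapping x y).obj m)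
    (b : (mapping y z).obj m) : normalForm (mcomp a b) = normalForm a * normalForm b := by
  obtain ⟨a⟩ := a
  obtain ⟨b⟩ := b
  exact Word.necklace_append a b

end normalForm

end Rigid

/-! ### The simplicial monoid of flags of sets of natural numbers -/

/-- A chain of sets of natural numbers. -/
@[ext]
structure Flag (m : SimplexCategoryᵒᵖ) : Type u where
  set : Fin (m.unop.len + 1) → Set ℕ
  mono : Monotone set

namespace Flag

instance (m : SimplexCategoryᵒᵖ) : Monoid (Flag.{u} m) where
  mul a b := ⟨fun t => a.set t ∪ b.set t, fun _ _ h => Set.union_subset_union (a.mono h) (b.mono h)⟩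
  one := ⟨fun _ => ∅, fun _ _ _ => le_rfl⟩
  mul_assoc _ _ _ := Flag.ext (funext fun _ => Set.union_assoc _ _ _)
  one_mul _ := Flag.ext (funext fun _ => Set.empty_union _)
  mul_one _ := Flag.ext (funext fun _ => Set.union_empty _)

/-- The action of the simplicial operators on flags. -/
def map {m m' : SimplexCategoryᵒᵖ} (f : m ⟶ m') (a : Flag.{u} m) : Flag.{u} m' :=
  ⟨fun t => a.set (f.unop.toOrderHom t), fun _ _ h => a.mono (f.unop.toOrderHom.monotone h)⟩

/-- The flag with prescribed labels: the label of `i + 1` is the `i`-th entry of the list. -/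
def ofLabels (m : SimplexCategoryᵒᵖ) (L : List ℕ) : Flag.{u} m where
  set t := {v | ∃ i a, v = i + 1 ∧ L[i]? = some a ∧ a ≤ t}
  mono := by
    rintro s t h v ⟨i, a, hv, hi, ha⟩
    exact ⟨i, a, hv, hi, ha.trans h⟩

theorem mem_ofLabels {m : SimplexCategoryᵒᵖ} {L : List ℕ} {t : Fin (m.unop.len + 1)} {i : ℕ}
    (hi : i < L.length) : i + 1 ∈ (ofLabels.{u} m L).set t ↔ L[i] ≤ t := by
  constructor
  · rintro ⟨i', a, hi', h, ha⟩
    obtain rfl : i = i' := by omega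
    rw [List.getElem?_eq_getElem hi, Option.some.injEq] at h
    exact h ▸ ha
  · exact fun h => ⟨i, _, rfl, List.getElem?_eq_getElem hi, h⟩

/-- Under an operator `f` the new label of a vertex is the first `t` for which its old label is at
most `f t`. The condition on pairs of labels says this by comparison, so that it also covers
vertices that become joints or disappear. -/
theorem map_ofLabels {m m' : SimplexCategoryᵒᵖ} (f : m ⟶ m') {L L' : List ℕ}
    (h : List.Forall₂ (fun a' a : ℕ => ∀ t, a' ≤ (t : Fin (m'.unop.len + 1)) ↔
      a ≤ f.unop.toOrderHom t) L' L) : (ofLabels.{u} m L).map f = ofLabels m' L' := by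
  have hl := h.length_eq
  refine Flag.ext (funext fun t => Set.ext fun v => ?_)
  constructor
  · rintro ⟨i, a, rfl, hi, ha⟩
    obtain ⟨hi', rfl⟩ := List.getElem?_eq_some_iff.1 hi
    rw [mem_ofLabels (hl.symm ▸ hi')]
    exact (List.Forall₂.get h (hl.symm ▸ hi') hi' t).2 ha
  · rintro ⟨i, a, rfl, hi, ha⟩
    obtain ⟨hi', rfl⟩ := List.getElem?_eq_some_iff.1 hi
    exact ⟨i, _, rfl, List.getElem?_eq_getElem (hl ▸ hi'), (List.Forall₂.get h hi' (hl ▸ hi') t).1 ha⟩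

end Flag

/-- The simplicial monoid of flags of sets of natural numbers. -/
def flags : SimplicialObject MonCat.{u} where
  obj m := MonCat.of (Flag.{u} m)
  map f := MonCat.ofHom
    { toFun := Flag.map f
      map_one' := rfl
      map_mul' := fun _ _ => rfl }

/-! ### Simplices of the loop monoid -/

namespace Rigid

variable {S : ReducedSSet.{u}} {m m' : SimplexCategoryᵒᵖ}

/-- The simplex of the loop monoid given by a simplex of a mapping space of `𝔠(Δⁿ)`. -/
def gen {n : ℕ} (σ : S.toSSet.obj (op ⦋n⦌)) (i j : Fin (n + 1)) (c : (Cube i j).obj m) :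
    (loopMonoid.obj S).obj m :=
  (Quot.mk _ (.cons ⟨n, σ, i, j, c, S.eq_vertex _, S.eq_vertex _⟩ (.nil _)) :
    (mapping S.vertex S.vertex).obj m)

theorem gen_mul {n : ℕ} (σ : S.toSSet.obj (op ⦋n⦌)) {i j l : Fin (n + 1)} (c : (Cube i j).obj m)
    (c' : (Cube j l).obj m) : gen σ i j c * gen σ j l c' = gen σ i l (scomp c c') :=
  Quot.sound (Rel.comp σ i j l c c' (S.eq_vertex _) (S.eq_vertex _) (S.eq_vertex _) _)

theorem gen_eq_one {n : ℕ} (σ : S.toSSet.obj (op ⦋n⦌)) {i j : Fin (n + 1)} (c : (Cube i j).obj m)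
    (h : i = j) : gen σ i j c = 1 := by
  subst h
  rw [show c = sid (SimplicialThickening.mk i) m from flagSet_ext fun t => Set.ext fun v =>
    ⟨fun h => le_antisymm (le_of_mem_flagSet h).2 (le_of_mem_flagSet h).1,
      fun h => (show v = i from h) ▸ left_mem_flagSet c t⟩]
  exact Quot.sound (Rel.id σ i (S.eq_vertex _) _)

theorem gen_congr {n : ℕ} (σ : S.toSSet.obj (op ⦋n⦌)) {i j i' j' : Fin (n + 1)}
    {c : (Cube i j).obj m} {c' : (Cube i' j').obj m} (hi : i = i') (hj : j = j')
    (h : ∀ t, flagSet c t = flagSet c' t) : gen σ i j c = gen σ i' j' c' := by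
  subst hi hj
  rw [flagSet_ext h]

theorem gen_operator {n n' : ℕ} (α : ⦋n'⦌ ⟶ ⦋n⦌) (σ : S.toSSet.obj (op ⦋n⦌)) {i j : Fin (n' + 1)}
    {c : (Cube i j).obj m} {i' j' : Fin (n + 1)} {c' : (Cube i' j').obj m}
    (hi : α.toOrderHom i = i') (hj : α.toOrderHom j = j')
    (h : ∀ t u, u ∈ flagSet c' t ↔ ∃ v ∈ flagSet c t, α.toOrderHom v = u) :
    gen (S.toSSet.map α.op σ) i j c = gen σ i' j' c' := by
  refine Eq.trans (Quot.sound (Rel.operator α σ i j c (S.eq_vertex _) (S.eq_vertex _)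
    (S.eq_vertex _) (S.eq_vertex _) _)) (gen_congr σ hi hj fun t => Set.ext fun u => ?_)
  rw [h]
  rfl

/-- The product of the generators of a word. -/
def wordProd : {x y : S.toSSet.obj (op ⦋0⦌)} → Word S.toSSet m x y → (loopMonoid.obj S).obj m
  | _, _, .nil _ => 1
  | _, _, .cons g w => gen g.σ g.i g.j g.c * wordProd w

/-- The vertices along a word equal the base point only propositionally, so the two sides have
different types until the vertices are substituted; hence a heterogeneous equality. -/
theorem mk_eq_wordProd {x y : S.toSSet.obj (op ⦋0⦌)} (w : Word S.toSSet m x y) :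
    HEq (Quot.mk _ w : (mapping x y).obj m) (wordProd w) := by
  induction w with
  | nil x =>
    obtain rfl := S.eq_vertex x
    rfl
  | @cons x y z g w ih =>
    obtain rfl := S.eq_vertex x
    obtain rfl := S.eq_vertex y
    obtain rfl := S.eq_vertex z
    rw [wordProd, ← eq_of_heq ih]
    rfl

@[elab_as_elim]
theorem gen_induction {P : (loopMonoid.obj S).obj m → Prop} (one : P 1)
    (mul : ∀ a b, P a → P b → P (a * b))
    (gen : ∀ (n : ℕ) (σ : S.toSSet.obj (op ⦋n⦌)) (i j : Fin (n + 1)) (c : (Cube i j).obj m),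
      P (gen σ i j c)) (a : (loopMonoid.obj S).obj m) : P a := by
  have key : ∀ {x y : S.toSSet.obj (op ⦋0⦌)} (w : Word S.toSSet m x y), P (wordProd w) := by
    intro x y w
    induction w with
    | nil _ => exact one
    | cons g w ih => exact mul _ _ (gen _ _ _ _ _) ih
  obtain ⟨w⟩ := (show (mapping S.vertex S.vertex).obj m from a)
  exact (eq_of_heq (mk_eq_wordProd w)).symm ▸ key w

/-- The simplex of the mapping space of `𝔠(Δⁿ)` from the first to the last vertex given by a flag of
sets. -/
def elFlag (n : ℕ) (T : Flag.{u} m) : (Cube (0 : Fin (n + 1)) (Fin.last n)).obj m :=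
  flag m (Fin.zero_le _) (fun t => {v | (v : ℕ) ∈ T.set t})
    (fun _ _ h _ hv => T.mono h hv : Monotone fun t => {v : Fin (n + 1) | (v : ℕ) ∈ T.set t})

theorem mem_elFlag {n : ℕ} {T : Flag.{u} m} {t : Fin (m.unop.len + 1)} {v : Fin (n + 1)} :
    v ∈ flagSet (elFlag n T) t ↔ v = 0 ∨ v = Fin.last n ∨ (v : ℕ) ∈ T.set t := by
  refine mem_flagSet_flag.trans (or_congr_right (or_congr_right ?_))
  exact ⟨fun h => h.2.2, fun h => ⟨Fin.zero_le _, Fin.le_last _, h⟩⟩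

theorem interior_mem_elFlag {k : ℕ} {T : Flag.{u} m} {t : Fin (m.unop.len + 1)} {i : Fin k} :
    i.succ.castSucc ∈ flagSet (elFlag (k + 1) T) t ↔ (i : ℕ) + 1 ∈ T.set t := by
  rw [mem_elFlag]
  constructor
  · rintro (h | h | h)
    · exact absurd (congrArg Fin.val h) (by simp)
    · exact absurd (congrArg Fin.val h) (by simpa using i.2.ne)
    · exact h
  · exact fun h => Or.inr (Or.inr h)

theorem exists_interior {k : ℕ} {u : Fin (k + 2)} (h0 : u ≠ 0) (hn : u ≠ Fin.last (k + 1)) :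
    ∃ i : Fin k, u = i.succ.castSucc := by
  have h0 : (u : ℕ) ≠ 0 := fun h => h0 (Fin.ext h)
  have hn : (u : ℕ) ≠ k + 1 := fun h => hn (Fin.ext h)
  exact ⟨⟨u - 1, by omega⟩, Fin.ext (show (u : ℕ) = u - 1 + 1 by omega)⟩

/-- The simplex of the loop monoid given by a simplex of `S` and a flag of sets of vertices. -/
def el {n : ℕ} (σ : S.toSSet.obj (op ⦋n⦌)) (T : Flag.{u} m) : (loopMonoid.obj S).obj m :=
  gen σ 0 (Fin.last n) (elFlag n T)

theorem map_el (f : m ⟶ m') {n : ℕ} (σ : S.toSSet.obj (op ⦋n⦌)) (T : Flag.{u} m) :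
    ((loopMonoid.obj S).map f).hom (el σ T) = el σ (T.map f) := rfl

/-- The end vertices belong to every set of the flag, so an operator that fixes both ends has to be
compared on interior vertices only. -/
theorem el_operator {n n' : ℕ} (α : ⦋n'⦌ ⟶ ⦋n⦌) (σ : S.toSSet.obj (op ⦋n⦌)) {T T' : Flag.{u} m}
    (h0 : α.toOrderHom 0 = 0) (hn : α.toOrderHom (Fin.last n') = Fin.last n)
    (h : ∀ t u, u ≠ 0 → u ≠ Fin.last n → ((u : ℕ) ∈ T'.set t ↔
      ∃ v : Fin (n' + 1), α.toOrderHom v = u ∧ (v : ℕ) ∈ T.set t)) :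
    el (S.toSSet.map α.op σ) T = el σ T' := by
  refine gen_operator α σ h0 hn fun t u => ?_
  rw [mem_elFlag]
  by_cases hu0 : u = 0
  · subst hu0
    exact ⟨fun _ => ⟨0, mem_elFlag.2 (Or.inl rfl), h0⟩, fun _ => Or.inl rfl⟩
  by_cases hun : u = Fin.last n
  · subst hun
    exact ⟨fun _ => ⟨Fin.last n', mem_elFlag.2 (Or.inr (Or.inl rfl)), hn⟩,
      fun _ => Or.inr (Or.inl rfl)⟩
  have := h t u hu0 hun
  constructor
  · rintro (hu | hu | hu)
    · exact absurd hu hu0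
    · exact absurd hu hun
    · obtain ⟨v, hv, hv'⟩ := this.1 hu
      exact ⟨v, mem_elFlag.2 (Or.inr (Or.inr hv')), hv⟩
  · rintro ⟨v, hv, rfl⟩
    rw [mem_elFlag] at hv
    rcases hv with rfl | rfl | hv
    · exact absurd h0 hu0
    · exact absurd hn hun
    · exact Or.inr (Or.inr (this.2 ⟨v, rfl, hv⟩))

theorem el_congr {n : ℕ} (σ : S.toSSet.obj (op ⦋n⦌)) {T T' : Flag.{u} m}
    (h : ∀ t, ∀ u : Fin (n + 1), u ≠ 0 → u ≠ Fin.last n → ((u : ℕ) ∈ T.set t ↔ (u : ℕ) ∈ T'.set t)) :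
    el σ T = el σ T' := by
  refine gen_congr σ rfl rfl fun t => Set.ext fun u => ?_
  rw [mem_elFlag, mem_elFlag]
  by_cases hu0 : u = 0
  · simp [hu0]
  by_cases hun : u = Fin.last n
  · simp [hun]
  rw [h t u hu0 hun]

/-- If `α` hits every vertex that occurs in the flag, the generator already lives on the face given
by `α`, where its end vertices become the first and the last one. -/
theorem gen_eq_el {n n' : ℕ} (α : ⦋n'⦌ ⟶ ⦋n⦌) (σ : S.toSSet.obj (op ⦋n⦌)) {i j : Fin (n + 1)}
    {c : (Cube i j).obj m} {T : Flag.{u} m}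
    (h0 : α.toOrderHom 0 = i) (hn : α.toOrderHom (Fin.last n') = j)
    (h : ∀ t v, v ≠ 0 → v ≠ Fin.last n' → ((v : ℕ) ∈ T.set t ↔ α.toOrderHom v ∈ flagSet c t))
    (hs : ∀ t, ∀ u ∈ flagSet c t, ∃ v, α.toOrderHom v = u) :
    gen σ i j c = el (S.toSSet.map α.op σ) T := by
  refine (gen_operator α σ h0 hn fun t u => ?_).symm
  constructor
  · intro hu
    obtain ⟨v, rfl⟩ := hs t u hu
    refine ⟨v, mem_elFlag.2 ?_, rfl⟩
    by_cases hv0 : v = 0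
    · exact Or.inl hv0
    by_cases hvn : v = Fin.last n'
    · exact Or.inr (Or.inl hvn)
    exact Or.inr (Or.inr ((h t v hv0 hvn).2 hu))
  · rintro ⟨v, hv, rfl⟩
    by_cases hv0 : v = 0
    · rw [hv0, h0]; exact left_mem_flagSet c t
    by_cases hvn : v = Fin.last n'
    · rw [hvn, hn]; exact right_mem_flagSet c t
    rw [mem_elFlag] at hv
    exact (h t v hv0 hvn).1 ((hv.resolve_left hv0).resolve_left hvn)

theorem el_zero (σ : S.toSSet.obj (op ⦋0⦌)) (T : Flag.{u} m) : el σ T = 1 :=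
  gen_eq_one σ _ rfl

/-! ### Realization of necklaces -/

/-- The total number of interior vertices of a sequence of cells. -/
def dim (w : List (Cell S.toSSet)) : ℕ := (w.map Cell.n).sum

theorem dim_cons (x : Cell S.toSSet) (w : List (Cell S.toSSet)) : dim (x :: w) = x.n + dim w := by
  simp [dim]

theorem dim_append (w w' : List (Cell S.toSSet)) : dim (w ++ w') = dim w + dim w' := by
  simp [dim]

/-- The simplex of the loop monoid given by a sequence of cells and labels of their interior
vertices. -/
def realize (m : SimplexCategoryᵒᵖ) : List (Cell S.toSSet) → List ℕ → (loopMonoid.obj S).obj m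
  | [], _ => 1
  | x :: w, L => el x.x (Flag.ofLabels m (L.take x.n)) * realize m w (L.drop x.n)

theorem realize_append (w w' : List (Cell S.toSSet)) {L : List ℕ} (L' : List ℕ)
    (h : L.length = dim w) : realize m (w ++ w') (L ++ L') = realize m w L * realize m w' L' := by
  induction w generalizing L with
  | nil =>
    obtain rfl := List.length_eq_zero_iff.1 h
    exact (one_mul _).symm
  | cons x w ih =>
    rw [dim_cons] at h
    rw [List.cons_append, realize, realize, List.take_append_of_le_length (by omega),
      List.drop_append_of_le_length (by omega), ih (by rw [List.length_drop]; omega), mul_assoc]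

theorem map_realize (f : m ⟶ m') (w : List (Cell S.toSSet)) {L L' : List ℕ}
    (h : List.Forall₂ (fun a' a : ℕ => ∀ t, a' ≤ (t : Fin (m'.unop.len + 1)) ↔
      a ≤ f.unop.toOrderHom t) L' L) :
    ((loopMonoid.obj S).map f).hom (realize m w L) = realize m' w L' := by
  induction w generalizing L L' with
  | nil => exact map_one _
  | cons x w ih =>
    rw [realize, map_mul, map_el, Flag.map_ofLabels f (List.forall₂_take _ h),
      ih (List.forall₂_drop _ h), realize]

/-- The labels are positive and bounded, and there is one for each interior vertex. -/
def Labels (m : SimplexCategoryᵒᵖ) (w : List (Cell S.toSSet)) (L : List ℕ) : Prop :=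
  L.length = dim w ∧ ∀ a ∈ L, 1 ≤ a ∧ a ≤ m.unop.len

theorem Labels.append {w w' : List (Cell S.toSSet)} {L L' : List ℕ} (h : Labels m w L)
    (h' : Labels m w' L') : Labels m (w ++ w') (L ++ L') := by
  refine ⟨by rw [List.length_append, h.1, h'.1, dim_append], fun a ha => ?_⟩
  rcases List.mem_append.1 ha with ha | ha
  exacts [h.2 a ha, h'.2 a ha]

theorem Labels.of_cons {x : Cell S.toSSet} {w : List (Cell S.toSSet)} {L : List ℕ}
    (h : Labels m (x :: w) L) : ((L.take x.n).length = x.n ∧ ∀ a ∈ L.take x.n, 1 ≤ a ∧ a ≤ m.unop.len) ∧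
      Labels m w (L.drop x.n) := by
  have h1 := h.1
  rw [dim_cons] at h1
  exact ⟨⟨by rw [List.length_take]; omega, fun a ha => h.2 a (List.mem_of_mem_take ha)⟩,
    by rw [List.length_drop]; omega, fun a ha => h.2 a (List.mem_of_mem_drop ha)⟩

/-- Every labelled simplex whose interior vertices have positive labels reduces to a labelled cell. -/
theorem exists_realize_el {r : ℕ} (τ : S.toSSet.obj (op ⦋r⦌)) (T : Flag.{u} m)
    (h0 : ∀ v : Fin (r + 1), v ≠ 0 → v ≠ Fin.last r → (v : ℕ) ∉ T.set 0)
    (hm : ∀ v : Fin (r + 1), (v : ℕ) ∈ T.set (Fin.last _)) :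
    ∃ w L, Labels m w L ∧ realize m w L = el τ T := by
  obtain ⟨k, g, hg, ⟨x, hx⟩, rfl⟩ := S.toSSet.exists_nonDegenerate τ
  have hs := surjective_of_epi g
  have hg0 : g.toOrderHom 0 = 0 := by
    obtain ⟨v, hv⟩ := hs 0
    exact le_antisymm (hv ▸ g.toOrderHom.monotone (Fin.zero_le v)) (Fin.zero_le _)
  have hgn : g.toOrderHom (Fin.last r) = Fin.last k := by
    obtain ⟨v, hv⟩ := hs (Fin.last k)
    exact le_antisymm (Fin.le_last _) (hv ▸ g.toOrderHom.monotone (Fin.le_last v))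
  -- The image of the flag under the degeneracy operator, as a flag on the nondegenerate simplex.
  let T' : Flag.{u} m := ⟨fun t => {u | ∃ v : Fin (r + 1), (g.toOrderHom v : ℕ) = u ∧
    (v : ℕ) ∈ T.set t}, fun s t h u ⟨v, hv, hv'⟩ => ⟨v, hv, T.mono h hv'⟩⟩
  have H : el (S.toSSet.map g.op x) T = el x T' :=
    el_operator g x hg0 hgn fun t u _ _ => exists_congr fun v => and_congr_left fun _ => Fin.ext_iff.symm
  obtain _ | k := k
  -- A degenerate simplex over a vertex is the identity and needs no cell.
  · exact ⟨[], [], ⟨rfl, by simp⟩, by rw [H, el_zero]; rfl⟩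
  refine ⟨[⟨k, x, hx⟩], List.ofFn fun i : Fin k => label (elFlag (k + 1) T') i.succ.castSucc,
    ⟨?_, fun a ha => ?_⟩, ?_⟩
  · rw [List.length_ofFn, dim_cons]; rfl
  · rw [List.mem_ofFn] at ha
    obtain ⟨i, rfl⟩ := ha
    rw [Nat.one_le_iff_ne_zero, Ne, label_eq_zero, interior_mem_elFlag]
    constructor
    · rintro ⟨v, hv, hv'⟩
      refine h0 v ?_ ?_ hv'
      · rintro rfl
        rw [hg0] at hv
        exact absurd hv (by simp)
      · rintro rfl
        rw [hgn] at hv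
        exact absurd hv (by simpa using i.2.ne')
    · refine (label_le_iff _ _ (Fin.last _)).2 (interior_mem_elFlag.2 ?_)
      obtain ⟨v, hv⟩ := hs i.succ.castSucc
      exact ⟨v, congrArg Fin.val hv, hm v⟩
  · rw [realize, realize, mul_one, H, List.take_of_length_le (by rw [List.length_ofFn])]
    refine el_congr x fun t u hu0 hun => ?_
    obtain ⟨i, rfl⟩ := exists_interior hu0 hun
    refine (Flag.mem_ofLabels (by rw [List.length_ofFn]; exact i.2)).trans ?_
    rw [List.getElem_ofFn, label_le_iff]
    exact interior_mem_elFlag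

/-- The generators are cut at their joints. Between consecutive joints one restricts to the face
spanned by the vertices that ever occur; there every interior vertex has a positive finite label, so
`exists_realize_el` applies. -/
theorem exists_realize (a : (loopMonoid.obj S).obj m) : ∃ w L, Labels m w L ∧ realize m w L = a := by
  have mul : ∀ a b : (loopMonoid.obj S).obj m, (∃ w L, Labels m w L ∧ realize m w L = a) →
      (∃ w L, Labels m w L ∧ realize m w L = b) → ∃ w L, Labels m w L ∧ realize m w L = a * b := by
    rintro _ _ ⟨w, L, h, rfl⟩ ⟨w', L', h', rfl⟩
    exact ⟨w ++ w', L ++ L', h.append h', realize_append w w' L' h.1⟩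
  refine gen_induction ⟨[], [], ⟨rfl, by simp⟩, rfl⟩ mul ?_ a
  intro n σ i j c
  -- The flag `c'` is the part of `c` between two joints. It is quantified together with its
  -- characterization, so that the pieces on both sides of an intermediate joint can be used as
  -- well.
  refine zero_induction (lab := label c) (P := fun i' j' => ∀ c' : (Cube i' j').obj m,
    (∀ t v, v ∈ flagSet c' t ↔ i' ≤ v ∧ v ≤ j' ∧ v ∈ flagSet c t) →
    ∃ w L, Labels m w L ∧ realize m w L = gen σ i' j' c') ?_ ?_ ?_ i j (flag_le c) (label_left c)
    (label_right c) c fun t v =>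
      ⟨fun h => ⟨(le_of_mem_flagSet h).1, (le_of_mem_flagSet h).2, h⟩, fun h => h.2.2⟩
  · intro i _ c' _
    exact ⟨[], [], ⟨rfl, by simp⟩, (gen_eq_one σ c' rfl).symm⟩
  · intro i' j' hij hi hj h c' hc'
    let A := between (label c) m.unop.len i' j'
    have hiA : i' ∈ A := mem_between.2 ⟨le_rfl, hij.le, by omega⟩
    have hjA : j' ∈ A := mem_between.2 ⟨hij.le, le_rfl, by omega⟩
    have hA : A.Nonempty := ⟨i', hiA⟩
    have hinj : Function.Injective (incl A hA).toOrderHom :=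
      (A.orderEmbOfFin (k := A.card - 1 + 1) (Nat.sub_add_cancel hA.card_pos).symm).injective
    have hα0 : (incl A hA).toOrderHom 0 = i' := by
      obtain ⟨v, hv⟩ := (mem_iff_incl (hA := hA)).1 hiA
      exact le_antisymm (((incl A hA).toOrderHom.monotone (Fin.zero_le v)).trans hv.le)
        (mem_between.1 ((mem_iff_incl (hA := hA)).2 ⟨0, rfl⟩)).1
    have hαn : (incl A hA).toOrderHom (Fin.last _) = j' := by
      obtain ⟨v, hv⟩ := (mem_iff_incl (hA := hA)).1 hjA
      exact le_antisymm (mem_between.1 ((mem_iff_incl (hA := hA)).2 ⟨Fin.last _, rfl⟩)).2.1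
        (hv.ge.trans ((incl A hA).toOrderHom.monotone (Fin.le_last v)))
    have hT : ∀ (t : Fin (m.unop.len + 1)) (v : Fin (A.card - 1 + 1)),
        (∃ v' : Fin (A.card - 1 + 1), (v' : ℕ) = v ∧ (incl A hA).toOrderHom v' ∈ flagSet c t) ↔
          (incl A hA).toOrderHom v ∈ flagSet c t := fun t v =>
      ⟨fun ⟨v', hv, h⟩ => Fin.ext hv ▸ h, fun h => ⟨v, rfl, h⟩⟩
    rw [gen_eq_el (incl A hA) σ (T := ⟨fun t => {v | ∃ v' : Fin (A.card - 1 + 1), (v' : ℕ) = v ∧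
      (incl A hA).toOrderHom v' ∈ flagSet c t}, fun s t h v ⟨v', hv, hv'⟩ =>
        ⟨v', hv, flagSet_mono c h hv'⟩⟩) hα0 hαn]
    · refine exists_realize_el _ _ (fun v hv0 hvn hv => ?_) fun v => ?_
      · have h1 := mem_between.1 ((mem_iff_incl (hA := hA)).2 ⟨v, rfl⟩)
        refine h _ (lt_of_le_of_ne h1.1 fun h => hv0 (hinj (hα0.trans h).symm))
          (lt_of_le_of_ne h1.2.1 fun h => hvn (hinj (h.trans hαn.symm)))
          ((label_eq_zero _ _).2 ((hT _ _).1 hv))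
      · refine (hT _ _).2 ((label_le_iff _ _ (Fin.last _)).1 ?_)
        exact (mem_between.1 ((mem_iff_incl (hA := hA)).2 ⟨v, rfl⟩)).2.2
    · intro t v _ _
      refine (hT t v).trans ?_
      have h1 := mem_between.1 ((mem_iff_incl (hA := hA)).2 ⟨v, rfl⟩)
      rw [hc']
      exact ⟨fun h => ⟨h1.1, h1.2.1, h⟩, fun h => h.2.2⟩
    · intro t u hu
      rw [hc'] at hu
      exact mem_iff_incl.1 (mem_between.2 ⟨hu.1, hu.2.1,
        ((label_le_iff _ _ _).2 hu.2.2).trans (Nat.lt_succ_iff.1 t.2)⟩)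
  · intro i' j' l' hij hjl hi hj hl h1 h2 c' hc'
    let c1 : (Cube i' j').obj m := flag m hij.le (fun t => flagSet c t) (flagSet_mono c)
    let c2 : (Cube j' l').obj m := flag m hjl.le (fun t => flagSet c t) (flagSet_mono c)
    have hz : ∀ v t, label c v = 0 → v ∈ flagSet c t := fun v t h =>
      (label_le_iff c v t).1 (h.le.trans (Nat.zero_le _))
    have e1 : ∀ t v, v ∈ flagSet c1 t ↔ i' ≤ v ∧ v ≤ j' ∧ v ∈ flagSet c t := fun t v => by
      rw [mem_flagSet_flag]
      constructor
      · rintro (rfl | rfl | h)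
        exacts [⟨le_rfl, hij.le, hz _ _ hi⟩, ⟨hij.le, le_rfl, hz _ _ hj⟩, h]
      · exact fun h => Or.inr (Or.inr h)
    have e2 : ∀ t v, v ∈ flagSet c2 t ↔ j' ≤ v ∧ v ≤ l' ∧ v ∈ flagSet c t := fun t v => by
      rw [mem_flagSet_flag]
      constructor
      · rintro (rfl | rfl | h)
        exacts [⟨le_rfl, hjl.le, hz _ _ hj⟩, ⟨hjl.le, le_rfl, hz _ _ hl⟩, h]
      · exact fun h => Or.inr (Or.inr h)
    have : gen σ i' l' c' = gen σ i' j' c1 * gen σ j' l' c2 := by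
      rw [gen_mul]
      refine gen_congr σ rfl rfl fun t => Set.ext fun v => ?_
      rw [flagSet_scomp, Set.mem_union, e1, e2, hc']
      constructor
      · intro h
        rcases le_total v j' with h' | h'
        exacts [Or.inl ⟨h.1, h', h.2.2⟩, Or.inr ⟨h', h.2⟩]
      · rintro (h | h)
        exacts [⟨h.1, h.2.1.trans hjl.le, h.2.2⟩, ⟨hij.le.trans h.1, h.2⟩]
    rw [this]
    exact mul _ _ (h1 c1 e1) (h2 c2 e2)

/-! ### Uniqueness of the realization -/

/-- The normal form of a simplex of the loop monoid. -/
noncomputable def nf (a : (loopMonoid.obj S).obj m) : Necklace S.toSSet :=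
  normalForm (show (mapping S.vertex S.vertex).obj m from a)

theorem nf_mul (a b : (loopMonoid.obj S).obj m) : nf (a * b) = nf a * nf b :=
  normalForm_mcomp (x := S.vertex) (y := S.vertex) (z := S.vertex) a b

theorem nf_gen {n : ℕ} (σ : S.toSSet.obj (op ⦋n⦌)) (i j : Fin (n + 1)) (c : (Cube i j).obj m) :
    nf (gen σ i j c) = necklace σ (label c) m.unop.len i j :=
  mul_one _

theorem eq_label {n : ℕ} {i j v : Fin (n + 1)} {c : (Cube i j).obj m} {a : ℕ} (ha : a ≤ m.unop.len)
    (h : ∀ t, v ∈ flagSet c t ↔ a ≤ t) : label c v = a := by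
  have h1 : label c v ≤ a := (label_le_iff_of_le c v ha).2 ((h _).2 le_rfl)
  exact le_antisymm h1 ((h ⟨label c v, Nat.lt_succ_of_le (h1.trans ha)⟩).1
    ((label_le_iff _ _ _).1 le_rfl))

theorem nf_el (x : Cell S.toSSet) {L : List ℕ} (hL : L.length = x.n)
    (h : ∀ a ∈ L, 1 ≤ a ∧ a ≤ m.unop.len) :
    nf (el x.x (Flag.ofLabels m L)) = (FreeMonoid.of x, FreeMonoid.ofList L) := by
  obtain ⟨k, x, hx⟩ := x
  change L.length = k at hL
  subst hL
  dsimp only [el]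
  rw [nf_gen]
  generalize hc : elFlag (L.length + 1) (Flag.ofLabels.{u} m L) = c
  have hlab : ∀ i : Fin L.length, label c i.succ.castSucc = L[i] := fun i => by
    refine eq_label (h _ (List.getElem_mem _)).2 fun t => ?_
    rw [← hc, interior_mem_elFlag]
    exact Flag.mem_ofLabels.{u} i.2
  have hne : ∀ u, u ≠ 0 → u ≠ Fin.last (L.length + 1) → 1 ≤ label c u ∧ label c u ≤ m.unop.len := by
    intro u h0 hn
    obtain ⟨i, rfl⟩ := exists_interior h0 hn
    rw [hlab]
    exact h _ (List.getElem_mem _)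
  rw [necklace_consecutive x m.unop.len (Fin.last_pos) (label_left c) (label_right c)
    fun u h0 hn => Nat.one_le_iff_ne_zero.1 (hne u h0.ne' hn.ne).1]
  rw [piece_eq x (𝟙 _) (label c)]
  · rw [op_id, S.toSSet.map_id]
    refine (reduce_of_nonDegenerate x hx _).trans ?_
    refine Prod.ext rfl ?_
    refine congrArg FreeMonoid.ofList ?_
    rw [funext hlab]
    exact List.ofFn_getElem
  · intro u
    refine ⟨fun _ => ⟨u, rfl⟩, fun _ => mem_between.2 ⟨Fin.zero_le _, Fin.le_last _, ?_⟩⟩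
    by_cases h0 : u = 0
    · rw [h0, label_left c]; exact Nat.zero_le _
    by_cases hn : u = Fin.last _
    · rw [hn, label_right c]; exact Nat.zero_le _
    exact (hne u h0 hn).2
  · intro u _ t
    exact ⟨fun h => ⟨u, rfl, h⟩, fun ⟨v, hv, h⟩ => (show v = u from hv) ▸ h⟩

/-- A labelled cell has no joints in its interior, no absent vertices, and is nondegenerate, so the
normal form returns it unchanged, and normal forms are multiplicative. Together with
`exists_realize` this identifies the simplices of the loop monoid with the admissibly labelled
sequences of cells. -/
theorem nf_realize {w : List (Cell S.toSSet)} {L : List ℕ} (h : Labels m w L) :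
    nf (realize m w L) = (FreeMonoid.ofList w, FreeMonoid.ofList L) := by
  induction w generalizing L with
  | nil =>
    obtain rfl := List.length_eq_zero_iff.1 h.1
    rfl
  | cons x w ih =>
    obtain ⟨h1, h2⟩ := h.of_cons
    rw [realize, nf_mul, nf_el x h1.1 h1.2, ih h2]
    refine Prod.ext rfl ?_
    exact List.take_append_drop _ _

theorem labels_nf (a : (loopMonoid.obj S).obj m) : Labels m (nf a).1.toList (nf a).2.toList := by
  obtain ⟨w, L, h, rfl⟩ := exists_realize a
  rw [nf_realize h]
  exact h

theorem realize_nf (a : (loopMonoid.obj S).obj m) :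
    realize m (nf a).1.toList (nf a).2.toList = a := by
  obtain ⟨w, L, h, rfl⟩ := exists_realize a
  rw [nf_realize h]
  rfl

/-! ### The number of interior vertices of an outer face -/

/-- An interior vertex in the first set of the flag is a joint, and one outside the last set is
absent; neither leaves a label in the normal form. -/
theorem length_nf_el {k : ℕ} (σ : S.toSSet.obj (op ⦋k + 1⦌)) (T : Flag.{u} m) :
    (nf (el σ T)).2.length ≤ k ∧
    ((∃ i < k, i + 1 ∈ T.set 0 ∨ i + 1 ∉ T.set (Fin.last _)) → (nf (el σ T)).2.length < k) := by
  classical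
  rw [el, nf_gen]
  have h1 := length_necklace_le σ m.unop.len (Fin.zero_le (Fin.last (k + 1)))
    (label_left (elFlag (k + 1) T)) (label_right (elFlag (k + 1) T))
  have h2 : (Finset.univ.filter fun v => 0 < v ∧ v < Fin.last (k + 1) ∧
      label (elFlag (k + 1) T) v ≠ 0 ∧ label (elFlag (k + 1) T) v ≤ m.unop.len) ⊆
      (Finset.univ.filter fun i : Fin k =>
        ¬ ((i : ℕ) + 1 ∈ T.set 0 ∨ (i : ℕ) + 1 ∉ T.set (Fin.last _))).image
          fun i => i.succ.castSucc := by
    intro v hv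
    rw [Finset.mem_filter] at hv
    obtain ⟨-, h0, hn, hv, hv'⟩ := hv
    obtain ⟨i, rfl⟩ := exists_interior h0.ne' hn.ne
    refine Finset.mem_image.2 ⟨i, Finset.mem_filter.2 ⟨Finset.mem_univ _, ?_⟩, rfl⟩
    rw [Ne, label_eq_zero, interior_mem_elFlag] at hv
    have := (label_le_iff (elFlag (k + 1) T) i.succ.castSucc (Fin.last _)).1 hv'
    rw [interior_mem_elFlag] at this
    tauto
  have h3 := h1.trans ((Finset.card_le_card h2).trans Finset.card_image_le)
  refine ⟨h3.trans ((Finset.card_filter_le _ _).trans_eq (Finset.card_fin _)), ?_⟩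
  rintro ⟨i, hi, h⟩
  refine h3.trans_lt ((Finset.card_lt_univ_of_notMem (x := (⟨i, hi⟩ : Fin k)) ?_).trans_eq
    (Fintype.card_fin _))
  rw [Finset.mem_filter]
  exact fun h' => h'.2 h

/-- Under an operator that omits initial indices, small labels turn into joints; under one that
omits final indices, vertices with large labels disappear. In both cases an interior vertex is lost.
-/
theorem length_nf_map (f : m ⟶ m') {w : List (Cell S.toSSet)} {L : List ℕ} (hL : L.length = dim w) :
    (nf (((loopMonoid.obj S).map f).hom (realize m w L))).2.length ≤ dim w ∧
    ((∃ a ∈ L, a ≤ f.unop.toOrderHom 0 ∨ ¬ a ≤ f.unop.toOrderHom (Fin.last _)) →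
      (nf (((loopMonoid.obj S).map f).hom (realize m w L))).2.length < dim w) := by
  induction w generalizing L with
  | nil =>
    obtain rfl := List.length_eq_zero_iff.1 hL
    exact ⟨le_rfl, fun ⟨a, ha, _⟩ => absurd ha List.not_mem_nil⟩
  | cons x w ih =>
    rw [dim_cons] at hL
    have h1 := length_nf_el x.x ((Flag.ofLabels.{u} m (L.take x.n)).map f)
    have h2 := ih (L := L.drop x.n) (by rw [List.length_drop]; omega)
    rw [realize, map_mul, map_el, nf_mul, Prod.snd_mul, FreeMonoid.length_mul, dim_cons]
    refine ⟨add_le_add h1.1 h2.1, ?_⟩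
    rintro ⟨a, ha, ha'⟩
    rw [← List.take_append_drop x.n L, List.mem_append] at ha
    rcases ha with ha | ha
    · refine add_lt_add_of_lt_of_le (h1.2 ?_) h2.1
      obtain ⟨i, hi, rfl⟩ := List.getElem_of_mem ha
      exact ⟨i, by rw [List.length_take] at hi; omega, ha'.imp (Flag.mem_ofLabels.{u} hi).2
        (mt (Flag.mem_ofLabels.{u} hi).1)⟩
    · exact add_lt_add_of_le_of_lt h1.1 (h2.2 ⟨a, ha, ha'⟩)

end Rigid

namespace Rigid

variable {S : ReducedSSet.{u}} {m m' : SimplexCategoryᵒᵖ}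

/-! ### Simplicial operators on labels -/

theorem exists_first {n : ℕ} (P : Fin (n + 1) → Prop) (hP : ∀ s t, s ≤ t → P s → P t)
    (hn : P (Fin.last n)) : ∃ a ≤ n, ∀ t : Fin (n + 1), a ≤ t ↔ P t := by
  classical
  have h : ∃ a, ∃ h : a < n + 1, P ⟨a, h⟩ := ⟨n, n.lt_succ_self, hn⟩
  refine ⟨Nat.find h, Nat.find_min' h ⟨n.lt_succ_self, hn⟩, fun t => ⟨fun ht => ?_, fun ht =>
    Nat.find_min' h ⟨t.2, ht⟩⟩⟩
  obtain ⟨h1, h2⟩ := Nat.find_spec h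
  exact hP _ _ ht h2

/-- The relation between the labels of a simplex and of its image under a simplicial operator. -/
abbrev LabelRel (f : m ⟶ m') (a' a : ℕ) : Prop :=
  ∀ t, a' ≤ (t : Fin (m'.unop.len + 1)) ↔ a ≤ f.unop.toOrderHom t

theorem exists_labels (f : m ⟶ m') {L : List ℕ} (h0 : f.unop.toOrderHom 0 = 0)
    (hl : f.unop.toOrderHom (Fin.last _) = Fin.last _) (h : ∀ a ∈ L, 1 ≤ a ∧ a ≤ m.unop.len) :
    ∃ L', List.Forall₂ (LabelRel f) L' L ∧ ∀ a ∈ L', 1 ≤ a ∧ a ≤ m'.unop.len := by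
  induction L with
  | nil => exact ⟨[], .nil, by simp⟩
  | cons a L ih =>
    obtain ⟨L', h1, h2⟩ := ih fun a ha => h a (List.mem_cons_of_mem _ ha)
    have ha := h a List.mem_cons_self
    obtain ⟨a', h3, h4⟩ := exists_first (n := m'.unop.len) (fun t => a ≤ f.unop.toOrderHom t)
      (fun s t hst h => h.trans (f.unop.toOrderHom.monotone hst)) (by rw [hl]; exact ha.2)
    refine ⟨a' :: L', .cons h4 h1, fun b hb => ?_⟩
    rcases List.mem_cons.1 hb with rfl | hb
    · refine ⟨Nat.one_le_iff_ne_zero.2 ?_, h3⟩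
      rintro rfl
      have := (h4 0).1 le_rfl
      rw [h0] at this
      exact absurd (ha.1.trans this) (by simp)
    · exact h2 b hb

/-- An operator that preserves the first and the last index neither creates joints nor removes
vertices, so the cells remain and only the labels change. -/
theorem nf_map (f : m ⟶ m') (h0 : f.unop.toOrderHom 0 = 0)
    (hl : f.unop.toOrderHom (Fin.last _) = Fin.last _) (y : (loopMonoid.obj S).obj m) :
    (nf (((loopMonoid.obj S).map f).hom y)).1 = (nf y).1 ∧
    List.Forall₂ (LabelRel f) (nf (((loopMonoid.obj S).map f).hom y)).2.toList (nf y).2.toList := by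
  obtain ⟨w, L, h, rfl⟩ := exists_realize y
  obtain ⟨L', h1, h2⟩ := exists_labels f h0 hl h.2
  rw [map_realize f w h1, nf_realize h, nf_realize ⟨h1.length_eq.trans h.1, h2⟩]
  exact ⟨rfl, h1⟩

theorem sigma_val {n : ℕ} (i t : ℕ) (hi : i < n + 1) (ht : t < n + 2) :
    ((SimplexCategory.σ (⟨i, hi⟩ : Fin (n + 1))).toOrderHom ⟨t, ht⟩ : ℕ) = if t ≤ i then t else t - 1 := by
  simp only [SimplexCategory.σ, SimplexCategory.mkHom, SimplexCategory.Hom.toOrderHom_mk]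
  change ((⟨i, hi⟩ : Fin (n + 1)).predAbove ⟨t, ht⟩ : ℕ) = _
  unfold Fin.predAbove
  split_ifs with h1 h2 h2
  · simp only [Fin.lt_def, Fin.val_castSucc] at h1; omega
  · simp
  · simp
  · simp only [Fin.lt_def, Fin.val_castSucc] at h1; omega

/-- The degeneracy `σ i` repeats the set with index `i`, so no vertex can enter at index `i + 1`. -/
theorem not_good_degenerate {n : ℕ} (i : Fin (n + 1)) (y : (loopMonoid.obj S).obj (op ⦋n⦌)) :
    (i : ℕ) + 1 ∉ (nf (((loopMonoid.obj S).map (SimplexCategory.σ i).op).hom y)).2.toList := by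
  obtain ⟨i, hi⟩ := i
  have h := (nf_map (SimplexCategory.σ (⟨i, hi⟩ : Fin (n + 1))).op (S := S)
    (Fin.ext (by exact (sigma_val i 0 hi _).trans (by simp)))
    (Fin.ext (by exact (sigma_val i (n + 1) hi _).trans (by rw [if_neg (by omega)]; rfl))) y).2
  intro hmem
  obtain ⟨j, hj, hj'⟩ := List.getElem_of_mem hmem
  have := List.Forall₂.get h hj (h.length_eq ▸ hj)
  simp only [List.get_eq_getElem, hj'] at this
  have h1 := (this ⟨i + 1, Nat.succ_lt_succ hi⟩).1 le_rfl
  have h2 := mt (this ⟨i, hi.trans (Nat.lt_succ_self _)⟩).2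
  have h3 := sigma_val i (i + 1) hi (Nat.succ_lt_succ hi)
  have h4 := sigma_val i i hi (hi.trans (Nat.lt_succ_self _))
  rw [if_neg (by omega)] at h3
  rw [if_pos le_rfl] at h4
  refine h2 (by simp) ?_
  refine (h1.trans_eq ?_)
  exact h3.trans h4.symm

/-! ### Nondegenerate simplices as labelled sequences of cells. -/

section chains

variable (k : Type v) [CommRing k]

/-- If no vertex enters at index `c`, the sets with indices `c - 1` and `c` agree, and the simplex
is a degeneracy along `σ (c - 1)`. The criterion for nondegeneracy is thus that the label list is
good. -/
theorem mcls_eq_zero {n : ℕ} (y : (loopMonoid.obj S).obj (op ⦋n⦌))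
    (h : ¬ OrdPart.Good n (nf y).2.toList) : NChains.mcls k y = 0 := by
  obtain ⟨w, L, hL, rfl⟩ := exists_realize y
  rw [nf_realize hL] at h
  change ¬ OrdPart.Good n L at h
  obtain ⟨c, h1, hn, hc⟩ : ∃ c, 1 ≤ c ∧ c ≤ n ∧ c ∉ L := by
    by_contra! h'
    exact h fun a => ⟨hL.2 a, fun ha => h' a ha.1 ha.2⟩
  obtain ⟨n, rfl⟩ : ∃ n', n = n' + 1 := ⟨n - 1, by omega⟩
  obtain ⟨i, rfl⟩ : ∃ i, c = i + 1 := ⟨c - 1, by omega⟩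
  rw [← map_realize (m := op ⦋n⦌) (SimplexCategory.σ (⟨i, by omega⟩ : Fin (n + 1))).op w
    (L := L.map (OrdPart.merge i))]
  · exact NChains.cls_σ k (X := underlying (loopMonoid.obj S)) _ _
  · rw [List.forall₂_map_right_iff, List.forall₂_same]
    rintro a ha ⟨t, ht⟩
    have := sigma_val i t (by omega) ht
    change _ ↔ OrdPart.merge i a ≤ ((SimplexCategory.σ (⟨i, by omega⟩ : Fin (n + 1))).toOrderHom ⟨t, ht⟩ : ℕ)
    have hac : a ≠ i + 1 := fun h => hc (h ▸ ha)
    have ha1 := (hL.2 a ha).1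
    rw [this]
    simp only [OrdPart.merge]
    split_ifs <;> omega

/-- Omitting the index `i` makes the vertices with labels `i` and `i + 1` enter together. The
formula includes the outer faces, but there it may produce the labels `0` or `n + 1`, and then the
right side is not a normal form. -/
theorem map_delta_realize {n : ℕ} (i : Fin (n + 2)) (w : List (Cell S.toSSet)) (L : List ℕ) :
    ((loopMonoid.obj S).map (SimplexCategory.δ i).op).hom (realize (op ⦋n + 1⦌) w L) =
      realize (op ⦋n⦌) w (L.map (OrdPart.merge i)) := by
  refine map_realize _ w ?_
  rw [List.forall₂_map_left_iff, List.forall₂_same]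
  intro a ha t
  have := NChains.delta_val n i t
  change _ ↔ a ≤ ((SimplexCategory.δ i).toOrderHom t : ℕ)
  rw [this]
  simp only [OrdPart.merge]
  split_ifs <;> omega

/-! ### The filtration by the number of interior vertices. -/

/-- The number of interior vertices of a simplex of the loop monoid. -/
noncomputable def weight (y : (loopMonoid.obj S).obj m) : ℕ := (nf y).2.length

theorem weight_eq_dim (y : (loopMonoid.obj S).obj m) : weight y = dim (nf y).1.toList :=
  (labels_nf y).1

theorem weight_mul (y z : (loopMonoid.obj S).obj m) : weight (y * z) = weight y + weight z := by
  rw [weight, nf_mul, Prod.snd_mul, FreeMonoid.length_mul]; rfl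

theorem weight_map_le (f : m ⟶ m') (y : (loopMonoid.obj S).obj m) :
    weight (((loopMonoid.obj S).map f).hom y) ≤ weight y := by
  obtain ⟨w, L, hL, rfl⟩ := exists_realize y
  rw [weight_eq_dim (realize m w L), nf_realize hL]
  exact (length_nf_map f hL.1).1

theorem weight_realize {w : List (Cell S.toSSet)} {L : List ℕ} (hL : Labels m w L) :
    weight (realize m w L) = dim w := by
  rw [weight_eq_dim, nf_realize hL]
  rfl

/-- The first face turns the vertices with label `1` into joints, the last face removes those with
label `n + 1`. Both labels occur, since the list is good. -/
theorem weight_face_lt {n : ℕ} (i : Fin (n + 2)) (hi : i = 0 ∨ i = Fin.last (n + 1))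
    (y : (loopMonoid.obj S).obj (op ⦋n + 1⦌)) (h : OrdPart.Good (n + 1) (nf y).2.toList) :
    weight (((loopMonoid.obj S).map (SimplexCategory.δ i).op).hom y) < weight y := by
  obtain ⟨w, L, hL, rfl⟩ := exists_realize y
  rw [nf_realize hL] at h
  rw [weight_realize hL]
  refine (length_nf_map _ hL.1).2 ?_
  rcases hi with rfl | rfl
  · refine ⟨1, (h 1).2 ⟨le_rfl, by omega⟩, Or.inl ?_⟩
    exact (NChains.delta_val n 0 0).ge
  · refine ⟨n + 1, (h (n + 1)).2 ⟨by omega, le_rfl⟩, Or.inr ?_⟩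
    change ¬ _ ≤ ((SimplexCategory.δ (Fin.last (n + 1))).toOrderHom (Fin.last n) : ℕ)
    rw [NChains.delta_val]
    simp

variable (S) in
/-- The chains of degree `n` on the loop monoid with less than `p` interior vertices. -/
noncomputable def fil (p n : ℕ) : Submodule k (NChains k (underlying (loopMonoid.obj S))) :=
  Submodule.span k {c | ∃ y : (loopMonoid.obj S).obj (op ⦋n⦌), weight y < p ∧ c = NChains.mcls k y}

variable {k}

theorem mcls_mem_fil {p n : ℕ} {y : (loopMonoid.obj S).obj (op ⦋n⦌)} (h : weight y < p) :
    NChains.mcls k y ∈ fil S k p n := Submodule.subset_span ⟨y, h, rfl⟩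

theorem fil_mono {p q n : ℕ} (h : p ≤ q) : fil S k p n ≤ fil S k q n :=
  Submodule.span_mono fun _ ⟨y, hy, hc⟩ => ⟨y, hy.trans_le h, hc⟩

theorem fil_le_gr (p n : ℕ) : fil S k p n ≤ NChains.gr k (underlying (loopMonoid.obj S)) n :=
  Submodule.span_le.2 (by rintro _ ⟨y, _, rfl⟩; exact NChains.cls_mem k _)

@[elab_as_elim]
theorem fil_induction {p n : ℕ} {P : NChains k (underlying (loopMonoid.obj S)) → Prop}
    {c : NChains k (underlying (loopMonoid.obj S))} (hc : c ∈ fil S k p n)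
    (mem : ∀ y : (loopMonoid.obj S).obj (op ⦋n⦌), weight y < p → P (NChains.mcls k y))
    (zero : P 0) (add : ∀ a b, P a → P b → P (a + b)) (smul : ∀ (r : k) a, P a → P (r • a)) : P c :=
  Submodule.span_induction (p := fun c _ => P c) (by rintro _ ⟨y, hy, rfl⟩; exact mem y hy) zero
    (fun a b _ _ => add a b) (fun r a _ => smul r a) hc

theorem exists_mem_fil {n : ℕ} {c : NChains k (underlying (loopMonoid.obj S))}
    (hc : c ∈ NChains.gr k (underlying (loopMonoid.obj S)) n) : ∃ p, c ∈ fil S k p n := by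
  refine Submodule.span_induction (p := fun c _ => ∃ p, c ∈ fil S k p n) ?_ ⟨0, zero_mem _⟩ ?_ ?_ hc
  · rintro _ ⟨y, rfl⟩
    exact ⟨_, mcls_mem_fil (Nat.lt_succ_self (weight (show (loopMonoid.obj S).obj (op ⦋n⦌) from y)))⟩
  · rintro a b _ _ ⟨p, hp⟩ ⟨q, hq⟩
    exact ⟨max p q, add_mem (fil_mono (le_max_left p q) hp) (fil_mono (le_max_right p q) hq)⟩
  · rintro r a _ ⟨p, hp⟩
    exact ⟨p, Submodule.smul_mem _ r hp⟩

/-- A nondegenerate `n`-simplex has `n` distinct labels, hence at least `n` interior vertices. -/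
theorem fil_eq_zero {p n : ℕ} (h : p ≤ n) {c : NChains k (underlying (loopMonoid.obj S))}
    (hc : c ∈ fil S k p n) : c = 0 := by
  refine fil_induction hc (fun y hy => mcls_eq_zero k y fun hg => ?_) rfl
    (fun a b ha hb => by rw [ha, hb, add_zero]) fun r a ha => by rw [ha, smul_zero]
  have : n ≤ weight y := hg.le_length
  omega

theorem mul_mem_fil {p q n n' : ℕ} {c c' : NChains k (underlying (loopMonoid.obj S))}
    (hc : c ∈ fil S k (p + 1) n) (hc' : c' ∈ fil S k (q + 1) n') :
    c * c' ∈ fil S k (p + q + 1) (n + n') := by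
  refine fil_induction hc (fun y hy => ?_) (by rw [zero_mul]; exact zero_mem _)
    (fun a b ha hb => by rw [add_mul]; exact add_mem ha hb)
    fun r a ha => by rw [smul_mul_assoc]; exact Submodule.smul_mem _ _ ha
  refine fil_induction hc' (fun z hz => ?_) (by rw [mul_zero]; exact zero_mem _)
    (fun a b ha hb => by rw [mul_add]; exact add_mem ha hb)
    fun r a ha => by rw [mul_smul_comm]; exact Submodule.smul_mem _ _ ha
  rw [NChains.mul_def, NChains.mulMap_mcls]
  refine sum_mem fun s _ => zsmul_mem ?_ _
  rw [← s.len_eq]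
  refine mcls_mem_fil ?_
  rw [weight_mul]
  have h1 := weight_map_le s.fst.op y
  have h2 := weight_map_le s.snd.op z
  omega

theorem d_mem_fil {p n : ℕ} {c : NChains k (underlying (loopMonoid.obj S))}
    (hc : c ∈ fil S k p (n + 1)) : NChains.d k c ∈ fil S k p n := by
  refine fil_induction hc (fun y hy => ?_) (by rw [map_zero]; exact zero_mem _)
    (fun a b ha hb => by rw [map_add]; exact add_mem ha hb)
    fun r a ha => by rw [map_smul]; exact Submodule.smul_mem _ _ ha
  rw [NChains.d_mcls]
  exact sum_mem fun i _ => zsmul_mem (mcls_mem_fil ((weight_map_le _ y).trans_lt hy)) _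

/-! ### Symbols -/

variable (S) in
/-- The sequences of cells with `p` interior vertices. -/
abbrev Cells (p : ℕ) := {w : List (Cell S.toSSet) // dim w = p}

open Classical in
/-- The symbol of a simplex of the loop monoid. -/
noncomputable def symbolVal (k : Type v) [CommRing k] (p n : ℕ) (y : (loopMonoid.obj S).obj (op ⦋n⦌)) :
    List ℕ →₀ (Cells S p →₀ k) :=
  if h : OrdPart.Good n (nf y).2.toList ∧ dim (nf y).1.toList = p then
    Finsupp.single (nf y).2.toList (Finsupp.single ⟨(nf y).1.toList, h.2⟩ 1) else 0

open Classical in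
/-- The symbol of a chain of degree `n` on the loop monoid: the part with `p` interior vertices. -/
noncomputable def symbol (p n : ℕ) :
    NChains k (underlying (loopMonoid.obj S)) →ₗ[k] (List ℕ →₀ (Cells S p →₀ k)) :=
  NChains.lift (fun n' y => if n' = n then symbolVal k p n' y else 0) fun n' i y => by
    split_ifs with h
    · exact dif_neg fun h' => not_good_degenerate i y ((h'.1 _).2 ⟨by omega, by omega⟩)
    · rfl

theorem symbol_mcls (p n : ℕ) (y : (loopMonoid.obj S).obj (op ⦋n⦌)) :
    symbol p n (NChains.mcls k y) = symbolVal k p n y :=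
  (NChains.lift_cls (X := underlying (loopMonoid.obj S)) _ _ y).trans (if_pos rfl)

theorem symbol_realize {p n : ℕ} {w : List (Cell S.toSSet)} {L : List ℕ} (hw : dim w = p)
    (hl : L.length = p) (hL : OrdPart.Good n L) :
    symbol p n (NChains.mcls k (realize (op ⦋n⦌) w L)) =
      Finsupp.single L (Finsupp.single ⟨w, hw⟩ 1) := by
  have h : Labels (op ⦋n⦌) w L := ⟨hl.trans hw.symm, fun a ha => (hL a).1 ha⟩
  have h' := nf_realize h
  rw [symbol_mcls, symbolVal, dif_pos]
  · congr 2
    · rw [h']; rfl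
    · congr 2
      rw [h']; rfl
  · rw [h']; exact ⟨hL, hw⟩

theorem symbol_fil {p n : ℕ} {c : NChains k (underlying (loopMonoid.obj S))} (hc : c ∈ fil S k p n) :
    symbol p n c = 0 := by
  refine fil_induction hc (fun y hy => ?_) (map_zero _)
    (fun a b ha hb => by rw [map_add, ha, hb, add_zero]) fun r a ha => by rw [map_smul, ha, smul_zero]
  rw [symbol_mcls, symbolVal, dif_neg]
  rw [weight_eq_dim] at hy
  exact fun h => hy.ne h.2

/-- The chain with a given symbol. -/
noncomputable def ofSymbol (p n : ℕ) :
    (List ℕ →₀ (Cells S p →₀ k)) →ₗ[k] NChains k (underlying (loopMonoid.obj S)) :=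
  Finsupp.lsum ℕ fun L => Finsupp.linearCombination k fun w =>
    NChains.mcls k (realize (op ⦋n⦌) w.1 L)

theorem ofSymbol_single (p n : ℕ) (L : List ℕ) (w : Cells S p) :
    ofSymbol (k := k) p n (Finsupp.single L (Finsupp.single w 1)) =
      NChains.mcls k (realize (op ⦋n⦌) w.1 L) := by
  simp [ofSymbol]

/-- A nondegenerate simplex with exactly `p` interior vertices is recovered from its symbol by
`realize_nf`; everything else in this filtration step is degenerate or has fewer interior vertices.
The kernel of the symbol is therefore the next smaller step. -/
theorem sub_ofSymbol_mem {p n : ℕ} {c : NChains k (underlying (loopMonoid.obj S))}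
    (hc : c ∈ fil S k (p + 1) n) : c - ofSymbol p n (symbol p n c) ∈ fil S k p n := by
  refine fil_induction hc (fun y hy => ?_) (by rw [map_zero, map_zero, sub_zero]; exact zero_mem _)
    (fun a b ha hb => by rw [map_add, map_add, add_sub_add_comm]; exact add_mem ha hb)
    fun r a ha => by rw [map_smul, map_smul, ← smul_sub]; exact Submodule.smul_mem _ _ ha
  rw [symbol_mcls, symbolVal]
  split_ifs with h
  · rw [ofSymbol_single, realize_nf, sub_self]
    exact zero_mem _
  · rw [map_zero, sub_zero]
    rcases (Nat.lt_succ_iff.1 hy).lt_or_eq with hy | hy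
    · exact mcls_mem_fil hy
    · rw [weight_eq_dim] at hy
      rw [mcls_eq_zero k y fun hg => h ⟨hg, hy⟩]
      exact zero_mem _

theorem symbol_mem_chains {p n : ℕ} {c : NChains k (underlying (loopMonoid.obj S))}
    (hc : c ∈ fil S k (p + 1) n) : symbol p n c ∈ OrdPart.chains (Cells S p →₀ k) n p := by
  refine fil_induction hc (fun y hy => ?_) (by rw [map_zero]; exact zero_mem _)
    (fun a b ha hb => by rw [map_add]; exact add_mem ha hb) fun r a ha L hL => by
      rw [map_smul, Finsupp.smul_apply, ha L hL, smul_zero]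
  rw [symbol_mcls, symbolVal]
  split_ifs with h
  · exact OrdPart.single_mem_chains h.1 ((labels_nf y).1.trans h.2) _
  · exact zero_mem _

theorem ofSymbol_mem {p n : ℕ} {u : List ℕ →₀ (Cells S p →₀ k)}
    (hu : u ∈ OrdPart.chains (Cells S p →₀ k) n p) :
    ofSymbol p n u ∈ fil S k (p + 1) n ∧ symbol p n (ofSymbol p n u) = u := by
  refine OrdPart.chains_induction hu (by simp) (fun x y hx hy => ?_) fun L v hL hp => ?_
  · rw [map_add, map_add, hx.2, hy.2]
    exact ⟨add_mem hx.1 hy.1, rfl⟩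
  · induction v using Finsupp.induction_linear with
    | zero => simp
    | add v v' h h' =>
      rw [Finsupp.single_add, map_add, map_add, h.2, h'.2]
      exact ⟨add_mem h.1 h'.1, rfl⟩
    | single w r =>
      rw [show Finsupp.single w r = r • Finsupp.single w 1 by simp, ← Finsupp.smul_single, map_smul,
        map_smul, ofSymbol_single, symbol_realize w.2 hp hL]
      refine ⟨Submodule.smul_mem _ _ (mcls_mem_fil ?_), rfl⟩
      rw [weight_realize ⟨hp.trans w.2.symm, fun a ha => (hL a).1 ha⟩, w.2]
      exact Nat.lt_succ_self p

/-- Outer faces have fewer interior vertices and vanish in the symbol, inner faces merge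
neighbouring labels. On the associated graded complex this leaves the differential of the complex of
ordered set partitions. -/
theorem symbol_d {p n : ℕ} {c : NChains k (underlying (loopMonoid.obj S))}
    (hc : c ∈ fil S k (p + 1) (n + 1)) :
    symbol p n (NChains.d k c) = OrdPart.bd _ (n + 1) (symbol p (n + 1) c) := by
  -- The differential `OrdPart.bd` is defined as an additive map only; here its linearity over `k`
  -- is supplied.
  have key : ∀ r : k, ∀ u : List ℕ →₀ (Cells S p →₀ k),
      OrdPart.bd _ (n + 1) (r • u) = r • OrdPart.bd _ (n + 1) u := fun r u => by
    induction u using Finsupp.induction_linear with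
    | zero => simp
    | add u u' h h' => rw [smul_add, map_add, map_add, h, h', smul_add]
    | single L v =>
      rw [Finsupp.smul_single, OrdPart.bd_single, OrdPart.bd_single, OrdPart.bdry, OrdPart.bdry,
        Finset.smul_sum]
      refine Finset.sum_congr rfl fun l _ => ?_
      rw [← Finsupp.smul_single, smul_comm]
  refine fil_induction hc (fun y hy => ?_) (by simp)
    (fun a b ha hb => by simp only [map_add, ha, hb]) fun r a ha => by
      simp only [map_smul, ha, key]
  by_cases hg : OrdPart.Good (n + 1) (nf y).2.toList
  · rcases (Nat.lt_succ_iff.1 hy).lt_or_eq with hy | hy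
    · rw [symbol_fil (mcls_mem_fil hy), symbol_fil (d_mem_fil (mcls_mem_fil hy)), map_zero]
    · have hw := (weight_eq_dim y).symm.trans hy
      rw [symbol_mcls, symbolVal, dif_pos ⟨hg, hw⟩, NChains.d_mcls, map_sum, Fin.sum_univ_succ,
        Fin.sum_univ_castSucc]
      have ho : ∀ i : Fin (n + 2), (i = 0 ∨ i = Fin.last (n + 1)) → symbol (S := S) p n
          (NChains.mcls k (((loopMonoid.obj S).map (SimplexCategory.δ i).op).hom y)) = 0 := fun i hi =>
        symbol_fil (mcls_mem_fil ((weight_face_lt i hi y hg).trans_eq hy))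
      simp only [map_zsmul]
      rw [ho 0 (Or.inl rfl), Fin.succ_last, ho _ (Or.inr rfl), smul_zero, smul_zero, zero_add,
        add_zero, OrdPart.bd_single, OrdPart.bdry, Nat.add_sub_cancel, ← Fin.sum_univ_eq_sum_range
          (fun l => (-1 : ℤ) ^ (l + 1) • Finsupp.single ((nf y).2.toList.map (OrdPart.merge (l + 1)))
            (Finsupp.single (⟨(nf y).1.toList, hw⟩ : Cells S p) (1 : k)))]
      refine Finset.sum_congr rfl fun i _ => ?_
      rw [show ((i.castSucc.succ : Fin (n + 2)) : ℕ) = i + 1 from rfl]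
      congr 1
      have hy' := realize_nf y
      rw [← symbol_realize (n := n) hw (L := (nf y).2.toList.map (OrdPart.merge (i + 1)))]
      · congr 2
        conv_lhs => rw [← hy']
        exact map_delta_realize i.castSucc.succ _ _
      · rw [List.length_map]; exact hy
      · exact hg.merge (by omega) (by omega)
  · rw [mcls_eq_zero k y hg]
    simp

/-! ### Reduction to the diagonal of the filtration. -/

/-- A chain whose boundary has few interior vertices is homologous to a chain with fewer interior
vertices, except where the degree equals the number of interior vertices. -/
theorem exists_sub_d_mem {p n : ℕ} (hpn : n ≠ p) {c : NChains k (underlying (loopMonoid.obj S))}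
    (hc : c ∈ fil S k (p + 1) n) (hd : NChains.d k c ∈ fil S k p (n - 1)) :
    ∃ y ∈ fil S k (p + 1) (n + 1), c - NChains.d k y ∈ fil S k p n := by
  have hs := symbol_mem_chains hc
  -- In degree zero the combinatorial boundary is an empty sum; in positive degree it is the symbol
  -- of the boundary, which vanishes by hypothesis.
  have hb : OrdPart.bd _ n (symbol p n c) = 0 := by
    obtain _ | n := n
    · refine OrdPart.chains_induction hs (map_zero _)
        (fun x y hx hy => by rw [map_add, hx, hy, add_zero]) fun L v _ _ => ?_
      rw [OrdPart.bd_single]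
      exact Finset.sum_empty
    · rw [← symbol_d hc]
      exact symbol_fil hd
  have : ∃ u ∈ OrdPart.chains (Cells S p →₀ k) (n + 1) p,
      OrdPart.bd _ (n + 1) u = symbol p n c := by
    -- Below the top degree the complex of partitions is exact. Above it, a partition would have
    -- more blocks than elements, so the symbol is zero.
    rcases lt_or_gt_of_ne hpn with h | h
    · exact OrdPart.exists_bd hs h hb
    · exact ⟨0, zero_mem _, by rw [OrdPart.chains_eq_zero h hs, map_zero]⟩
  obtain ⟨u, hu, hu'⟩ := this
  obtain ⟨h1, h2⟩ := ofSymbol_mem hu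
  refine ⟨_, h1, ?_⟩
  have h3 := sub_ofSymbol_mem (sub_mem hc (d_mem_fil h1))
  rwa [map_sub, symbol_d h1, h2, hu', sub_self, map_zero, sub_zero] at h3

/-- As long as the number of interior vertices exceeds the degree, the leading symbol is a cycle
below the top degree and can be removed by a boundary. This does not alter the boundary of the
chain, so the process continues until it stops on the diagonal. -/
theorem exists_sub_d_mem_diag {n : ℕ} {c : NChains k (underlying (loopMonoid.obj S))}
    (hc : c ∈ NChains.gr k (underlying (loopMonoid.obj S)) n)
    (hd : NChains.d k c ∈ fil S k (n + 1) (n - 1)) :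
    ∃ y ∈ NChains.gr k (underlying (loopMonoid.obj S)) (n + 1),
      c - NChains.d k y ∈ fil S k (n + 1) n := by
  obtain ⟨p, hp⟩ := exists_mem_fil hc
  induction p generalizing c with
  | zero => exact ⟨0, zero_mem _, by rw [map_zero, sub_zero]; exact fil_mono (Nat.zero_le _) hp⟩
  | succ p ih =>
    rcases le_or_gt p n with h | h
    · exact ⟨0, zero_mem _, by rw [map_zero, sub_zero]; exact fil_mono (by omega) hp⟩
    · obtain ⟨y, hy, hy'⟩ := exists_sub_d_mem h.ne hp (fil_mono (by omega) hd)
      have hd' : NChains.d k (c - NChains.d k y) = NChains.d k c := by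
        rw [map_sub, NChains.d_d, sub_zero]
      obtain ⟨z, hz, hz'⟩ := ih (fil_le_gr _ _ hy') (by rwa [hd']) hy'
      refine ⟨y + z, add_mem (fil_le_gr _ _ hy) hz, ?_⟩
      rwa [map_add, ← sub_sub]

/-- The symbol of such a chain is a top-degree cycle of the complex of partitions, which vanishes
with its coefficient at `1, …, n`. The chain then has fewer than `n` interior vertices in degree
`n`, so it is zero. -/
theorem eq_zero_of_symbol {n : ℕ} {c : NChains k (underlying (loopMonoid.obj S))}
    (hc : c ∈ fil S k (n + 1) n) (hd : NChains.d k c ∈ fil S k n (n - 1))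
    (h : symbol n n c (List.range' 1 n) = 0) : c = 0 := by
  have hs := symbol_mem_chains hc
  have hb : OrdPart.bd _ n (symbol n n c) = 0 := by
    obtain _ | n := n
    · refine OrdPart.chains_induction hs (map_zero _)
        (fun x y hx hy => by rw [map_add, hx, hy, add_zero]) fun L v _ _ => ?_
      rw [OrdPart.bd_single]
      exact Finset.sum_empty
    · rw [← symbol_d hc]
      exact symbol_fil hd
  have h1 := sub_ofSymbol_mem hc
  rw [OrdPart.eq_zero_of_bd hs hb h, map_zero, sub_zero] at h1
  exact fil_eq_zero le_rfl h1

end chains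

end Rigid

/-! ### The first shuffle -/

namespace Shuffle

/-- The shuffle with steps in the first coordinate only. -/
def left : (p : ℕ) → Shuffle p 0
  | 0 => nil
  | p + 1 => inl (left p)

theorem eq_left : {p : ℕ} → (w : Shuffle p 0) → w = left p
  | _, nil => rfl
  | _, inl w => by rw [left, eq_left w]

/-- The shuffle that begins with all the steps in the first coordinate. -/
def first (p : ℕ) : (q : ℕ) → Shuffle p q
  | 0 => left p
  | q + 1 => inr (first p q)

theorem sgn_left (p : ℕ) : (left p).sgn = 1 := by
  induction p with
  | zero => rfl
  | succ p ih => rw [left, sgn, ih]; rfl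

theorem sgn_first (p q : ℕ) : (first p q).sgn = 1 := by
  induction q with
  | zero => exact sgn_left p
  | succ q ih => exact ih

theorem append_of_lt {n m : ℕ} (f : ⦋n⦌ ⟶ ⦋m⦌) (t : Fin (n + 1 + 1)) (h : (t : ℕ) < n + 1) :
    (append f).toOrderHom t = f.toOrderHom ⟨t, h⟩ :=
  append_castSucc f ⟨t, h⟩

theorem append_delta_of_lt {n m : ℕ} (f : ⦋n⦌ ⟶ ⦋m⦌) (t : Fin (n + 1 + 1)) (h : (t : ℕ) < n + 1) :
    ((append (f ≫ SimplexCategory.δ (Fin.last (m + 1)))).toOrderHom t : ℕ) =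
      f.toOrderHom ⟨t, h⟩ := by
  rw [append_of_lt _ t h, comp_apply, delta_last_apply, Fin.val_castSucc]

theorem append_of_eq {n m : ℕ} (f : ⦋n⦌ ⟶ ⦋m⦌) (t : Fin (n + 1 + 1)) (h : (t : ℕ) = n + 1) :
    ((append f).toOrderHom t : ℕ) = m := by
  obtain rfl : t = Fin.last (n + 1) := Fin.ext h
  rw [append_last]
  rfl

/-- Each letter of a shuffle raises exactly one of the two coordinates by one. -/
theorem fst_add_snd : {p q : ℕ} → (w : Shuffle p q) → (t : Fin (w.len + 1)) →
    (w.fst.toOrderHom t : ℕ) + w.snd.toOrderHom t = t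
  | _, _, nil, t => by
    obtain rfl : t = 0 := Subsingleton.elim (α := Fin 1) _ _
    rfl
  | p + 1, q, inl w, t => by
    have hw := w.len_eq
    rcases Nat.lt_or_eq_of_le (Nat.lt_succ_iff.1 t.2) with h | h
    · exact (congrArg₂ (· + ·) (append_delta_of_lt w.fst t h) (congrArg Fin.val
        (append_of_lt w.snd t h))).trans (fst_add_snd w ⟨t, h⟩)
    · refine (congrArg₂ (· + ·) (append_of_eq (w.fst ≫ SimplexCategory.δ (Fin.last (p + 1))) t h)
        (append_of_eq w.snd t h)).trans ?_
      rw [h, len, hw]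
      exact Nat.add_right_comm p 1 q
  | p, q + 1, inr w, t => by
    have hw := w.len_eq
    rcases Nat.lt_or_eq_of_le (Nat.lt_succ_iff.1 t.2) with h | h
    · exact (congrArg₂ (· + ·) (congrArg Fin.val (append_of_lt w.fst t h))
        (append_delta_of_lt w.snd t h)).trans (fst_add_snd w ⟨t, h⟩)
    · refine (congrArg₂ (· + ·) (append_of_eq w.fst t h)
        (append_of_eq (w.snd ≫ SimplexCategory.δ (Fin.last (q + 1))) t h)).trans ?_
      rw [h, len, hw]
      rfl

theorem fst_first_of_le (p : ℕ) : (q : ℕ) → (t : Fin ((first p q).len + 1)) → (t : ℕ) ≤ p →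
    ((first p q).fst.toOrderHom t : ℕ) = t
  | 0, t, _ => by
    have h1 := fst_add_snd (first p 0) t
    have h2 := Nat.lt_one_iff.1 ((first p 0).snd.toOrderHom t).2
    omega
  | q + 1, t, ht => by
    have hw := (first p q).len_eq
    have h : (t : ℕ) < (first p q).len + 1 := by omega
    exact (congrArg Fin.val (append_of_lt (first p q).fst t h)).trans (fst_first_of_le p q ⟨t, h⟩ ht)

/-- A first coordinate that equals `p` after `p` letters leaves no room for an earlier step in the
second coordinate. -/
theorem eq_first : {p q : ℕ} → (w : Shuffle p q) → (t : Fin (w.len + 1)) → (t : ℕ) = p →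
    (w.fst.toOrderHom t : ℕ) = p → w = first p q
  | _, _, nil, _, _, _ => rfl
  | p + 1, 0, w, _, _, _ => eq_left w
  | p + 1, q + 1, inl w, t, ht, h => by
    have hw := w.len_eq
    have ht' : (t : ℕ) < w.len + 1 := by omega
    have h1 := (append_delta_of_lt w.fst t ht').symm.trans h
    have h2 := (w.fst.toOrderHom ⟨t, ht'⟩).2
    rw [h1] at h2
    exact absurd h2 (lt_irrefl _)
  | p, q + 1, inr w, t, ht, h => by
    have hw := w.len_eq
    have ht' : (t : ℕ) < w.len + 1 := by omega
    rw [first, eq_first w ⟨t, ht'⟩ ht ((congrArg Fin.val (append_of_lt w.fst t ht')).symm.trans h)]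

theorem fst_zero {p q : ℕ} (w : Shuffle p q) : w.fst.toOrderHom 0 = 0 := by
  have := fst_add_snd w 0
  exact Fin.ext (by simp at this ⊢; omega)

theorem snd_zero {p q : ℕ} (w : Shuffle p q) : w.snd.toOrderHom 0 = 0 := by
  have := fst_add_snd w 0
  exact Fin.ext (by simp at this ⊢; omega)

theorem sum_eq_first {V : Type*} [AddCommGroup V] {p q : ℕ} (f : Shuffle p q → V)
    (h : ∀ w, w ≠ first p q → f w = 0) : ∑ w : Shuffle p q, w.sgn • f w = f (first p q) := by
  rw [Fintype.sum_eq_single (first p q) fun w hw => by rw [h w hw, smul_zero], sgn_first, one_smul]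

end Shuffle

theorem eq_range'_of_pairwise {p : ℕ} {L : List ℕ} (h : ∀ a ∈ L, 1 ≤ a ∧ a ≤ p)
    (hs : L.Pairwise (· < ·)) : L.length ≤ p ∧ (p ≤ L.length → L = List.range' 1 p) := by
  have hn : L.Nodup := hs.imp fun h => h.ne
  have hsub : L.toFinset ⊆ Finset.Icc 1 p := fun a ha =>
    Finset.mem_Icc.2 (h a (List.mem_toFinset.1 ha))
  have hc := Finset.card_le_card hsub
  rw [List.toFinset_card_of_nodup hn, Nat.card_Icc, Nat.add_sub_cancel] at hc
  refine ⟨hc, fun hp => ?_⟩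
  have he : L.toFinset = Finset.Icc 1 p := Finset.eq_of_subset_of_card_le hsub (by
    rw [List.toFinset_card_of_nodup hn, Nat.card_Icc, Nat.add_sub_cancel]; exact hp)
  refine List.Perm.eq_of_pairwise (le := (· ≤ ·)) (fun a b _ _ => le_antisymm)
    (hs.imp fun h => h.le) ((List.pairwise_lt_range' (s := 1) (n := p)).imp fun h => h.le) ?_
  refine List.perm_of_nodup_nodup_toFinset_eq hn List.nodup_range' ?_
  rw [he]
  ext a
  rw [Finset.mem_Icc, List.mem_toFinset, List.mem_range'_1]
  omega

namespace Rigid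

variable {S : ReducedSSet.{u}}

/-! ### The evaluation on sequences of cells -/

/-- Operators act on labels by a weakly monotone rule, so they cannot make a weakly decreasing pair
strictly increasing. -/
theorem pairwise_of_labelRel {m m' : SimplexCategoryᵒᵖ} {f : m ⟶ m'} {L L' : List ℕ}
    (h : List.Forall₂ (LabelRel f) L' L) (hs : L'.Pairwise (· < ·)) (hl : ∀ a ∈ L', a ≤ m'.unop.len) :
    L.Pairwise (· < ·) := by
  rw [List.pairwise_iff_getElem] at hs ⊢
  intro i j hi hj hij
  have hi' := h.length_eq.symm ▸ hi
  have hj' := h.length_eq.symm ▸ hj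
  by_contra hle
  have h1 := (List.Forall₂.get h hi' hi ⟨L'[i], Nat.lt_succ_of_le (hl _ (List.getElem_mem _))⟩).1 le_rfl
  have h2 := (List.Forall₂.get h hj' hj ⟨L'[i], Nat.lt_succ_of_le (hl _ (List.getElem_mem _))⟩).2
    ((not_lt.1 hle).trans h1)
  exact absurd (hs i j hi' hj' hij) (not_lt.2 h2)

/-- The labels of the product are those of the two degenerated factors, one after the other. If
together they read `1, …, p + q`, the original lists are strictly increasing in `1, …, p` and in `1,
…, q`, hence no longer than `p` and `q`. The total length forces equality, so that both lists are
full. Then the first factor's vertices enter at the first `p` steps, which determines the shuffle.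
This is what makes `ev` multiplicative. -/
theorem eq_first_of_nf_mul {p q : ℕ} {a : (loopMonoid.obj S).obj (op ⦋p⦌)}
    {b : (loopMonoid.obj S).obj (op ⦋q⦌)} (w : Shuffle p q)
    (h : (nf (((loopMonoid.obj S).map w.fst.op).hom a * ((loopMonoid.obj S).map w.snd.op).hom b)).2.toList =
      List.range' 1 w.len) :
    w = Shuffle.first p q ∧ (nf a).2.toList = List.range' 1 p ∧ (nf b).2.toList = List.range' 1 q := by
  have h1 := (nf_map w.fst.op (S := S) w.fst_zero w.fst_last a).2
  have h2 := (nf_map w.snd.op (S := S) w.snd_zero w.snd_last b).2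
  rw [nf_mul, Prod.snd_mul, FreeMonoid.toList_mul] at h
  generalize (nf (((loopMonoid.obj S).map w.fst.op).hom a)).2.toList = L1' at *
  generalize (nf (((loopMonoid.obj S).map w.snd.op).hom b)).2.toList = L2' at *
  have ha := (labels_nf a).2
  have hb := (labels_nf b).2
  generalize (nf a).2.toList = L1 at *
  generalize (nf b).2.toList = L2 at *
  have hlen := congrArg List.length h
  rw [List.length_append, List.length_range'] at hlen
  have hw := w.len_eq
  have hle : ∀ x ∈ L1' ++ L2', x ≤ w.len := fun x hx => by
    rw [h, List.mem_range'_1] at hx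
    omega
  have hpw : (L1' ++ L2').Pairwise (· < ·) := by
    rw [h]; exact List.pairwise_lt_range'
  rw [List.pairwise_append] at hpw
  obtain ⟨hp, hp'⟩ := eq_range'_of_pairwise ha (pairwise_of_labelRel h1 hpw.1
    fun x hx => hle x (List.mem_append_left _ hx))
  obtain ⟨hq, hq'⟩ := eq_range'_of_pairwise hb (pairwise_of_labelRel h2 hpw.2.1
    fun x hx => hle x (List.mem_append_right _ hx))
  have e1 := h1.length_eq
  have e2 := h2.length_eq
  change L1.length ≤ p at hp
  change L2.length ≤ q at hq
  have hp2 := hp' (show p ≤ L1.length by omega)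
  have hq2 := hq' (show q ≤ L2.length by omega)
  obtain rfl : L1 = List.range' 1 p := hp2
  obtain rfl : L2 = List.range' 1 q := hq2
  refine ⟨?_, rfl, rfl⟩
  have hpw : p < w.len + 1 := by omega
  refine Shuffle.eq_first w ⟨p, hpw⟩ rfl (le_antisymm (Nat.lt_succ_iff.1
    (w.fst.toOrderHom ⟨p, hpw⟩).2) ?_)
  rcases Nat.eq_zero_or_pos p with rfl | hpos
  · exact Nat.zero_le _
  rw [List.length_range'] at e1
  -- The last vertex of the first factor has label `p` before and after the degeneracy. Comparing
  -- both labels at index `p` shows that the first coordinate has reached `p` there.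
  have := (List.Forall₂.get h1 (i := p - 1) (by omega) (by rw [List.length_range']; omega)
    ⟨p, hpw⟩).1 ?_
  · simp only [List.get_eq_getElem, List.getElem_range'] at this
    refine le_trans (by omega) this
  · simp only [List.get_eq_getElem]
    have h3 : (L1' ++ L2')[p - 1]'(by rw [List.length_append]; omega) = L1'[p - 1]'(by omega) :=
      List.getElem_append_left _
    rw [← h3]
    simp only [h, List.getElem_range']
    omega

/-- The first shuffle exhausts the first coordinate before it moves the second, so it keeps the
labels of `a` and raises those of `b` by `p`. -/
theorem nf_mul_first {p q : ℕ} {a : (loopMonoid.obj S).obj (op ⦋p⦌)}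
    {b : (loopMonoid.obj S).obj (op ⦋q⦌)} (ha : (nf a).2.toList = List.range' 1 p)
    (hb : (nf b).2.toList = List.range' 1 q) :
    nf (((loopMonoid.obj S).map (Shuffle.first p q).fst.op).hom a *
      ((loopMonoid.obj S).map (Shuffle.first p q).snd.op).hom b) =
      ((nf a).1 * (nf b).1, FreeMonoid.ofList (List.range' 1 (Shuffle.first p q).len)) := by
  have hla := labels_nf a
  have hlb := labels_nf b
  have hlen := (Shuffle.first p q).len_eq
  have fs := Shuffle.fst_add_snd (Shuffle.first p q)
  have ff := Shuffle.fst_first_of_le p q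
  have ef : ∀ t : Fin ((Shuffle.first p q).len + 1), p ≤ t →
      ((Shuffle.first p q).fst.toOrderHom t : ℕ) = p := fun t ht => by
    refine le_antisymm (Nat.lt_succ_iff.1 ((Shuffle.first p q).fst.toOrderHom t).2) ?_
    have h1 := ff ⟨p, by omega⟩ le_rfl
    exact h1.ge.trans ((Shuffle.first p q).fst.toOrderHom.monotone ht)
  have e1 : ((loopMonoid.obj S).map (Shuffle.first p q).fst.op).hom a =
      realize _ (nf a).1.toList (List.range' 1 p) := by
    conv_lhs => rw [← realize_nf a, ha]
    refine map_realize _ _ (List.forall₂_same.2 fun i hi t => ?_)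
    rw [List.mem_range'_1] at hi
    change _ ↔ i ≤ ((Shuffle.first p q).fst.toOrderHom t : ℕ)
    rcases le_total (t : ℕ) p with h | h
    · rw [ff t h]
    · rw [ef t h]
      omega
  have e2 : ((loopMonoid.obj S).map (Shuffle.first p q).snd.op).hom b =
      realize _ (nf b).1.toList (List.range' (1 + p) q) := by
    conv_lhs => rw [← realize_nf b, hb]
    refine map_realize _ _ ?_
    rw [show List.range' (1 + p) q = (List.range' 1 q).map (p + ·) by
      rw [List.map_add_range', add_comm]]
    rw [List.forall₂_map_left_iff]
    refine List.forall₂_same.2 fun i hi t => ?_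
    rw [List.mem_range'_1] at hi
    change _ ↔ i ≤ ((Shuffle.first p q).snd.toOrderHom t : ℕ)
    have := fs t
    rcases le_total (t : ℕ) p with h | h
    · have := ff t h; omega
    · have := ef t h; omega
  have hl : Labels (op ⦋(Shuffle.first p q).len⦌) ((nf a).1.toList ++ (nf b).1.toList)
      (List.range' 1 p ++ List.range' (1 + p) q) := by
    rw [ha] at hla
    rw [hb] at hlb
    refine ⟨?_, fun x hx => ?_⟩
    · rw [List.length_append, dim_append, ← hla.1, ← hlb.1]
      simp
    · rw [List.mem_append, List.mem_range'_1, List.mem_range'_1] at hx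
      change 1 ≤ x ∧ x ≤ (Shuffle.first p q).len
      omega
  rw [e1, e2, ← realize_append, nf_realize hl]
  · refine Prod.ext rfl ?_
    refine congrArg FreeMonoid.ofList ?_
    rw [hlen, ← List.range'_append, one_mul]
  · rw [← hla.1, ha]

section ev

variable {k : Type v} [CommRing k]

open Classical in
/-- The value of the evaluation on a simplex. -/
noncomputable def evVal (k : Type v) [CommRing k] (n : ℕ) (y : (loopMonoid.obj S).obj (op ⦋n⦌)) :
    MonoidAlgebra k (FreeMonoid (Cell S.toSSet)) :=
  if (nf y).2.toList = List.range' 1 n then MonoidAlgebra.of k _ (nf y).1 else 0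

theorem good_range' (n : ℕ) : OrdPart.Good n (List.range' 1 n) := fun a => by
  rw [List.mem_range'_1]; omega

/-- The linear map that sends a simplex with labels `1, …, n` to its sequence of cells, and all other
simplices to zero. -/
noncomputable def evLin (k : Type v) [CommRing k] (S : ReducedSSet.{u}) :
    NChains k (underlying (loopMonoid.obj S)) →ₗ[k] MonoidAlgebra k (FreeMonoid (Cell S.toSSet)) :=
  NChains.lift (fun n y => evVal k n y) fun n i y => by
    refine if_neg fun h => not_good_degenerate i y ?_
    have h' := (good_range' (n + 1) (i + 1)).2 ⟨by omega, by omega⟩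
    rw [← h] at h'
    exact h'

theorem evLin_mcls {n : ℕ} (y : (loopMonoid.obj S).obj (op ⦋n⦌)) :
    evLin k S (NChains.mcls k y) = evVal k n y :=
  NChains.lift_cls (X := underlying (loopMonoid.obj S)) _ _ y

/-- By `eq_first_of_nf_mul` only the first shuffle can produce the label list `1, …, p + q`, and
only if both factors have full lists. It has sign `1`, and the sequences of cells are concatenated.
-/
theorem evLin_mul (c c' : NChains k (underlying (loopMonoid.obj S))) :
    evLin k S (c * c') = evLin k S c * evLin k S c' := by
  have : (NChains.mulMap k (M := loopMonoid.obj S)).compr₂ (evLin k S) =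
      (LinearMap.mul k _).compl₁₂ (evLin k S) (evLin k S) := by
    refine NChains.hom_ext' k fun p a => NChains.hom_ext' k fun q b => ?_
    rw [LinearMap.compr₂_apply, LinearMap.compl₁₂_apply, LinearMap.mul_apply', NChains.mulMap_mcls,
      NChains.shuffleProd, map_sum]
    simp only [map_zsmul, evLin_mcls]
    by_cases h : (nf a).2.toList = List.range' 1 p ∧ (nf b).2.toList = List.range' 1 q
    · rw [Shuffle.sum_eq_first (fun w : Shuffle p q => evVal k w.len
        (((loopMonoid.obj S).map w.fst.op).hom a * ((loopMonoid.obj S).map w.snd.op).hom b)) fun w hw =>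
          if_neg fun h' => hw (eq_first_of_nf_mul w h').1]
      rw [evVal, evVal, evVal, nf_mul_first h.1 h.2, if_pos h.1, if_pos h.2]
      exact (if_pos rfl).trans (map_mul _ _ _)
    · rw [Finset.sum_eq_zero fun w _ => by
        rw [evVal, if_neg fun h' => h (eq_first_of_nf_mul w h').2, smul_zero]]
      rw [not_and_or] at h
      rcases h with h | h
      · rw [evVal, if_neg h, zero_mul]
      · rw [evVal, evVal, if_neg h, mul_zero]
  exact LinearMap.congr_fun (LinearMap.congr_fun this c) c'

/-- The evaluation of chains on the loop monoid on sequences of cells. -/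
noncomputable def ev (k : Type v) [CommRing k] (S : ReducedSSet.{u}) :
    NChains k (underlying (loopMonoid.obj S)) →ₐ[k] MonoidAlgebra k (FreeMonoid (Cell S.toSSet)) :=
  AlgHom.ofLinearMap (evLin k S) ((evLin_mcls _).trans (if_pos rfl)) evLin_mul

theorem ev_mcls {n : ℕ} (y : (loopMonoid.obj S).obj (op ⦋n⦌)) :
    ev k S (NChains.mcls k y) = evVal k n y := evLin_mcls y

theorem ev_coeff {n : ℕ} {c : NChains k (underlying (loopMonoid.obj S))}
    (hc : c ∈ NChains.gr k (underlying (loopMonoid.obj S)) n) (w : Cells S n) :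
    symbol n n c (List.range' 1 n) w = (ev k S c).coeff (FreeMonoid.ofList w.1) := by
  classical
  have key : ∀ y : (loopMonoid.obj S).obj (op ⦋n⦌), symbolVal k n n y (List.range' 1 n) w =
      (evVal k n y).coeff (FreeMonoid.ofList w.1) := fun y => by
    have hl := labels_nf y
    rw [symbolVal, evVal]
    by_cases h : (nf y).2.toList = List.range' 1 n
    · have hd : dim (nf y).1.toList = n := by
        have := hl.1
        rw [h, List.length_range'] at this
        exact this.symm
      rw [if_pos h, dif_pos ⟨h ▸ good_range' n, hd⟩, Finsupp.single_apply, if_pos h, MonoidAlgebra.of_apply, MonoidAlgebra.coeff_single,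
        Finsupp.single_apply, Finsupp.single_apply]
      refine if_congr ?_ rfl rfl
      rw [Subtype.ext_iff]
      rfl
    · rw [if_neg h]
      split_ifs
      · rw [Finsupp.single_eq_of_ne' h]
        rfl
      · rfl
  refine Submodule.span_induction (p := fun c _ => symbol n n c (List.range' 1 n) w =
    (ev k S c).coeff (FreeMonoid.ofList w.1)) ?_ (by simp) ?_ ?_ hc
  · rintro _ ⟨y, rfl⟩
    have h1 := symbol_mcls (S := S) (k := k) n n y
    have h2 := ev_mcls (S := S) (k := k) (n := n) y
    have h3 := key y
    rw [← h1, ← h2] at h3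
    exact h3
  · intro a b _ _ ha hb
    simp only [map_add, Finsupp.add_apply, ha, hb, MonoidAlgebra.coeff_add]
  · intro r a _ ha
    simp only [map_smul, Finsupp.smul_apply, ha, MonoidAlgebra.coeff_smul]

/-- The coefficients of `ev` in degree `n` are the coefficients of the symbol at the distinguished
partition, one for each sequence of cells, and these determine a diagonal chain. -/
theorem eq_zero_of_ev {n : ℕ} {c : NChains k (underlying (loopMonoid.obj S))}
    (hc : c ∈ fil S k (n + 1) n) (hd : NChains.d k c ∈ fil S k n (n - 1)) (h : ev k S c = 0) : c = 0 := by
  refine eq_zero_of_symbol hc hd (Finsupp.ext fun w => ?_)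
  rw [ev_coeff (fil_le_gr _ _ hc), h]
  rfl

end ev

end Rigid

/-! ### Chains of flags -/

namespace Flag

/-- The image of flags under a relation between natural numbers. -/
def relabel (r : ℕ → ℕ → Prop) : flags.{u} ⟶ flags.{u} where
  app m := MonCat.ofHom
    { toFun := fun T : Flag.{u} m => (⟨fun t => {b | ∃ a ∈ T.set t, r a b},
        fun _ _ h _ ⟨a, ha, hr⟩ => ⟨a, T.mono h ha, hr⟩⟩ : Flag.{u} m)
      map_one' := Flag.ext (funext fun _ => Set.ext fun _ =>
        ⟨fun ⟨_, ha, _⟩ => ha, fun h => h.elim⟩)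
      map_mul' := fun T T' => Flag.ext (funext fun _ => Set.ext fun _ =>
        ⟨fun ⟨a, ha, hr⟩ => ha.imp (fun h => ⟨a, h, hr⟩) fun h => ⟨a, h, hr⟩,
          fun h => h.elim (fun ⟨a, ha, hr⟩ => ⟨a, Or.inl ha, hr⟩)
            fun ⟨a, ha, hr⟩ => ⟨a, Or.inr ha, hr⟩⟩) }

/-- The edge from the empty set to a given set. -/
def edge (B : Set ℕ) : flags.{u}.obj (op ⦋1⦌) :=
  (⟨fun t => {b | t ≠ 0 ∧ b ∈ B}, fun _ _ h _ hb =>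
    ⟨((Fin.pos_iff_ne_zero.2 hb.1).trans_le h).ne', hb.2⟩⟩ : Flag.{u} (op ⦋1⦌))

/-- The constant flag. -/
def const (B : Set ℕ) (m : SimplexCategoryᵒᵖ) : flags.{u}.obj m :=
  (⟨fun _ => B, fun _ _ _ => le_rfl⟩ : Flag.{u} m)

end Flag

variable (k : Type v) [CommRing k]

/-- The algebra of normalized chains of flags. -/
abbrev FlagChains : Type (max u v) := NChains k (underlying flags.{u})

namespace FlagChains

open NChains

/-- The edge from the empty set to the set that consists of a given number. -/
noncomputable def e (b : ℕ) : FlagChains.{u} k := mcls k (Flag.edge {b})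

/-- The set that consists of a given number. -/
noncomputable def vert (b : ℕ) : FlagChains.{u} k :=
  mcls k (Flag.const {b} (op ⦋0⦌))

/-- The product of the edges to given numbers. -/
noncomputable def chain (l : List ℕ) : FlagChains.{u} k := (l.map (e k)).prod

variable {k}

theorem chain_nil : chain k [] = (1 : FlagChains.{u} k) := rfl

theorem chain_append (l l' : List ℕ) :
    chain k (l ++ l') = (chain k l * chain k l' : FlagChains.{u} k) := by
  rw [chain, List.map_append, List.prod_append, chain, chain]

theorem chain_singleton (b : ℕ) : chain k [b] = (e k b : FlagChains.{u} k) := by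
  rw [chain, List.map_singleton, List.prod_singleton]

theorem e_mem (b : ℕ) : e k b ∈ gr k (underlying flags.{u}) 1 :=
  cls_mem k (X := underlying flags.{u}) _

theorem chain_mem (l : List ℕ) : chain k l ∈ gr k (underlying flags.{u}) l.length := by
  induction l with
  | nil => exact SetLike.GradedOne.one_mem
  | cons b l ih =>
    rw [chain, List.map_cons, List.prod_cons, List.length_cons, add_comm]
    exact SetLike.mul_mem_graded (e_mem b) ih

theorem mcls_edge_map {n : ℕ} {m : SimplexCategory} (f : ⦋n⦌ ⟶ m) (x : flags.{u}.obj (op m)) (t : Fin n)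
    (ht : f.toOrderHom t.castSucc = f.toOrderHom t.succ) :
    mcls k ((flags.{u}.map f.op).hom x) = 0 :=
  cls_map k (X := underlying flags.{u}) f x t ht

theorem mcls_edge_empty : mcls k (Flag.edge.{u} ∅) = 0 := by
  refine (congrArg (mcls k) ?_).trans (mcls_edge_map (k := k) (SimplexCategory.σ (0 : Fin 1)) (1 : Flag.{u} (op ⦋0⦌)) 0
    (Subsingleton.elim (α := Fin 1) _ _))
  exact Flag.ext (funext fun t => Set.ext fun b => ⟨fun h => h.2, fun h => h.elim⟩)

theorem d_e (b : ℕ) : d k (e k b) = (vert k b - 1 : FlagChains.{u} k) := by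
  rw [e, d_mcls, Fin.sum_univ_two, Fin.val_zero, pow_zero, one_smul, Fin.val_one, pow_one, neg_one_smul,
    ← sub_eq_add_neg]
  refine congrArg₂ (· - ·) (congrArg (mcls k) ?_) (congrArg (mcls k) ?_)
  · exact Flag.ext (funext fun t => Set.ext fun b => ⟨fun h => h.2, fun h =>
      ⟨by obtain rfl : t = 0 := Subsingleton.elim (α := Fin 1) _ _
          exact Fin.succ_ne_zero (n := 1) 0, h⟩⟩)
  · exact Flag.ext (funext fun t => Set.ext fun b => ⟨fun h => h.1 (by
      obtain rfl : t = 0 := Subsingleton.elim (α := Fin 1) _ _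
      rfl), fun h => h.elim⟩)

/-- Multiplication is union, so in each of the shuffles the set `{b}` is present from index `1` on.
The resulting `2`-simplex does not change between the indices `1` and `2` and is degenerate. -/
theorem e_mul_e (b : ℕ) : e k b * e k b = (0 : FlagChains.{u} k) := by
  rw [e, mul_def, mulMap_mcls, shuffleProd]
  refine Finset.sum_eq_zero fun w _ => ?_
  have hw := w.len_eq
  have key : (flags.{u}.map w.fst.op).hom (Flag.edge {b}) * (flags.{u}.map w.snd.op).hom (Flag.edge {b}) =
      (flags.{u}.map (SimplexCategory.mkHom
        { toFun := fun t => if t = 0 then 0 else 1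
          monotone' := fun s t h => by
            dsimp only
            by_cases h1 : s = 0
            · rw [if_pos h1]
              exact Fin.zero_le _
            · rw [if_neg h1, if_neg fun h2 : t = 0 => h1 (le_antisymm (h2 ▸ h) (Fin.zero_le _))] } :
          ⦋w.len⦌ ⟶ ⦋1⦌).op).hom (Flag.edge {b}) := by
    refine Flag.ext (funext fun t => Set.ext fun c => ?_)
    change ((w.fst.toOrderHom t ≠ 0 ∧ c = b) ∨ (w.snd.toOrderHom t ≠ 0 ∧ c = b)) ↔
      ((if t = 0 then (0 : Fin 2) else 1) ≠ 0 ∧ c = b)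
    rw [← or_and_right]
    refine and_congr_left fun _ => ?_
    have h1 := Shuffle.fst_add_snd w t
    by_cases ht : t = 0
    · rw [if_pos ht, ht, Shuffle.fst_zero, Shuffle.snd_zero]
      exact ⟨fun h => h.elim id id, Or.inl⟩
    · rw [if_neg ht]
      refine iff_of_true ?_ one_ne_zero
      by_contra! h
      rw [h.1, h.2] at h1
      exact ht (Fin.ext h1.symm)
  have h1 : ∀ t : Fin (w.len + 1), (t : ℕ) ≠ 0 → (if t = 0 then (0 : Fin 2) else 1) = 1 :=
    fun t ht => if_neg fun h => ht (congrArg Fin.val h)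
  rw [key, mcls_edge_map _ _ ⟨1, by omega⟩, smul_zero]
  exact (h1 ⟨1, by omega⟩ (Nat.succ_ne_zero 0)).trans (h1 ⟨2, by omega⟩ (Nat.succ_ne_zero 1)).symm

theorem vert_mul_mcls {n : ℕ} (b : ℕ) (T : flags.{u}.obj (op ⦋n⦌)) :
    vert k b * mcls k T = mcls k (Flag.const {b} (op ⦋n⦌) * T) := by
  rw [vert, mul_def, mulMap_mcls, shuffleProd]
  exact Shuffle.sum_left_zero n fun i β => mcls k
    (Flag.const {b} (op ⦋i⦌) * (flags.{u}.map β.op).hom T)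

theorem mmap_relabel_e {r : ℕ → ℕ → Prop} {b c : ℕ} (h : ∀ x, r b x ↔ x = c) :
    mmap (Flag.relabel.{u} r) (e k b) = e k c := by
  rw [e, mmap_mcls, e]
  refine congrArg (mcls k) (Flag.ext (funext fun t => Set.ext fun x => ?_))
  exact ⟨fun ⟨a, ⟨h0, ha⟩, hr⟩ => ⟨h0, (h x).1 ((show a = b from ha) ▸ hr)⟩,
    fun hx => ⟨b, ⟨hx.1, rfl⟩, (h x).2 hx.2⟩⟩

theorem mmap_relabel_e_eq_zero {r : ℕ → ℕ → Prop} {b : ℕ} (h : ∀ x, ¬ r b x) :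
    mmap (Flag.relabel.{u} r) (e k b) = 0 := by
  rw [e, mmap_mcls]
  refine (congrArg (mcls k) (Flag.ext (funext fun t => Set.ext fun x => ?_))).trans mcls_edge_empty
  exact ⟨fun ⟨a, ⟨h0, ha⟩, hr⟩ => (h x ((show a = b from ha) ▸ hr)).elim, fun hx => hx.2.elim⟩

theorem mmap_relabel_chain {r : ℕ → ℕ → Prop} {l l' : List ℕ}
    (h : List.Forall₂ (fun b c => ∀ x, r b x ↔ x = c) l l') :
    mmap (Flag.relabel.{u} r) (chain k l) = chain k l' := by
  induction h with
  | nil => exact map_one _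
  | cons h _ ih =>
    rw [chain, List.map_cons, List.prod_cons, map_mul, mmap_relabel_e h, ← chain, ih]
    rfl

theorem mmap_relabel_chain_eq_zero {r : ℕ → ℕ → Prop} {l : List ℕ} {b : ℕ} (hb : b ∈ l)
    (h : ∀ x, ¬ r b x) : mmap (Flag.relabel.{u} r) (chain k l) = 0 := by
  obtain ⟨l₁, l₂, rfl⟩ := List.append_of_mem hb
  rw [← List.singleton_append, chain_append, chain_append, chain_singleton, map_mul, map_mul, mmap_relabel_e_eq_zero h, zero_mul, mul_zero]

/-- By the Leibniz rule one edge at a time is replaced by the difference of its end points: the set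
`{i + 1}`, and the empty set, which is the unit. -/
theorem d_chain_range' (n : ℕ) : d k (chain k (List.range' 1 n) : FlagChains.{u} k) =
    ∑ i ∈ Finset.range n, (-1 : ℤ) ^ i • (chain k (List.range' 1 i) * (vert k (i + 1) - 1) *
      chain k (List.range' (i + 2) (n - 1 - i))) := by
  induction n with
  | zero =>
    rw [Finset.sum_range_zero]
    exact d_zero k _ (chain_mem [])
  | succ n ih =>
    have hm : chain k (List.range' 1 n) ∈ gr k (underlying flags.{u}) n := by
      have := chain_mem.{u} (k := k) (List.range' 1 n)
      rwa [List.length_range'] at this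
    rw [List.range'_1_concat, chain_append, chain_singleton, leibniz k n _ _ hm, ih, d_e,
      Finset.sum_range_succ, Finset.sum_mul]
    congr 1
    · refine Finset.sum_congr rfl fun i hi => ?_
      rw [Finset.mem_range] at hi
      rw [smul_mul_assoc, mul_assoc, ← chain_singleton, ← chain_append,
        show n + 1 - 1 - i = (n - 1 - i) + 1 by omega, List.range'_1_concat,
        show i + 2 + (n - 1 - i) = 1 + n by omega]
    · rw [show n + 1 - 1 - n = 0 by omega, List.range'_zero, chain_nil, mul_one, add_comm 1 n]

end FlagChains

namespace Rigid

open NChains FlagChains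

variable {S : ReducedSSet.{u}} {m m' : SimplexCategoryᵒᵖ}

/-! ### Cutting a simplex at a vertex -/

/-- The two faces share the vertex `p + 1`, at which the product is a joint. So this vertex belongs
to every set of the flag `T`, the flag of the front face is read below it, and that of the back face
is translated by `p + 1`. -/
theorem el_mul_el {p q r : ℕ} (hr : p + q = r) (σ : S.toSSet.obj (op ⦋r + 2⦌)) {a b T : Flag.{u} m}
    (h : ∀ t u, u ∈ T.set t ↔ (u ∈ a.set t ∧ u ≤ p) ∨ u = p + 1 ∨ ∃ v ∈ b.set t, v + (p + 1) = u) :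
    el (S.toSSet.map (seg (r + 2) 0 (p + 1)).op σ) a *
      el (S.toSSet.map (seg (r + 2) (p + 1) (q + 1)).op σ) b = el σ T := by
  subst hr
  have hP : p + 1 < p + q + 2 + 1 := by omega
  let c₁ : (Cube (0 : Fin (p + q + 2 + 1)) ⟨p + 1, hP⟩).obj m := flag m (Fin.zero_le _)
    (fun t => {v | (v : ℕ) ∈ a.set t}) fun s t h v hv => a.mono h hv
  let c₂ : (Cube (⟨p + 1, hP⟩ : Fin (p + q + 2 + 1)) (Fin.last _)).obj m := flag m (Fin.le_last _)
    (fun t => {v | (v : ℕ) - (p + 1) ∈ b.set t}) fun s t h v hv => b.mono h hv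
  have e₁ : el (S.toSSet.map (seg (p + q + 2) 0 (p + 1)).op σ) a = gen σ 0 ⟨p + 1, hP⟩ c₁ := by
    refine gen_operator _ σ (Fin.ext ?_) (Fin.ext ?_) fun t u => ?_
    · rw [seg_val]; simp
    · rw [seg_val, Fin.val_last]; dsimp only; omega
    · refine mem_flagSet_flag.trans ?_
      simp only [Fin.ext_iff, Fin.le_def, Set.mem_ofPred_eq, Fin.val_zero, seg_val]
      constructor
      · rintro (hu | hu | ⟨_, hu, hu'⟩)
        · exact ⟨0, mem_elFlag.2 (Or.inl rfl), by rw [hu]; simp⟩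
        · exact ⟨Fin.last _, mem_elFlag.2 (Or.inr (Or.inl rfl)), by rw [hu, Fin.val_last]; omega⟩
        · exact ⟨⟨u, by omega⟩, mem_elFlag.2 (Or.inr (Or.inr hu')), by dsimp only; omega⟩
      · rintro ⟨v, hv, hu⟩
        rw [mem_elFlag, Fin.ext_iff, Fin.ext_iff, Fin.val_last, Fin.val_zero] at hv
        have hvu : (v : ℕ) = u := by have := v.2; omega
        rw [hvu] at hv
        rcases hv with hv | hv | hv
        exacts [Or.inl hv, Or.inr (Or.inl hv), Or.inr (Or.inr ⟨Nat.zero_le _, by have := v.2; omega, hv⟩)]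
  have e₂ : el (S.toSSet.map (seg (p + q + 2) (p + 1) (q + 1)).op σ) b =
      gen σ ⟨p + 1, hP⟩ (Fin.last _) c₂ := by
    refine gen_operator _ σ (Fin.ext ?_) (Fin.ext ?_) fun t u => ?_
    · rw [seg_val, Fin.val_zero]; dsimp only; omega
    · rw [seg_val, Fin.val_last, Fin.val_last]; omega
    · refine mem_flagSet_flag.trans ?_
      have hu2 := u.2
      simp only [Fin.ext_iff, Fin.le_def, Set.mem_ofPred_eq, Fin.val_last, seg_val]
      constructor
      · rintro (hu | hu | ⟨hu, _, hu'⟩)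
        · exact ⟨0, mem_elFlag.2 (Or.inl rfl), by rw [hu, Fin.val_zero]; omega⟩
        · exact ⟨Fin.last _, mem_elFlag.2 (Or.inr (Or.inl rfl)), by rw [hu, Fin.val_last]; omega⟩
        · exact ⟨⟨u - (p + 1), by omega⟩, mem_elFlag.2 (Or.inr (Or.inr hu')), by dsimp only; omega⟩
      · rintro ⟨v, hv, hu⟩
        have hv2 := v.2
        rw [mem_elFlag, Fin.ext_iff, Fin.ext_iff, Fin.val_last, Fin.val_zero] at hv
        have hvu : (v : ℕ) = u - (p + 1) := by omega
        rcases hv with hv | hv | hv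
        exacts [Or.inl (by omega), Or.inr (Or.inl (by omega)),
          Or.inr (Or.inr ⟨by omega, by omega, hvu ▸ hv⟩)]
  rw [e₁, e₂, gen_mul]
  refine gen_congr σ rfl rfl fun t => Set.ext fun u => ?_
  have hu2 := u.2
  rw [flagSet_scomp, Set.mem_union, mem_elFlag, h]
  refine (or_congr mem_flagSet_flag mem_flagSet_flag).trans ?_
  simp only [Fin.ext_iff, Fin.le_def, Set.mem_ofPred_eq, Fin.val_last, Fin.val_zero]
  constructor
  · rintro ((h1 | h1 | ⟨_, h1, h2⟩) | (h1 | h1 | ⟨h1, _, h2⟩))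
    · exact Or.inl h1
    · exact Or.inr (Or.inr (Or.inr (Or.inl h1)))
    · rcases Nat.lt_or_eq_of_le h1 with h1 | h1
      · exact Or.inr (Or.inr (Or.inl ⟨h2, by omega⟩))
      · exact Or.inr (Or.inr (Or.inr (Or.inl h1)))
    · exact Or.inr (Or.inr (Or.inr (Or.inl h1)))
    · exact Or.inr (Or.inl h1)
    · exact Or.inr (Or.inr (Or.inr (Or.inr ⟨_, h2, by omega⟩)))
  · rintro (h1 | h1 | ⟨h1, h2⟩ | h1 | ⟨v, h1, h2⟩)
    · exact Or.inl (Or.inl h1)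
    · exact Or.inr (Or.inr (Or.inl h1))
    · exact Or.inl (Or.inr (Or.inr ⟨Nat.zero_le _, by omega, h1⟩))
    · exact Or.inl (Or.inr (Or.inl h1))
    · refine Or.inr (Or.inr (Or.inr ⟨by omega, by omega, ?_⟩))
      rwa [← h2, Nat.add_sub_cancel]

/-! ### Flags as simplices of the loop monoid -/

/-- The map of simplicial sets from flags to the loop monoid given by a simplex. -/
def ofFlag {n : ℕ} (σ : S.toSSet.obj (op ⦋n⦌)) : underlying flags.{u} ⟶ underlying (loopMonoid.obj S) where
  app m := TypeCat.ofHom fun T : Flag.{u} m => el σ T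

variable {k : Type v} [CommRing k]

/-- The map from chains of flags to chains on the loop monoid given by a simplex. -/
noncomputable def ofFlagChain {n : ℕ} (σ : S.toSSet.obj (op ⦋n⦌)) :
    FlagChains.{u} k →ₗ[k] NChains k (underlying (loopMonoid.obj S)) :=
  NChains.map (ofFlag σ)

theorem ofFlagChain_mcls {n i : ℕ} (σ : S.toSSet.obj (op ⦋n⦌)) (T : flags.{u}.obj (op ⦋i⦌)) :
    ofFlagChain σ (mcls k T) = mcls k (el (m := op ⦋i⦌) σ T) :=
  map_cls k (X := underlying flags.{u}) _ _

/-- The map from flags to the loop monoid given by a simplex is simplicial but does not respect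
products: in flags both factors use the same simplex, in the loop monoid they are composed. The
factor `vert k (p + 1)` marks the joint, and the two relabellings place the flags on its two sides.
-/
theorem ofFlagChain_mul {p q r : ℕ} (hr : p + q = r) (σ : S.toSSet.obj (op ⦋r + 2⦌))
    (a b : FlagChains.{u} k) :
    ofFlagChain (S.toSSet.map (seg (r + 2) 0 (p + 1)).op σ) a *
      ofFlagChain (S.toSSet.map (seg (r + 2) (p + 1) (q + 1)).op σ) b =
    ofFlagChain σ (mmap (Flag.relabel.{u} fun v u => v = u ∧ v ≤ p) a * vert k (p + 1) *
      mmap (Flag.relabel.{u} fun v u => v + (p + 1) = u) b) := by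
  have H : (mulMap k (M := loopMonoid.obj S)).compl₁₂
      (ofFlagChain (S.toSSet.map (seg (r + 2) 0 (p + 1)).op σ))
      (ofFlagChain (S.toSSet.map (seg (r + 2) (p + 1) (q + 1)).op σ)) =
      ((mulMap k (M := flags.{u})).compl₁₂
        (mmap (Flag.relabel.{u} fun v u => v = u ∧ v ≤ p)).toLinearMap
        (mulMap k (vert k (p + 1)) ∘ₗ
          (mmap (Flag.relabel.{u} fun v u => v + (p + 1) = u)).toLinearMap)).compr₂ (ofFlagChain σ) := by
    refine NChains.hom_ext' k fun i a => NChains.hom_ext' k fun j b => ?_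
    rw [LinearMap.compr₂_apply, LinearMap.compl₁₂_apply, LinearMap.compl₁₂_apply]
    simp only [LinearMap.comp_apply, AlgHom.toLinearMap_apply]
    rw [mmap_mcls, mmap_mcls, ← mul_def, ← mul_def, ← mul_def, vert_mul_mcls, mul_def, mul_def]
    rw [ofFlagChain_mcls, ofFlagChain_mcls, mulMap_mcls, mulMap_mcls, shuffleProd, shuffleProd, map_sum]
    refine Finset.sum_congr rfl fun w _ => ?_
    rw [map_zsmul]
    refine congrArg _ (.trans (congrArg (mcls k) ?_) (ofFlagChain_mcls (k := k) σ _).symm)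
    refine el_mul_el (m := op ⦋w.len⦌) (a := Flag.map (m := op ⦋i⦌) w.fst.op a)
      (b := Flag.map (m := op ⦋j⦌) w.snd.op b) hr σ fun t u => ?_
    constructor
    · rintro (⟨v, hv, rfl, hv'⟩ | hu | ⟨v, hv, rfl⟩)
      exacts [Or.inl ⟨hv, hv'⟩, Or.inr (Or.inl hu), Or.inr (Or.inr ⟨v, hv, rfl⟩)]
    · rintro (⟨hu, hu'⟩ | hu | ⟨v, hv, rfl⟩)
      exacts [Or.inl ⟨u, hu, rfl, hu'⟩, Or.inr (Or.inl hu), Or.inr (Or.inr ⟨v, hv, rfl⟩)]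
  rw [mul_assoc]
  exact LinearMap.congr_fun (LinearMap.congr_fun H a) b

theorem ofFlagChain_d {n : ℕ} (σ : S.toSSet.obj (op ⦋n⦌)) (c : FlagChains.{u} k) :
    ofFlagChain σ (NChains.d k c) = NChains.d k (ofFlagChain σ c) :=
  map_d k _ c

/-- The relation between interior vertices given by a simplicial operator. -/
def opRel {n n' : ℕ} (α : ⦋n'⦌ ⟶ ⦋n⦌) (v u : ℕ) : Prop :=
  u ≠ 0 ∧ u ≠ n ∧ ∃ h : v < n' + 1, (α.toOrderHom ⟨v, h⟩ : ℕ) = u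

theorem opRel_iff {n n' : ℕ} {α : ⦋n'⦌ ⟶ ⦋n⦌} {v : ℕ} (h : v < n' + 1)
    (h0 : (α.toOrderHom ⟨v, h⟩ : ℕ) ≠ 0) (hn : (α.toOrderHom ⟨v, h⟩ : ℕ) ≠ n) (u : ℕ) :
    opRel α v u ↔ u = α.toOrderHom ⟨v, h⟩ :=
  ⟨fun ⟨_, _, _, hu⟩ => hu.symm, fun hu => ⟨hu ▸ h0, hu ▸ hn, h, hu.symm⟩⟩

theorem ofFlagChain_operator {n n' : ℕ} (α : ⦋n'⦌ ⟶ ⦋n⦌) (σ : S.toSSet.obj (op ⦋n⦌))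
    (h0 : α.toOrderHom 0 = 0) (hn : α.toOrderHom (Fin.last n') = Fin.last n) (c : FlagChains.{u} k) :
    ofFlagChain (S.toSSet.map α.op σ) c =
      ofFlagChain σ (mmap (Flag.relabel.{u} (opRel α)) c) := by
  refine LinearMap.congr_fun (f := ofFlagChain (S.toSSet.map α.op σ))
    (g := ofFlagChain σ ∘ₗ (mmap (Flag.relabel.{u} (opRel α))).toLinearMap)
    (hom_ext' k fun i T => ?_) c
  rw [LinearMap.comp_apply, AlgHom.toLinearMap_apply, mmap_mcls, ofFlagChain_mcls, ofFlagChain_mcls]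
  refine congrArg (mcls k) (el_operator (m := op ⦋i⦌) α σ h0 hn fun t u hu0 hun => ?_)
  constructor
  · rintro ⟨v, hv, -, -, h, hu⟩
    exact ⟨⟨v, h⟩, Fin.ext hu, hv⟩
  · rintro ⟨v, rfl, hv⟩
    exact ⟨v, hv, fun h => hu0 (Fin.ext h), fun h => hun (Fin.ext h), v.2, rfl⟩

/-! ### The fundamental chain of a simplex -/

variable (k) in
/-- The fundamental chain of the cube of paths from the first to the last vertex of a simplex, as a
chain on the loop monoid. -/
noncomputable def cube {n : ℕ} (σ : S.toSSet.obj (op ⦋n + 1⦌)) :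
    NChains k (underlying (loopMonoid.obj S)) :=
  ofFlagChain σ (chain k (List.range' 1 n))

theorem cube_mem_fil {n : ℕ} (σ : S.toSSet.obj (op ⦋n + 1⦌)) : cube k σ ∈ fil S k (n + 1) n := by
  have hm := chain_mem.{u} (k := k) (List.range' 1 n)
  rw [List.length_range'] at hm
  refine map_gr (ofFlagChain σ) n _ (fun T => ?_) _ hm
  exact (ofFlagChain_mcls (k := k) σ T).symm ▸
    mcls_mem_fil (Nat.lt_succ_of_le (length_nf_el (m := op ⦋n⦌) σ T).1)

theorem cube_zero (σ : S.toSSet.obj (op ⦋1⦌)) : cube k σ = mcls k (el (m := op ⦋0⦌) σ 1) :=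
  ofFlagChain_mcls σ _

theorem cube_degenerate_zero (τ : S.toSSet.obj (op ⦋0⦌)) :
    cube k (S.toSSet.map (SimplexCategory.σ (0 : Fin 1)).op τ) = 1 := by
  rw [cube_zero, one_def]
  refine congrArg (mcls k) ((el_operator (m := op ⦋0⦌) (T' := 1) _ _ (Subsingleton.elim (α := Fin 1) _ _)
    (Subsingleton.elim (α := Fin 1) _ _) fun t u hu _ => ?_).trans (el_zero τ _))
  exact absurd (Subsingleton.elim (α := Fin 1) _ _) hu

/-- A degeneracy in the interior identifies two interior vertices, and the product of their edges
contains a square, which vanishes. At either end an interior vertex is identified with an end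
vertex; its edge becomes the edge from the empty set to itself, which is degenerate. -/
theorem cube_degenerate {n : ℕ} (j : Fin (n + 2)) (τ : S.toSSet.obj (op ⦋n + 1⦌)) :
    cube k (S.toSSet.map (SimplexCategory.σ j).op τ) = 0 := by
  have hv : ∀ (v : ℕ) (h : v < n + 3), ((SimplexCategory.σ j).toOrderHom ⟨v, h⟩ : ℕ) =
      if v ≤ j then v else v - 1 := fun v h => sigma_val j v j.2 h
  have hj := j.2
  rw [cube, ofFlagChain_operator]
  rotate_left
  · exact Fin.ext ((hv 0 (by omega)).trans (by simp))
  · exact Fin.ext ((hv (n + 2) (by omega)).trans (by rw [if_neg (by omega)]; rfl))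
  by_cases h0 : (j : ℕ) = 0
  · rw [mmap_relabel_chain_eq_zero (b := 1) (by simp), map_zero]
    rintro x ⟨hx0, hxn, h, hx⟩
    rw [hv, h0] at hx
    exact hx0 hx.symm
  by_cases hn : (j : ℕ) = n + 1
  · rw [mmap_relabel_chain_eq_zero (b := n + 1) (by simp), map_zero]
    rintro x ⟨hx0, hxn, h, hx⟩
    rw [hv, if_pos hn.ge] at hx
    exact hxn hx.symm
  -- The vertices `j` and `j + 1`, which both go to `j`, are singled out.
  have hl : List.range' 1 (n + 1) = List.range' 1 (j - 1) ++ [(j : ℕ), (j : ℕ) + 1] ++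
      List.range' (j + 2) (n - j) := by
    rw [show [(j : ℕ), (j : ℕ) + 1] = List.range' j 2 from rfl,
      show List.range' j 2 = List.range' (1 + 1 * (j - 1)) 2 by congr 1; omega, List.range'_append,
      show List.range' (j + 2) (n - j) = List.range' (1 + 1 * (j - 1 + 2)) (n - j) by congr 1; omega,
      List.range'_append]
    congr 1
    omega
  have he : ∀ v, v = (j : ℕ) ∨ v = j + 1 → mmap (Flag.relabel.{u} (opRel (SimplexCategory.σ j)))
      (e k v) = e k (j : ℕ) := fun v h => by
    have hv3 : v < n + 3 := by omega
    refine mmap_relabel_e fun x => ?_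
    have hvj : (((SimplexCategory.σ j).toOrderHom ⟨v, hv3⟩ : Fin (n + 2)) : ℕ) = j := by
      rw [hv]; split_ifs <;> omega
    rw [opRel_iff (show v < n + 1 + 1 + 1 by omega) (by rw [hvj]; exact h0) (by rw [hvj]; exact hn), hvj]
  have h2 : mmap (Flag.relabel.{u} (opRel (SimplexCategory.σ j))) (chain k [(j : ℕ), (j : ℕ) + 1]) = 0 := by
    rw [← List.singleton_append, chain_append, chain_singleton, chain_singleton, map_mul,
      he _ (Or.inl rfl), he _ (Or.inr rfl), e_mul_e]
  rw [hl, chain_append, chain_append, map_mul (mmap _), map_mul (mmap _), h2, mul_zero, zero_mul, map_zero]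

theorem cube_face {m : ℕ} (i : Fin (m + 1)) (σ : S.toSSet.obj (op ⦋m + 2⦌)) :
    cube k (S.toSSet.map (SimplexCategory.δ i.succ.castSucc).op σ) =
      ofFlagChain σ (chain k (List.range' 1 i) * chain k (List.range' (i + 2) (m - i))) := by
  have hv : ∀ (v : ℕ) (h : v < m + 2), ((SimplexCategory.δ i.succ.castSucc).toOrderHom ⟨v, h⟩ : ℕ) =
      if v < i + 1 then v else v + 1 := fun v h => delta_val _ _ ⟨v, h⟩
  have hi := i.2
  rw [cube, ofFlagChain_operator, ← chain_append]
  · have hl : List.range' 1 m = List.range' 1 i ++ List.range' (i + 1) (m - i) := by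
      rw [show List.range' (i + 1) (m - i) = List.range' (1 + 1 * i) (m - i) by congr 1; omega,
        List.range'_append]
      congr 1
      omega
    rw [hl, mmap_relabel_chain]
    refine List.rel_append (List.forall₂_same.2 fun v hv' x => ?_) ?_
    · rw [List.mem_range'_1] at hv'
      have hvj := hv v (by omega)
      rw [if_pos (by omega)] at hvj
      rw [opRel_iff (show v < m + 1 + 1 by omega) (by rw [hvj]; omega) (by rw [hvj]; omega), hvj]
    · rw [show List.range' (i + 2) (m - i) = (List.range' (i + 1) (m - i)).map (1 + ·) by
        rw [List.map_add_range']; congr 1; omega, List.forall₂_map_right_iff]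
      refine List.forall₂_same.2 fun v hv' x => ?_
      rw [List.mem_range'_1] at hv'
      have hvj := hv v (by omega)
      rw [if_neg (by omega)] at hvj
      rw [opRel_iff (show v < m + 1 + 1 by omega) (by rw [hvj]; omega) (by rw [hvj]; omega), hvj,
        add_comm]
  · exact Fin.ext ((hv 0 (by omega)).trans (by simp))
  · exact Fin.ext ((hv (m + 1) (by omega)).trans (by rw [if_neg (by omega)]; rfl))

/-- The vertex `i + 1` is the joint of the two factors; the interior vertices `1, …, i` come from
the front face, those from `i + 2` on from the back face. -/
theorem cube_mul_cube {m : ℕ} (i : Fin (m + 1)) (σ : S.toSSet.obj (op ⦋m + 2⦌)) :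
    cube k (S.toSSet.map (seg (m + 2) 0 (i + 1)).op σ) *
      cube k (S.toSSet.map (seg (m + 2) (i + 1) (m - i + 1)).op σ) =
    ofFlagChain σ (chain k (List.range' 1 i) * vert k (i + 1) * chain k (List.range' (i + 2) (m - i))) := by
  rw [cube, cube, ofFlagChain_mul (by omega)]
  congr 3
  · refine mmap_relabel_chain (List.forall₂_same.2 fun v hv x => ?_)
    rw [List.mem_range'_1] at hv
    omega
  · refine mmap_relabel_chain ?_
    rw [show List.range' (i + 2) (m - i) = (List.range' 1 (m - i)).map ((i : ℕ) + 1 + ·) by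
      rw [List.map_add_range'], List.forall₂_map_right_iff]
    refine List.forall₂_same.2 fun v hv x => ?_
    omega

/-- A facet of the cube fixes whether one interior vertex belongs to the path. If it does, the path
factors through it (`cube_mul_cube`); if it does not, the path lies in the inner face that omits it
(`cube_face`). -/
theorem d_cube {m : ℕ} (σ : S.toSSet.obj (op ⦋m + 2⦌)) : NChains.d k (cube k σ) =
    ∑ i : Fin (m + 1), (-1 : ℤ) ^ (i : ℕ) •
      (cube k (S.toSSet.map (seg (m + 2) 0 (i + 1)).op σ) *
        cube k (S.toSSet.map (seg (m + 2) (i + 1) (m - i + 1)).op σ) -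
      cube k (S.toSSet.map (SimplexCategory.δ i.succ.castSucc).op σ)) := by
  rw [cube, ← ofFlagChain_d, d_chain_range', Finset.sum_range, map_sum]
  refine Finset.sum_congr rfl fun i _ => ?_
  rw [map_zsmul, cube_mul_cube, cube_face, ← map_sub, mul_sub, mul_one, sub_mul, Nat.add_sub_cancel]

end Rigid

/-! ### Evaluation of the fundamental chain -/

/-- The flag is `∅ ⊆ {1} ⊆ {1, 2} ⊆ ⋯`. -/
def Flag.IsStair {m : SimplexCategoryᵒᵖ} (T : Flag.{u} m) : Prop :=
  ∀ t b, b ∈ T.set t ↔ 1 ≤ b ∧ b ≤ (t : ℕ)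

namespace FlagChains

open NChains

variable (k : Type v) [CommRing k]

open Classical in
/-- The coefficient of the flag `∅ ⊆ {1} ⊆ {1, 2} ⊆ ⋯` in a chain. -/
noncomputable def stair : FlagChains.{u} k →ₗ[k] k :=
  NChains.lift (X := underlying flags.{u}) (fun n (T : Flag.{u} (op ⦋n⦌)) => if T.IsStair then 1 else 0)
    fun n i T => if_neg fun h => by
      have h1 := h i.castSucc (i + 1)
      have h2 := (h i.succ (i + 1)).2 ⟨Nat.le_add_left _ _, le_rfl⟩
      have h3 : (SimplexCategory.σ i).toOrderHom i.castSucc = (SimplexCategory.σ i).toOrderHom i.succ :=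
        sigma_step i
      have h4 : (i : ℕ) + 1 ∈ Flag.set (m := op ⦋n⦌) T ((SimplexCategory.σ i).toOrderHom i.succ) := h2
      rw [← h3] at h4
      exact absurd (h1.1 h4).2 (by simp)

variable {k}

open Classical in
theorem stair_mcls {n : ℕ} (T : flags.{u}.obj (op ⦋n⦌)) :
    stair k (mcls k T) = if Flag.IsStair (m := op ⦋n⦌) T then 1 else 0 :=
  lift_cls (X := underlying flags.{u}) _ _ T

variable (k) in
/-- The chains of flags of subsets of `{1, …, n}`. -/
noncomputable def upTo (n : ℕ) : Submodule k (FlagChains.{u} k) :=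
  Submodule.span k {c | ∃ (m : ℕ) (T : flags.{u}.obj (op ⦋m⦌)), m = n ∧
    (∀ t, ∀ b ∈ Flag.set (m := op ⦋m⦌) T t, 1 ≤ b ∧ b ≤ n) ∧ c = mcls k T}

/-- The staircase on `n + 1` elements needs `n + 1` to enter last, that is, after all steps of the
first factor. So only the first shuffle counts, and up to index `n` it shows the staircase on `n`
elements in the first factor. -/
theorem mul_e_mem_upTo {n : ℕ} {c : FlagChains.{u} k} (hc : c ∈ upTo k n) :
    c * e k (n + 1) ∈ upTo.{u} k (n + 1) ∧ stair k (c * e k (n + 1)) = stair k c := by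
  classical
  induction hc using Submodule.span_induction with
  | mem c hc =>
    obtain ⟨_, T, rfl, hT, rfl⟩ := hc
    rename_i m
    rw [e, mul_def, mulMap_mcls, shuffleProd]
    constructor
    · refine sum_mem fun w _ => zsmul_mem ?_ _
      refine Submodule.subset_span ⟨w.len, _, w.len_eq, ?_, rfl⟩
      rintro t b (h | ⟨_, h⟩)
      · have := hT _ b h
        omega
      · obtain rfl : b = m + 1 := h
        omega
    · rw [map_sum]
      simp only [map_zsmul, stair_mcls]
      have key : ∀ (w : Shuffle m 1) (t : Fin (w.len + 1)) (b : ℕ),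
          b ∈ Flag.set (m := op ⦋w.len⦌) ((flags.{u}.map w.fst.op).hom T *
            (flags.{u}.map w.snd.op).hom (Flag.edge {m + 1})) t ↔
          b ∈ Flag.set (m := op ⦋m⦌) T (w.fst.toOrderHom t) ∨ (w.snd.toOrderHom t ≠ 0 ∧ b = m + 1) :=
        fun w t b => Iff.rfl
      rw [Shuffle.sum_eq_first (fun w : Shuffle m 1 => if Flag.IsStair (m := op ⦋w.len⦌)
        ((flags.{u}.map w.fst.op).hom T * (flags.{u}.map w.snd.op).hom (Flag.edge {m + 1})) then
          (1 : k) else 0)]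
      · have hlen := (Shuffle.first m 1).len_eq
        -- Up to index `m` the first shuffle moves only the first coordinate and the new element is
        -- absent; at the last index the first factor is complete and the new element is present.
        refine if_congr (Iff.intro (fun h t b => ?_) fun h t b => ?_) rfl rfl
        · have ht := t.2
          change (t : ℕ) < m + 1 at ht
          let t' : Fin ((Shuffle.first m 1).len + 1) := ⟨t, by omega⟩
          have h1 := Shuffle.fst_first_of_le m 1 t' (Nat.lt_succ_iff.1 ht)
          have h2 := Shuffle.fst_add_snd (Shuffle.first m 1) t'
          have h3 := (key _ t' b).symm.trans (h t' b)
          rw [show (Shuffle.first m 1).fst.toOrderHom t' = t from Fin.ext h1] at h3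
          rw [show (Shuffle.first m 1).snd.toOrderHom t' = 0 from Fin.ext (by
            rw [h1] at h2; exact Nat.add_eq_left.1 h2)] at h3
          rw [← h3]
          simp
        · have ht := t.2
          change (t : ℕ) < (Shuffle.first m 1).len + 1 at ht
          rw [key]
          have h2 := Shuffle.fst_add_snd (Shuffle.first m 1) t
          have h4 := ((Shuffle.first m 1).fst.toOrderHom t).2
          change _ < m + 1 at h4
          rcases Nat.lt_or_ge m t with h5 | h5
          · have h1 := Shuffle.fst_first_of_le m 1 ⟨m, by omega⟩ le_rfl
            have h6 := Fin.le_def.1 ((Shuffle.first m 1).fst.toOrderHom.monotone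
              (show (⟨m, by omega⟩ : Fin ((Shuffle.first m 1).len + 1)) ≤ t from h5.le))
            rw [h1] at h6
            rw [show (Shuffle.first m 1).fst.toOrderHom t = Fin.last m from
              Fin.ext (le_antisymm (Nat.lt_succ_iff.1 h4) h6), h]
            have h7 : (Shuffle.first m 1).snd.toOrderHom t ≠ 0 := fun h8 => by
              rw [h8, Fin.val_zero] at h2
              omega
            simp only [h7, ne_eq, not_false_eq_true, true_and]
            change (1 ≤ b ∧ b ≤ m) ∨ b = m + 1 ↔ _
            omega
          · have h1 := Shuffle.fst_first_of_le m 1 t h5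
            have h7 : (Shuffle.first m 1).snd.toOrderHom t = 0 := Fin.ext (by
              rw [h1] at h2; exact Nat.add_eq_left.1 h2)
            rw [h, h1, h7]
            simp
      · refine fun w hw => if_neg fun h => hw ?_
        have hlen := w.len_eq
        have hm : m < w.len + 1 := by omega
        refine Shuffle.eq_first w ⟨m, hm⟩ rfl ?_
        have h1 := Shuffle.fst_add_snd w ⟨m, hm⟩
        have h2 : w.snd.toOrderHom ⟨m, hm⟩ = 0 := by
          by_contra h3
          have := ((h ⟨m, hm⟩ (m + 1)).1 ((key _ _ _).2 (Or.inr ⟨h3, rfl⟩))).2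
          exact absurd this (Nat.not_succ_le_self m)
        rw [h2] at h1
        exact h1
  | zero => rw [zero_mul, map_zero]; exact ⟨zero_mem _, rfl⟩
  | add x y _ _ hx hy => rw [add_mul, map_add, map_add, hx.2, hy.2]; exact ⟨add_mem hx.1 hy.1, rfl⟩
  | smul r x _ hx =>
    rw [smul_mul_assoc, map_smul, map_smul, hx.2]; exact ⟨Submodule.smul_mem _ _ hx.1, rfl⟩

theorem chain_mem_upTo (n : ℕ) : chain k (List.range' 1 n) ∈ upTo.{u} k n ∧
    stair.{u} k (chain k (List.range' 1 n)) = 1 := by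
  classical
  induction n with
  | zero =>
    refine ⟨Submodule.subset_span ⟨0, 1, rfl, fun t b hb => hb.elim, rfl⟩, (stair_mcls _).trans
      (if_pos fun t b => ?_)⟩
    have ht := t.2
    change (t : ℕ) < 1 at ht
    exact ⟨fun h => h.elim, fun h => by omega⟩
  | succ n ih =>
    rw [List.range'_1_concat, chain_append, chain_singleton, add_comm 1 n]
    have := mul_e_mem_upTo.{u} ih.1
    rwa [ih.2] at this

end FlagChains

namespace Rigid

open NChains FlagChains

variable {S : ReducedSSet.{u}} {k : Type v} [CommRing k]

/-- On a cell the label list of a flag is `1, …, n` exactly for the staircase. A flag in which an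
interior vertex is a joint or never occurs has fewer than `n` labels and is killed by `ev`. So `ev`
reads the staircase coefficient, which is `1` for the fundamental chain. -/
theorem ev_ofFlagChain (x : Cell S.toSSet) {c : FlagChains.{u} k} (hc : c ∈ upTo k x.n) :
    ev k S (ofFlagChain x.x c) = stair k c • MonoidAlgebra.of k _ (FreeMonoid.of x) := by
  classical
  induction hc using Submodule.span_induction with
  | mem c hc =>
    obtain ⟨m, T, hm, hT, rfl⟩ := hc
    rw [ofFlagChain_mcls, ev_mcls, stair_mcls, evVal]
    generalize hTT : (show Flag.{u} (op ⦋m⦌) from T) = T'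
    change T = T' at hTT
    subst hTT
    let L : List ℕ := List.ofFn fun i : Fin x.n => label (elFlag (m := op ⦋m⦌) (x.n + 1) T) i.succ.castSucc
    have hL : L.length = x.n := List.length_ofFn
    have hlab : ∀ (i : ℕ) (hi : i < L.length) (t : Fin (m + 1)), L[i] ≤ t ↔ i + 1 ∈ Flag.set (m := op ⦋m⦌) T t :=
      fun i hi t => by
        rw [List.getElem_ofFn, label_le_iff _ _ (show Fin ((op ⦋m⦌ : SimplexCategoryᵒᵖ).unop.len + 1) from t)]
        exact interior_mem_elFlag
    have hel : el (m := op ⦋m⦌) x.x T = el x.x (Flag.ofLabels (op ⦋m⦌) L) := by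
      refine el_congr (m := op ⦋m⦌) x.x fun t u h0 hn => ?_
      obtain ⟨i, rfl⟩ := exists_interior h0 hn
      exact (hlab i (hL.symm ▸ i.2) t).symm.trans (Flag.mem_ofLabels.{u} (hL.symm ▸ i.2)).symm
    by_cases hb : ∀ a ∈ L, 1 ≤ a ∧ a ≤ m
    · have hnf := nf_el (m := op ⦋m⦌) x hL hb
      rw [← hel] at hnf
      rw [hnf]
      have : L = List.range' 1 m ↔ Flag.IsStair (m := op ⦋m⦌) T := by
        constructor
        · intro h t b
          constructor
          · intro hb
            have h1 := hT t b hb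
            obtain ⟨i, rfl⟩ : ∃ i, b = i + 1 := ⟨b - 1, by omega⟩
            have h2 := (hlab i (by omega) t).2 hb
            simp only [h, List.getElem_range'] at h2
            omega
          · rintro ⟨h1, h2⟩
            have ht := t.2
            change (t : ℕ) < m + 1 at ht
            obtain ⟨i, rfl⟩ : ∃ i, b = i + 1 := ⟨b - 1, by omega⟩
            refine (hlab i (by omega) t).1 ?_
            simp only [h, List.getElem_range']
            omega
        · intro h
          refine List.ext_getElem (by rw [hL, List.length_range', hm]) fun i h1 h2 => ?_
          rw [List.length_range'] at h2
          have h3 := fun t => (hlab i h1 t).trans (h t (i + 1))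
          have h4 := (h3 ⟨i + 1, by omega⟩).2 ⟨by omega, le_rfl⟩
          dsimp only at h4
          have h5 := ((h3 ⟨L[i], by omega⟩).1 le_rfl).2
          dsimp only at h5
          rw [List.getElem_range']
          omega
      rw [FreeMonoid.toList_ofList]
      by_cases hs : Flag.IsStair (m := op ⦋m⦌) T
      · rw [if_pos (this.2 hs), if_pos hs, one_smul]
      · rw [if_neg (fun h => hs (this.1 h)), if_neg hs, zero_smul]
    -- A label `0` is a joint and a label above `m` an absent vertex; either way the normal form is
    -- too short, and the flag is not the staircase.
    · push Not at hb
      obtain ⟨a, ha, hb⟩ := hb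
      obtain ⟨i, hi, rfl⟩ := List.getElem_of_mem ha
      have h0 := hlab i hi 0
      have h1 := hlab i hi (Fin.last m)
      rw [Fin.val_last] at h1
      rw [Fin.val_zero] at h0
      have h2 : i + 1 ∈ Flag.set (m := op ⦋m⦌) T 0 ∨ i + 1 ∉ Flag.set (m := op ⦋m⦌) T (Fin.last m) := by
        by_cases h3 : 1 ≤ L[i]
        · exact Or.inr fun h => absurd (h1.2 h) (by have := hb h3; omega)
        · exact Or.inl (h0.1 (by omega))
      rw [if_neg, if_neg, zero_smul]
      · intro h
        rcases h2 with h2 | h2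
        · have := (h 0 (i + 1)).1 h2
          simp at this
        · exact h2 ((h (Fin.last m) (i + 1)).2 ⟨by omega, by change i + 1 ≤ m; omega⟩)
      · intro h
        have h4 := (length_nf_el (m := op ⦋m⦌) x.x T).2 ⟨i, by omega, h2⟩
        have h5 := congrArg List.length h
        rw [List.length_range'] at h5
        exact absurd (h5.symm.trans_lt (h4.trans_eq hm.symm)) (lt_irrefl _)
  | zero => simp
  | add a b _ _ ha hb => rw [map_add, map_add, ha, hb, map_add, add_smul]
  | smul r a _ ha => rw [map_smul, map_smul, ha, map_smul, smul_assoc]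

theorem ev_cube (x : Cell S.toSSet) : ev k S (cube k x.x) = MonoidAlgebra.of k _ (FreeMonoid.of x) := by
  obtain ⟨h1, h2⟩ := chain_mem_upTo.{u} (k := k) x.n
  rw [cube, ev_ofFlagChain x h1, h2, one_smul]

/-! ### Naturality -/

/-- The map of loop monoids contains a transport along the equality of base points. The base points
are made variable first, so that this equality can be substituted. -/
theorem loopMonoid_map_el {S T : ReducedSSet.{u}} (f : S.toSSet ⟶ T.toSSet) {m : SimplexCategoryᵒᵖ}
    {n : ℕ} (σ : S.toSSet.obj (op ⦋n⦌)) (F : Flag.{u} m) :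
    ((loopMonoid.map (X := S) (Y := T) f).app m).hom (el σ F) = el (f.app (op ⦋n⦌) σ) F := by
  have key : ∀ {x : S.toSSet.obj (op ⦋0⦌)} {y : Rigid T.toSSet} (h : (functor f).obj ⟨x⟩ = y)
      (i j : Fin (n + 1)) (c : (Cube i j).obj m) (hi : vertex σ i = x) (hj : vertex σ j = x)
      (hi' : vertex (f.app (op ⦋n⦌) σ) i = y.as) (hj' : vertex (f.app (op ⦋n⦌) σ) j = y.as),
      ((endMonoidMap (functor f) h).app m).hom (Quot.mk _ (.cons ⟨n, σ, i, j, c, hi, hj⟩ (.nil _)) :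
        (mapping x x).obj m) = (Quot.mk _ (.cons ⟨n, f.app (op ⦋n⦌) σ, i, j, c, hi', hj'⟩ (.nil _)) :
          (mapping y.as y.as).obj m) := by
    intro x y h i j c hi hj hi' hj'
    subst h
    rfl
  exact key _ _ _ _ _ _ _ _

theorem mmap_loopMonoid_ofFlagChain {S T : ReducedSSet.{u}} (f : S.toSSet ⟶ T.toSSet) {n : ℕ}
    (σ : S.toSSet.obj (op ⦋n⦌)) (c : FlagChains.{u} k) :
    mmap (loopMonoid.map (X := S) (Y := T) f) (ofFlagChain σ c) = ofFlagChain (f.app (op ⦋n⦌) σ) c := by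
  refine LinearMap.congr_fun (f := (mmap (loopMonoid.map (X := S) (Y := T) f)).toLinearMap ∘ₗ ofFlagChain σ)
    (g := ofFlagChain (f.app (op ⦋n⦌) σ)) (hom_ext' k fun i F => ?_) c
  rw [LinearMap.comp_apply, AlgHom.toLinearMap_apply, ofFlagChain_mcls, ofFlagChain_mcls, mmap_mcls]
  exact congrArg (mcls k) (loopMonoid_map_el f σ _)

end Rigid

/-! ### An elementwise criterion for quasi-isomorphisms -/

/-- The hypotheses are surjectivity and injectivity of the induced map between the quotients of
cycles by boundaries, spelled out on representatives. -/
theorem quasiIso_of_elements {R : Type v} [Ring R] {A B : ShortComplex (ModuleCat.{w} R)}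
    (φ : A ⟶ B) (surj : ∀ z, B.g z = 0 → ∃ a, A.g a = 0 ∧ ∃ y, z - φ.τ₂ a = B.f y)
    (inj : ∀ a, A.g a = 0 → (∃ y, φ.τ₂ a = B.f y) → ∃ b, a = A.f b) :
    ShortComplex.QuasiIso φ := by
  let γ : ShortComplex.LeftHomologyMapData φ A.moduleCatLeftHomologyData
    B.moduleCatLeftHomologyData := default
  rw [γ.quasiIso_iff, ConcreteCategory.isIso_iff_bijective]
  have hi : ∀ a : LinearMap.ker A.g.hom, (show LinearMap.ker B.g.hom from γ.φK a).1 = φ.τ₂ a.1 :=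
    fun a => congrArg (fun f => f.hom a) γ.commi
  have hπ : ∀ a : LinearMap.ker A.g.hom, γ.φH (A.moduleCatLeftHomologyData.π a) =
      B.moduleCatLeftHomologyData.π (γ.φK a) := fun a => congrArg (fun f => f.hom a) γ.commπ
  have hz : ∀ {C : ShortComplex (ModuleCat.{w} R)} (c : LinearMap.ker C.g.hom),
      C.moduleCatLeftHomologyData.π c = 0 ↔ ∃ y, c.1 = C.f y := fun {C} c => by
    refine (Submodule.Quotient.mk_eq_zero (LinearMap.range C.moduleCatToCycles)).trans ?_
    exact ⟨fun ⟨y, hy⟩ => ⟨y, (congrArg Subtype.val hy).symm⟩, fun ⟨y, hy⟩ => ⟨y, Subtype.ext hy.symm⟩⟩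
  constructor
  · refine (injective_iff_map_eq_zero γ.φH.hom).2 fun a ha => ?_
    obtain ⟨a, rfl⟩ := Submodule.mkQ_surjective _ a
    refine (hz a).2 (inj a.1 a.2 ?_)
    obtain ⟨y, hy⟩ := (hz (show LinearMap.ker B.g.hom from γ.φK a)).1 ((hπ a).symm.trans ha)
    exact ⟨y, (hi a).symm.trans hy⟩
  · intro z
    obtain ⟨⟨z, hz'⟩, rfl⟩ := Submodule.mkQ_surjective _ z
    obtain ⟨a, ha, y, hy⟩ := surj z hz'
    refine ⟨A.moduleCatLeftHomologyData.π (⟨a, ha⟩ : LinearMap.ker A.g.hom), ?_⟩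
    rw [hπ]
    have h1 := (hz ((⟨z, hz'⟩ : LinearMap.ker B.g.hom) -
      (show LinearMap.ker B.g.hom from γ.φK (⟨a, ha⟩ : LinearMap.ker A.g.hom)))).2 ⟨y, by
        rw [← hy, ← hi ⟨a, ha⟩]; rfl⟩
    exact (sub_eq_zero.1 ((map_sub B.moduleCatLeftHomologyData.π.hom _ _).symm.trans h1)).symm

theorem DGAlg.isWeakEquivalence_of_elements {k : Type v} [CommRing k] {A B : DGAlg.{v, w} k} (f : A ⟶ B)
    (surj : ∀ (n : ℕ) (z : B.carrier), z ∈ B.gr n → B.d z = 0 → ∃ a ∈ A.gr n, A.d a = 0 ∧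
      ∃ y ∈ B.gr (n + 1), z - f.toAlgHom a = B.d y)
    (inj : ∀ (n : ℕ) (a : A.carrier), a ∈ A.gr n → A.d a = 0 →
      (∃ y ∈ B.gr (n + 1), f.toAlgHom a = B.d y) → ∃ b ∈ A.gr (n + 1), a = A.d b) :
    IsWeakEquivalence f := by
  have hd : ∀ (A : DGAlg.{v, w} k) (n : ℕ) (a : A.gr (n + 1)),
      ((show A.gr n from A.toChainComplex.d (n + 1) n a) : A.carrier) = A.d a := fun A n a => by
    rw [toChainComplex_d]; rfl
  have hf : ∀ (n : ℕ) (a : A.gr n), ((show B.gr n from (toChainMap f).f n a) : B.carrier) =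
    f.toAlgHom a := fun n a => rfl
  have key : ∀ (n m : ℕ), (∀ (A : DGAlg.{v, w} k) (a : A.gr n),
      A.toChainComplex.d n m a = 0 ↔ A.d a = 0) → ShortComplex.QuasiIso
        ((HomologicalComplex.shortComplexFunctor' (ModuleCat.{w} k) (ComplexShape.down ℕ)
          (n + 1) n m).map (toChainMap f)) := by
    intro n m hnm
    refine quasiIso_of_elements _ ?_ ?_
    · intro (z : B.gr n) hz
      obtain ⟨a, ha, hda, y, hy, h⟩ := surj n z z.2 ((hnm B z).1 hz)
      exact ⟨(⟨a, ha⟩ : A.gr n), (hnm A ⟨a, ha⟩).2 hda, (⟨y, hy⟩ : B.gr (n + 1)),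
        Subtype.ext (h.trans (hd B n ⟨y, hy⟩).symm)⟩
    · intro (a : A.gr n) ha ⟨(y : B.gr (n + 1)), hy⟩
      obtain ⟨b, hb, h⟩ := inj n a a.2 ((hnm A a).1 ha)
        ⟨y, y.2, (hf n a).symm.trans ((congrArg Subtype.val hy).trans (hd B n y))⟩
      exact ⟨(⟨b, hb⟩ : A.gr (n + 1)), Subtype.ext (h.trans (hd A n ⟨b, hb⟩).symm)⟩
  refine ⟨fun n => ?_⟩
  cases n with
  | zero =>
    rw [ChainComplex.quasiIsoAt₀_iff]
    -- In degree zero the outgoing arrow is taken to be the component from `0` to `0`, which is zero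
    -- since it does not fit the shape of a chain complex; `A.d` vanishes in degree zero as well.
    refine key 0 0 fun A a => iff_of_true ?_ (A.d_zero a a.2)
    rw [A.toChainComplex.shape _ _ (by simp)]
    rfl
  | succ n =>
    rw [quasiIsoAt_iff' _ (n + 2) (n + 1) n (by simp) (by simp)]
    refine key (n + 1) n fun A a => ?_
    rw [← hd A n a]
    exact ⟨fun h => congrArg Subtype.val h, fun h => Subtype.ext h⟩

/-! ### Maps out of the cobar construction -/

namespace Cobar

variable {k : Type v} [CommRing k] {C : ConnDGCoalg.{v, w} k}

/-- The family `F` need not be the grading of the target. It is applied to the diagonal steps of the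
filtration, which are multiplicative. -/
theorem lift_mem {A : Type*} [Ring A] [Algebra k A] (f : C.carrier →ₗ[k] A)
    (hf : ∀ c ∈ C.gr 0, f c = 0) (F : ℕ → Submodule k A) (one : 1 ∈ F 0)
    (mul : ∀ p q, ∀ a ∈ F p, ∀ b ∈ F q, a * b ∈ F (p + q)) (h : ∀ p, ∀ c ∈ C.gr (p + 1), f c ∈ F p)
    {n : ℕ} {x : Carrier C} (hx : x ∈ gr C n) : lift C f hf x ∈ F n := by
  induction hx using Submodule.span_induction with
  | mem x hx =>
    change IsMonomial C n x at hx
    induction hx with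
    | one => rw [map_one]; exact one
    | mul hc _ ih => rw [map_mul, lift_s]; exact mul _ _ _ (h _ _ hc) _ ih
  | zero => rw [map_zero]; exact zero_mem _
  | add x y _ _ hx hy => rw [map_add]; exact add_mem hx hy
  | smul r x _ hx => rw [map_smul]; exact Submodule.smul_mem _ _ hx

/-- The last hypothesis is the twisting cochain equation. It gives compatibility with the
differentials on generators; since both differentials satisfy the Leibniz rule with the same signs,
this extends to monomials. -/
theorem lift_d {B : DGAlg.{v, u₁} k} (f : C.carrier →ₗ[k] B.carrier) (hf : ∀ c ∈ C.gr 0, f c = 0)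
    (hg : ∀ p, ∀ c ∈ C.gr (p + 1), f c ∈ B.gr p)
    (hd : ∀ c, B.d (f c) = -f (C.d c) + LinearMap.mul' k _ (TensorProduct.map
      (f ∘ₗ signInvolution C.gr) f (Coalgebra.comul (R := k) c))) (x : Carrier C) :
    lift C f hf (d C x) = B.d (lift C f hf x) := by
  have hs : ∀ c, lift C f hf (dGen C c) = B.d (f c) := fun c => by
    rw [hd]
    simp only [dGen, LinearMap.add_apply, LinearMap.neg_apply, LinearMap.comp_apply, map_add, map_neg,
      lift_s]
    congr 1
    generalize Coalgebra.comul (R := k) c = t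
    induction t using TensorProduct.induction_on with
    | zero => simp
    | add x y hx hy => simp only [map_add, hx, hy]
    | tmul x y => simp [lift_s]
  have key : ∀ n, ∀ x ∈ gr C n, lift C f hf (d C x) = B.d (lift C f hf x) := by
    intro n x hx
    induction hx using Submodule.span_induction with
    | mem x hx =>
      change IsMonomial C n x at hx
      induction hx with
      | one => rw [d_one, map_zero, map_one, B.d_zero _ SetLike.GradedOne.one_mem]
      | mul hc _ ih =>
        rw [d_mul, sign_of_mem _ (s_mem _ hc), d_s, map_add, map_mul, map_mul, map_zsmul, map_mul,
          lift_s, hs, ih, B.leibniz _ _ _ (hg _ _ hc), smul_mul_assoc]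
    | zero => simp only [map_zero]
    | add x y _ _ hx hy => simp only [map_add, hx, hy]
    | smul r x _ hx => simp only [map_smul, hx]
  classical
  rw [← DirectSum.sum_support_decompose (gr C) x]
  simp only [map_sum]
  exact Finset.sum_congr rfl fun i _ => key i _ (SetLike.coe_mem _)

end Cobar

namespace Rigid

open NChains

variable {S : ReducedSSet.{u}} (k : Type v) [CommRing k]

/-! ### The map from the cobar construction -/

variable (S) in
/-- The twisting cochain: a simplex goes to the fundamental chain of its cube of paths, up to sign,
minus the unit if the simplex is an edge. -/
noncomputable def twist : NChains k S.toSSet →ₗ[k] NChains k (underlying (loopMonoid.obj S)) :=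
  NChains.lift (fun
    | 0, _ => 0
    | n + 1, σ => (-1 : ℤ) ^ n • cube k σ - if n = 0 then 1 else 0)
    (fun
    | 0, i, τ => by
      obtain rfl : i = 0 := Subsingleton.elim (α := Fin 1) _ _
      dsimp only
      rw [cube_degenerate_zero, pow_zero, one_smul, if_pos rfl, sub_self]
    | n + 1, i, τ => by
      dsimp only
      rw [cube_degenerate, smul_zero, if_neg n.succ_ne_zero, sub_zero])

variable {k}

theorem twist_zero (σ : S.toSSet.obj (op ⦋0⦌)) : twist S k (cls k σ) = 0 := lift_cls _ _ σ

theorem twist_succ {n : ℕ} (σ : S.toSSet.obj (op ⦋n + 1⦌)) :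
    twist S k (cls k σ) = (-1 : ℤ) ^ n • cube k σ - if n = 0 then 1 else 0 := lift_cls _ _ σ

theorem twist_mem_fil {n : ℕ} {c : NChains k S.toSSet} (hc : c ∈ gr k S.toSSet (n + 1)) :
    twist S k c ∈ fil S k (n + 1) n := by
  refine map_gr _ _ _ (fun σ => ?_) c hc
  rw [twist_succ]
  refine sub_mem (zsmul_mem (cube_mem_fil σ) _) ?_
  split_ifs with h
  · subst h
    exact mcls_mem_fil Nat.one_pos
  · exact zero_mem _

theorem twist_eq_zero {c : NChains k S.toSSet} (hc : c ∈ gr k S.toSSet 0) : twist S k c = 0 :=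
  map_gr (twist S k) 0 ⊥ (fun σ => twist_zero σ) c hc

/-- Here `a` and `b` stand for the cubes of the front and back face. A front face that is an edge
(`i = 0`) carries a unit, which leaves the back cube `b'` alone; a back face that is an edge (`i`
last) leaves the front cube `a'` alone. For `m = 0` both happen at once and the product of the two
units appears too. -/
theorem mul_sub_unit {R : Type*} [Ring R] {m : ℕ} (i : Fin (m + 1)) {a b a' b' : R}
    (ha : i = Fin.last m → a = a') (hb : i = 0 → b = b') :
    (-1 : ℤ) ^ ((i : ℕ) + 1) • (((-1 : ℤ) ^ (i : ℕ) • a - if (i : ℕ) = 0 then 1 else 0) *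
      ((-1 : ℤ) ^ (m - i) • b - if m - i = 0 then 1 else 0)) =
    (-1 : ℤ) ^ (m + 1 + i) • (a * b) + (if i = 0 then (-1 : ℤ) ^ m • b' else 0) +
      (if i = Fin.last m then a' else 0) - (if i = 0 then if m = 0 then 1 else 0 else 0) := by
  have hi := i.2
  by_cases hi0 : i = 0
  · rw [← hb hi0]
    subst hi0
    rw [if_pos rfl, if_pos rfl, Fin.val_zero, if_pos rfl, pow_zero, one_smul, zero_add, pow_one,
      Nat.sub_zero, add_zero]
    by_cases hm : m = 0
    · subst hm
      rw [if_pos rfl, if_pos (Subsingleton.elim (α := Fin 1) _ _),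
        ← ha (Subsingleton.elim (α := Fin 1) _ _)]
      simp only [pow_zero, zero_add, pow_one, neg_one_smul, one_smul, sub_mul, mul_sub, one_mul,
        mul_one]
      abel
    · rw [if_neg hm, if_neg fun h => hm (congrArg Fin.val h).symm]
      rw [add_zero, sub_zero, sub_zero, sub_mul, one_mul, mul_smul_comm, pow_succ, mul_neg_one,
        neg_smul, neg_smul, one_smul]
      abel
  · have hi0' : (i : ℕ) ≠ 0 := fun h => hi0 (Fin.ext h)
    rw [if_neg hi0, if_neg hi0, if_neg hi0', sub_zero, sub_zero, add_zero,
      smul_mul_assoc, smul_smul]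
    by_cases hl : i = Fin.last m
    · rw [← ha hl]
      subst hl
      rw [if_pos rfl, Fin.val_last, Nat.sub_self, if_pos rfl, pow_zero, one_smul, mul_sub, mul_one,
        smul_sub, ← pow_add, show m + 1 + m = 2 * m + 1 by ring, pow_succ, pow_mul]
      simp
    · rw [if_neg hl, if_neg fun h => hl (Fin.ext (by rw [Fin.val_last]; omega)), sub_zero, add_zero,
        mul_smul_comm, smul_smul]
      congr 1
      rw [← pow_add, ← pow_add, show (i : ℕ) + 1 + i + (m - i) = m + 1 + i by omega]

/-- This is the twisting cochain equation in an abstract ring: `f` stands for the cubes of the inner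
faces, `b'` and `a'` for those of the first and last face. The isolated cubes from `mul_sub_unit`
cancel the outer faces of the simplicial boundary, and the units cancel among themselves. -/
theorem sum_mul_sub_unit {R : Type*} [Ring R] {m : ℕ} (a b f : Fin (m + 1) → R) {a' b' : R}
    (ha : a (Fin.last m) = a') (hb : b 0 = b') :
    (-1 : ℤ) ^ (m + 1) • ∑ i : Fin (m + 1), (-1 : ℤ) ^ (i : ℕ) • (a i * b i - f i) =
    -((-1 : ℤ) ^ 0 • ((-1 : ℤ) ^ m • b' - if m = 0 then 1 else 0) +
      ((∑ i : Fin (m + 1), (-1 : ℤ) ^ ((i : ℕ) + 1) • ((-1 : ℤ) ^ m • f i - if m = 0 then 1 else 0)) +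
      (-1 : ℤ) ^ (m + 1 + 1) • ((-1 : ℤ) ^ m • a' - if m = 0 then 1 else 0))) +
    ∑ i : Fin (m + 1), (-1 : ℤ) ^ ((i : ℕ) + 1) • (((-1 : ℤ) ^ (i : ℕ) • a i - if (i : ℕ) = 0 then 1 else 0) *
      ((-1 : ℤ) ^ (m - i) • b i - if m - i = 0 then 1 else 0)) := by
  rw [Finset.sum_congr rfl fun i _ => mul_sub_unit i (a := a i) (b := b i)
    (fun h => h ▸ ha) (fun h => h ▸ hb), Finset.sum_sub_distrib, Finset.sum_add_distrib,
    Finset.sum_add_distrib, Finset.sum_ite_eq' Finset.univ, Finset.sum_ite_eq' Finset.univ,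
    Finset.sum_ite_eq' Finset.univ, if_pos (Finset.mem_univ _), if_pos (Finset.mem_univ _),
    if_pos (Finset.mem_univ _)]
  have h1 : ∑ i : Fin (m + 1), (-1 : ℤ) ^ ((i : ℕ) + 1) • ((-1 : ℤ) ^ m • f i - if m = 0 then 1 else 0) =
      (-1 : ℤ) ^ (m + 1) • (∑ i : Fin (m + 1), (-1 : ℤ) ^ (i : ℕ) • f i) + if m = 0 then 1 else 0 := by
    by_cases hm : m = 0
    · subst hm
      simp [sub_eq_neg_add, add_comm]
    · rw [if_neg hm, add_zero, Finset.smul_sum]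
      refine Finset.sum_congr rfl fun i _ => ?_
      rw [sub_zero, smul_smul, smul_smul, ← pow_add, ← pow_add, add_right_comm, add_comm (i : ℕ), add_right_comm]
  have h2 : (-1 : ℤ) ^ (m + 1 + 1) • ((-1 : ℤ) ^ m • a' - if m = 0 then 1 else 0) =
      a' - if m = 0 then 1 else 0 := by
    by_cases hm : m = 0
    · subst hm
      simp
    · rw [if_neg hm, sub_zero, sub_zero, smul_smul, ← pow_add, show m + 1 + 1 + m = 2 * (m + 1) by ring, pow_mul]
      simp
  have h3 : (-1 : ℤ) ^ (m + 1) • ∑ i : Fin (m + 1), (-1 : ℤ) ^ (i : ℕ) • (a i * b i - f i) =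
      ∑ i : Fin (m + 1), (-1 : ℤ) ^ (m + 1 + i) • (a i * b i) -
        (-1 : ℤ) ^ (m + 1) • (∑ i : Fin (m + 1), (-1 : ℤ) ^ (i : ℕ) • f i) := by
    simp only [smul_sub, Finset.sum_sub_distrib, Finset.smul_sum, smul_smul, ← pow_add]
  rw [h1, h2, h3, pow_zero, one_smul]
  abel

theorem cube_front {m p : ℕ} (hp : p = m) (σ : S.toSSet.obj (op ⦋m + 2⦌)) :
    cube k (S.toSSet.map (seg (m + 2) 0 (p + 1)).op σ) =
      cube k (S.toSSet.map (SimplexCategory.δ (Fin.last (m + 2))).op σ) := by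
  subst hp
  congr 5
  apply Shuffle.hom_ext
  intro t
  have ht : (t : ℕ) < p + 2 := t.2
  apply Fin.ext
  rw [seg_val, delta_val, Fin.val_last, if_pos ht]
  omega

theorem cube_back {m p q : ℕ} (hp : p = 0) (hq : q = m) (σ : S.toSSet.obj (op ⦋m + 2⦌)) :
    cube k (S.toSSet.map (seg (m + 2) (p + 1) (q + 1)).op σ) =
      cube k (S.toSSet.map (SimplexCategory.δ 0).op σ) := by
  subst hp hq
  congr 5
  apply Shuffle.hom_ext
  intro t
  have ht : (t : ℕ) < q + 2 := t.2
  apply Fin.ext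
  rw [seg_val, delta_val, if_neg (by simp)]
  omega

/-- The boundary of a cube contains products and inner faces only, while the simplicial boundary
contains also the outer faces. The two agree because the units subtracted from edges in the
quadratic term contribute exactly the outer faces. -/
theorem d_twist {m : ℕ} (σ : S.toSSet.obj (op ⦋m + 2⦌)) : NChains.d k (twist S k (cls k σ)) =
    -twist S k (NChains.d k (cls k σ)) + ∑ pq ∈ Finset.HasAntidiagonal.antidiagonal (m + 2), (-1 : ℤ) ^ pq.1 •
      (twist S k (cls k (S.toSSet.map (seg (m + 2) 0 pq.1).op σ)) *
        twist S k (cls k (S.toSSet.map (seg (m + 2) pq.1 pq.2).op σ))) := by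
  rw [twist_succ, if_neg (Nat.succ_ne_zero m), sub_zero, map_zsmul, d_cube, d_cls_succ,
    Finset.Nat.sum_antidiagonal_succ, Finset.Nat.sum_antidiagonal_succ' (n := m)]
  -- The two extreme terms of the coproduct have a vertex as a factor, which `twist` kills; what
  -- remains is the reduced coproduct.
  rw [twist_zero, twist_zero, zero_mul, mul_zero, smul_zero, smul_zero, zero_add, zero_add,
    Finset.Nat.sum_antidiagonal_eq_sum_range_succ_mk, Finset.sum_range, map_sum,
    Fin.sum_univ_succ (n := m + 2), Fin.sum_univ_castSucc (n := m + 1)]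
  simp only [map_zsmul, twist_succ, Fin.val_zero, Fin.val_last, Fin.val_succ, Fin.val_castSucc]
  exact sum_mul_sub_unit (R := NChains k (underlying (loopMonoid.obj S)))
    (fun i => cube k (S.toSSet.map (seg (m + 2) 0 (i + 1)).op σ))
    (fun i => cube k (S.toSSet.map (seg (m + 2) (i + 1) (m - i + 1)).op σ))
    (fun i => cube k (S.toSSet.map (SimplexCategory.δ i.succ.castSucc).op σ))
    (cube_front (Fin.val_last m) σ) (cube_back rfl rfl σ)

/-- The differential graded coalgebra of normalized chains of a reduced simplicial set. -/
noncomputable abbrev coalg (k : Type v) [CommRing k] (S : ReducedSSet.{u}) : ConnDGCoalg.{v, max u v} k :=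
  (normalizedChainsCoalg.{u} k).obj S

variable (S k) in
/-- The algebra map from the cobar construction to the chains on the loop monoid. -/
noncomputable def ofCobar : Cobar.Carrier (coalg k S) →ₐ[k] NChains k (underlying (loopMonoid.obj S)) :=
  Cobar.lift (coalg k S) (twist S k) fun _ hc => twist_eq_zero hc

theorem ofCobar_s (c : (coalg k S).carrier) : ofCobar S k (Cobar.s (coalg k S) c) = twist S k c :=
  Cobar.lift_s (coalg k S) _ _ c

theorem d_twist_eq (c : NChains k S.toSSet) : NChains.d k (twist S k c) =
    -twist S k (NChains.d k c) + LinearMap.mul' k _ (TensorProduct.map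
      (twist S k ∘ₗ signInvolution (gr k S.toSSet)) (twist S k) (NChains.comul k c)) := by
  refine LinearMap.congr_fun (f := NChains.d k ∘ₗ twist S k)
    (g := -(twist S k ∘ₗ NChains.d k) + LinearMap.mul' k _ ∘ₗ TensorProduct.map
      (twist S k ∘ₗ signInvolution (gr k S.toSSet)) (twist S k) ∘ₗ NChains.comul k)
    (NChains.hom_ext (X := S.toSSet) fun n σ => ?_) c
  rw [LinearMap.comp_apply, LinearMap.add_apply, LinearMap.neg_apply, LinearMap.comp_apply,
    LinearMap.comp_apply, LinearMap.comp_apply, comul_cls, map_sum, map_sum]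
  simp only [TensorProduct.map_tmul, LinearMap.mul'_apply, LinearMap.comp_apply,
    signInvolution_of_mem _ (cls_mem k _), map_zsmul, smul_mul_assoc]
  match n, σ with
  | 0, σ => simp [d_cls_zero, twist_zero]
  | 1, σ =>
    rw [d_zero k _ (fil_le_gr _ _ (twist_mem_fil (cls_mem k σ))), d_cls_succ]
    simp [twist_zero, Finset.Nat.antidiagonal_succ]
  | m + 2, σ => exact d_twist σ

/-- The cube of an `(n + 1)`-simplex has degree `n` and at most `n` interior vertices, and this
diagonal condition is stable under products. Together with compatibility with the differentials it
puts the image into the diagonal chains. -/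
theorem ofCobar_mem_fil {n : ℕ} {a : Cobar.Carrier (coalg k S)} (ha : a ∈ Cobar.gr (coalg k S) n) :
    ofCobar S k a ∈ fil S k (n + 1) n :=
  Cobar.lift_mem (C := coalg k S) _ _ (fun n => fil S k (n + 1) n) (mcls_mem_fil Nat.one_pos)
    (fun _ _ _ ha _ hb => mul_mem_fil ha hb) (fun _ _ hc => twist_mem_fil hc) ha

variable (S k) in
/-- The morphism of differential graded algebras from the cobar construction to the chains on the loop
monoid. -/
noncomputable def ofCobarHom : (cobar k).obj (coalg k S) ⟶ (loopChains k).obj S :=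
  DGAlg.Hom.mk (A := (cobar k).obj (coalg k S)) (B := (loopChains k).obj S) (ofCobar S k)
    (fun _ _ ha => fil_le_gr _ _ (ofCobar_mem_fil ha))
    (Cobar.lift_d (C := coalg k S) (B := (loopChains k).obj S) _ _
      (fun _ _ hc => fil_le_gr _ _ (twist_mem_fil hc)) d_twist_eq)

theorem twist_natural {S T : ReducedSSet.{u}} (f : S.toSSet ⟶ T.toSSet) (c : NChains k S.toSSet) :
    twist T k (NChains.map f c) = mmap (loopMonoid.map (X := S) (Y := T) f) (twist S k c) := by
  refine LinearMap.congr_fun (f := twist T k ∘ₗ NChains.map f)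
    (g := (mmap (loopMonoid.map (X := S) (Y := T) f)).toLinearMap ∘ₗ twist S k)
    (NChains.hom_ext fun n σ => ?_) c
  rw [LinearMap.comp_apply, LinearMap.comp_apply, map_cls, AlgHom.toLinearMap_apply]
  match n, σ with
  | 0, σ => rw [twist_zero, twist_zero, map_zero]
  | n + 1, σ =>
    rw [twist_succ, twist_succ, map_sub, map_zsmul, cube, cube, mmap_loopMonoid_ofFlagChain]
    congr 1
    split_ifs
    exacts [(map_one _).symm, (map_zero _).symm]

variable (k) in
/-- The natural transformation from the cobar construction to the chains on the loop monoid. -/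
noncomputable def cobarToLoop : normalizedChainsCoalg.{u} k ⋙ cobar k ⟶ loopChains.{u} k where
  app S := ofCobarHom S k
  naturality S T f := DGAlg.Hom.ext (Cobar.algHom_ext (coalg k S) fun c => by
    refine (congrArg (ofCobar T k) (Cobar.map_s ((normalizedChainsCoalg k).map f) c)).trans ?_
    refine (ofCobar_s _).trans ((twist_natural (S := S) (T := T) f c).trans ?_)
    exact congrArg (mmap (loopMonoid.map f)) (ofCobar_s c).symm)

end Rigid

namespace Rigid

open NChains

variable {S : ReducedSSet.{u}} {k : Type v} [CommRing k]

/-! ### The cobar construction as a monoid algebra -/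

/-- The element of the cobar construction given by a simplex. -/
noncomputable def cobarGen (k : Type v) [CommRing k] {n : ℕ} (σ : S.toSSet.obj (op ⦋n⦌)) :
    Cobar.Carrier (coalg k S) :=
  Cobar.s (coalg k S) (cls k σ)

theorem cobarGen_mem {n : ℕ} (σ : S.toSSet.obj (op ⦋n + 1⦌)) :
    cobarGen k σ ∈ Cobar.gr (coalg k S) n := Cobar.s_mem _ (cls_mem k σ)

theorem ofCobar_cobarGen {n : ℕ} (σ : S.toSSet.obj (op ⦋n + 1⦌)) :
    ofCobar S k (cobarGen k σ) = (-1 : ℤ) ^ n • cube k σ - if n = 0 then 1 else 0 :=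
  (ofCobar_s _).trans (twist_succ σ)

variable (S k) in
/-- The algebra map from the monoid algebra on sequences of cells to the cobar construction. -/
noncomputable def ofWords : MonoidAlgebra k (FreeMonoid (Cell S.toSSet)) →ₐ[k] Cobar.Carrier (coalg k S) :=
  MonoidAlgebra.lift k _ _ (FreeMonoid.lift fun x : Cell S.toSSet =>
    (-1 : ℤ) ^ x.n • cobarGen k x.x + if x.n = 0 then 1 else 0)

theorem ofWords_of (w : FreeMonoid (Cell S.toSSet)) : ofWords S k (MonoidAlgebra.of k _ w) =
    FreeMonoid.lift (fun x : Cell S.toSSet =>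
      (-1 : ℤ) ^ x.n • cobarGen k x.x + if x.n = 0 then 1 else 0) w :=
  MonoidAlgebra.lift_of _ _

theorem ofWords_of_of (x : Cell S.toSSet) : ofWords S k (MonoidAlgebra.of k _ (FreeMonoid.of x)) =
    (-1 : ℤ) ^ x.n • cobarGen k x.x + if x.n = 0 then 1 else 0 := by
  rw [ofWords_of, FreeMonoid.lift_eval_of]

theorem ev_ofCobar_cobarGen (x : Cell S.toSSet) : ev k S (ofCobar S k (cobarGen k x.x)) =
    (-1 : ℤ) ^ x.n • MonoidAlgebra.of k _ (FreeMonoid.of x) - if x.n = 0 then 1 else 0 := by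
  rw [ofCobar_cobarGen, map_sub, map_zsmul, ev_cube]
  congr 1
  split_ifs
  exacts [map_one _, map_zero _]

theorem zpow_neg_one_smul {A : Type*} [AddCommGroup A] (n : ℕ) (a : A) :
    (-1 : ℤ) ^ n • (-1 : ℤ) ^ n • a = a := by
  rw [smul_smul, ← mul_pow, neg_one_mul, neg_neg, one_pow, one_smul]

theorem zpow_neg_one_smul_unit {A : Type*} [Ring A] (n : ℕ) :
    (-1 : ℤ) ^ n • (if n = 0 then 1 else 0 : A) = if n = 0 then 1 else 0 := by
  split_ifs with h
  · rw [h, pow_zero, one_smul]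
  · rw [smul_zero]

/-- It suffices to check generators. As `ev` sends the cube of a cell to the cell, `s x` goes to
plus or minus `x`, with the unit subtracted for an edge; `ofWords` undoes this affine change of
generators. Vertices and degenerate simplices are zero on both sides. -/
theorem ofWords_ev_ofCobar (a : Cobar.Carrier (coalg k S)) :
    ofWords S k (ev k S (ofCobar S k a)) = a := by
  refine AlgHom.congr_fun (φ₁ := ((ofWords S k).comp (ev k S)).comp (ofCobar S k))
    (φ₂ := AlgHom.id k _) (Cobar.algHom_ext (coalg k S) fun c => ?_) a
  refine LinearMap.congr_fun
    (f := (((ofWords S k).comp (ev k S)).comp (ofCobar S k)).toLinearMap ∘ₗ Cobar.s (coalg k S))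
    (g := Cobar.s (coalg k S)) (NChains.hom_ext (X := S.toSSet) fun n σ => ?_) c
  change ofWords S k (ev k S (ofCobar S k (cobarGen k σ))) = cobarGen k σ
  match n, σ with
  | 0, σ =>
    have h : cobarGen k σ = 0 := Cobar.s_zero (coalg k S) _ (cls_mem k σ)
    rw [h, map_zero, map_zero, map_zero]
  | n + 1, σ =>
    by_cases hσ : σ ∈ S.toSSet.degenerate (n + 1)
    · have h : cobarGen k σ = 0 :=
        (congrArg (Cobar.s (coalg k S)) (cls_degenerate k _ hσ)).trans (map_zero _)
      rw [h, map_zero, map_zero, map_zero]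
    · refine (congrArg (ofWords S k) (ev_ofCobar_cobarGen ⟨n, σ, hσ⟩)).trans ?_
      rw [map_sub, map_zsmul, ofWords_of_of]
      dsimp only
      rw [smul_add, zpow_neg_one_smul, zpow_neg_one_smul_unit]
      split_ifs
      · rw [map_one, add_sub_cancel_right]
      · rw [map_zero, add_zero, sub_zero]

theorem ofCobar_injective : Function.Injective (ofCobar S k) :=
  Function.LeftInverse.injective (g := fun c => ofWords S k (ev k S c)) ofWords_ev_ofCobar

theorem monoidAlgebra_algHom_ext {M A : Type*} [Monoid M] [Semiring A] [Algebra k A]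
    {f g : MonoidAlgebra k M →ₐ[k] A}
    (h : (f : MonoidAlgebra k M →* A).comp (MonoidAlgebra.of k M) =
      (g : MonoidAlgebra k M →* A).comp (MonoidAlgebra.of k M)) : f = g :=
  (MonoidAlgebra.lift k A M).symm.injective h

theorem ev_ofCobar_ofWords (a : MonoidAlgebra k (FreeMonoid (Cell S.toSSet))) :
    ev k S (ofCobar S k (ofWords S k a)) = a := by
  refine AlgHom.congr_fun (φ₁ := ((ev k S).comp (ofCobar S k)).comp (ofWords S k))
    (φ₂ := AlgHom.id k _) (monoidAlgebra_algHom_ext (FreeMonoid.hom_eq fun x => ?_)) a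
  change ev k S (ofCobar S k (ofWords S k (MonoidAlgebra.of k _ (FreeMonoid.of x)))) =
    MonoidAlgebra.of k _ (FreeMonoid.of x)
  rw [ofWords_of_of, map_add, map_add, map_zsmul, map_zsmul, ev_ofCobar_cobarGen, smul_sub,
    zpow_neg_one_smul, zpow_neg_one_smul_unit]
  split_ifs
  · rw [map_one, map_one, sub_add_cancel]
  · rw [map_zero, map_zero, sub_zero, add_zero]

/-- The added unit does not disturb homogeneity: it occurs only for edges, whose generators have
degree zero in the cobar construction. -/
theorem ofWords_mem (w : FreeMonoid (Cell S.toSSet)) :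
    ofWords S k (MonoidAlgebra.of k _ w) ∈ Cobar.gr (coalg k S) (dim w.toList) := by
  induction w using FreeMonoid.inductionOn' with
  | one =>
    rw [map_one (MonoidAlgebra.of k _), map_one (ofWords S k)]
    exact Cobar.IsMonomial.mem .one
  | of_mul x w ih =>
    rw [map_mul (MonoidAlgebra.of k _), map_mul (ofWords S k), ofWords_of_of, FreeMonoid.toList_mul, FreeMonoid.toList_of,
      List.singleton_append, dim_cons]
    refine SetLike.mul_mem_graded (add_mem (zsmul_mem (cobarGen_mem x.x) _) ?_) ih
    split_ifs with h
    · rw [h]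
      exact Cobar.IsMonomial.mem .one
    · exact zero_mem _

theorem ofWords_ev_mem {n : ℕ} {c : NChains k (underlying (loopMonoid.obj S))}
    (hc : c ∈ fil S k (n + 1) n) : ofWords S k (ev k S c) ∈ Cobar.gr (coalg k S) n := by
  refine fil_induction hc (fun y hy => ?_) ?_ (fun a b ha hb => ?_) (fun r a ha => ?_)
  · rw [ev_mcls, evVal]
    split_ifs with h
    · have hl := (labels_nf y).1
      rw [h, List.length_range'] at hl
      have hw := ofWords_mem (k := k) (nf y).1
      rwa [← hl] at hw
    · rw [map_zero]
      exact zero_mem _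
  · rw [map_zero, map_zero]
    exact zero_mem _
  · rw [map_add, map_add]
    exact add_mem ha hb
  · rw [map_smul, map_smul]
    exact Submodule.smul_mem _ r ha

/-! ### The quasi-isomorphism -/

theorem ofCobar_d (a : Cobar.Carrier (coalg k S)) :
    ofCobar S k (Cobar.d (coalg k S) a) = NChains.d k (ofCobar S k a) :=
  (ofCobarHom S k).map_d a

/-- Since the map commutes with the differentials, the boundary of an image is the image of an
element one degree lower, which is again diagonal. In degree zero the boundary is zero. -/
theorem d_ofCobar_mem_fil {n : ℕ} {a : Cobar.Carrier (coalg k S)} (ha : a ∈ Cobar.gr (coalg k S) n) :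
    NChains.d k (ofCobar S k a) ∈ fil S k n (n - 1) := by
  match n with
  | 0 =>
    rw [d_zero k _ (fil_le_gr _ _ (ofCobar_mem_fil ha))]
    exact zero_mem _
  | n + 1 =>
    rw [← ofCobar_d]
    exact ofCobar_mem_fil (((cobar k).obj (coalg k S)).d_mem n a ha)

/-- A chain in the diagonal part whose boundary lies in the diagonal part comes from the cobar
construction. -/
theorem exists_ofCobar_eq {n : ℕ} {c : NChains k (underlying (loopMonoid.obj S))}
    (hc : c ∈ fil S k (n + 1) n) (hd : NChains.d k c ∈ fil S k n (n - 1)) :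
    ∃ a ∈ Cobar.gr (coalg k S) n, ofCobar S k a = c := by
  -- The only candidate is the one prescribed by `ev`. Its image and `c` are diagonal chains with
  -- the same evaluation, so their difference vanishes by `eq_zero_of_ev`.
  refine ⟨ofWords S k (ev k S c), ofWords_ev_mem hc, (sub_eq_zero.1 ?_).symm⟩
  refine eq_zero_of_ev (n := n) (sub_mem hc (ofCobar_mem_fil (ofWords_ev_mem hc))) ?_ ?_
  · rw [map_sub]
    exact sub_mem hd (d_ofCobar_mem_fil (ofWords_ev_mem hc))
  · rw [map_sub, ev_ofCobar_ofWords, sub_self]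

/-- Both halves move a chain to the diagonal by a boundary and then use that diagonal chains are the
images of unique elements of the cobar construction. -/
theorem isWeakEquivalence_ofCobarHom : DGAlg.IsWeakEquivalence (ofCobarHom S k) := by
  refine DGAlg.isWeakEquivalence_of_elements _ (fun n (z : NChains k _) hz hd => ?_) (fun n a ha => ?_)
  · change NChains.d k z = 0 at hd
    -- Surjectivity: the cycle becomes diagonal after subtracting a boundary. Its preimage is a
    -- cycle because the map is injective.
    obtain ⟨y, hy, h⟩ := exists_sub_d_mem_diag (S := S) (k := k) hz (hd ▸ zero_mem _)
    have hd' : NChains.d k (z - NChains.d k y) = 0 := by rw [map_sub, hd, d_d, sub_zero]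
    obtain ⟨a, ha, e⟩ := exists_ofCobar_eq h (hd' ▸ zero_mem _)
    refine ⟨a, ha, ofCobar_injective ?_, y, hy, ?_⟩
    · exact (ofCobar_d a).trans ((congrArg (NChains.d k) e).trans (hd'.trans (map_zero _).symm))
    · exact (congrArg (fun t => z - t) e).trans (sub_sub_cancel _ _)
  · rintro - ⟨y, hy, h⟩
    change NChains k _ at y
    change ofCobar S k a = NChains.d k y at h
    -- Injectivity: the bounding chain has a diagonal boundary, namely the image of `a`. So the
    -- chain itself can be made diagonal without changing its boundary, and its preimage bounds `a`.
    obtain ⟨t, ht, h'⟩ := exists_sub_d_mem_diag (S := S) (k := k) (n := n + 1) hy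
      (h ▸ fil_mono (Nat.le_succ _) (ofCobar_mem_fil ha))
    have hd' : NChains.d k (y - NChains.d k t) = ofCobar S k a := by rw [map_sub, d_d, sub_zero, h]
    obtain ⟨b, hb, e⟩ := exists_ofCobar_eq h' (hd' ▸ ofCobar_mem_fil ha)
    refine ⟨b, hb, ofCobar_injective ?_⟩
    exact hd'.symm.trans ((congrArg (NChains.d k) e.symm).trans (ofCobar_d b).symm)

end Rigid

end CobarRigid

theorem proposition7p3 (k : Type v) [CommRing k] :
    CobarRigid.DGAlg.NaturallyWeaklyEquivalent
      (CobarRigid.normalizedChainsCoalg.{u} k ⋙ CobarRigid.cobar k)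
      (CobarRigid.loopChains.{u} k) := Relation.EqvGen.rel _ _
    ⟨CobarRigid.Rigid.cobarToLoop k, fun _ => CobarRigid.Rigid.isWeakEquivalence_ofCobarHom⟩
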